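/- **Definitions.** Let $S$ be a smooth complex projective surface (integral). *Trees.* A tree $T$ is a finite partially ordered set with a unique minimal vertex $\alpha$ (the root) such that every $b\neq\alpha$ has a unique predecessor $b^-$ (a maximal vertex below $b$); $a^+=\{b : b^-=a\}$. Fix integers $n$ and $C_0$. $\mathbf T_n$ is the set of trees that admit integer weights $(n_a)_{a\in T}$ with $n_a\ge 0$ for $a\ne\alpha$, $\#a^+\ge 2$ whenever $a\neq\alpha$ and $n_a=0$, $n_\alpha\ge C_0$ and $\sum_a n_a=n$. *Trees of surfaces.* For a tree $T$, put $P_\alpha=S$ and, for $a\ne\alpha$, let $P_a$ be a copy of $\mathbb P_2(\mathbb C)$ with a line $l_a\subset P_a$. Choose distinct closed points $x_b\in P_a$, $b\in a^+$, not on $l_a$ if $a\neq\alpha$, and let $\sigma_a:S_a\to P_a$ be the blowup of $P_a$ in these points, with exceptional lines $\tilde l_b\subset S_a$. A $T$-surface $S_T=\bigcup_{a} S_a$ over $S$ is a reduced surface obtained by gluing the $S_a$ transversally along isomorphisms $\tilde l_b\cong l_b$ ($b\neq\alpha$), so that $S_b\cap S_{b^-}=l_b$, and there are no other intersections of components. Its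 standard contraction $S_T\to S$ is $\sigma_\alpha$ on $S_\alpha$ and maps $S_b$, for $b\geq a\in\alpha^+$, to the point $x_a$. *Families.* Let $Y$ be a scheme locally of finite type over $\mathbb C$. A $\mathbf T_n$-family of surfaces over $Y$ is a flat morphism $\pi:\mathbf X\to Y$, locally of finite type, with a morphism $\sigma:\mathbf X\to S\times Y$ such that (i) $\pi=pr_2\circ\sigma$; (ii) for every closed point $y\in Y$ the fibre $\mathbf X_y$ is a $T$-surface over $S$ for some $T\in\mathbf T_n$, with standard contraction $\sigma_y:\mathbf X_y\to S$; (iii) $\sigma$ restricts to a birational morphism $\mathbf X^b\to S\times Y$ on some union $\mathbf X^b$ of irreducible components of $\mathbf X$. The family is *good* if $\sigma$ is birational on the whole of $\mathbf X$. An *intersection line* is a nonempty intersection $L\subset\mathbf X$ of two different irreducible components of a fibre of $\pi$ over a closed point. *Singularities.* Let $A_k\times\mathbb A^1$ be the threefold $\{xy=z^{k+1}\}\subset\mathbb A^4$ with coordinates $x,y,z,w$ (smooth if $k=0$). **Theorem.** Let $\pi:\mathbf X\to C$, with $\sigma:\mathbf X\to S\times C$, be a good $\mathbf T_n$-family of surfaces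 over a smooth curve $C$ over $\mathbb C$. Then the total space $\mathbf X$ has at most $A_k$-singularities, and these are locally trivial along the intersection lines of the components of the fibres. Precisely: 1. For every closed point $p\in\mathbf X$, either $\mathbf X$ is smooth at $p$, or there is $k\geq1$ such that $p\in\mathbf X$ and $0\in A_k\times\mathbb A^1$ have a common étale neighbourhood over $\mathbb C$; in particular $\mathbf X$ at $p$ is analytically isomorphic to $A_k\times\mathbb A^1$ at $0$. 2. $\mathbf X$ is smooth at every closed point that lies on no intersection line. 3. For every intersection line $L$ there is one integer $k\ge 0$ such that, for every closed point $p\in L$, there is a common étale neighbourhood over $\mathbb C$ of $p\in\mathbf X$ and of $0\in A_k\times\mathbb A^1$ on which the inverse images of $L$ and of the line $\{x=y=z=0\}$ coincide. In particular, the pair $(\mathbf X,L)$ is, analytically locally at every point of $L$, the product of the surface singularity $A_k$ (a smooth point if $k=0$) with a disc. -/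

import Mathlib

open AlgebraicGeometry CategoryTheory CategoryTheory.Limits TopologicalSpace

noncomputable section

namespace TreeSurfaces

/-! ### Complex schemes: the ground field, projective spaces, lines, birational morphisms -/

/-- The spectrum of the field of complex numbers. A complex scheme is a scheme with a morphism
to `SpecC`. -/
abbrev SpecC : Scheme.{0} := Spec (CommRingCat.of ℂ)

attribute [local instance] MvPolynomial.gradedAlgebra

/-- Complex projective space of dimension `N`. -/
def PSpace (N : ℕ) : Scheme.{0} := Proj (MvPolynomial.homogeneousSubmodule (Fin (N + 1)) ℂ)

/-- The structure morphism of projective space. -/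
def PSpace.toC (N : ℕ) : PSpace N ⟶ SpecC :=
  Proj.toSpecZero (MvPolynomial.homogeneousSubmodule (Fin (N + 1)) ℂ) ≫
    Spec.map (CommRingCat.ofHom
      (algebraMap ℂ (MvPolynomial.homogeneousSubmodule (Fin (N + 1)) ℂ 0)))

/-- A line in the projective plane (as a closed set): the zero locus of a nonzero linear form. -/
def IsLine (l : Set (PSpace 2)) : Prop :=
  ∃ f : MvPolynomial (Fin 3) ℂ, f.IsHomogeneous 1 ∧ f ≠ 0 ∧
    l = ProjectiveSpectrum.zeroLocus (MvPolynomial.homogeneousSubmodule (Fin 3) ℂ) {f}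

/-- `S` (with structure morphism `sS`) is a smooth complex projective surface. -/
structure IsSmoothProjectiveSurface {S : Scheme.{0}} (sS : S ⟶ SpecC) : Prop where
  integral : IsIntegral S
  smooth : SmoothOfRelativeDimension 2 sS
  projective : ∃ (N : ℕ) (i : S ⟶ PSpace N), IsClosedImmersion i ∧ i ≫ PSpace.toC N = sS

/-- A birational morphism: it restricts to an isomorphism from a dense open subscheme of the
source onto a dense open subscheme of the target. -/
def IsBirationalMorphism {X Y : Scheme.{0}} (f : X ⟶ Y) : Prop :=
  ∃ U : X.Opens, Dense (U : Set X) ∧ IsOpenImmersion (U.ι ≫ f) ∧ Dense (Set.range (U.ι ≫ f))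

/-! ### Blowing up -/

/-- The closed subscheme cut out by the ideal sheaf `I` is an effective Cartier divisor: locally
`I` is generated by a single nonzerodivisor. -/
def IsEffectiveCartier {X : Scheme.{0}} (I : X.IdealSheafData) : Prop :=
  ∀ x : X, ∃ U : X.affineOpens, x ∈ U.1 ∧
    ∃ g ∈ nonZeroDivisors Γ(X, U.1), I.ideal U = Ideal.span {g}

/-- `f : B ⟶ P` is the blowup of `P` along the reduced closed subscheme supported on (the closure
of) `Z`: the inverse image of that subscheme is an effective Cartier divisor, and `f` is universal
with this property. -/
def IsBlowup {B P : Scheme.{0}} (f : B ⟶ P) (Z : Set P) : Prop :=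
  IsEffectiveCartier
      ((Scheme.IdealSheafData.vanishingIdeal (Closeds.closure Z)).comap f) ∧
    ∀ (W : Scheme.{0}) (g : W ⟶ P),
      IsEffectiveCartier
        ((Scheme.IdealSheafData.vanishingIdeal (Closeds.closure Z)).comap g) →
      ∃! h : W ⟶ B, h ≫ f = g

/-! ### Trees -/

/-- A tree: a finite partially ordered set of vertices with a unique minimal vertex `⊥`, the root,
such that every other vertex has a unique predecessor. Here `a ⋖ b` says that `a` is a maximal
vertex below `b`, that is, `a` is the predecessor of `b`, and `b` is a direct successor of `a`. -/
structure IsTree (T : Type) [PartialOrder T] [OrderBot T] : Prop where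
  finite : Finite T
  pred : ∀ b : T, b ≠ ⊥ → ∃! a : T, a ⋖ b

/-- A weighting of total charge `n` on a tree; `c` is the lower bound for the weight of the
root. -/
structure IsWeighting (c n : ℤ) {T : Type} [PartialOrder T] [OrderBot T] (w : T → ℤ) : Prop where
  nonneg : ∀ a, a ≠ ⊥ → 0 ≤ w a
  stable : ∀ a, a ≠ ⊥ → w a = 0 → 2 ≤ Set.ncard {b : T | a ⋖ b}
  root : c ≤ w ⊥
  total : ∑ᶠ a, w a = n

/-- `T` is one of the trees of the set `𝐓_n`: it admits a weighting of total charge `n`. -/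
def InTn (c n : ℤ) (T : Type) [PartialOrder T] [OrderBot T] : Prop :=
  IsTree T ∧ ∃ w : T → ℤ, IsWeighting c n w

/-! ### Trees of surfaces -/

/-- A presentation of the complex scheme `X` as a `T`-surface over `S` for which `σ : X ⟶ S` is the
standard contraction. -/
structure TreeSurface (T : Type) [PartialOrder T] [OrderBot T]
    {S X : Scheme.{0}} (sS : S ⟶ SpecC) (sX : X ⟶ SpecC) (σ : X ⟶ S) where
  /-- The surfaces that are blown up: `S` at the root and copies of the projective plane at the
  other vertices. -/
  P : T → Scheme.{0}
  toC : ∀ a, P a ⟶ SpecC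
  rootIso : P ⊥ ≅ S
  rootIso_over : rootIso.hom ≫ sS = toC ⊥
  planeIso : ∀ a, a ≠ ⊥ → (P a ≅ PSpace 2)
  planeIso_over : ∀ a (ha : a ≠ ⊥), (planeIso a ha).hom ≫ PSpace.toC 2 = toC a
  /-- The line `l_a` in the plane `P a`. -/
  line : ∀ a, a ≠ ⊥ → Set (P a)
  isLine : ∀ a (ha : a ≠ ⊥), ∃ l : Set (PSpace 2), IsLine l ∧ line a ha = (planeIso a ha).hom ⁻¹' l
  /-- The points `x_b` of `P a`, one for every direct successor `b` of `a`: distinct closed points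
  that do not lie on the line `l_a`. -/
  pt : ∀ {a b : T}, a ⋖ b → P a
  isClosed_pt : ∀ {a b : T} (h : a ⋖ b), IsClosed {pt h}
  pt_injective : ∀ {a b b' : T} (h : a ⋖ b) (h' : a ⋖ b'), pt h = pt h' → b = b'
  pt_notMem_line : ∀ {a b : T} (h : a ⋖ b) (ha : a ≠ ⊥), pt h ∉ line a ha
  /-- The components: `comp a` is the blowup of `P a` in the points `x_b`. -/
  comp : T → Scheme.{0}
  blow : ∀ a, comp a ⟶ P a
  isBlowup : ∀ a, IsBlowup (blow a) {x | ∃ (b : T) (h : a ⋖ b), x = pt h}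
  /-- `X` is reduced and it is the union of the components, which are closed subschemes. -/
  isReduced : IsReduced X
  incl : ∀ a, comp a ⟶ X
  isClosedImmersion_incl : ∀ a, IsClosedImmersion (incl a)
  incl_over : ∀ a, incl a ≫ sX = blow a ≫ toC a
  cover : ∀ x : X, ∃ a, x ∈ Set.range (incl a)
  /-- If `a` is the predecessor of `b`, then the scheme-theoretic intersection of `comp a` and
  `comp b` is reduced; in `comp a` it is the exceptional line over `x_b`, and in `comp b` it is
  the inverse image of the line `l_b`. So the two components are glued (transversally) along an
  isomorphism of these two lines. -/
  isReduced_inter : ∀ {a b : T}, a ⋖ b → IsReduced (pullback (incl a) (incl b))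
  range_fst : ∀ {a b : T} (h : a ⋖ b),
    Set.range (pullback.fst (incl a) (incl b)) = blow a ⁻¹' {pt h}
  range_snd : ∀ {a b : T} (h : a ⋖ b),
    Set.range (pullback.snd (incl a) (incl b)) = blow b ⁻¹' line b (ne_bot_of_gt h.lt)
  /-- There are no other intersections of components. -/
  disjoint : ∀ a b : T, a ≠ b → ¬ a ⋖ b → ¬ b ⋖ a →
    Disjoint (Set.range (incl a)) (Set.range (incl b))
  /-- The standard contraction is the blowup morphism on the root component; every other component
  is contracted to the point of `S` blown up on the way to it. -/
  σ_over : σ ≫ sS = sX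
  σ_root : incl ⊥ ≫ σ = blow ⊥ ≫ rootIso.hom
  σ_contract : ∀ {a : T} (h : ⊥ ⋖ a) (b : T), a ≤ b → ∀ z : comp b,
    σ (incl b z) = rootIso.hom (pt h)

/-! ### Families of trees of surfaces -/

/-- `π : X ⟶ Y` together with the standard contraction `σ : X ⟶ S × Y` is a `𝐓_n`-family of
surfaces. -/
structure IsTnFamily (c n : ℤ) {S X Y : Scheme.{0}} (sS : S ⟶ SpecC) (sY : Y ⟶ SpecC)
    (π : X ⟶ Y) (σ : X ⟶ pullback sS sY) : Prop where
  locallyOfFiniteType_base : LocallyOfFiniteType sY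
  locallyOfFiniteType : LocallyOfFiniteType π
  flat : Flat π
  comp_snd : σ ≫ pullback.snd sS sY = π
  /-- The fibres over the closed points are `T`-surfaces with `T` in `𝐓_n`, and `σ` induces their
  standard contractions to `S`. -/
  fibre : ∀ y : Y, IsClosed {y} →
    ∃ (T : Type) (_ : PartialOrder T) (_ : OrderBot T), InTn c n T ∧
      Nonempty (TreeSurface T sS (π.fiberι y ≫ π ≫ sY) (π.fiberι y ≫ σ ≫ pullback.fst sS sY))
  /-- `σ` is birational on a closed subscheme supported on a union of irreducible components. -/
  main : ∃ (Xb : Scheme.{0}) (i : Xb ⟶ X), IsClosedImmersion i ∧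
    (∃ Z ⊆ irreducibleComponents X, Set.range i = ⋃₀ Z) ∧ IsBirationalMorphism (i ≫ σ)

/-- A good `𝐓_n`-family: the standard contraction is birational on the whole of `X`. -/
structure IsGoodTnFamily (c n : ℤ) {S X Y : Scheme.{0}} (sS : S ⟶ SpecC) (sY : Y ⟶ SpecC)
    (π : X ⟶ Y) (σ : X ⟶ pullback sS sY) : Prop extends IsTnFamily c n sS sY π σ where
  birational : IsBirationalMorphism σ

/-- `L` is an intersection line in a fibre of `π`: the (nonempty) intersection of two different
irreducible components of the fibre over a closed point, viewed as a subset of `X`. -/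
def IsIntersectionLine {X Y : Scheme.{0}} (π : X ⟶ Y) (L : Set X) : Prop :=
  ∃ y : Y, IsClosed {y} ∧ ∃ Z₁ ∈ irreducibleComponents (π.fiber y),
    ∃ Z₂ ∈ irreducibleComponents (π.fiber y), Z₁ ≠ Z₂ ∧ (Z₁ ∩ Z₂).Nonempty ∧
      L = π.fiberι y '' (Z₁ ∩ Z₂)

/-! ### Singularities of type `A_k` on threefolds -/

/-- The product of the surface singularity `x y = z ^ (k + 1)` of type `A_k` with the affine line
with coordinate `w`; the variables `x, y, z, w` are numbered `0, 1, 2, 3`. It is smooth for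
`k = 0`. -/
abbrev AkRing (k : ℕ) : Type :=
  MvPolynomial (Fin 4) ℂ ⧸ Ideal.span
    {(MvPolynomial.X 0 * MvPolynomial.X 1 - MvPolynomial.X 2 ^ (k + 1) : MvPolynomial (Fin 4) ℂ)}

/-- The threefold `{x y = z ^ (k + 1)}` in affine `4`-space. -/
def AkModel (k : ℕ) : Scheme.{0} := Spec (CommRingCat.of (AkRing k))

/-- The structure morphism of the model. -/
def AkModel.toC (k : ℕ) : AkModel k ⟶ SpecC :=
  Spec.map (CommRingCat.ofHom (algebraMap ℂ (AkRing k)))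

/-- The coordinate functions of the model. -/
def AkModel.coord (k : ℕ) (i : Fin 4) : AkRing k := Ideal.Quotient.mk _ (MvPolynomial.X i)

/-- The line `x = y = z = 0` in the model, the singular locus if `k ≥ 1`. -/
def AkModel.line (k : ℕ) : Set (AkModel k) :=
  PrimeSpectrum.zeroLocus {AkModel.coord k 0, AkModel.coord k 1, AkModel.coord k 2}

/-- The origin of the model (a set with one element). -/
def AkModel.origin (k : ℕ) : Set (AkModel k) :=
  PrimeSpectrum.zeroLocus (Set.range (AkModel.coord k))

/-- `X` is smooth over the complex numbers near `p`. -/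
def IsSmoothAt {X : Scheme.{0}} (sX : X ⟶ SpecC) (p : X) : Prop :=
  ∃ U : X.Opens, p ∈ U ∧ Smooth (U.ι ≫ sX)

/-- The threefold `X` has a singularity of type `A_k` at `p`: there is a common étale neighbourhood
(over the complex numbers) of `p` in `X` and of the origin in the model. Étale morphisms of complex
schemes are local isomorphisms of the associated analytic spaces. -/
def IsAkAt {X : Scheme.{0}} (sX : X ⟶ SpecC) (k : ℕ) (p : X) : Prop :=
  ∃ (W : Scheme.{0}) (w : W) (u : W ⟶ X) (v : W ⟶ AkModel k), Etale u ∧ Etale v ∧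
    u ≫ sX = v ≫ AkModel.toC k ∧ u w = p ∧ v w ∈ AkModel.origin k

/-- Near the point `p` of `L`, the pair `(X, L)` is the product of the `A_k`-singularity
`(x y = z ^ (k + 1), 0)` with a line: there is a common étale neighbourhood of `p` in `X` and of
the origin in the model, on which the subsets `L` and `x = y = z = 0` agree. -/
def IsTrivialAkAlongAt {X : Scheme.{0}} (sX : X ⟶ SpecC) (k : ℕ) (L : Set X) (p : X) : Prop :=
  ∃ (W : Scheme.{0}) (w : W) (u : W ⟶ X) (v : W ⟶ AkModel k), Etale u ∧ Etale v ∧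
    u ≫ sX = v ≫ AkModel.toC k ∧ u w = p ∧ v w ∈ AkModel.origin k ∧
    u ⁻¹' L = v ⁻¹' AkModel.line k

end TreeSurfaces

end

/-!
Let `L` be an intersection line in the fibre over a closed point of `C`. Near `L` the fibre
consists of two smooth surfaces `A` and `B`, and these meet transversally in the projective line
`L`. By flatness, an étale coordinate `t` of `C` at this point becomes a regular function on `X`
with zero scheme `A ∪ B` (`TreeSurface.exists_isTwoBranch`). Choose local functions `x` and `y` on
`X` that vanish on `B` and on `A` and restrict to equations of `L` on `A` and on `B`. Their product
vanishes on `A ∪ B`, so that `x * y = t ^ m * g` with `m = 1`, and `X` is locally the hypersurface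
given by this equation in an étale scheme over affine four-space
(`exists_etale_hypersurface_mvPolynomial`). If `g` is invertible, this is an étale neighbourhood of
a point of `A_(m - 1) × 𝔸¹` (`IsTwoBranch.exists_model`). The number `m` has to be raised until `g`
becomes invertible, simultaneously at all points of `L`.

This works because the normal bundles of `L` in `A` and in `B` are dual to each other: one of the
surfaces contains `L` as an exceptional line with normal bundle `𝒪(-1)`, the other one as the inverse
image of a line in the plane with normal bundle `𝒪(1)`. It is made explicit by affine charts of the
two surfaces along `L` in which the transition functions of the equations of `L` are inverse to each
other on `L` (`GluedCharts`, `TreeSurface.exists_gluedCharts`); the universal property of blowing up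
gives the charts of the blown up surfaces. With restrictions to `A` and `B` fixed in this way,
`g` restricted to `L` depends on no choices (`level_coeff_unique`, `IsTwoBranch.coeff_eq`). So these
restrictions glue to a function on the projective line, which is a constant
(`IsTwoBranch.exists_const`). If the constant is not zero, `g` is invertible all along `L`. If it is
zero, then `g` lies in the ideal `(x, y, t)`, and correcting `x` and `y` by multiples of `t ^ m` makes
their product divisible by `t ^ (m + 1)` (`exists_lift_level`). Hence there is one `k` for the whole of
`L`, unless equations of all levels `m` exist (`IsTwoBranch.exists_level`).

The latter is impossible since `σ` is birational. Every component of a fibre that `σ` contracts lies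
in the exceptional locus of `σ`, and, since its ideal is generically generated by a coordinate of
`C`, it is an irreducible component of the exceptional locus (`mem_minimalPrimes_of_forall_exists`).
There are finitely many of these near a given point, so that the other fibres meet a neighbourhood of
a point of `L` only in their root components (`exists_affine_forall_notMem`). Therefore `X` is smooth
over `C` with two-dimensional fibres there, the differentials of `X` over `C` are generated by two
elements outside of the zero locus of `t`, and a power `t ^ N` annihilates all `3 × 3`-minors. But
modulo `x, y, t ^ m` the differentials of the hypersurface `x * y = t ^ m * g` over `C` are free of
rank three, so that `m ≤ N` (`exists_level_bound`, `IsTwoBranch.exists_not_hasLevel`).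

At a point on only one component the fibre is smooth, hence so is `X`, by flatness
(`TreeSurface.isSmoothAt_of_forall_notMem`).
-/


universe u

namespace TreeSurfaces

/-! ### Commutative algebra of the equation `x * y = t ^ m * g` -/

section Loc

variable {E : Type*} [CommRing E]

open Ideal

/-- Nakayama's lemma for `J ≤ I ⊔ y J` in a Noetherian local ring. -/
lemma le_of_forall_exists_mul [IsLocalRing E] [IsNoetherianRing E] {J I : Ideal E} {y : E}
    (hy : y ∈ IsLocalRing.maximalIdeal E) (h : ∀ j ∈ J, ∃ b ∈ J, j - y * b ∈ I) : J ≤ I := by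
  refine Submodule.le_of_le_smul_of_le_jacobson_bot (I := span {y}) (IsNoetherian.noetherian J)
    ?_ ?_
  · rw [IsLocalRing.jacobson_eq_maximalIdeal ⊥ bot_ne_top, span_le]
    simpa using hy
  · intro j hj
    obtain ⟨b, hb, hjb⟩ := h j hj
    rw [show j = (j - y * b) + y * b by ring]
    exact Submodule.add_mem_sup hjb
      (Submodule.smul_mem_smul (mem_span_singleton_self y) hb)

/-- In a Noetherian local ring with a regular configuration `x, y, t`, an ideal `J` inside
`(x, y, t)` modulo which `t`, `x`, `y` behave like a degeneration of two smooth branches is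
generated by the single equation `x y - t ^ m g` that it contains. -/
lemma eq_span_of_two_branches [IsLocalRing E] [IsNoetherianRing E] {J : Ideal E}
    {x y t g : E} {m : ℕ} (hm : m ≠ 0)
    (hx : x ∈ IsLocalRing.maximalIdeal E) (hy : y ∈ IsLocalRing.maximalIdeal E)
    (ht : t ∈ IsLocalRing.maximalIdeal E)
    (hJ : J ≤ span {x, y, t}) (hf : x * y - t ^ m * g ∈ J)
    (htJ : ∀ a, t * a ∈ J → a ∈ J)
    (hxJ : ∀ a, x * a ∈ J ⊔ span {y, t} → a ∈ J ⊔ span {y, t})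
    (hyJ : ∀ a, y * a ∈ J ⊔ span {x, t} → a ∈ J ⊔ span {x, t})
    (hxE : ∀ a, x * a ∈ span {y, t} → a ∈ span {y, t}) :
    J = span {x * y - t ^ m * g} := by
  -- the two branches lie on `x = t = 0` and `y = t = 0`
  have h1 : J ≤ span {x, t} := by
    have h : J ⊔ span {x, t} ≤ span {x, t} := by
      refine le_of_forall_exists_mul hy fun j hj ↦ ?_
      obtain ⟨a, ha, b, hb, rfl⟩ := Submodule.mem_sup.mp hj
      obtain ⟨p, q, r, hpqr⟩ := Submodule.mem_span_triple.mp (hJ ha)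
      simp only [smul_eq_mul] at hpqr
      refine ⟨q, hyJ q ?_, ?_⟩
      · rw [show y * q = a - (p * x + r * t) by rw [← hpqr]; ring]
        exact sub_mem (Ideal.mem_sup_left ha)
          (Ideal.mem_sup_right (mem_span_pair.mpr ⟨p, r, rfl⟩))
      · rw [show a + b - y * q = (p * x + r * t) + b by rw [← hpqr]; ring]
        exact add_mem (mem_span_pair.mpr ⟨p, r, rfl⟩) hb
    exact le_sup_left.trans h
  have h2 : J ≤ span {y, t} := by
    have h : J ⊔ span {y, t} ≤ span {y, t} := by
      refine le_of_forall_exists_mul hx fun j hj ↦ ?_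
      obtain ⟨a, ha, b, hb, rfl⟩ := Submodule.mem_sup.mp hj
      obtain ⟨p, q, r, hpqr⟩ := Submodule.mem_span_triple.mp (hJ ha)
      simp only [smul_eq_mul] at hpqr
      refine ⟨p, hxJ p ?_, ?_⟩
      · rw [show x * p = a - (q * y + r * t) by rw [← hpqr]; ring]
        exact sub_mem (Ideal.mem_sup_left ha)
          (Ideal.mem_sup_right (mem_span_pair.mpr ⟨q, r, rfl⟩))
      · rw [show a + b - x * p = (q * y + r * t) + b by rw [← hpqr]; ring]
        exact add_mem (mem_span_pair.mpr ⟨q, r, rfl⟩) hb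
    exact le_sup_left.trans h
  refine le_antisymm (le_of_forall_exists_mul ht fun j hj ↦ ?_)
    ((span_singleton_le_iff_mem _).mpr hf)
  obtain ⟨a, b, hab⟩ := mem_span_pair.mp (h1 hj)
  have ha : x * a ∈ span {y, t} := by
    rw [show x * a = j - b * t by rw [← hab]; ring]
    exact sub_mem (h2 hj) (mul_mem_left _ _ (subset_span (by simp)))
  obtain ⟨c, d, hcd⟩ := mem_span_pair.mp (hxE a ha)
  obtain ⟨k, rfl⟩ : ∃ k, m = k + 1 := Nat.exists_eq_succ_of_ne_zero hm
  have hj' : j = c * (x * y - t ^ (k + 1) * g) + t * (b + x * d + c * t ^ k * g) := by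
    rw [← hab, ← hcd]; ring
  refine ⟨b + x * d + c * t ^ k * g, htJ _ ?_, ?_⟩
  · rw [show t * (b + x * d + c * t ^ k * g) = j - c * (x * y - t ^ (k + 1) * g) by
      rw [hj']; ring]
    exact sub_mem hj (mul_mem_left _ _ hf)
  · rw [mem_span_singleton, hj']
    exact ⟨c, by ring⟩

end Loc

section Levels

variable {B : Type*} [CommRing B] {t x y x' y' τ τ' g g' : B} {m : ℕ}

/-- If the product of two branch equations is divisible by `t ^ m` with quotient vanishing on the
double curve, the branch equations can be corrected modulo `t ^ m` so that their product becomes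
divisible by `t ^ (m + 1)`. -/
lemma exists_lift_level (hm : m ≠ 0) (h : x * y = t ^ m * g) (hg : g ∈ Ideal.span {x, y, t}) :
    ∃ a b g', (x - t ^ m * a) * (y - t ^ m * b) = t ^ (m + 1) * g' := by
  obtain ⟨p, q, r, hpqr⟩ := Submodule.mem_span_triple.mp hg
  simp only [smul_eq_mul] at hpqr
  obtain ⟨k, rfl⟩ : ∃ k, m = k + 1 := Nat.exists_eq_succ_of_ne_zero hm
  refine ⟨q, p, r + t ^ k * p * q, ?_⟩
  have : (x - t ^ (k + 1) * q) * (y - t ^ (k + 1) * p) =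
    x * y - t ^ (k + 1) * (p * x + q * y) + t ^ (k + 1) * t ^ (k + 1) * p * q := by ring
  rw [this, h, ← hpqr]
  ring

/-- The leading coefficient `g` of the product of two branch equations at level `m` restricts to
a well-defined function on the double curve, once the restrictions of the branch equations to the
two branches are fixed: it is multiplied by the factors by which these restrictions change. -/
lemma level_coeff_unique (ht : t ∈ nonZeroDivisors B)
    (hyt : ∀ a, y * a ∈ Ideal.span {x, t} → a ∈ Ideal.span {x, t})
    (hxt : ∀ a, x * a ∈ Ideal.span {y, t} → a ∈ Ideal.span {y, t})
    (hτ : ∀ a, τ * a ∈ Ideal.span {y, t} → a ∈ Ideal.span {y, t})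
    (hτ' : ∀ a, τ' * a ∈ Ideal.span {x, t} → a ∈ Ideal.span {x, t})
    (hm : m ≠ 0)
    (h : x * y = t ^ m * g) (h' : x' * y' = t ^ m * g')
    (hx : ∃ c, x' = τ * x + t * c) (hy : ∃ d, y' = τ' * y + t * d) :
    g' - τ * τ' * g ∈ Ideal.span {x, y, t} := by
  have hxle : Ideal.span {x, t} ≤ Ideal.span {x, y, t} :=
    Ideal.span_mono (by intro; simp; tauto)
  have hyle : Ideal.span {y, t} ≤ Ideal.span {x, y, t} :=
    Ideal.span_mono (by intro; simp; tauto)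
  have htm : t ∈ Ideal.span {x, y, t} := Ideal.subset_span (by simp)
  have hxm : x ∈ Ideal.span {x, y, t} := Ideal.subset_span (by simp)
  have hym : y ∈ Ideal.span {x, y, t} := Ideal.subset_span (by simp)
  -- improve the congruences `x' ≡ τ x`, `y' ≡ τ' y` from modulus `t` to modulus `t ^ m`
  have key : ∀ j, j + 1 ≤ m → ∃ u v c d p q, x' = u * x + t ^ (j + 1) * c ∧
      y' = v * y + t ^ (j + 1) * d ∧ u = τ + t * p ∧ v = τ' + t * q := by
    intro j
    induction j with
    | zero =>
      intro _
      obtain ⟨c, hc⟩ := hx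
      obtain ⟨d, hd⟩ := hy
      exact ⟨τ, τ', c, d, 0, 0, by simpa using hc, by simpa using hd, by simp, by simp⟩
    | succ j ih =>
      intro hj
      obtain ⟨u, v, c, d, p, q, hc, hd, hu, hv⟩ := ih (by omega)
      obtain ⟨i, rfl⟩ := Nat.exists_eq_add_of_le hj
      have e : t ^ (j + 1) * (t ^ (i + 1) * (g' - u * v * g)) =
          t ^ (j + 1) * (c * (v * y) + d * (u * x) + t ^ (j + 1) * c * d) := by
        have h1 : x' * y' = u * v * (x * y) +
            t ^ (j + 1) * (c * (v * y) + d * (u * x) + t ^ (j + 1) * c * d) := by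
          rw [hc, hd]; ring
        rw [h, h'] at h1
        linear_combination h1
      have e' := mul_cancel_left_mem_nonZeroDivisors (pow_mem ht (j + 1)) |>.mp e
      have hc' : c ∈ Ideal.span {x, t} := by
        refine hτ' _ (hyt _ ?_)
        refine Ideal.mem_span_pair.mpr ⟨- d * u, t ^ i * (g' - u * v * g) - t ^ j * c * d
          - c * q * y, ?_⟩
        rw [hv] at e' ⊢
        linear_combination e'
      have hd' : d ∈ Ideal.span {y, t} := by
        refine hτ _ (hxt _ ?_)
        refine Ideal.mem_span_pair.mpr ⟨- c * v, t ^ i * (g' - u * v * g) - t ^ j * c * d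
          - d * p * x, ?_⟩
        rw [hu] at e' ⊢
        linear_combination e'
      obtain ⟨c₁, c₂, hc₁⟩ := Ideal.mem_span_pair.mp hc'
      obtain ⟨d₁, d₂, hd₁⟩ := Ideal.mem_span_pair.mp hd'
      refine ⟨u + t ^ (j + 1) * c₁, v + t ^ (j + 1) * d₁, c₂, d₂, p + t ^ j * c₁, q + t ^ j * d₁,
        ?_, ?_, ?_, ?_⟩
      · rw [hc, ← hc₁]; ring
      · rw [hd, ← hd₁]; ring
      · rw [hu]; ring
      · rw [hv]; ring
  obtain ⟨k, rfl⟩ : ∃ k, m = k + 1 := Nat.exists_eq_succ_of_ne_zero hm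
  obtain ⟨u, v, c, d, p, q, hc, hd, hu, hv⟩ := key k le_rfl
  have e : t ^ (k + 1) * (g' - u * v * g) =
      t ^ (k + 1) * (c * (v * y) + d * (u * x) + t ^ (k + 1) * c * d) := by
    have h1 : x' * y' = u * v * (x * y) +
        t ^ (k + 1) * (c * (v * y) + d * (u * x) + t ^ (k + 1) * c * d) := by
      rw [hc, hd]; ring
    rw [h, h'] at h1
    linear_combination h1
  have e' := mul_cancel_left_mem_nonZeroDivisors (pow_mem ht (k + 1)) |>.mp e
  have : g' - τ * τ' * g = (c * v) * y + (d * u) * x +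
      (t ^ k * c * d + g * (τ * q + p * τ' + t * p * q)) * t := by
    have : g' = u * v * g + (c * (v * y) + d * (u * x) + t ^ (k + 1) * c * d) := by
      linear_combination e'
    rw [this, hu, hv]; ring
  rw [this]
  exact add_mem (add_mem (Ideal.mul_mem_left _ _ hym) (Ideal.mul_mem_left _ _ hxm))
    (Ideal.mul_mem_left _ _ htm)

end Levels

end TreeSurfaces

namespace TreeSurfaces

/-! ### Étale neighbourhoods by lifting from the double curve -/

open TensorProduct

/-- The kernel of `M ⟶ A' ⊗[A] M` for a surjection `A ⟶ A'`. -/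
lemma ker_includeRight_of_surjective {A A' M : Type*} [CommRing A] [CommRing A'] [CommRing M]
    [Algebra A A'] [Algebra A M] (h : Function.Surjective (algebraMap A A')) :
    RingHom.ker (Algebra.TensorProduct.includeRight : M →ₐ[A] A' ⊗[A] M) =
      (RingHom.ker (algebraMap A A')).map (algebraMap A M) := by
  have h1 := Algebra.TensorProduct.rTensor_ker (R := A) (C := M) (f := Algebra.ofId A A') h
  have h2 : (Algebra.TensorProduct.includeRight : M →ₐ[A] A' ⊗[A] M) =
      (Algebra.TensorProduct.map (Algebra.ofId A A') (AlgHom.id A M)).comp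
        (Algebra.TensorProduct.lid A M).symm.toAlgHom := by
    ext; simp
  have h3 : ((RingHom.ker (algebraMap A A')).map (algebraMap A M)) =
      ((RingHom.ker (Algebra.ofId A A')).map (Algebra.TensorProduct.includeLeft :
        A →ₐ[A] A ⊗[A] M)).map (Algebra.TensorProduct.lid A M).toRingEquiv := by
    change _ = ((RingHom.ker (algebraMap A A')).map (Algebra.TensorProduct.includeLeft :
        A →ₐ[A] A ⊗[A] M).toRingHom).map (Algebra.TensorProduct.lid A M).toRingEquiv.toRingHom
    rw [Ideal.map_map]
    congr 1
    ext a
    simp [Algebra.algebraMap_eq_smul_one]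
  ext m
  rw [RingHom.mem_ker, h2, h3, ← Ideal.comap_symm, Ideal.mem_comap, ← h1]
  rfl

section

variable {R B : Type*} [CommRing R] [CommRing B] [Algebra R B]

/-- If `B / I` is unramified over `R` for an ideal `I` generated by elements of `R`, then `B` is
unramified over `R` at all primes containing `I`. -/
lemma isUnramifiedAt_of_quotient [Algebra.FiniteType R B] (K : Ideal R) {Λ : Type*} [CommRing Λ]
    [Algebra R Λ] [Algebra B Λ] [IsScalarTower R B Λ] (hΛ : Function.Surjective (algebraMap B Λ))
    (hK : RingHom.ker (algebraMap B Λ) = K.map (algebraMap R B))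
    [Algebra.FormallyUnramified R Λ] (p : Ideal B) [p.IsPrime]
    (hp : K.map (algebraMap R B) ≤ p) : Algebra.IsUnramifiedAt R p := by
  have h0 : KaehlerDifferential.kerCotangentToTensor R B Λ = 0 := by
    ext x
    obtain ⟨⟨x, hx⟩, rfl⟩ := Ideal.toCotangent_surjective _ x
    rw [KaehlerDifferential.kerCotangentToTensor_toCotangent]
    simp only [LinearMap.zero_apply]
    rw [hK] at hx
    induction hx using Submodule.span_induction with
    | mem x h =>
      obtain ⟨k, -, rfl⟩ := h
      simp
    | zero => simp
    | add x y hx hy h1 h2 => simp [TensorProduct.tmul_add, h1, h2]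
    | smul a x hx h =>
      have hx0 : algebraMap B Λ x = 0 := by
        rw [← RingHom.mem_ker, hK]; exact hx
      simp only [smul_eq_mul, Derivation.leibniz, TensorProduct.tmul_add, TensorProduct.tmul_smul,
        h, smul_zero, zero_add]
      rw [← TensorProduct.tmul_smul, ← TensorProduct.smul_tmul, Algebra.smul_def, hx0, zero_mul,
        TensorProduct.zero_tmul]
  have hsub : Subsingleton (Λ ⊗[B] Ω[B⁄R]) := by
    refine ⟨fun a b ↦ ?_⟩
    have := (KaehlerDifferential.exact_kerCotangentToTensor_mapBaseChange R B Λ hΛ (a - b)).mp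
      (Subsingleton.elim _ _)
    obtain ⟨c, hc⟩ := this
    rw [h0, LinearMap.zero_apply] at hc
    exact (sub_eq_zero.mp hc.symm)
  change (⟨p, ‹_›⟩ : PrimeSpectrum B) ∈ Algebra.unramifiedLocus R B
  rw [Algebra.unramifiedLocus_eq_compl_support, Set.mem_compl_iff, Module.notMem_support_iff]
  have htop : (⊤ : Submodule B Ω[B⁄R]) ≤ RingHom.ker (algebraMap B Λ) • ⊤ := by
    intro m _
    have h2 : Subsingleton ((B ⧸ RingHom.ker (algebraMap B Λ)) ⊗[B] Ω[B⁄R]) := by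
      let e : (B ⧸ RingHom.ker (algebraMap B Λ)) ≃ₗ[B] Λ :=
        (Ideal.quotientKerAlgEquivOfSurjective (f := Algebra.ofId B Λ) hΛ).toLinearEquiv
      exact (TensorProduct.congr e (LinearEquiv.refl B Ω[B⁄R])).toEquiv.subsingleton
    have h3 : Subsingleton (Ω[B⁄R] ⧸ (RingHom.ker (algebraMap B Λ) • ⊤ : Submodule B Ω[B⁄R])) :=
      (TensorProduct.quotTensorEquivQuotSMul Ω[B⁄R]
        (RingHom.ker (algebraMap B Λ))).symm.toEquiv.subsingleton
    rw [Submodule.Quotient.subsingleton_iff] at h3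
    rw [h3]; trivial
  obtain ⟨r, hr, hr0⟩ := Submodule.exists_sub_one_mem_and_smul_eq_zero_of_fg_of_le_smul _ _
    (Module.Finite.fg_top) htop
  rw [LocalizedModule.subsingleton_iff]
  intro m
  refine ⟨r, fun hrp ↦ ?_, hr0 m trivial⟩
  rw [hK] at hr
  have : (1 : B) ∈ p := by
    have := sub_mem hrp (hp hr)
    simpa using this
  exact (Ideal.ne_top_iff_one p).mp (Ideal.IsPrime.ne_top ‹_›) this

/-- A surjection `φ : E ⟶ B` of `R`-algebras with `E` unramified over `R` that induces modulo
`K` a surjection onto an étale `R / K`-algebra has kernel contained in `K E + (ker φ) ^ 2`. -/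
lemma ker_le_of_formallyEtale_quotient {E R' Λ : Type*} [CommRing E] [Algebra R E]
    [Algebra.FormallyUnramified R E] (φ : E →ₐ[R] B) (hφ : Function.Surjective φ)
    [CommRing R'] [Algebra R R'] (hR : Function.Surjective (algebraMap R R'))
    [CommRing Λ] [Algebra R Λ] [Algebra R' Λ] [IsScalarTower R R' Λ] [Algebra B Λ]
    [IsScalarTower R B Λ] (hΛ : Function.Surjective (algebraMap B Λ))
    (hK : RingHom.ker (algebraMap B Λ) = (RingHom.ker (algebraMap R R')).map (algebraMap R B))
    [Algebra.FormallyEtale R' Λ] :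
    RingHom.ker φ ≤ (RingHom.ker φ) ^ 2 ⊔
      (RingHom.ker (algebraMap R R')).map (algebraMap R E) := by
  set K := RingHom.ker (algebraMap R R') with hKdef
  let ψ : (R' ⊗[R] E) →ₐ[R'] Λ := Algebra.TensorProduct.lift (Algebra.ofId R' Λ)
    ((IsScalarTower.toAlgHom R B Λ).comp φ) (fun _ _ ↦ mul_comm _ _)
  have hψ (e : E) : ψ (1 ⊗ₜ e) = algebraMap B Λ (φ e) := by
    refine (Algebra.TensorProduct.lift_tmul _ _ _ _ _).trans ?_
    rw [map_one, one_mul]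
    rfl
  have hψs : Function.Surjective ψ := by
    intro l
    obtain ⟨b, rfl⟩ := hΛ l
    obtain ⟨e, rfl⟩ := hφ b
    exact ⟨_, hψ e⟩
  have hinc : Function.Surjective (Algebra.TensorProduct.includeRight : E →ₐ[R] R' ⊗[R] E) :=
    Algebra.TensorProduct.includeRight_surjective _ hR
  algebraize [ψ.toRingHom]
  have : IsScalarTower R' (R' ⊗[R] E) Λ := .of_algebraMap_eq' ψ.comp_algebraMap.symm
  have : Algebra.FormallyEtale (R' ⊗[R] E) Λ := .of_restrictScalars (R := R')
  have hid := (Algebra.FormallyEtale.iff_of_surjective (R := R' ⊗[R] E) (S := Λ) hψs).mp this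
  have hker : RingHom.ker (algebraMap (R' ⊗[R] E) Λ) =
      (RingHom.ker φ).map (Algebra.TensorProduct.includeRight : E →ₐ[R] R' ⊗[R] E) := by
    apply le_antisymm
    · intro z hz
      obtain ⟨e, rfl⟩ := hinc z
      have h1 : φ e ∈ K.map (algebraMap R B) := by
        rw [← hK, RingHom.mem_ker, ← hψ]; exact hz
      have h2 : K.map (algebraMap R B) = (K.map (algebraMap R E)).map (φ : E →+* B) := by
        rw [Ideal.map_map, φ.comp_algebraMap]
      rw [h2, Ideal.mem_map_iff_of_surjective (φ : E →+* B) hφ] at h1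
      obtain ⟨e', he', hee'⟩ := h1
      have h3 : (Algebra.TensorProduct.includeRight : E →ₐ[R] R' ⊗[R] E) e' = 0 := by
        rw [← RingHom.mem_ker, ker_includeRight_of_surjective hR]
        exact he'
      rw [← sub_zero ((Algebra.TensorProduct.includeRight : E →ₐ[R] R' ⊗[R] E) e), ← h3, ← map_sub]
      exact Ideal.mem_map_of_mem _ (by rw [RingHom.mem_ker, map_sub, sub_eq_zero]; exact hee'.symm)
    · rw [Ideal.map_le_iff_le_comap]
      intro e he
      change ψ (1 ⊗ₜ e) = 0
      rw [hψ, he, map_zero]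
  intro j hj
  have h1 : (Algebra.TensorProduct.includeRight : E →ₐ[R] R' ⊗[R] E) j ∈
      ((RingHom.ker φ) ^ 2).map (Algebra.TensorProduct.includeRight : E →ₐ[R] R' ⊗[R] E) := by
    rw [Ideal.map_pow, ← hker, pow_two, hid, hker]
    exact Ideal.mem_map_of_mem _ hj
  rw [Ideal.mem_map_iff_of_surjective _ hinc] at h1
  obtain ⟨e, he, hej⟩ := h1
  have : j - e ∈ K.map (algebraMap R E) := by
    rw [← ker_includeRight_of_surjective hR, RingHom.mem_ker, map_sub, hej, sub_self]
  rw [show j = e + (j - e) by ring]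
  exact Submodule.add_mem_sup he this

end

/-- Multiplication by `x` being injective modulo an ideal is preserved by localization. -/
lemma regular_mod_localization {E E' : Type*} [CommRing E] [CommRing E'] [Algebra E E']
    (M : Submonoid E) [IsLocalization M E'] {x : E} {K : Ideal E}
    (h : ∀ a, x * a ∈ K → a ∈ K) (a : E')
    (ha : algebraMap E E' x * a ∈ K.map (algebraMap E E')) : a ∈ K.map (algebraMap E E') := by
  obtain ⟨e, s, rfl⟩ := IsLocalization.exists_mk'_eq M a
  rw [IsLocalization.mul_mk'_eq_mk'_of_mul, IsLocalization.mk'_mem_map_algebraMap_iff] at ha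
  rw [IsLocalization.mk'_mem_map_algebraMap_iff]
  obtain ⟨r, hr, h1⟩ := ha
  exact ⟨r, hr, h _ (by rwa [show x * (r * e) = r * (x * e) by ring])⟩

/-- Multiplication by `x` being injective modulo an ideal is preserved by flat base change. -/
lemma regular_mod_flat {R E : Type*} [CommRing R] [CommRing E] [Algebra R E] [Module.Flat R E]
    {x : R} {K : Ideal R} (h : ∀ a, x * a ∈ K → a ∈ K) (a : E)
    (ha : algebraMap R E x * a ∈ K.map (algebraMap R E)) : a ∈ K.map (algebraMap R E) := by
  have h1 : IsSMulRegular (R ⧸ K) x := by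
    intro u v huv
    obtain ⟨u, rfl⟩ := Ideal.Quotient.mk_surjective u
    obtain ⟨v, rfl⟩ := Ideal.Quotient.mk_surjective v
    rw [Ideal.Quotient.eq]
    apply h
    rw [mul_sub, ← Ideal.Quotient.eq]
    exact huv
  have h2 : IsSMulRegular ((R ⧸ K) ⊗[R] E) x := h1.rTensor E
  have hmem (e : E) : e ∈ K.map (algebraMap R E) ↔ (1 : R ⧸ K) ⊗ₜ[R] e = 0 := by
    have h3 := ker_includeRight_of_surjective (A := R) (A' := R ⧸ K) (M := E)
      Ideal.Quotient.mk_surjective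
    rw [Ideal.Quotient.algebraMap_eq, Ideal.mk_ker] at h3
    rw [← h3]
    rfl
  rw [hmem] at ha ⊢
  apply h2
  change x • _ = x • _
  rw [smul_zero, ← TensorProduct.tmul_smul, Algebra.smul_def, ha]

lemma awayMapₐ_algebraMap {R E B : Type*} [CommRing R] [CommRing E] [CommRing B] [Algebra R E]
    [Algebra R B] (φ : E →ₐ[R] B) (a e : E) :
    IsLocalization.Away.mapₐ (Localization.Away a) (Localization.Away (φ a)) φ a
      (algebraMap E _ e) = algebraMap B _ (φ e) := by
  rw [IsLocalization.Away.mapₐ_apply]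
  exact IsLocalization.map_eq (M := .powers a) (T := .powers (φ a)) _ e

/-- Local structure of a family of surfaces along a double curve: if `B` is an algebra of finite
type over a Noetherian ring `R` containing "coordinates" `X, Y, T` that satisfy `X Y = T ^ m g`
in `B`, such that `B / (X, Y, T)` is étale over `R / (X, Y, T)` and `T`, `X`, `Y` are regular on
`B`, `B / (Y, T)` and `B / (X, T)`, then locally `B` is the hypersurface `X Y = T ^ m g` in an
étale `R`-algebra. -/
theorem exists_etale_hypersurface {R R' B Λ : Type} [CommRing R] [IsNoetherianRing R]
    [CommRing R'] [CommRing B] [CommRing Λ] [Algebra R B] [Algebra.FiniteType R B]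
    [Algebra R R'] [Algebra R Λ] [Algebra B Λ] [Algebra R' Λ] [IsScalarTower R R' Λ]
    [IsScalarTower R B Λ] [Algebra.FormallyEtale R' Λ] {X Y T : R}
    (hR : Function.Surjective (algebraMap R R'))
    (hRker : RingHom.ker (algebraMap R R') = Ideal.span {X, Y, T})
    (hΛ : Function.Surjective (algebraMap B Λ))
    (hΛker : RingHom.ker (algebraMap B Λ) = (Ideal.span {X, Y, T}).map (algebraMap R B))
    (hXR : ∀ a, X * a ∈ Ideal.span {Y, T} → a ∈ Ideal.span {Y, T})
    (hT : ∀ a, algebraMap R B T * a = 0 → a = 0)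
    (hX : ∀ a, algebraMap R B X * a ∈ (Ideal.span {Y, T}).map (algebraMap R B) →
      a ∈ (Ideal.span {Y, T}).map (algebraMap R B))
    (hY : ∀ a, algebraMap R B Y * a ∈ (Ideal.span {X, T}).map (algebraMap R B) →
      a ∈ (Ideal.span {X, T}).map (algebraMap R B))
    (p : Ideal B) [p.IsPrime] (hp : (Ideal.span {X, Y, T}).map (algebraMap R B) ≤ p)
    {m : ℕ} (hm : m ≠ 0) (g : B)
    (hg : algebraMap R B X * algebraMap R B Y = algebraMap R B T ^ m * g) :
    ∃ h ∉ p, ∃ (E Bh : Type) (_ : CommRing E) (_ : CommRing Bh) (_ : Algebra R E)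
      (_ : Algebra B Bh) (_ : Algebra R Bh) (_ : IsScalarTower R B Bh)
      (_ : IsLocalization.Away h Bh) (_ : Algebra.Etale R E)
      (φ : E →ₐ[R] Bh) (g' : E), Function.Surjective φ ∧
      RingHom.ker φ = Ideal.span {algebraMap R E X * algebraMap R E Y - algebraMap R E T ^ m * g'} ∧
      φ g' = algebraMap B Bh g ∧ (g = 1 → g' = 1) := by
  set K : Ideal R := Ideal.span {X, Y, T} with hK
  have : Algebra.FormallyUnramified R R' :=
    .of_surjective (Algebra.ofId R R') hR
  have : Algebra.FormallyUnramified R Λ := .comp R R' Λ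
  have : Algebra.IsUnramifiedAt R p := isUnramifiedAt_of_quotient K hΛ hΛker p hp
  -- unramified algebras are locally quotients of étale algebras
  obtain ⟨f, hfp, Pr, φ, hφ⟩ :=
    Algebra.IsUnramifiedAt.exists_hasStandardEtaleSurjectionOn (R := R) p
  let E := Pr.Ring
  let Bf := Localization.Away f
  have : IsNoetherianRing E := Algebra.FiniteType.isNoetherianRing R E
  have hp' : (p.map (algebraMap B Bf)).IsPrime :=
    IsLocalization.isPrime_of_isPrime_disjoint (.powers f) _ _ ‹_›
      ((Ideal.disjoint_powers_iff_notMem_of_isPrime _).mpr hfp)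
  let q : Ideal E := (p.map (algebraMap B Bf)).comap (φ : E →+* Bf)
  have hq : q.IsPrime := Ideal.comap_isPrime _ _
  let Eq := Localization.AtPrime q
  have : IsNoetherianRing Eq := IsLocalization.isNoetherianRing q.primeCompl _ inferInstance
  let J := RingHom.ker (φ : E →+* Bf)
  -- the ideal of the double curve in the étale algebra and in the localization of `B`
  have hcomp : (φ : E →+* Bf).comp (algebraMap R E) = (algebraMap B Bf).comp (algebraMap R B) := by
    rw [← IsScalarTower.algebraMap_eq]; exact φ.comp_algebraMap
  have hmapK (I : Ideal R) : (I.map (algebraMap R E)).map (φ : E →+* Bf) =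
      (I.map (algebraMap R B)).map (algebraMap B Bf) := by
    rw [Ideal.map_map, Ideal.map_map, hcomp]
  have hcm (I : Ideal R) : ((I.map (algebraMap R B)).map (algebraMap B Bf)).comap (φ : E →+* Bf) =
      J ⊔ I.map (algebraMap R E) := by
    rw [← hmapK, Ideal.comap_map_of_surjective' (φ : E →+* Bf) hφ, sup_comm]
  have hKq : K.map (algebraMap R E) ≤ q := by
    rw [← Ideal.map_le_iff_le_comap, hmapK]
    exact Ideal.map_mono hp
  have hJq : J ≤ q := by
    intro j hj
    change φ j ∈ p.map (algebraMap B Bf)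
    rw [show φ j = 0 from hj]; exact zero_mem _
  have hx (e : E) (he : e ∈ q) : algebraMap E Eq e ∈ IsLocalRing.maximalIdeal Eq :=
    (IsLocalization.AtPrime.to_map_mem_maximal_iff Eq q e).mpr he
  have hmem {z : R} (hz : z ∈ K) : algebraMap R E z ∈ q := hKq (Ideal.mem_map_of_mem _ hz)
  have hXK : X ∈ K := Ideal.subset_span (by simp)
  have hYK : Y ∈ K := Ideal.subset_span (by simp)
  have hTK : T ∈ K := Ideal.subset_span (by simp)
  obtain ⟨g', hg', hg1⟩ : ∃ g', φ g' = algebraMap B Bf g ∧ (g = 1 → g' = 1) := by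
    by_cases h1 : g = 1
    · exact ⟨1, by rw [h1, map_one, map_one], fun _ ↦ rfl⟩
    · obtain ⟨g', hg'⟩ := hφ (algebraMap B Bf g)
      exact ⟨g', hg', fun h ↦ absurd h h1⟩
  have hspan3 : (K.map (algebraMap R E)).map (algebraMap E Eq) =
      Ideal.span {algebraMap E Eq (algebraMap R E X), algebraMap E Eq (algebraMap R E Y),
        algebraMap E Eq (algebraMap R E T)} := by
    rw [hK, Ideal.map_span, Ideal.map_span]
    simp [Set.image_insert_eq]
  have hspan2 (a b : R) : ((Ideal.span {a, b}).map (algebraMap R E)).map (algebraMap E Eq) =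
      Ideal.span {algebraMap E Eq (algebraMap R E a), algebraMap E Eq (algebraMap R E b)} := by
    rw [Ideal.map_span, Ideal.map_span]
    simp [Set.image_insert_eq]
  have hφR (z : R) : φ (algebraMap R E z) = algebraMap B Bf (algebraMap R B z) :=
    congr($hcomp z)
  have key : J.map (algebraMap E Eq) = Ideal.span {algebraMap E Eq (algebraMap R E X) *
      algebraMap E Eq (algebraMap R E Y) - algebraMap E Eq (algebraMap R E T) ^ m *
        algebraMap E Eq g'} := by
    refine eq_span_of_two_branches hm (hx _ (hmem hXK)) (hx _ (hmem hYK)) (hx _ (hmem hTK))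
      ?_ ?_ ?_ ?_ ?_ ?_
    · rw [← hspan3]
      -- the double curve is étale over `R / K`, hence the kernel lies in its ideal
      have h1 : J ≤ J ^ 2 ⊔ K.map (algebraMap R E) := by
        have hc1 : SMulCommClass B R' Λ := ⟨fun b r l ↦ by simp only [Algebra.smul_def]; ring⟩
        let _ : Algebra Bf (Λ ⊗[B] Bf) :=
          (Algebra.TensorProduct.includeRight : Bf →ₐ[B] Λ ⊗[B] Bf).toRingHom.toAlgebra
        have hBf (b : Bf) : algebraMap Bf (Λ ⊗[B] Bf) b = 1 ⊗ₜ b := rfl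
        have : IsScalarTower R R' (Λ ⊗[B] Bf) := inferInstance
        have : IsScalarTower R' Λ (Λ ⊗[B] Bf) := inferInstance
        have : IsScalarTower R Bf (Λ ⊗[B] Bf) := .of_algebraMap_eq fun r ↦ by
          change algebraMap R Λ r ⊗ₜ[B] (1 : Bf) = 1 ⊗ₜ[B] algebraMap R Bf r
          rw [IsScalarTower.algebraMap_apply R B Λ,
            IsScalarTower.algebraMap_apply R B Bf, Algebra.algebraMap_eq_smul_one,
            Algebra.algebraMap_eq_smul_one (A := Bf), TensorProduct.smul_tmul]
        have : Algebra.FormallyEtale R' (Λ ⊗[B] Bf) := .comp R' Λ _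
        have h0 := ker_le_of_formallyEtale_quotient (R := R) (E := E) (B := Bf) (R' := R')
          (Λ := Λ ⊗[B] Bf) φ hφ hR (Algebra.TensorProduct.includeRight_surjective _ hΛ)
          (by
            have := ker_includeRight_of_surjective (M := Bf) hΛ
            rw [hΛker, Ideal.map_map, ← IsScalarTower.algebraMap_eq, ← hRker] at this
            exact this)
        rw [hRker] at h0
        exact h0
      have h2 := Ideal.map_mono (f := algebraMap E Eq) h1
      rw [Ideal.map_sup, Ideal.map_pow] at h2
      have hJm : J.map (algebraMap E Eq) ≤ IsLocalRing.maximalIdeal Eq := by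
        rw [Ideal.map_le_iff_le_comap]
        exact fun j hj ↦ hx j (hJq hj)
      refine Submodule.le_of_le_smul_of_le_jacobson_bot (I := IsLocalRing.maximalIdeal Eq)
        (IsNoetherian.noetherian _) ?_ (h2.trans ?_)
      · rw [IsLocalRing.jacobson_eq_maximalIdeal ⊥ bot_ne_top]
      · rw [sup_comm, pow_two]
        exact sup_le_sup_left (Ideal.mul_mono_left hJm) _
    · have : algebraMap R E X * algebraMap R E Y - algebraMap R E T ^ m * g' ∈ J := by
        change φ _ = 0
        rw [map_sub, map_mul, map_mul, map_pow, hφR, hφR, hφR, hg', ← map_mul, hg, map_mul,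
          map_pow, sub_self]
      simpa using Ideal.mem_map_of_mem (algebraMap E Eq) this
    -- the regularity of `t`, `x` and `y`, modulo the kernel
    · refine regular_mod_localization q.primeCompl fun a ha ↦ ?_
      change φ _ = 0 at ha
      rw [map_mul, hφR] at ha
      have := regular_mod_localization (E' := Bf) (K := ⊥) (.powers f)
        (fun a ha ↦ hT a ha) (φ a) (by rw [ha]; exact zero_mem _)
      rwa [Ideal.map_bot] at this
    · rw [← hspan2, ← Ideal.map_sup, ← hcm]
      refine regular_mod_localization q.primeCompl fun a ha ↦ ?_
      rw [Ideal.mem_comap, map_mul] at ha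
      exact regular_mod_localization (E' := Bf) (.powers f) hX (φ a) (by rw [← hφR]; exact ha)
    · rw [← hspan2, ← Ideal.map_sup, ← hcm]
      refine regular_mod_localization q.primeCompl fun a ha ↦ ?_
      rw [Ideal.mem_comap, map_mul] at ha
      exact regular_mod_localization (E' := Bf) (.powers f) hY (φ a) (by rw [← hφR]; exact ha)
    · rw [← hspan2]
      exact regular_mod_localization q.primeCompl (regular_mod_flat hXR)
  -- spread out the equality of ideals from the local ring to a neighbourhood
  set F : E := algebraMap R E X * algebraMap R E Y - algebraMap R E T ^ m * g' with hF
  have hFJ : F ∈ J := by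
    change φ _ = 0
    rw [map_sub, map_mul, map_mul, map_pow, hφR, hφR, hφR, hg', ← map_mul, hg, map_mul,
      map_pow, sub_self]
  have key' : J.map (algebraMap E Eq) = (Ideal.span {F}).map (algebraMap E Eq) := by
    rw [key, Ideal.map_span]; simp [hF]
  obtain ⟨s, hsq, hs⟩ : ∃ s ∉ q, ∀ j ∈ J, s * j ∈ Ideal.span {F} := by
    obtain ⟨S, hS⟩ := (IsNoetherian.noetherian J : J.FG)
    have : ∀ j : J, ∃ s ∉ q, s * j.1 ∈ Ideal.span {F} := fun j ↦ by
      have := Ideal.mem_map_of_mem (algebraMap E Eq) j.2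
      rw [key', IsLocalization.algebraMap_mem_map_algebraMap_iff q.primeCompl] at this
      obtain ⟨s, hs, h⟩ := this
      exact ⟨s, hs, h⟩
    choose s hsq hs using this
    have hSJ : ∀ j ∈ S, j ∈ J := fun j hj ↦ hS ▸ Ideal.subset_span hj
    refine ⟨∏ j ∈ S.attach, s ⟨j.1, hSJ _ j.2⟩, ?_, ?_⟩
    · rw [hq.prod_mem_iff]
      rintro ⟨j, -, hj⟩
      exact hsq _ hj
    · intro j hj
      rw [← hS] at hj
      induction hj using Submodule.span_induction with
      | mem j hj =>
        obtain ⟨c, hc⟩ := Finset.dvd_prod_of_mem (fun j : S ↦ s ⟨j.1, hSJ _ j.2⟩)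
          (Finset.mem_attach S ⟨j, hj⟩)
        rw [hc, show s ⟨j, hSJ _ hj⟩ * c * j = c * (s ⟨j, hSJ _ hj⟩ * j) by ring]
        exact Ideal.mul_mem_left _ _ (hs ⟨j, hSJ _ hj⟩)
      | zero => simp
      | add a b _ _ h1 h2 => rw [mul_add]; exact add_mem h1 h2
      | smul a b _ h => rw [smul_eq_mul, mul_left_comm]; exact Ideal.mul_mem_left _ _ h
  obtain ⟨b, k, hbk⟩ : ∃ b : B, ∃ k : ℕ, φ s * algebraMap B Bf (f ^ k) = algebraMap B Bf b := by
    obtain ⟨b, ⟨_, k, rfl⟩, hb⟩ := IsLocalization.exists_mk'_eq (.powers f) (φ s)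
    exact ⟨b, k, by rw [← hb]; exact IsLocalization.mk'_spec _ _ _⟩
  obtain ⟨a, ha⟩ := hφ (algebraMap B Bf (f ^ k))
  have hsa : φ (s * a) = algebraMap B Bf b := by rw [map_mul, ha, hbk]
  have hfB : algebraMap B Bf f ∉ p.map (algebraMap B Bf) := by
    rw [IsLocalization.algebraMap_mem_map_algebraMap_iff (.powers f)]
    rintro ⟨_, ⟨n, rfl⟩, h⟩
    exact hfp (‹p.IsPrime›.mem_of_pow_mem (n + 1) (by rwa [pow_succ]))
  have hbp : b ∉ p := by
    intro hb
    have h1 := Ideal.mem_map_of_mem (algebraMap B Bf) hb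
    rw [← hbk] at h1
    rcases hp'.mem_or_mem h1 with h | h
    · exact hsq h
    · rw [map_pow] at h
      exact hfB (hp'.mem_of_pow_mem _ h)
  let Es := Localization.Away (s * a)
  let Bs := Localization.Away (φ (s * a))
  have : IsLocalization.Away (f * b) Bs := by
    have : IsLocalization.Away (algebraMap B Bf b) Bs := hsa ▸ inferInstance
    exact .mul' Bf _ _ _
  let φs : Es →ₐ[R] Bs := IsLocalization.Away.mapₐ Es Bs φ (s * a)
  have hφs (e : E) : φs (algebraMap E Es e) = algebraMap Bf Bs (φ e) := by
    exact awayMapₐ_algebraMap φ _ e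
  refine ⟨f * b, ‹p.IsPrime›.mul_notMem hfp hbp, Es, Bs, inferInstance, inferInstance,
    inferInstance, inferInstance, inferInstance, inferInstance, inferInstance, ?_, φs,
    algebraMap E Es g',
    IsLocalization.Away.mapₐ_surjective_of_surjective _ hφ, ?_, ?_, fun h ↦ by rw [hg1 h, map_one]⟩
  · exact Algebra.Etale.comp R E Es
  · apply le_antisymm
    · intro z hz
      obtain ⟨e, ⟨_, n, rfl⟩, rfl⟩ := IsLocalization.exists_mk'_eq (.powers (s * a)) z
      have h1 : φs (algebraMap E Es e) = 0 := by
        rw [← IsLocalization.mk'_spec Es e (⟨_, n, rfl⟩ : Submonoid.powers (s * a)), map_mul, hz, zero_mul]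
      rw [hφs, IsLocalization.map_eq_zero_iff (.powers (φ (s * a)))] at h1
      obtain ⟨⟨_, i, rfl⟩, hi⟩ := h1
      have h2 : (s * a) ^ i * e ∈ J := by
        change φ _ = 0
        rw [map_mul, map_pow]; exact hi
      have h3 : (s * a) ^ (i + 1) * e ∈ Ideal.span {F} := by
        rw [show (s * a) ^ (i + 1) * e = a * (s * ((s * a) ^ i * e)) by ring]
        exact Ideal.mul_mem_left _ _ (hs _ h2)
      have h4 : IsLocalization.mk' Es e (⟨_, n, rfl⟩ : Submonoid.powers (s * a)) ∈
          (Ideal.span {F}).map (algebraMap E Es) := by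
        rw [IsLocalization.mk'_mem_map_algebraMap_iff]
        exact ⟨_, ⟨i + 1, rfl⟩, h3⟩
      rw [Ideal.map_span, Set.image_singleton, hF] at h4
      simpa [IsScalarTower.algebraMap_apply R E Es] using h4
    · rw [Ideal.span_singleton_le_iff_mem, RingHom.mem_ker]
      have : φs (algebraMap E Es F) = 0 := by
        rw [hφs, show φ F = 0 from hFJ, map_zero]
      rw [← this, hF]
      simp [IsScalarTower.algebraMap_apply R E Es]
  · rw [hφs, hg', ← IsScalarTower.algebraMap_apply]

/-- A quotient of an étale `R`-algebra by an ideal that comes from `R` is étale over the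
corresponding quotient of `R`. -/
lemma etale_of_ker_eq_map {R R' E B : Type*} [CommRing R] [CommRing R'] [CommRing E] [CommRing B]
    [Algebra R R'] [Algebra R E] [Algebra R B] [Algebra R' B] [IsScalarTower R R' B]
    [Algebra.Etale R E] (hR : Function.Surjective (algebraMap R R')) (φ : E →ₐ[R] B)
    (hφ : Function.Surjective φ)
    (hker : RingHom.ker φ = (RingHom.ker (algebraMap R R')).map (algebraMap R E)) :
    Algebra.Etale R' B := by
  let ψ : (R' ⊗[R] E) →ₐ[R'] B := Algebra.TensorProduct.lift (Algebra.ofId R' B) φ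
    (fun _ _ ↦ mul_comm _ _)
  have hψ (e : E) : ψ (1 ⊗ₜ e) = φ e := by
    refine (Algebra.TensorProduct.lift_tmul _ _ _ _ _).trans ?_
    rw [map_one, one_mul]
  refine Algebra.Etale.of_equiv (AlgEquiv.ofBijective ψ ⟨?_, fun b ↦ ?_⟩)
  · rw [injective_iff_map_eq_zero]
    intro z hz
    obtain ⟨e, rfl⟩ := Algebra.TensorProduct.includeRight_surjective _ hR z
    have h1 : e ∈ RingHom.ker φ := by rw [RingHom.mem_ker, ← hψ]; exact hz
    rw [hker, ← ker_includeRight_of_surjective hR] at h1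
    exact h1
  · obtain ⟨e, rfl⟩ := hφ b
    exact ⟨_, hψ e⟩

end TreeSurfaces

namespace TreeSurfaces

/-! ### Bounding the order of contact of the two branches -/

open TensorProduct KaehlerDifferential

section Derivations

set_option linter.unusedSectionVars false

variable {R S T M : Type*} [CommRing R] [CommRing S] [CommRing T] [Algebra R S] [Algebra R T]
  [Algebra S T] [IsScalarTower R S T] [AddCommGroup M] [Module R M] [Module S M] [Module T M]
  [IsScalarTower S T M] [IsScalarTower R T M] [IsScalarTower R S M]

/-- Derivations extend along formally étale algebras. -/
lemma exists_derivation_of_formallyEtale [Algebra.FormallyEtale S T] (d : Derivation R S M) :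
    ∃ d' : Derivation R T M, ∀ s, d' (algebraMap S T s) = d s := by
  let L : Ω[T⁄R] →ₗ[T] M := (isBaseChange_of_formallyEtale R S T).lift d.liftKaehlerDifferential
  refine ⟨L.compDer (D R T), fun s ↦ ?_⟩
  have := (isBaseChange_of_formallyEtale R S T).lift_eq d.liftKaehlerDifferential (D R S s)
  rw [map_D] at this
  simpa using this

/-- A derivation that vanishes on `S` vanishes on every formally unramified `S`-algebra. -/
lemma derivation_eq_zero_of_formallyUnramified [Algebra.FormallyUnramified S T]
    (d : Derivation R T M) (h : ∀ s, d (algebraMap S T s) = 0) (x : T) : d x = 0 := by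
  let d' : Derivation S T M := Derivation.mk'
    { toFun := d
      map_add' := d.map_add
      map_smul' := fun s y ↦ by
        rw [Algebra.smul_def, d.leibniz, h, smul_zero, add_zero, algebraMap_smul]
        rfl } (fun a b ↦ d.leibniz a b)
  change d' x = 0
  rw [← d'.liftKaehlerDifferential_comp_D, Subsingleton.elim (D S T x) 0, map_zero]

end Derivations

/-- If the differentials of `B` over `D` are generated by two elements at every maximal ideal that
does not contain `t`, then a power of `t` kills all `3 × 3`-minors of differentials. -/
lemma exists_pow_mul_det_eq_zero {D B : Type} [CommRing D] [CommRing B] [Algebra D B]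
    [IsJacobsonRing B] (t : B)
    (h : ∀ P : Ideal B, P.IsMaximal → t ∉ P → ∃ c ∉ P, ∃ ω₁ ω₂ : Ω[B⁄D], ∀ η : Ω[B⁄D],
      c • η ∈ Submodule.span B {ω₁, ω₂}) :
    ∃ N : ℕ, ∀ (M : Type) [CommRing M] [Algebra B M] (φ : Fin 3 → (Ω[B⁄D] →ₗ[B] M))
      (η : Fin 3 → Ω[B⁄D]),
      algebraMap B M t ^ N * Matrix.det (Matrix.of fun i j ↦ φ i (η j)) = 0 := by
  let I : Ideal B :=
    { carrier := {c | ∀ (M : Type) [CommRing M] [Algebra B M] (φ : Fin 3 → (Ω[B⁄D] →ₗ[B] M))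
        (η : Fin 3 → Ω[B⁄D]),
        algebraMap B M c * Matrix.det (Matrix.of fun i j ↦ φ i (η j)) = 0}
      add_mem' := fun ha hb M _ _ φ η ↦ by rw [map_add, add_mul, ha, hb, add_zero]
      zero_mem' := fun M _ _ φ η ↦ by rw [map_zero, zero_mul]
      smul_mem' := fun c x hx M _ _ φ η ↦ by
        rw [smul_eq_mul, map_mul, mul_assoc, hx, mul_zero] }
  have hI (c : B) : c ∈ I ↔ ∀ (M : Type) [CommRing M] [Algebra B M]
      (φ : Fin 3 → (Ω[B⁄D] →ₗ[B] M)) (η : Fin 3 → Ω[B⁄D]),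
        algebraMap B M c * Matrix.det (Matrix.of fun i j ↦ φ i (η j)) = 0 := Iff.rfl
  have ht : t ∈ I.radical := by
    rw [Ideal.radical_eq_jacobson]
    refine Ideal.mem_sInf.mpr fun P hP ↦ ?_
    obtain ⟨hIP, hP⟩ := hP
    by_contra htP
    obtain ⟨c, hcP, ω₁, ω₂, hc⟩ := h P hP htP
    refine hcP (hP.isPrime.mem_of_pow_mem 3 (hIP ((hI _).mpr fun M _ _ φ η ↦ ?_)))
    choose a b hab using fun j ↦ Submodule.mem_span_pair.mp (hc (η j))
    have key (i j : Fin 3) : algebraMap B M c * φ i (η j) =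
        algebraMap B M (a j) * φ i ω₁ + algebraMap B M (b j) * φ i ω₂ := by
      rw [← Algebra.smul_def, ← map_smul, ← hab, map_add, map_smul, map_smul, Algebra.smul_def,
        Algebra.smul_def]
    have h3 : algebraMap B M (c ^ 3) * Matrix.det (Matrix.of fun i j ↦ φ i (η j)) =
        Matrix.det (Matrix.of fun i j ↦ algebraMap B M c * φ i (η j)) := by
      rw [Matrix.det_fin_three, Matrix.det_fin_three, map_pow]
      simp only [Matrix.of_apply]
      ring
    rw [h3]
    simp only [key]
    rw [Matrix.det_fin_three]
    simp only [Matrix.of_apply]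
    ring
  obtain ⟨N, hN⟩ := ht
  exact ⟨N, fun M _ _ φ η ↦ by rw [← map_pow]; exact (hI _).mp hN M φ η⟩

/-- A variable is regular modulo the ideal generated by other variables. -/
lemma mem_span_X_of_X_mul_mem {σ k : Type*} [Field k] {i : σ} {s : Set σ} (hi : i ∉ s)
    (a : MvPolynomial σ k) (h : MvPolynomial.X i * a ∈ Ideal.span (MvPolynomial.X '' s)) :
    a ∈ Ideal.span (MvPolynomial.X '' s : Set (MvPolynomial σ k)) := by
  classical
  rw [MvPolynomial.mem_ideal_span_X_image] at h ⊢
  intro m hm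
  obtain ⟨j, hj, hmj⟩ := h (m + Finsupp.single i 1) (by
    rw [mul_comm, MvPolynomial.support_mul_X]
    exact Finset.mem_map.mpr ⟨m, hm, rfl⟩)
  refine ⟨j, hj, ?_⟩
  have hij : i ≠ j := fun e ↦ hi (e ▸ hj)
  simpa [Finsupp.single_apply, hij] using hmj

lemma mem_span_X_pair_of_X_mul_mem {σ k : Type*} [Field k] {i j l : σ} (hj : i ≠ j) (hl : i ≠ l)
    (a : MvPolynomial σ k)
    (h : MvPolynomial.X i * a ∈ Ideal.span {MvPolynomial.X j, MvPolynomial.X l}) :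
    a ∈ Ideal.span {MvPolynomial.X j, (MvPolynomial.X l : MvPolynomial σ k)} := by
  have := mem_span_X_of_X_mul_mem (i := i) (s := {j, l}) (by simp [hj, hl]) a
    (by rwa [Set.image_pair])
  rwa [Set.image_pair] at this

open MvPolynomial in
/-- Let `B` be an algebra over a curve `D` with étale coordinate `t` such that the differentials
of `B` over `D` are generated by two elements at all maximal ideals that do not contain `t`. Then
there is a bound for the numbers `m` such that a localization of `B` is the hypersurface
`X Y = t ^ m g` in an étale algebra over the polynomial ring in `X, Y, t, w`. Indeed, the partial
derivatives with respect to `X`, `Y` and `w` show that modulo `X, Y, t ^ m` the differentials of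
such a hypersurface over `D` are free of rank three. -/
theorem exists_level_bound {D B : Type} [CommRing D] [CommRing B] [Algebra D B]
    [IsJacobsonRing B] [Algebra ℂ D] [Algebra ℂ B] [IsScalarTower ℂ D B]
    [Algebra (Polynomial ℂ) D] [IsScalarTower ℂ (Polynomial ℂ) D]
    [Algebra.FormallyUnramified (Polynomial ℂ) D]
    (h : ∀ P : Ideal B, P.IsMaximal →
      algebraMap D B (algebraMap (Polynomial ℂ) D Polynomial.X) ∉ P →
      ∃ c ∉ P, ∃ ω₁ ω₂ : Ω[B⁄D], ∀ η : Ω[B⁄D], c • η ∈ Submodule.span B {ω₁, ω₂}) :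
    ∃ N : ℕ, ∀ (E Bh : Type) [CommRing E] [CommRing Bh] [Algebra (MvPolynomial (Fin 4) ℂ) E]
      [Algebra ℂ E] [IsScalarTower ℂ (MvPolynomial (Fin 4) ℂ) E]
      [Algebra.Etale (MvPolynomial (Fin 4) ℂ) E] [Algebra B Bh] [Algebra ℂ Bh]
      [IsScalarTower ℂ B Bh] (s : B) [IsLocalization.Away s Bh] (φ : E →ₐ[ℂ] Bh)
      (_ : Function.Surjective φ) (m : ℕ) (g' : E)
      (_ : RingHom.ker φ = Ideal.span {algebraMap (MvPolynomial (Fin 4) ℂ) E (X 0) *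
        algebraMap (MvPolynomial (Fin 4) ℂ) E (X 1) -
        algebraMap (MvPolynomial (Fin 4) ℂ) E (X 2) ^ m * g'})
      (_ : φ (algebraMap (MvPolynomial (Fin 4) ℂ) E (X 2)) =
        algebraMap B Bh (algebraMap D B (algebraMap (Polynomial ℂ) D Polynomial.X)))
      (P : Ideal Bh) (_ : P.IsPrime) (_ : φ (algebraMap (MvPolynomial (Fin 4) ℂ) E (X 0)) ∈ P)
      (_ : φ (algebraMap (MvPolynomial (Fin 4) ℂ) E (X 1)) ∈ P) (_ : φ (algebraMap (MvPolynomial (Fin 4) ℂ) E (X 2)) ∈ P), m ≤ N := by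
  obtain ⟨N, hN⟩ := exists_pow_mul_det_eq_zero _ h
  refine ⟨N, fun E Bh _ _ _ _ _ _ _ _ _ s _ φ hφ m g' hker hT P hP hPX hPY hPT ↦ ?_⟩
  by_contra! hm
  set R := MvPolynomial (Fin 4) ℂ with hR
  set x : E := algebraMap R E (X 0) with hx
  set y : E := algebraMap R E (X 1) with hy
  set t : E := algebraMap R E (X 2) with ht
  -- Modulo `x, y, t ^ m` the partial derivatives of `x * y - t ^ m * g'` with respect to the
  -- variables other than `t` vanish, so that these derivations descend to `B`.
  set K : Ideal E := Ideal.span {x, y, t ^ m} with hK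
  have hxK : x ∈ K := Ideal.subset_span (by simp)
  have hyK : y ∈ K := Ideal.subset_span (by simp)
  have htK : t ^ m ∈ K := Ideal.subset_span (by simp)
  let M := E ⧸ K
  have hsm {e : E} (he : e ∈ K) (z : M) : e • z = 0 := by
    rw [Algebra.smul_def, Ideal.Quotient.algebraMap_eq, Ideal.Quotient.eq_zero_iff_mem.mpr he,
      zero_mul]
  have hFK : RingHom.ker φ ≤ K := by
    rw [hker, Ideal.span_singleton_le_iff_mem]
    exact sub_mem (Ideal.mul_mem_right _ _ hxK) (Ideal.mul_mem_right _ _ htK)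
  let β : Bh →+* M := RingHom.liftOfSurjective (φ : E →+* Bh) hφ
    ⟨Ideal.Quotient.mk K, fun e he ↦ by
      rw [RingHom.mem_ker, Ideal.Quotient.eq_zero_iff_mem]; exact hFK he⟩
  have hβ (e : E) : β (φ e) = Ideal.Quotient.mk K e :=
    RingHom.liftOfRightInverse_comp_apply _ _ _ _ e
  let _ : Algebra B M := (β.comp (algebraMap B Bh)).toAlgebra
  have hBM (b : B) : algebraMap B M b = β (algebraMap B Bh b) := rfl
  let _ : Algebra D M := ((algebraMap B M).comp (algebraMap D B)).toAlgebra
  have : IsScalarTower D B M := .of_algebraMap_eq' rfl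
  have : IsScalarTower ℂ B M := .of_algebraMap_eq fun c ↦ by
    rw [hBM, ← IsScalarTower.algebraMap_apply, ← φ.commutes, hβ]; rfl
  have : IsScalarTower ℂ D M := .of_algebraMap_eq fun c ↦ by
    rw [IsScalarTower.algebraMap_apply D B M, ← IsScalarTower.algebraMap_apply ℂ D B,
      ← IsScalarTower.algebraMap_apply]
  -- the partial derivatives, extended to `E` and with values in `M`
  let idx : Fin 3 → Fin 4 := ![0, 1, 3]
  have hidx2 (i : Fin 3) : idx i ≠ 2 := by fin_cases i <;> simp [idx]
  let d₀ (i : Fin 3) : Derivation ℂ R M :=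
    mkDerivation ℂ (fun j ↦ if j = idx i then (1 : M) else 0)
  choose d hd using fun i ↦ exists_derivation_of_formallyEtale (T := E) (d₀ i)
  have hdX (i : Fin 3) (j : Fin 4) : d i (algebraMap R E (X j)) = if j = idx i then 1 else 0 := by
    rw [hd]; exact mkDerivation_X _ _ _
  have hdF (i : Fin 3) (e : E) (he : e ∈ RingHom.ker φ) : d i e = 0 := by
    rw [hker, Ideal.mem_span_singleton] at he
    obtain ⟨a, rfl⟩ := he
    have hF : x * y - t ^ m * g' ∈ K :=
      sub_mem (Ideal.mul_mem_right _ _ hxK) (Ideal.mul_mem_right _ _ htK)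
    have h1 : d i t = 0 := by rw [ht, hdX, if_neg (hidx2 i).symm]
    rw [Derivation.leibniz, hsm hF, zero_add, map_sub, Derivation.leibniz, Derivation.leibniz,
      Derivation.leibniz_pow, hsm hxK, hsm hyK, hsm htK, h1]
    simp
  have hdφ (i : Fin 3) (e e' : E) (he : φ e = φ e') : d i e = d i e' := by
    rw [← sub_eq_zero, ← map_sub]
    exact hdF i _ (by rw [RingHom.mem_ker, map_sub, he, sub_self])
  choose l hl using fun b ↦ hφ b
  let δ (i : Fin 3) : Derivation ℂ B M := Derivation.mk'
    { toFun := fun b ↦ d i (l (algebraMap B Bh b))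
      map_add' := fun a b ↦ by
        rw [← map_add]
        exact hdφ i _ _ (by simp [hl])
      map_smul' := fun c b ↦ by
        rw [RingHom.id_apply, ← (d i).map_smul]
        exact hdφ i _ _ (by simp [hl, Algebra.smul_def,
          ← IsScalarTower.algebraMap_apply]) } (fun a b ↦ by
      have h1 (a : B) (z : M) : a • z = l (algebraMap B Bh a) • z := by
        rw [Algebra.smul_def, hBM, Algebra.smul_def, Ideal.Quotient.algebraMap_eq, ← hβ, hl]
      rw [h1, h1]
      change d i _ = _ • d i _ + _ • d i _
      rw [← Derivation.leibniz]
      exact hdφ i _ _ (by simp [hl]))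
  have hδ (i : Fin 3) (b : B) (e : E) (he : φ e = algebraMap B Bh b) : δ i b = d i e :=
    hdφ i _ _ (by rw [hl, he])
  have hBl (a : B) (z : M) : a • z = l (algebraMap B Bh a) • z := by
    rw [Algebra.smul_def, hBM, Algebra.smul_def, Ideal.Quotient.algebraMap_eq, ← hβ, hl]
  let _ : Algebra (Polynomial ℂ) M := ((algebraMap D M).comp (algebraMap (Polynomial ℂ) D)).toAlgebra
  have : IsScalarTower (Polynomial ℂ) D M := .of_algebraMap_eq' rfl
  have : IsScalarTower ℂ (Polynomial ℂ) M := .of_algebraMap_eq fun c ↦ by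
    rw [IsScalarTower.algebraMap_apply (Polynomial ℂ) D M,
      ← IsScalarTower.algebraMap_apply ℂ (Polynomial ℂ) D, ← IsScalarTower.algebraMap_apply]
  -- the derivations kill `t`, hence all functions on the base
  have hδD (i : Fin 3) (a : D) : δ i (algebraMap D B a) = 0 := by
    refine derivation_eq_zero_of_formallyUnramified (S := Polynomial ℂ)
      ((δ i).compAlgebraMap D) (fun q ↦ ?_) a
    have h1 : algebraMap (Polynomial ℂ) D q =
        Polynomial.aeval (algebraMap (Polynomial ℂ) D Polynomial.X) q := by
      rw [Polynomial.aeval_algebraMap_apply, Polynomial.aeval_X_left_apply]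
    have h2 : ((δ i).compAlgebraMap D) (algebraMap (Polynomial ℂ) D Polynomial.X) = 0 := by
      refine (hδ i _ t hT).trans ?_
      rw [ht, hdX, if_neg (hidx2 i).symm]
    rw [h1, Derivation.map_aeval, h2, smul_zero]
  let φ' (i : Fin 3) : Ω[B⁄D] →ₗ[B] M := Derivation.liftKaehlerDifferential <| Derivation.mk'
    { toFun := δ i
      map_add' := (δ i).map_add
      map_smul' := fun a y ↦ by
        rw [Algebra.smul_def, (δ i).leibniz, hδD, smul_zero, add_zero, algebraMap_smul]
        rfl } (fun a b ↦ (δ i).leibniz a b)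
  have hφ' (i : Fin 3) (b : B) : φ' i (KaehlerDifferential.D D B b) = δ i b :=
    Derivation.liftKaehlerDifferential_comp_D _ _
  -- The coordinates are fractions over `B`. Clearing denominators gives three differentials of `B`
  -- on which the three derivations form a matrix that is diagonal with unit entries.
  have hlift (j : Fin 3) : ∃ b s' : B, IsUnit (algebraMap B Bh s') ∧
      algebraMap B Bh b = φ (algebraMap R E (X (idx j))) * algebraMap B Bh s' := by
    obtain ⟨b, s', hb⟩ := IsLocalization.exists_mk'_eq (.powers s) (φ (algebraMap R E (X (idx j))))
    refine ⟨b, s', IsLocalization.map_units _ s', ?_⟩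
    rw [← hb]; exact (IsLocalization.mk'_spec _ _ _).symm
  choose b s' hs' hb using hlift
  have hval (i j : Fin 3) : φ' i (s' j • KaehlerDifferential.D D B (b j) -
      b j • KaehlerDifferential.D D B (s' j)) =
      algebraMap B M (s' j) ^ 2 * if i = j then 1 else 0 := by
    have h1 : δ i (b j) = d i (algebraMap R E (X (idx j)) * l (algebraMap B Bh (s' j))) :=
      hδ i _ _ (by rw [map_mul, hl, hb])
    have h2 : δ i (s' j) = d i (l (algebraMap B Bh (s' j))) := hδ i _ _ (hl _)
    have h3 : b j • δ i (s' j) =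
        (algebraMap R E (X (idx j)) * l (algebraMap B Bh (s' j))) • δ i (s' j) := by
      rw [Algebra.smul_def, hBM, hb, Algebra.smul_def, Ideal.Quotient.algebraMap_eq, ← hβ]
      simp only [map_mul, hl]
    have h4 : algebraMap B M (s' j) = algebraMap E M (l (algebraMap B Bh (s' j))) := by
      rw [hBM, Ideal.Quotient.algebraMap_eq, ← hβ, hl]
    have h5 : (if j = i then (1 : M) else 0) = if idx j = idx i then 1 else 0 := by
      fin_cases i <;> fin_cases j <;> simp [idx]
    rw [map_sub, map_smul, map_smul, hφ', hφ', h3, h1, h2, hBl, Derivation.leibniz, hdX, ← h5, h4]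
    simp only [Algebra.smul_def, map_mul, eq_comm (a := i)]
    ring
  have hdet := hN M φ' (fun j ↦ s' j • KaehlerDifferential.D D B (b j) -
      b j • KaehlerDifferential.D D B (s' j))
  -- The determinant is a unit, hence `t ^ N` lies in `(x, y, t ^ m)`. As `N < m` and `t` is regular
  -- modulo `x, y`, this is absurd.
  have htN : t ^ N ∈ K := by
    simp only [hval] at hdet
    rw [Matrix.det_fin_three] at hdet
    have hu (j : Fin 3) : IsUnit (algebraMap B M (s' j)) := (hs' j).map β
    have h1 : algebraMap B M (algebraMap D B (algebraMap (Polynomial ℂ) D Polynomial.X)) ^ N *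
        (algebraMap B M (s' 0) ^ 2 * algebraMap B M (s' 1) ^ 2 * algebraMap B M (s' 2) ^ 2) = 0 := by
      simpa using hdet
    rw [(((hu 0).pow 2).mul ((hu 1).pow 2) |>.mul ((hu 2).pow 2)).mul_left_eq_zero, hBM, ← hT, hβ,
      ← map_pow, Ideal.Quotient.eq_zero_iff_mem] at h1
    exact h1
  have : ∃ a, t ^ N * (1 - t ^ (m - N) * a) ∈ (Ideal.span {X 0, X 1}).map (algebraMap R E) := by
    obtain ⟨p, q, r, hpqr⟩ := Submodule.mem_span_triple.mp htN
    refine ⟨r, ?_⟩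
    rw [Ideal.map_span, Set.image_pair, Ideal.mem_span_pair]
    refine ⟨p, q, ?_⟩
    have e : t ^ m = t ^ N * t ^ (m - N) := by rw [← pow_add]; congr 1; omega
    simp only [smul_eq_mul] at hpqr
    rw [e] at hpqr
    linear_combination hpqr
  obtain ⟨a, ha⟩ := this
  have h1 : 1 - t ^ (m - N) * a ∈ (Ideal.span {X 0, X 1}).map (algebraMap R E) := by
    have hreg : ∀ (i : ℕ) (z : E), t ^ i * z ∈ (Ideal.span {X 0, X 1}).map (algebraMap R E) →
        z ∈ (Ideal.span {X 0, X 1}).map (algebraMap R E) := by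
      intro i
      induction i with
      | zero => intro z hz; simpa using hz
      | succ i ih =>
        intro z hz
        refine regular_mod_flat (x := (X 2 : R)) (fun a ha ↦
          mem_span_X_pair_of_X_mul_mem (by decide) (by decide) a ha) z (ih _ ?_)
        rwa [← mul_assoc, ← pow_succ]
    exact hreg N _ ha
  have h2 : φ (1 - t ^ (m - N) * a) ∈ P := by
    have : (Ideal.span {X 0, X 1}).map (algebraMap R E) ≤ P.comap φ := by
      rw [Ideal.map_span, Set.image_pair, Ideal.span_le]
      rintro _ (rfl | rfl)
      exacts [hPX, hPY]
    exact this h1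
  rw [map_sub, map_one, map_mul, map_pow] at h2
  refine hP.ne_top ((Ideal.eq_top_iff_one _).mpr ?_)
  have h3 : φ t ^ (m - N) * φ a ∈ P :=
    Ideal.mul_mem_right _ _ (Ideal.pow_mem_of_mem _ hPT _ (by omega))
  simpa using add_mem h2 h3

end TreeSurfaces

namespace TreeSurfaces

/-! ### Ideal sheaves and affine charts -/

open Scheme


lemma ideal_comap_of_isAffine {X Y : Scheme.{u}} [IsAffine X] [IsAffine Y]
    (I : Y.IdealSheafData) (f : X ⟶ Y) :
    (I.comap f).ideal ⟨⊤, isAffineOpen_top X⟩ =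
      (I.ideal ⟨⊤, isAffineOpen_top Y⟩).map f.appTop.hom := by
  have key (J : X.IdealSheafData) : I.comap f ≤ J ↔
      (I.ideal ⟨⊤, isAffineOpen_top Y⟩).map f.appTop.hom ≤ J.ideal ⟨⊤, isAffineOpen_top X⟩ := by
    rw [← IdealSheafData.le_map_iff_comap_le, Ideal.map_le_iff_le_comap]
    have h1 := IdealSheafData.ideal_map_of_isAffineHom J f ⟨⊤, isAffineOpen_top Y⟩
    constructor
    · intro h
      exact (h _).trans h1.le
    · intro h
      exact IdealSheafData.le_of_isAffine (h.trans h1.ge)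
  apply le_antisymm
  · have := (key (IdealSheafData.ofIdealTop
      ((I.ideal ⟨⊤, isAffineOpen_top Y⟩).map f.appTop.hom))).mpr (by simp)
    simpa using this ⟨⊤, isAffineOpen_top X⟩
  · exact (key _).mp le_rfl

lemma appLE_fromSpec_top {X : Scheme.{u}} {W : X.Opens} (hW : IsAffineOpen W)
    (e : ⊤ ≤ hW.fromSpec ⁻¹ᵁ W) :
    hW.fromSpec.appLE W ⊤ e = (Scheme.ΓSpecIso Γ(X, W)).inv := by
  rw [Scheme.Hom.appLE, hW.fromSpec_app_self, Category.assoc, ← Functor.map_comp]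
  exact (congrArg _ ((Spec Γ(X, W)).presheaf.map_id _)).trans (Category.comp_id _)

lemma ideal_comap_fromSpec {X : Scheme.{u}} (I : X.IdealSheafData) {W : X.Opens}
    (hW : IsAffineOpen W) :
    (I.comap hW.fromSpec).ideal ⟨⊤, isAffineOpen_top _⟩ =
      (I.ideal ⟨W, hW⟩).map (Scheme.ΓSpecIso Γ(X, W)).inv.hom := by
  have hle : hW.fromSpec ''ᵁ ⊤ ≤ W := by
    rw [Scheme.Hom.image_top_eq_opensRange, hW.opensRange_fromSpec]
  have h2 (e : Γ(X, hW.fromSpec ''ᵁ ⊤) ≅ Γ(Spec Γ(X, W), ⊤)) (K : Ideal Γ(X, hW.fromSpec ''ᵁ ⊤)) :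
      K.comap e.inv.hom = K.map e.hom.hom :=
    Ideal.comap_symm (I := K) e.commRingCatIsoToRingEquiv
  refine (IdealSheafData.ideal_comap_of_isOpenImmersion _ _ _).trans ?_
  rw [h2, ← I.map_ideal (U := ⟨hW.fromSpec ''ᵁ ⊤, (isAffineOpen_top _).image_of_isOpenImmersion _⟩)
    (V := ⟨W, hW⟩) hle, Ideal.map_map]
  congr 1
  rw [← CommRingCat.hom_comp]
  congr 1
  rw [Scheme.Hom.appIso_hom', Scheme.Hom.map_appLE, appLE_fromSpec_top]

/-- The inverse image of an ideal sheaf on affine charts. -/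
lemma ideal_comap_eq_map {X Y : Scheme.{u}} (I : Y.IdealSheafData) (f : X ⟶ Y)
    {V : Y.Opens} (hV : IsAffineOpen V) {W : X.Opens} (hW : IsAffineOpen W) (h : W ≤ f ⁻¹ᵁ V) :
    (I.comap f).ideal ⟨W, hW⟩ = (I.ideal ⟨V, hV⟩).map (f.appLE V W h).hom := by
  have h1 : (I.comap hV.fromSpec).comap (Spec.map (f.appLE V W h)) =
      (I.comap f).comap hW.fromSpec := by
    rw [← IdealSheafData.comap_comp, ← IdealSheafData.comap_comp,
      IsAffineOpen.SpecMap_appLE_fromSpec]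
  have h2 := congr(($h1).ideal ⟨⊤, isAffineOpen_top _⟩)
  rw [ideal_comap_of_isAffine, ideal_comap_fromSpec, ideal_comap_fromSpec, Ideal.map_map,
    ← CommRingCat.hom_comp, ← Scheme.ΓSpecIso_inv_naturality, CommRingCat.hom_comp,
    ← Ideal.map_map] at h2
  have h3 : Function.Injective (Ideal.map (Scheme.ΓSpecIso Γ(X, W)).inv.hom) := by
    intro a b hab
    have h4 (K : Ideal Γ(X, W)) :
        (K.map (Scheme.ΓSpecIso Γ(X, W)).inv.hom).map (Scheme.ΓSpecIso Γ(X, W)).hom.hom = K := by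
      rw [Ideal.map_map, ← CommRingCat.hom_comp, Iso.inv_hom_id]
      exact Ideal.map_id _
    rw [← h4 a, hab, h4]
  exact (h3 h2).symm

end TreeSurfaces

namespace TreeSurfaces

open Scheme


/-! ### Ideals of reduced closed subschemes on affine open sets -/

lemma fromSpec_mem_basicOpen_iff {X : Scheme.{u}} {U : X.Opens} (hU : IsAffineOpen U)
    (s : Γ(X, U)) (p : PrimeSpectrum Γ(X, U)) :
    hU.fromSpec p ∈ X.basicOpen s ↔ s ∉ p.asIdeal := by
  have := hU.fromSpec_preimage_basicOpen s
  exact (SetLike.ext_iff.mp this p : _)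

lemma mem_basicOpen_iff_notMem_primeIdealOf {X : Scheme.{u}} {U : X.Opens} (hU : IsAffineOpen U)
    (s : Γ(X, U)) {x : X} (hx : x ∈ U) :
    x ∈ X.basicOpen s ↔ s ∉ (hU.primeIdealOf ⟨x, hx⟩).asIdeal := by
  rw [← fromSpec_mem_basicOpen_iff hU, hU.fromSpec_primeIdealOf]

/-- The vanishing ideal of a closed set on an affine open subset: any radical ideal with the right
zero locus. -/
lemma vanishingIdeal_ideal_eq_of_isRadical {X : Scheme.{u}} (Z : Closeds X)
    {U : X.Opens} (hU : IsAffineOpen U) {I : Ideal Γ(X, U)} (hI : I.IsRadical)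
    (h : ∀ x ∈ U, x ∈ Z ↔ ∀ s ∈ I, x ∉ X.basicOpen s) :
    (IdealSheafData.vanishingIdeal Z).ideal ⟨U, hU⟩ = I := by
  rw [IdealSheafData.vanishingIdeal_ideal]
  have h1 : hU.fromSpec ⁻¹' (Z : Set X) = PrimeSpectrum.zeroLocus (I : Set Γ(X, U)) := by
    ext p
    have h2 : hU.fromSpec p ∈ U := by
      have : hU.fromSpec p ∈ hU.fromSpec.opensRange := ⟨p, rfl⟩
      rwa [hU.opensRange_fromSpec] at this
    refine (h _ h2).trans ?_
    refine ⟨fun h s hs ↦ ?_, fun h s hs hp ↦ (fromSpec_mem_basicOpen_iff hU s p).mp hp (h hs)⟩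
    by_contra hp
    exact h s hs ((fromSpec_mem_basicOpen_iff hU s p).mpr hp)
  exact (congrArg _ h1).trans
    ((PrimeSpectrum.vanishingIdeal_zeroLocus_eq_radical I).trans hI.radical)

lemma ker_eq_vanishingIdeal {A X : Scheme.{u}} (f : A ⟶ X) [IsClosedImmersion f] [IsReduced A] :
    f.ker = IdealSheafData.vanishingIdeal ⟨Set.range f, f.isClosedEmbedding.isClosed_range⟩ := by
  have h1 : f.ker.radical = f.ker := by
    ext V : 2
    rw [IdealSheafData.radical_ideal, f.ker_apply]
    refine (Ideal.IsRadical.radical fun a ⟨n, ha⟩ ↦ ?_)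
    rw [RingHom.mem_ker, map_pow] at ha
    exact eq_zero_of_pow_eq_zero ha
  rw [← h1, ← IdealSheafData.vanishingIdeal_support]
  congr 1
  ext1
  rw [Scheme.Hom.support_ker]
  exact f.isClosedEmbedding.isClosed_range.closure_eq

/-- The ideal of a reduced closed subscheme on an affine open subset: any radical ideal with the
right zero locus. -/
lemma ker_ideal_eq_of_isRadical {A X : Scheme.{u}} (f : A ⟶ X) [IsClosedImmersion f] [IsReduced A]
    {U : X.Opens} (hU : IsAffineOpen U) {I : Ideal Γ(X, U)} (hI : I.IsRadical)
    (h : ∀ x ∈ U, x ∈ Set.range f ↔ ∀ s ∈ I, x ∉ X.basicOpen s) :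
    f.ker.ideal ⟨U, hU⟩ = I := by
  rw [ker_eq_vanishingIdeal]
  exact vanishingIdeal_ideal_eq_of_isRadical _ hU hI h

lemma forall_mem_span_singleton_notMem_basicOpen {X : Scheme.{u}} {U : X.Opens} (e : Γ(X, U))
    (x : X) : (∀ s ∈ Ideal.span {e}, x ∉ X.basicOpen s) ↔ x ∉ X.basicOpen e := by
  refine ⟨fun h ↦ h e (Ideal.mem_span_singleton_self e), fun h s hs hx ↦ h ?_⟩
  obtain ⟨a, rfl⟩ := Ideal.mem_span_singleton.mp hs
  rw [X.basicOpen_mul] at hx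
  exact hx.1

/-! ### Coordinates on smooth complex schemes -/

/-- The complex numbers as constant functions on an open subset of a complex scheme. -/
noncomputable def const {X : Scheme.{0}} (sX : X ⟶ SpecC) (U : X.Opens) : ℂ →+* Γ(X, U) :=
  (sX.appLE ⊤ U le_top).hom.comp (Scheme.ΓSpecIso (CommRingCat.of ℂ)).inv.hom

lemma appLE_const {X Y : Scheme.{0}} {sX : X ⟶ SpecC} {sY : Y ⟶ SpecC} (f : X ⟶ Y)
    (hf : f ≫ sY = sX) {U : Y.Opens} {V : X.Opens} (e : V ≤ f ⁻¹ᵁ U) (c : ℂ) :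
    (f.appLE U V e).hom (const sY U c) = const sX V c := by
  subst hf
  have := Scheme.Hom.appLE_comp_appLE f sY ⊤ U V le_top e
  simp only [const, RingHom.comp_apply]
  exact congr(($this).hom _)

lemma map_const {X : Scheme.{0}} {sX : X ⟶ SpecC} {U V : X.Opens} (e : V ≤ U) (c : ℂ) :
    (X.presheaf.map (homOfLE e).op).hom (const sX U c) = const sX V c := by
  have := appLE_const (sX := sX) (sY := sX) (𝟙 X) (Category.id_comp _) (U := U) (V := V) e c
  have h1 : (𝟙 X : X ⟶ X).appLE U V e = X.presheaf.map (homOfLE e).op := by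
    simp [Scheme.Hom.appLE]
    exact Category.id_comp _
  rwa [h1] at this

open MvPolynomial in
/-- At a maximal ideal, étale coordinates of a complex algebra can be chosen to generate the
maximal ideal. -/
lemma exists_etale_coordinates_algebra {A : Type} [CommRing A] [Algebra ℂ A] {n : ℕ}
    (g : MvPolynomial (Fin n) ℂ →ₐ[ℂ] A) (hg : g.Etale) (m : Ideal A) [hm : m.IsMaximal] :
    ∃ g' : MvPolynomial (Fin n) ℂ →ₐ[ℂ] A, g'.Etale ∧ (∀ i, g' (X i) ∈ m) ∧
      ∃ s ∉ m, ∀ a ∈ m, s * a ∈ Ideal.span (Set.range fun i ↦ g' (X i)) := by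
  let _ : Field (A ⧸ m) := Ideal.Quotient.field m
  have hft : Algebra.FiniteType ℂ A := by
    algebraize [g.toRingHom]
    have : IsScalarTower ℂ (MvPolynomial (Fin n) ℂ) A := .of_algebraMap_eq' g.comp_algebraMap.symm
    exact .trans (S := MvPolynomial (Fin n) ℂ) inferInstance inferInstance
  have hbij : Function.Bijective (algebraMap ℂ (A ⧸ m)) := by
    have : Module.Finite ℂ (A ⧸ m) := finite_of_finite_type_of_isJacobsonRing ℂ (A ⧸ m)
    exact IsAlgClosed.algebraMap_bijective_of_isIntegral
  choose c hc using fun i ↦ hbij.2 (Ideal.Quotient.mk m (g (X i)))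
  let τ : MvPolynomial (Fin n) ℂ ≃ₐ[ℂ] MvPolynomial (Fin n) ℂ :=
    AlgEquiv.ofAlgHom (aeval fun i ↦ X i - C (c i)) (aeval fun i ↦ X i + C (c i))
      (by ext; simp) (by ext; simp)
  let g' := g.comp τ.toAlgHom
  have hg' : g'.Etale :=
    RingHom.Etale.stableUnderComposition _ _ (.of_bijective τ.bijective) hg
  have hgX (i : Fin n) : g' (X i) ∈ m := by
    have h1 : g' (X i) = g (X i) - algebraMap ℂ A (c i) := by
      simp only [g', τ, AlgHom.comp_apply]
      exact (congrArg g (aeval_X _ i)).trans (by rw [map_sub, ← algebraMap_eq, g.commutes])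
    rw [← Ideal.Quotient.eq_zero_iff_mem, h1, map_sub, ← hc, sub_eq_zero]
    rfl
  refine ⟨g', hg', hgX, ?_⟩
  set K : Ideal A := Ideal.span (Set.range fun i ↦ g' (X i)) with hK
  have hKm : K ≤ m := by
    rw [hK, Ideal.span_le]
    rintro _ ⟨i, rfl⟩
    exact hgX i
  -- an étale algebra has no cotangent space
  have hm2 : m ≤ m ^ 2 ⊔ K := by
    algebraize [g'.toRingHom]
    have halg (q : MvPolynomial (Fin n) ℂ) :
        algebraMap (MvPolynomial (Fin n) ℂ) (A ⧸ m) q = Ideal.Quotient.mk m (g' q) := rfl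
    have hker : RingHom.ker (algebraMap (MvPolynomial (Fin n) ℂ) (A ⧸ m)) ≤
        Ideal.span (X '' Set.univ) := by
      intro q hq
      have h0 (p : MvPolynomial (Fin n) ℂ) : p - C (constantCoeff p) ∈
          Ideal.span (X '' (Set.univ : Set (Fin n))) := by
        rw [mem_ideal_span_X_image]
        intro d hd
        by_contra! hd0
        have : d = 0 := by ext i; exact hd0 i trivial
        rw [this, mem_support_iff] at hd
        simp [constantCoeff_eq] at hd
      have h1 : Ideal.span (X '' Set.univ) ≤
          RingHom.ker (algebraMap (MvPolynomial (Fin n) ℂ) (A ⧸ m)) := by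
        rw [Ideal.span_le]
        rintro _ ⟨i, -, rfl⟩
        exact Ideal.Quotient.eq_zero_iff_mem.mpr (hgX i)
      have h2 : algebraMap ℂ (A ⧸ m) (constantCoeff q) = 0 := by
        have h3 := sub_mem hq (h1 (h0 q))
        rw [sub_sub_cancel, RingHom.mem_ker, halg, ← algebraMap_eq, g'.commutes] at h3
        exact h3
      have h4 : constantCoeff q = 0 := hbij.1 (by rw [h2, map_zero])
      have h5 := h0 q
      rwa [h4, map_zero, sub_zero] at h5
    have h1 := ker_le_of_formallyEtale_quotient (R := MvPolynomial (Fin n) ℂ) (E := A)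
      (R' := A ⧸ m) (B := A ⧸ m) (Λ := A ⧸ m)
      (IsScalarTower.toAlgHom (MvPolynomial (Fin n) ℂ) A (A ⧸ m))
      Ideal.Quotient.mk_surjective ?_ Function.surjective_id ?_
    · have h6 : RingHom.ker (IsScalarTower.toAlgHom (MvPolynomial (Fin n) ℂ) A (A ⧸ m)) = m :=
        Ideal.mk_ker
      rw [h6] at h1
      refine h1.trans (sup_le_sup_left ((Ideal.map_mono hker).trans ?_) _)
      rw [Ideal.map_span, Ideal.span_le]
      rintro _ ⟨_, ⟨i, -, rfl⟩, rfl⟩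
      exact Ideal.subset_span ⟨i, rfl⟩
    · intro z
      obtain ⟨c, rfl⟩ := hbij.2 z
      exact ⟨C c, by rw [halg, ← algebraMap_eq, g'.commutes]; rfl⟩
    · rw [(Ideal.map_eq_bot_iff_le_ker _).mpr le_rfl]
      exact (RingHom.injective_iff_ker_eq_bot _).mp Function.injective_id
  have hN : (m.map (Ideal.Quotient.mk K)) ≤ (m.map (Ideal.Quotient.mk K)) • (m.map (Ideal.Quotient.mk K)) := by
    have := Ideal.map_mono (f := Ideal.Quotient.mk K) hm2
    rwa [Ideal.map_sup, Ideal.map_quotient_self, sup_bot_eq, Ideal.map_pow, pow_two] at this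
  have : IsNoetherianRing A := Algebra.FiniteType.isNoetherianRing ℂ A
  obtain ⟨r, hr, hr0⟩ := Submodule.exists_sub_one_mem_and_smul_eq_zero_of_fg_of_le_smul _ _
    (IsNoetherian.noetherian _) hN
  obtain ⟨s, rfl⟩ := Ideal.Quotient.mk_surjective r
  refine ⟨s, fun hs ↦ ?_, fun a ha ↦ ?_⟩
  · rw [← map_one (Ideal.Quotient.mk K), ← map_sub, Ideal.mem_quotient_iff_mem hKm] at hr
    exact hm.ne_top ((Ideal.eq_top_iff_one _).mpr (by simpa using sub_mem hs hr))
  · have := hr0 _ (Ideal.mem_map_of_mem _ ha)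
    rwa [smul_eq_mul, ← map_mul, Ideal.Quotient.eq_zero_iff_mem] at this

lemma etale_map_basicOpen {X : Scheme.{u}} {U : X.Opens} (hU : IsAffineOpen U) (r : Γ(X, U)) :
    (X.presheaf.map (homOfLE (X.basicOpen_le r)).op).hom.Etale := by
  have := hU.isLocalization_basicOpen r
  have h1 : Algebra.Etale Γ(X, U) Γ(X, X.basicOpen r) := .of_isLocalizationAway r
  exact RingHom.etale_algebraMap.mpr h1

lemma exists_pow_mul_eq_map {X : Scheme.{u}} {U : X.Opens} (hU : IsAffineOpen U) (r : Γ(X, U))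
    (b : Γ(X, X.basicOpen r)) : ∃ (a : Γ(X, U)) (k : ℕ),
      b * (X.presheaf.map (homOfLE (X.basicOpen_le r)).op).hom r ^ k =
        (X.presheaf.map (homOfLE (X.basicOpen_le r)).op).hom a := by
  have := hU.isLocalization_basicOpen r
  obtain ⟨a, ⟨_, k, rfl⟩, h⟩ := IsLocalization.exists_mk'_eq (.powers r) b
  refine ⟨a, k, ?_⟩
  rw [← map_pow, ← h]
  exact IsLocalization.mk'_spec _ _ _

open MvPolynomial in
/-- Every closed point of a smooth complex scheme has an affine neighbourhood with étale coordinates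
that generate the ideal of the point. -/
lemma exists_etale_coordinates {X : Scheme.{0}} (sX : X ⟶ SpecC) (n : ℕ)
    [SmoothOfRelativeDimension n sX] {x : X} (hx : IsClosed {x}) {O : X.Opens} (hxO : x ∈ O) :
    ∃ (V : X.Opens) (_ : IsAffineOpen V), x ∈ V ∧ V ≤ O ∧
      ∃ g : MvPolynomial (Fin n) ℂ →+* Γ(X, V), g.Etale ∧ g.comp C = const sX V ∧
        ∀ s : Γ(X, V), x ∉ X.basicOpen s ↔ s ∈ Ideal.span (Set.range fun i ↦ g (MvPolynomial.X i)) := by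
  obtain ⟨U₀, hU₀, V₁, hV₁, hxV₁, e, hst⟩ :=
    SmoothOfRelativeDimension.exists_isStandardSmoothOfRelativeDimension (n := n) (f := sX) x
  obtain rfl : U₀ = ⊤ := by
    rw [← top_le_iff]
    intro z _
    rw [Subsingleton.elim z (sX x)]
    exact e hxV₁
  obtain ⟨f, hfO, hxf⟩ := hV₁.exists_basicOpen_le ⟨x, hxO⟩ hxV₁
  obtain ⟨g₀, hg₀, hg₀e⟩ := hst.exists_etale_mvPolynomial
  let ε : ℂ ≃+* Γ(SpecC, ⊤) := (Scheme.ΓSpecIso (CommRingCat.of ℂ)).symm.commRingCatIsoToRingEquiv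
  algebraize [const sX V₁]
  let g₁ : MvPolynomial (Fin n) ℂ →ₐ[ℂ] Γ(X, V₁) :=
    { g₀.comp (MvPolynomial.mapEquiv _ ε).toRingHom with
      commutes' := fun c ↦ by
        have : MvPolynomial.map (ε : ℂ →+* Γ(SpecC, ⊤)) (C c : MvPolynomial (Fin n) ℂ) = C (ε c) :=
          MvPolynomial.map_C _ _
        change g₀ (MvPolynomial.map (ε : ℂ →+* Γ(SpecC, ⊤)) (C c : MvPolynomial (Fin n) ℂ)) = _
        rw [this, ← RingHom.comp_apply, hg₀]
        rfl }
  have hg₁ : g₁.Etale :=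
    RingHom.Etale.stableUnderComposition _ _ (.of_bijective (MvPolynomial.mapEquiv _ ε).bijective)
      hg₀e
  have hm := hV₁.primeIdealOf_isMaximal_of_isClosed ⟨x, hxV₁⟩ hx
  obtain ⟨g, hg, hgX, s, hs, hsm⟩ := exists_etale_coordinates_algebra g₁ hg₁
    (hV₁.primeIdealOf ⟨x, hxV₁⟩).asIdeal
  set ρ := (X.presheaf.map (homOfLE (X.basicOpen_le (s * f))).op).hom with hρ
  have hbas (a : Γ(X, V₁)) : x ∉ X.basicOpen a ↔ a ∈ (hV₁.primeIdealOf ⟨x, hxV₁⟩).asIdeal := by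
    rw [mem_basicOpen_iff_notMem_primeIdealOf hV₁ _ hxV₁, not_not]
  have hxs : x ∈ X.basicOpen s := by
    by_contra h
    exact hs ((hbas s).mp h)
  have hxV : x ∈ X.basicOpen (s * f) := by
    rw [X.basicOpen_mul]
    exact ⟨hxs, hxf⟩
  have hres (a : Γ(X, V₁)) : x ∈ X.basicOpen (ρ a) ↔ x ∈ X.basicOpen a := by
    rw [hρ, X.basicOpen_res]
    exact ⟨fun h ↦ h.2, fun h ↦ ⟨hxV, h⟩⟩
  have hunit : IsUnit (ρ (s * f)) := RingedSpace.isUnit_res_basicOpen _ _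
  refine ⟨X.basicOpen (s * f), hV₁.basicOpen _, hxV, ?_, ρ.comp g.toRingHom, ?_, ?_, ?_⟩
  · rw [X.basicOpen_mul]
    exact inf_le_right.trans hfO
  · exact RingHom.Etale.stableUnderComposition _ _ hg (etale_map_basicOpen hV₁ _)
  · ext c
    refine (congrArg ρ (g.commutes c)).trans ?_
    exact map_const _ c
  · intro b
    obtain ⟨a, k, hab⟩ := exists_pow_mul_eq_map hV₁ (s * f) b
    constructor
    · intro hb
      have ha : a ∈ (hV₁.primeIdealOf ⟨x, hxV₁⟩).asIdeal := by
        rw [← hbas, ← hres, hρ, ← hab, X.basicOpen_mul]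
        exact fun h ↦ hb h.1
      have h1 : ρ (s * a) ∈ Ideal.span (Set.range fun i ↦ (ρ.comp g.toRingHom) (MvPolynomial.X i)) := by
        have := Ideal.mem_map_of_mem ρ (hsm a ha)
        rw [Ideal.map_span, ← Set.range_comp] at this
        exact this
      have h2 : ρ (s * a) * ρ f = b * ρ (s * f) ^ (k + 1) := by
        rw [pow_succ, ← mul_assoc, hab, map_mul, map_mul]
        ring
      have h3 := Ideal.mul_mem_right (ρ f) _ h1
      rw [h2] at h3
      exact (Ideal.mul_unit_mem_iff_mem _ (hunit.pow _)).mp h3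
    · intro hb hxb
      rw [mem_basicOpen_iff_notMem_primeIdealOf (hV₁.basicOpen _) _ hxV] at hxb
      refine hxb ((Ideal.span_le.mpr ?_) hb)
      rintro _ ⟨i, rfl⟩
      by_contra h
      rw [SetLike.mem_coe, ← mem_basicOpen_iff_notMem_primeIdealOf (hV₁.basicOpen _) _ hxV] at h
      exact ((hbas _).mpr (hgX i)) ((hres _).mp h)

end TreeSurfaces

namespace TreeSurfaces

open Scheme

/-! ### Restriction of sections and constants -/

/-- Restriction of sections of the structure sheaf. -/
noncomputable abbrev res {X : Scheme.{0}} {U V : X.Opens} (h : V ≤ U) : Γ(X, U) →+* Γ(X, V) :=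
  (X.presheaf.map (homOfLE h).op).hom

lemma res_res {X : Scheme.{0}} {U V W : X.Opens} (h : V ≤ U) (h' : W ≤ V) (s : Γ(X, U)) :
    res h' (res h s) = res (h'.trans h) s := by
  rw [← RingHom.comp_apply, ← CommRingCat.hom_comp, ← Functor.map_comp]
  rfl

lemma mem_basicOpen_res {X : Scheme.{0}} {U V : X.Opens} (h : V ≤ U) (s : Γ(X, U)) {x : X}
    (hx : x ∈ V) : x ∈ X.basicOpen (res h s) ↔ x ∈ X.basicOpen s := by
  rw [Scheme.basicOpen_res]
  exact ⟨fun h ↦ h.2, fun h ↦ ⟨hx, h⟩⟩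

lemma eq_const_of_comp_eq {X : Scheme.{0}} {sX : X ⟶ SpecC} {U : X.Opens} {κ : ℂ →+* Γ(X, U)}
    (h : U.toSpecΓ ≫ Spec.map (CommRingCat.ofHom κ) = U.ι ≫ sX) : κ = const sX U := by
  have h1 := congr(Scheme.Hom.appTop $h)
  rw [Scheme.Hom.comp_appTop, Scheme.Hom.comp_appTop, Scheme.Opens.toSpecΓ_appTop] at h1
  have h2 : CommRingCat.ofHom κ = (Scheme.ΓSpecIso (CommRingCat.of ℂ)).inv ≫
      (Spec.map (CommRingCat.ofHom κ)).appTop ≫ (Scheme.ΓSpecIso Γ(X, U)).hom :=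
    (Iso.eq_inv_comp _).mpr (Scheme.ΓSpecIso_naturality (CommRingCat.ofHom κ)).symm
  have h3 : (Spec.map (CommRingCat.ofHom κ)).appTop ≫ (Scheme.ΓSpecIso Γ(X, U)).hom =
      sX.appLE ⊤ U le_top := by
    rw [← Category.assoc, Iso.comp_inv_eq, Category.assoc] at h1
    rw [h1, Scheme.Opens.ι_appTop]
    exact congrArg (sX.app ⊤ ≫ ·) (X.presheaf.map_comp (homOfLE _).op
      (eqToHom U.ι_image_top.symm).op).symm
  rw [h3] at h2
  ext c
  exact congr(($h2).hom c)

/-! ### Affine charts of the projective plane adapted to a line -/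

section Plane

open MvPolynomial HomogeneousLocalization

attribute [local instance] MvPolynomial.gradedAlgebra

/-- The grading of the homogeneous coordinate ring of the projective plane. -/
abbrev planeGrading : ℕ → Submodule ℂ (MvPolynomial (Fin 3) ℂ) :=
  MvPolynomial.homogeneousSubmodule (Fin 3) ℂ

lemma X_mem_planeGrading (i : Fin 3) : (X i : MvPolynomial (Fin 3) ℂ) ∈ planeGrading 1 :=
  isHomogeneous_X ℂ i

/-- The constants in the degree zero part of a homogeneous localization. -/
noncomputable def awayConst (i : Fin 3) : ℂ →+* Away planeGrading (X i) :=
  (fromZeroRingHom planeGrading _).comp (algebraMap ℂ (planeGrading 0))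

/-- The localization map of the homogeneous coordinate ring at `X i`. -/
noncomputable abbrev toLoc (i : Fin 3) : MvPolynomial (Fin 3) ℂ →+*
    Localization.Away (X i : MvPolynomial (Fin 3) ℂ) := algebraMap _ _

lemma val_awayConst (i : Fin 3) (c : ℂ) :
    (awayConst i c).val = toLoc i (C c) := by
  rfl

/-- The quotient `f / X i` for a linear form `f`. -/
noncomputable def linearQuot (i : Fin 3) (f : MvPolynomial (Fin 3) ℂ) (hf : f.IsHomogeneous 1) :
    Away planeGrading (X i) :=
  Away.mk planeGrading (X_mem_planeGrading i) 1 f (by simpa using hf)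

lemma linearQuot_val_mul (i : Fin 3) (f : MvPolynomial (Fin 3) ℂ) (hf : f.IsHomogeneous 1) :
    (linearQuot i f hf).val * toLoc i (X i)
      = toLoc i f := by
  rw [linearQuot, Away.val_mk, Localization.mk_eq_mk']
  simp

lemma isUnit_away (i : Fin 3) :
    IsUnit (toLoc i (X i)) :=
  IsLocalization.Away.algebraMap_isUnit _

lemma linearQuot_self (i : Fin 3) : linearQuot i (X i) (isHomogeneous_X ℂ i) = 1 := by
  apply val_injective
  apply (isUnit_away i).mul_right_cancel
  rw [linearQuot_val_mul, val_one, one_mul]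

lemma eval₂_linearQuot_val (i : Fin 3) (n : ℕ) (f : MvPolynomial (Fin 3) ℂ) (hf : f.IsHomogeneous n) :
    (eval₂ (awayConst i) (fun m ↦ linearQuot i (X m) (isHomogeneous_X ℂ m)) f).val *
      toLoc i (X i) ^ n =
      toLoc i f := by
  have key : ∀ d : Fin 3 →₀ ℕ, (∏ m, (linearQuot i (X m) (isHomogeneous_X ℂ m)) ^ d m).val *
      toLoc i (X i) ^ d.degree =
      toLoc i (∏ m, X m ^ d m) := by
    intro d
    have h : ∀ m, ((linearQuot i (X m) (isHomogeneous_X ℂ m)) ^ d m).val *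
      toLoc i (X i) ^ d m =
      toLoc i (X m ^ d m) := by
      intro m
      rw [val_pow, ← mul_pow, linearQuot_val_mul, map_pow]
    rw [Finsupp.degree_eq_sum, Fin.sum_univ_three, Fin.prod_univ_three, Fin.prod_univ_three,
      map_mul, map_mul, ← h 0, ← h 1, ← h 2, val_mul, val_mul]
    ring
  have hv : ∀ a : Away planeGrading (X i : MvPolynomial (Fin 3) ℂ), a.val =
    algebraMap (Away planeGrading (X i : MvPolynomial (Fin 3) ℂ))
      (Localization (Submonoid.powers (X i : MvPolynomial (Fin 3) ℂ))) a := fun a ↦ rfl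
  rw [eval₂_eq', hv, map_sum, Finset.sum_mul]
  conv_rhs => rw [f.as_sum, map_sum]
  refine Finset.sum_congr rfl fun d hd ↦ ?_
  have hdeg : d.degree = n := by
    by_contra h
    exact (mem_support_iff.mp hd) (hf.coeff_eq_zero h)
  rw [map_mul, ← hv, ← hv, mul_assoc, ← hdeg, key, val_awayConst, ← map_mul, monomial_eq,
    Finsupp.prod_pow]

/-- Coordinates on the chart `X i ≠ 0` of the plane: the quotients by `X i` of a linear form
and of `X j`. -/
noncomputable def chartHom (i j : Fin 3) (l : MvPolynomial (Fin 3) ℂ) (hl : l.IsHomogeneous 1) :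
    MvPolynomial (Fin 2) ℂ →+* Away planeGrading (X i) :=
  eval₂Hom (awayConst i) ![linearQuot i l hl, linearQuot i (X j) (isHomogeneous_X ℂ j)]

lemma exists_linear (l : MvPolynomial (Fin 3) ℂ) (hl : l.IsHomogeneous 1) :
    ∃ c : Fin 3 → ℂ, l = ∑ m, C (c m) * X m := by
  have h : l ∈ Submodule.span ℂ (Set.range (X : Fin 3 → MvPolynomial (Fin 3) ℂ)) := by
    rw [← homogeneousSubmodule_one_eq_span_X]; exact hl
  obtain ⟨c, hc⟩ := (Submodule.mem_span_range_iff_exists_fun ℂ).mp h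
  exact ⟨c, by simp [← hc, MvPolynomial.smul_eq_C_mul]⟩

lemma chartHom_bijective {i j k : Fin 3} (hij : i ≠ j) (hik : i ≠ k) (hjk : j ≠ k)
    (l : MvPolynomial (Fin 3) ℂ) (hl : l.IsHomogeneous 1) (c : Fin 3 → ℂ)
    (hc : l = ∑ m, C (c m) * X m) (hk : c k ≠ 0) :
    Function.Bijective (chartHom i j l hl) := by
  have huniv : (Finset.univ : Finset (Fin 3)) = {i, j, k} := by
    symm
    rw [← Finset.card_eq_iff_eq_univ]
    simp [hij, hik, hjk]
  have hlin : l = C (c i) * X i + C (c j) * X j + C (c k) * X k := by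
    rw [hc, huniv, Finset.sum_insert (by simp [hij, hik]), Finset.sum_pair hjk, add_assoc]
  have hq : linearQuot i l hl = awayConst i (c i) +
      awayConst i (c j) * linearQuot i (X j) (isHomogeneous_X ℂ j) +
      awayConst i (c k) * linearQuot i (X k) (isHomogeneous_X ℂ k) := by
    apply val_injective
    apply (isUnit_away i).mul_right_cancel
    rw [linearQuot_val_mul, val_add, val_add, val_mul, val_mul, add_mul, add_mul, mul_assoc,
      mul_assoc, linearQuot_val_mul, linearQuot_val_mul, val_awayConst, val_awayConst,
      val_awayConst, ← map_mul, ← map_mul, ← map_mul, ← map_add, ← map_add, ← hlin]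
  constructor
  · -- dehomogenization is a left inverse
    let ev : MvPolynomial (Fin 3) ℂ →+* MvPolynomial (Fin 2) ℂ := eval₂Hom C fun m ↦
      if m = i then 1 else if m = j then X 1 else C (c k)⁻¹ * (X 0 - C (c i) - C (c j) * X 1)
    have evi : ev (X i) = 1 := by simp [ev]
    have evj : ev (X j) = X 1 := by simp [ev, hij.symm]
    have evk : ev (X k) = C (c k)⁻¹ * (X 0 - C (c i) - C (c j) * X 1) := by
      simp [ev, hik.symm, hjk.symm]
    have evC : ∀ r, ev (C r) = C r := fun r ↦ by simp [ev]
    let Φ : Localization.Away (X i : MvPolynomial (Fin 3) ℂ) →+* MvPolynomial (Fin 2) ℂ :=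
      IsLocalization.Away.lift (X i : MvPolynomial (Fin 3) ℂ) (g := ev) (by rw [evi]; exact isUnit_one)
    have hΦ : ∀ f, Φ (toLoc i f) = ev f := fun f ↦ IsLocalization.Away.lift_eq _ _ f
    have hΦq : ∀ f hf, Φ (linearQuot i f hf).val = ev f := by
      intro f hf
      have := congrArg Φ (linearQuot_val_mul i f hf)
      rwa [map_mul, hΦ, hΦ, evi, mul_one] at this
    let v : Away planeGrading (X i : MvPolynomial (Fin 3) ℂ) →+*
      Localization (Submonoid.powers (X i : MvPolynomial (Fin 3) ℂ)) := algebraMap _ _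
    have hv : ∀ a, v a = a.val := fun a ↦ rfl
    have hid : (Φ.comp v).comp (chartHom i j l hl) = RingHom.id _ := by
      apply MvPolynomial.ringHom_ext
      · intro r
        simp only [RingHom.comp_apply, chartHom, coe_eval₂Hom, eval₂_C, hv, val_awayConst]
        rw [hΦ, evC]; rfl
      · intro m
        fin_cases m
        · simp only [RingHom.comp_apply, chartHom, coe_eval₂Hom, eval₂_X, hv]
          refine (hΦq l hl).trans ?_
          rw [hlin, map_add, map_add, map_mul, map_mul, map_mul, evi, evj, evk, evC, evC, evC]
          have : (C (c k) : MvPolynomial (Fin 2) ℂ) * C (c k)⁻¹ = 1 := by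
            rw [← C_mul, mul_inv_cancel₀ hk, C_1]
          rw [← mul_assoc, this]
          simp
        · simp only [RingHom.comp_apply, chartHom, coe_eval₂Hom, eval₂_X, hv]
          exact (hΦq _ (isHomogeneous_X ℂ j)).trans evj
    intro a b hab
    have := congrArg (Φ.comp v) hab
    rw [← RingHom.comp_apply, ← RingHom.comp_apply (Φ.comp v), hid] at this
    exact this
  · intro z
    obtain ⟨n, f, hf, rfl⟩ := Away.mk_surjective planeGrading (X_mem_planeGrading i) z
    have hf' : f.IsHomogeneous n := by simpa using hf
    have hz : Away.mk planeGrading (X_mem_planeGrading i) n f hf =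
        eval₂ (awayConst i) (fun m ↦ linearQuot i (X m) (isHomogeneous_X ℂ m)) f := by
      apply val_injective
      apply ((isUnit_away i).pow n).mul_right_cancel
      rw [eval₂_linearQuot_val i n f hf', Away.val_mk, Localization.mk_eq_mk']
      simpa using IsLocalization.mk'_spec (Localization.Away (X i : MvPolynomial (Fin 3) ℂ)) f
        (⟨X i ^ n, by use n⟩ : Submonoid.powers (X i : MvPolynomial (Fin 3) ℂ))
    rw [hz]
    have hcst : ∀ r, chartHom i j l hl (C r) = awayConst i r := fun r ↦ by simp [chartHom]
    have h0 : chartHom i j l hl (X 0) = linearQuot i l hl := by simp [chartHom]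
    have h1 : chartHom i j l hl (X 1) = linearQuot i (X j) (isHomogeneous_X ℂ j) := by
      simp [chartHom]
    have hmem : ∀ m, linearQuot i (X m) (isHomogeneous_X ℂ m) ∈ (chartHom i j l hl).range := by
      intro m
      have : m = i ∨ m = j ∨ m = k := by
        have := Finset.mem_univ m
        rw [huniv] at this
        simpa using this
      rcases this with rfl | rfl | rfl
      · rw [linearQuot_self]; exact one_mem _
      · exact ⟨X 1, h1⟩
      · refine ⟨C (c m)⁻¹ * (X 0 - C (c i) - C (c j) * X 1), ?_⟩
        rw [map_mul, map_sub, map_sub, map_mul, hcst, hcst, hcst, h0, h1, hq]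
        have : awayConst i (c m)⁻¹ * awayConst i (c m) = 1 := by
          rw [← map_mul, inv_mul_cancel₀ hk, map_one]
        linear_combination (linearQuot i (X m) (isHomogeneous_X ℂ m)) * this
    have : eval₂ (awayConst i) (fun m ↦ linearQuot i (X m) (isHomogeneous_X ℂ m)) f ∈
        (chartHom i j l hl).range := by
      rw [eval₂_eq']
      exact sum_mem fun d _ ↦ mul_mem ⟨C _, hcst _⟩ (prod_mem fun m _ ↦ pow_mem (hmem m) _)
    exact this

/-- A homogeneous fraction as a function on the chart `X i ≠ 0`. -/
noncomputable def planeSection (i : Fin 3) :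
    Away planeGrading (X i) →+* Γ(Proj planeGrading, Proj.basicOpen planeGrading (X i)) :=
  (Proj.awayToSection planeGrading (X i)).hom

lemma planeSection_bijective (i : Fin 3) : Function.Bijective (planeSection i) := by
  have := Proj.basicOpenIsoAway_hom planeGrading (X i) (X_mem_planeGrading i) one_pos
  have h2 : IsIso (Proj.awayToSection planeGrading (X i : MvPolynomial (Fin 3) ℂ)) := by
    rw [← this]; infer_instance
  exact ConcreteCategory.bijective_of_isIso _

lemma planeSection_awayConst (i : Fin 3) : (planeSection i).comp (awayConst i) =
    const (X := Proj planeGrading) (PSpace.toC 2) (Proj.basicOpen planeGrading (X i)) := by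
  apply eq_const_of_comp_eq
  have h1 := Proj.awayι_toSpecZero planeGrading (X i) (X_mem_planeGrading i) one_pos
  rw [← Proj.basicOpenIsoSpec_inv_ι, Category.assoc, Iso.inv_comp_eq,
    Proj.basicOpenIsoSpec_hom, Proj.basicOpenToSpec, Category.assoc, ← Spec.map_comp] at h1
  have h2 := congr($h1 ≫ Spec.map (CommRingCat.ofHom
      (algebraMap ℂ (MvPolynomial.homogeneousSubmodule (Fin (2 + 1)) ℂ 0))))
  rw [Category.assoc, Category.assoc, ← Spec.map_comp] at h2
  exact h2.symm

lemma mem_basicOpen_planeSection (i : Fin 3) (f : MvPolynomial (Fin 3) ℂ)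
    (hf : f.IsHomogeneous 1) (x : Proj planeGrading) (hx : x ∈ Proj.basicOpen planeGrading (X i)) :
    x ∈ (Proj planeGrading).basicOpen (planeSection i (linearQuot i f hf)) ↔
      x ∈ Proj.basicOpen planeGrading f := by
  let U := Proj.basicOpen planeGrading (X i : MvPolynomial (Fin 3) ℂ)
  have h1 := Scheme.Opens.toSpecΓ_preimage_basicOpen U (planeSection i (linearQuot i f hf))
  have h2 := Proj.awayι_preimage_basicOpen planeGrading (X_mem_planeGrading i) one_pos
    (g_deg := hf) one_pos
  have h3 : Away.isLocalizationElem (X_mem_planeGrading i) hf = linearQuot i f hf := by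
    apply val_injective
    simp [linearQuot]
  rw [h3] at h2
  have h4 : U.ι = Proj.basicOpenToSpec planeGrading (X i) ≫
      Proj.awayι planeGrading (X i) (X_mem_planeGrading i) one_pos := by
    rw [← Proj.basicOpenIsoSpec_inv_ι, ← Proj.basicOpenIsoSpec_hom planeGrading (X i)
      (X_mem_planeGrading i) one_pos, Iso.hom_inv_id_assoc]
  let x' : U := ⟨x, hx⟩
  have h5 : x' ∈ U.toSpecΓ ⁻¹ᵁ PrimeSpectrum.basicOpen (planeSection i (linearQuot i f hf)) ↔
    x' ∈ U.ι ⁻¹ᵁ (Proj planeGrading).basicOpen (planeSection i (linearQuot i f hf)) := by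
    rw [h1]
  have h6 : x ∈ Proj.basicOpen planeGrading f ↔ x' ∈ U.ι ⁻¹ᵁ Proj.basicOpen planeGrading f := by
    rfl
  refine h5.symm.trans ?_
  rw [h6, h4, Scheme.Hom.comp_preimage, h2]
  rfl

lemma planeSection_res (i j : Fin 3) {W : (Proj planeGrading).Opens}
    (hi : W ≤ Proj.basicOpen planeGrading (X i)) (hj : W ≤ Proj.basicOpen planeGrading (X j))
    (l : MvPolynomial (Fin 3) ℂ) (hl : l.IsHomogeneous 1) :
    res hi (planeSection i (linearQuot i l hl)) =
      res hj (planeSection j (linearQuot j l hl)) *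
      res hi (planeSection i (linearQuot i (X j) (isHomogeneous_X ℂ j))) := by
  let V := Proj.basicOpen planeGrading (X i * X j : MvPolynomial (Fin 3) ℂ)
  have hV : W ≤ V := by
    rw [show V = _ from Proj.basicOpen_mul ..]
    exact le_inf hi hj
  have hVi : V ≤ Proj.basicOpen planeGrading (X i) := Proj.basicOpen_mono _ _ _ ⟨_, rfl⟩
  have hVj : V ≤ Proj.basicOpen planeGrading (X j) := Proj.basicOpen_mono _ _ _ ⟨_, mul_comm _ _⟩
  have ri : ∀ a, res hi (planeSection i a) = res hV ((Proj.awayToSection planeGrading (X i * X j)).hom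
      (awayMap planeGrading (X_mem_planeGrading j) rfl a)) := fun a ↦ by
    rw [← res_res hVi hV]
    exact congr(res hV (($(Proj.awayMap_awayToSection planeGrading (f := X i)
      (X_mem_planeGrading j) rfl)).hom a)).symm
  have rj : ∀ a, res hj (planeSection j a) = res hV ((Proj.awayToSection planeGrading (X i * X j)).hom
      (awayMap planeGrading (X_mem_planeGrading i) (mul_comm _ _) a)) := fun a ↦ by
    rw [← res_res hVj hV]
    exact congr(res hV (($(Proj.awayMap_awayToSection planeGrading (f := X j)
      (X_mem_planeGrading i) (mul_comm (X i) (X j)))).hom a)).symm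
  rw [ri, ri, rj, ← map_mul, ← map_mul]
  congr 2
  apply val_injective
  let Λ := algebraMap (MvPolynomial (Fin 3) ℂ)
    (Localization.Away (X i * X j : MvPolynomial (Fin 3) ℂ))
  have hu : IsUnit (Λ (X i * X j)) := IsLocalization.Away.algebraMap_isUnit _
  have hu' := hu
  rw [map_mul, IsUnit.mul_iff] at hu'
  have ei : ∀ f hf, (awayMap planeGrading (X_mem_planeGrading j) rfl (linearQuot i f hf)).val *
      Λ (X i) = Λ f := by
    intro f hf
    rw [val_awayMap]
    have := congrArg (Localization.awayLift Λ (X i) hu'.1) (linearQuot_val_mul i f hf)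
    rwa [map_mul, toLoc, Localization.awayLift, IsLocalization.Away.lift_eq,
      IsLocalization.Away.lift_eq] at this
  have ej : ∀ f hf, (awayMap planeGrading (X_mem_planeGrading i) (mul_comm (X i) (X j))
      (linearQuot j f hf)).val * Λ (X j) = Λ f := by
    intro f hf
    rw [val_awayMap]
    have := congrArg (Localization.awayLift Λ (X j) hu'.2) (linearQuot_val_mul j f hf)
    rwa [map_mul, toLoc, Localization.awayLift, IsLocalization.Away.lift_eq,
      IsLocalization.Away.lift_eq] at this
  apply hu'.1.mul_right_cancel
  rw [ei, val_mul, mul_assoc, ei, ej]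

lemma planeSection_chart_bijective {i j k : Fin 3} (hij : i ≠ j) (hik : i ≠ k) (hjk : j ≠ k)
    (l : MvPolynomial (Fin 3) ℂ) (hl : l.IsHomogeneous 1) (c : Fin 3 → ℂ)
    (hc : l = ∑ m, C (c m) * X m) (hk : c k ≠ 0) :
    Function.Bijective (eval₂Hom (const (X := Proj planeGrading) (PSpace.toC 2)
      (Proj.basicOpen planeGrading (X i))) ![planeSection i (linearQuot i l hl),
        planeSection i (linearQuot i (X j) (isHomogeneous_X ℂ j))]) := by
  have h := (planeSection_bijective i).comp (chartHom_bijective hij hik hjk l hl c hc hk)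
  rw [← RingHom.coe_comp] at h
  refine (congrArg (Function.Bijective ∘ DFunLike.coe) ?_).mpr h
  apply MvPolynomial.ringHom_ext
  · intro r
    simp only [chartHom, RingHom.comp_apply, coe_eval₂Hom, eval₂_C]
    exact congr($(planeSection_awayConst i) r).symm
  · intro m
    fin_cases m <;> simp [chartHom]

lemma iSup_planeOpen :
    ⨆ i : Fin 3, Proj.basicOpen planeGrading (X i : MvPolynomial (Fin 3) ℂ) = ⊤ := by
  apply Proj.iSup_basicOpen_eq_top' planeGrading _ fun i ↦ ⟨1, X_mem_planeGrading i⟩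
  rw [eq_top_iff]
  intro f _
  induction f using MvPolynomial.induction_on with
  | C r =>
    exact Subalgebra.algebraMap_mem (Algebra.adjoin (planeGrading 0) _)
      (algebraMap ℂ (planeGrading 0) r)
  | add p q hp hq => exact add_mem (hp trivial) (hq trivial)
  | mul_X p i hp => exact mul_mem (hp trivial) (Algebra.subset_adjoin ⟨i, rfl⟩)

lemma exists_proj_charts (f : MvPolynomial (Fin 3) ℂ) (hf : f.IsHomogeneous 1)
    (hf0 : f ≠ 0) :
    ∃ (U : Fin 2 → (Proj planeGrading).Opens) (e s : ∀ i, Γ(Proj planeGrading, U i)),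
      (∀ i, IsAffineOpen (U i)) ∧
      (∀ i, Function.Bijective (eval₂Hom (const (X := Proj planeGrading) (PSpace.toC 2) (U i)) ![e i, s i])) ∧
      (∀ i, ∀ x ∈ U i, f ∈ x.asHomogeneousIdeal ↔ x ∉ (Proj planeGrading).basicOpen (e i)) ∧
      (∀ x : Proj planeGrading, f ∈ x.asHomogeneousIdeal → ∃ i, x ∈ U i) ∧
      (∀ i j, i ≠ j → (Proj planeGrading).basicOpen (s i) = U i ⊓ U j) ∧
      (∀ i j, i ≠ j → ∀ (W : (Proj planeGrading).Opens) (hi : W ≤ U i) (hj : W ≤ U j),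
        res hi (s i) * res hj (s j) = 1 ∧ res hj (e j) = res hj (s j) * res hi (e i)) := by
  obtain ⟨c, hc⟩ := exists_linear f hf
  obtain ⟨k, hk⟩ : ∃ k, c k ≠ 0 := by
    by_contra! h
    exact hf0 (by simp [hc, h])
  obtain ⟨v, hv, hvk⟩ : ∃ v : Fin 2 → Fin 3, (∀ i j, i ≠ j → v i ≠ v j) ∧ ∀ i, v i ≠ k := by
    fin_cases k
    · exact ⟨![1, 2], by decide, by decide⟩
    · exact ⟨![0, 2], by decide, by decide⟩
    · exact ⟨![0, 1], by decide, by decide⟩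
  let w : Fin 2 → Fin 2 := ![1, 0]
  have hw : ∀ i j : Fin 2, i ≠ j → w i = j := by decide
  have hw' : ∀ i : Fin 2, i ≠ w i := by decide
  have hbas : ∀ i, ∀ x ∈ Proj.basicOpen planeGrading (X (v i)),
      ∀ (g : MvPolynomial (Fin 3) ℂ) (hg : g.IsHomogeneous 1),
      x ∈ (Proj planeGrading).basicOpen (planeSection (v i) (linearQuot (v i) g hg)) ↔
      x ∈ Proj.basicOpen planeGrading g := fun i x hx g hg ↦
    mem_basicOpen_planeSection (v i) g hg x hx
  refine ⟨fun i ↦ Proj.basicOpen planeGrading (X (v i)),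
    fun i ↦ planeSection (v i) (linearQuot (v i) f hf),
    fun i ↦ planeSection (v i) (linearQuot (v i) (X (v (w i))) (isHomogeneous_X ℂ _)),
    fun i ↦ Proj.isAffineOpen_basicOpen _ _ (X_mem_planeGrading _) one_pos, fun i ↦ ?_,
    fun i x hx ↦ ?_, fun x hx ↦ ?_, fun i j hij ↦ ?_, fun i j hij W hi hj ↦ ?_⟩
  · exact planeSection_chart_bijective (hv i (w i) (hw' i)) (hvk i) (hvk (w i)) f hf c hc hk
  · refine Iff.trans ?_ (not_congr (hbas i x hx f hf)).symm
    rw [Proj.mem_basicOpen, not_not]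
  · by_contra! h
    have h1 : ∀ i, X (v i) ∈ x.asHomogeneousIdeal := fun i ↦ not_not.mp (h i)
    have h3 : ∀ m : Fin 3, m ≠ k → X m ∈ x.asHomogeneousIdeal := by
      intro m hm
      have : m = v 0 ∨ m = v 1 := by
        have h01 := hv 0 1 (by decide)
        have h0 := hvk 0
        have h1 := hvk 1
        omega
      rcases this with rfl | rfl <;> exact h1 _
    have h4 : C (c k) * X k ∈ x.asHomogeneousIdeal.toIdeal := by
      have : C (c k) * X k = f - ∑ m ∈ Finset.univ.erase k, C (c m) * X m := by
        rw [hc, ← Finset.add_sum_erase _ _ (Finset.mem_univ k)]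
        ring
      rw [this]
      exact sub_mem hx (sum_mem fun m hm ↦ Ideal.mul_mem_left _ _ (h3 m (Finset.ne_of_mem_erase hm)))
    have h5 : X k ∈ x.asHomogeneousIdeal.toIdeal := by
      have := Ideal.mul_mem_left _ (C (c k)⁻¹) h4
      rwa [← mul_assoc, ← C_mul, inv_mul_cancel₀ hk, C_1, one_mul] at this
    have h6 : (x : Proj planeGrading) ∈
        (⨆ i : Fin 3, Proj.basicOpen planeGrading (X i : MvPolynomial (Fin 3) ℂ)) := by
      rw [iSup_planeOpen]; trivial
    obtain ⟨m, hm⟩ := Opens.mem_iSup.mp h6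
    by_cases hmk : m = k
    · subst hmk; exact hm h5
    · exact hm (h3 m hmk)
  · obtain rfl := hw i j hij
    ext x
    constructor
    · intro hx
      have hx1 := (Proj planeGrading).basicOpen_le _ hx
      exact ⟨hx1, (hbas i x hx1 _ _).mp hx⟩
    · rintro ⟨hx1, hx2⟩
      exact (hbas i x hx1 _ _).mpr hx2
  · obtain rfl := hw i j hij
    have hww : w (w i) = i := hw _ _ (hw' i).symm
    have h1 := planeSection_res (v (w i)) (v i) hj hi f hf
    have h2 := planeSection_res (v i) (v (w i)) hi hj (X (v i)) (isHomogeneous_X ℂ _)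
    rw [linearQuot_self, map_one, map_one] at h2
    simp only [hww]
    exact ⟨(mul_comm _ _).trans h2.symm, h1.trans (mul_comm _ _)⟩

/-- Every line of the plane meets two of the standard charts; on each of them there are
coordinates `e, s` such that the line is `e = 0`, with the transition functions of `𝒪(1)`. -/
lemma exists_plane_charts (l : Set (PSpace 2)) (hl : IsLine l) :
    ∃ (U : Fin 2 → (PSpace 2).Opens) (e s : ∀ i, Γ(PSpace 2, U i)),
      (∀ i, IsAffineOpen (U i)) ∧
      (∀ i, Function.Bijective (eval₂Hom (const (PSpace.toC 2) (U i)) ![e i, s i])) ∧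
      (∀ i, ∀ x ∈ U i, x ∈ l ↔ x ∉ (PSpace 2).basicOpen (e i)) ∧
      (∀ x ∈ l, ∃ i, x ∈ U i) ∧
      (∀ i j, i ≠ j → (PSpace 2).basicOpen (s i) = U i ⊓ U j) ∧
      (∀ i j, i ≠ j → ∀ (W : (PSpace 2).Opens) (hi : W ≤ U i) (hj : W ≤ U j),
        res hi (s i) * res hj (s j) = 1 ∧ res hj (e j) = res hj (s j) * res hi (e i)) := by
  obtain ⟨f, hf, hf0, rfl⟩ := hl
  obtain ⟨U, e, s, h1, h2, h3, h4, h5, h6⟩ := exists_proj_charts f hf hf0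
  refine ⟨U, e, s, h1, h2, fun i x hx ↦ Iff.trans ?_ (h3 i x hx), fun x hx ↦ h4 x ?_, h5, h6⟩
  · exact Set.singleton_subset_iff
  · exact Set.singleton_subset_iff.mp hx

lemma isStandardSmoothOfRelativeDimension_mvPolynomial (n : ℕ) :
    Algebra.IsStandardSmoothOfRelativeDimension n ℂ (MvPolynomial (Fin n) ℂ) := by
  have : Algebra.IsStandardSmooth ℂ (MvPolynomial (Fin n) ℂ) :=
    Algebra.IsStandardSmooth.of_basis_kaehlerDifferential
      (KaehlerDifferential.mvPolynomialBasis ℂ (Fin n)) (by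
        rintro _ ⟨i, rfl⟩
        exact ⟨X i, by simp⟩)
  rw [Algebra.IsStandardSmoothOfRelativeDimension.iff_of_isStandardSmooth,
    rank_eq_card_basis (KaehlerDifferential.mvPolynomialBasis ℂ (Fin n))]
  simp

/-- A complex scheme covered by affine spaces is smooth. -/
lemma smoothOfRelativeDimension_of_charts {X : Scheme.{0}} (sX : X ⟶ SpecC) (n : ℕ)
    (h : ∀ x : X, ∃ U : X.Opens, x ∈ U ∧ IsAffineOpen U ∧ ∃ v : Fin n → Γ(X, U),
      Function.Bijective (eval₂Hom (const sX U) v)) : SmoothOfRelativeDimension n sX := by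
  rw [HasRingHomProperty.iff_exists_appLE_locally (P := @SmoothOfRelativeDimension n)
    (RingHom.isStandardSmoothOfRelativeDimension_stableUnderCompositionWithLocalizationAway n).left
    RingHom.isStandardSmoothOfRelativeDimension_respectsIso]
  intro x
  obtain ⟨U, hxU, hU, v, hv⟩ := h x
  refine ⟨⟨⊤, isAffineOpen_top _⟩, ⟨U, hU⟩, hxU, le_top, ?_⟩
  have h1 : (const sX U).IsStandardSmoothOfRelativeDimension n := by
    have h2 : (C : ℂ →+* MvPolynomial (Fin n) ℂ).IsStandardSmoothOfRelativeDimension n := by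
      have := isStandardSmoothOfRelativeDimension_mvPolynomial n
      rw [← RingHom.isStandardSmoothOfRelativeDimension_algebraMap] at this
      exact this
    have h3 : const sX U = (RingEquiv.ofBijective _ hv).toRingHom.comp C := by
      ext c; simp
    rw [h3]
    exact RingHom.isStandardSmoothOfRelativeDimension_respectsIso.1 _ _ h2
  have h4 : (sX.appLE ⊤ U le_top).hom = (const sX U).comp
      (Scheme.ΓSpecIso (CommRingCat.of ℂ)).commRingCatIsoToRingEquiv.toRingHom := by
    ext c
    simp only [const, RingHom.comp_apply]
    congr 1
    exact congr(($((Scheme.ΓSpecIso (CommRingCat.of ℂ)).hom_inv_id)).hom c).symm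
  change RingHom.IsStandardSmoothOfRelativeDimension n (sX.appLE ⊤ U le_top).hom
  rw [h4]
  exact RingHom.isStandardSmoothOfRelativeDimension_respectsIso.2 _ _ h1

lemma smoothOfRelativeDimension_plane : SmoothOfRelativeDimension 2 (PSpace.toC 2) := by
  apply smoothOfRelativeDimension_of_charts
  intro x
  have h : x ∈ (⨆ i : Fin 3, Proj.basicOpen planeGrading (X i : MvPolynomial (Fin 3) ℂ)) := by
    rw [iSup_planeOpen]; trivial
  obtain ⟨k, hk⟩ := Opens.mem_iSup.mp h
  obtain ⟨i, j, hij, hik, hjk⟩ : ∃ i j : Fin 3, k ≠ i ∧ k ≠ j ∧ i ≠ j := by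
    fin_cases k
    · exact ⟨1, 2, by decide, by decide, by decide⟩
    · exact ⟨0, 2, by decide, by decide, by decide⟩
    · exact ⟨0, 1, by decide, by decide, by decide⟩
  exact ⟨Proj.basicOpen planeGrading (X k), hk,
    Proj.isAffineOpen_basicOpen _ _ (X_mem_planeGrading _) one_pos, _,
    planeSection_chart_bijective hij hik hjk (X j) (isHomogeneous_X ℂ j)
      (fun m ↦ if m = j then 1 else 0) (by simp) (by simp)⟩

instance irreducibleSpace_plane : IrreducibleSpace (PSpace 2) := by
  have h0 : (⊥ : Ideal (MvPolynomial (Fin 3) ℂ)).IsPrime := Ideal.isPrime_bot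
  let η : ProjectiveSpectrum planeGrading := ⟨⊥, h0, fun h ↦ by
    have : (X 0 : MvPolynomial (Fin 3) ℂ) ∈ (HomogeneousIdeal.irrelevant planeGrading) := by
      rw [HomogeneousIdeal.mem_irrelevant_iff, GradedRing.proj_apply,
        DirectSum.decompose_of_mem_ne planeGrading (X_mem_planeGrading 0) one_ne_zero]
    exact X_ne_zero 0 (h this)⟩
  have h1 : closure ({η} : Set (ProjectiveSpectrum planeGrading)) = Set.univ := by
    refine Set.eq_univ_of_forall fun x ↦ ?_
    rw [← ProjectiveSpectrum.le_iff_mem_closure]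
    exact bot_le (α := HomogeneousIdeal planeGrading)
  have h2 : IsIrreducible (Set.univ : Set (ProjectiveSpectrum planeGrading)) :=
    h1 ▸ isIrreducible_singleton.closure
  exact (irreducibleSpace_def _).mpr h2
end Plane

end TreeSurfaces

namespace TreeSurfaces
open Scheme

/-! ### The affine charts of the blowup of a point -/

section ChartAlgebra

open MvPolynomial TensorProduct

/-- The affine chart `v = u * T` of the blowup of the plane. -/
noncomputable def chartMap : MvPolynomial (Fin 2) ℂ →ₐ[ℂ] MvPolynomial Bool ℂ :=
  aeval ![X false, X false * X true]

/-- The chart `v = u * T` of the blowup of a surface with étale coordinates `u, v`: the algebra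
`A[T] / (u T - v)`, its universal property, and the fact that modulo `u` it is the polynomial ring
in `T`. -/
lemma exists_chart_algebra {A : Type} [CommRing A] (g : MvPolynomial (Fin 2) ℂ →+* A)
    (hg : g.Etale) (hres : ∀ a, ∃ c : ℂ, a - g (C c) ∈ Ideal.span {g (X 0), g (X 1)})
    (hne : Ideal.span {g (X 0), g (X 1)} ≠ ⊤) :
    ∃ (A' : Type) (_ : CommRing A') (ρ : A →+* A') (T : A'),
      ρ (g (X 1)) = ρ (g (X 0)) * T ∧ ρ (g (X 0)) ∈ nonZeroDivisors A' ∧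
      (∀ (R : Type) [CommRing R] (φ : A →+* R) (t : R), φ (g (X 1)) = φ (g (X 0)) * t →
        ∃ χ : A' →+* R, χ.comp ρ = φ ∧ χ T = t) ∧
      (∀ (R : Type) [CommRing R] (χ χ' : A' →+* R), χ.comp ρ = χ'.comp ρ → χ T = χ' T → χ = χ') ∧
      (∀ z, ∃ q : Polynomial ℂ, z - q.eval₂ (ρ.comp (g.comp C)) T ∈ Ideal.span {ρ (g (X 0))}) ∧
      (∀ q : Polynomial ℂ, q.eval₂ (ρ.comp (g.comp C)) T ∈ Ideal.span {ρ (g (X 0))} → q = 0) := by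
  let R := MvPolynomial (Fin 2) ℂ
  let S := MvPolynomial Bool ℂ
  algebraize [g]
  let : Algebra R S := chartMap.toRingHom.toAlgebra
  have hS : ∀ p : R, algebraMap R S p = chartMap p := fun p ↦ rfl
  let ρ : A →+* S ⊗[R] A := (Algebra.TensorProduct.includeRight : A →ₐ[R] S ⊗[R] A).toRingHom
  let κ : S →+* S ⊗[R] A := Algebra.TensorProduct.includeLeftRingHom
  have hρκ : ∀ p : R, ρ (g p) = κ (chartMap p) := fun p ↦ by
    exact (Algebra.TensorProduct.includeRight : A →ₐ[R] S ⊗[R] A).commutes p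
  have hu : ρ (g (X 0)) = κ (X false) := by rw [hρκ]; simp [chartMap]
  have hv : ρ (g (X 1)) = κ (X false) * κ (X true) := by rw [hρκ, ← map_mul]; simp [chartMap]
  have hC : ∀ c, ρ (g (C c)) = κ (C c) := fun c ↦ by rw [hρκ]; simp [chartMap]
  have hind : ∀ {p : S ⊗[R] A → Prop}, (∀ x y, p x → p y → p (x + y)) →
      (∀ a s, p (ρ a * κ s)) → ∀ z, p z := by
    intro p h1 h2 z
    induction z with
    | zero => simpa using h2 0 0
    | add x y hx hy => exact h1 x y hx hy
    | tmul s a => simpa [ρ, κ] using h2 a s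
  have hmod : ∀ s : S, ∃ q : Polynomial ℂ, κ s - q.eval₂ (ρ.comp (g.comp C)) (κ (X true)) ∈
      Ideal.span {ρ (g (X 0))} := by
    intro s
    induction s using MvPolynomial.induction_on with
    | C c => exact ⟨Polynomial.C c, by simp [hC]⟩
    | add p q hp hq =>
      obtain ⟨a, ha⟩ := hp
      obtain ⟨b, hb⟩ := hq
      refine ⟨a + b, ?_⟩
      rw [map_add, Polynomial.eval₂_add, add_sub_add_comm]
      exact add_mem ha hb
    | mul_X p i hp =>
      obtain ⟨a, ha⟩ := hp
      cases i
      · refine ⟨0, ?_⟩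
        simp only [ map_mul, Polynomial.eval₂_zero, sub_zero, ← hu]
        exact Ideal.mul_mem_left _ _ (Ideal.mem_span_singleton_self _)
      · refine ⟨a * Polynomial.X, ?_⟩
        simp only [map_mul, Polynomial.eval₂_mul_X, ← sub_mul]
        exact Ideal.mul_mem_right _ _ ha
  have hspan : (Ideal.span {g (X 0), g (X 1)}).map ρ ≤ Ideal.span {ρ (g (X 0))} := by
    rw [Ideal.map_span, Ideal.span_le, Set.image_pair]
    rintro z (rfl | rfl)
    · exact Ideal.mem_span_singleton_self _
    · rw [hv, ← hu]; exact Ideal.mul_mem_right _ _ (Ideal.mem_span_singleton_self _)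
  refine ⟨S ⊗[R] A, inferInstance, ρ, κ (X true), by rw [hv, hu], ?_, ?_, ?_, ?_, ?_⟩
  · rw [hu, mem_nonZeroDivisors_iff_left]
    intro z hz
    have h1 := regular_mod_flat (R := S) (E := S ⊗[R] A) (x := X false) (K := ⊥) (fun a ha ↦ by
      simpa using (mul_eq_zero.mp (Ideal.mem_bot.mp ha)).resolve_left (X_ne_zero _)) z
      (by rw [Ideal.map_bot]; exact hz)
    simpa using h1
  · intro R' _ φ t ht
    let ψ : S →+* R' := eval₂Hom (φ.comp (g.comp C)) fun b ↦ cond b t (φ (g (X 0)))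
    let : Algebra R R' := (φ.comp g).toAlgebra
    have hψC : ∀ r, ψ (C r) = φ (g (C r)) := fun r ↦ eval₂_C _ _ _
    have hψX : ∀ b, ψ (X b) = cond b t (φ (g (X 0))) := fun b ↦ eval₂_X _ _ _
    have h1 : ψ.comp chartMap.toRingHom = φ.comp g := by
      apply MvPolynomial.ringHom_ext
      · intro r; simp [chartMap, hψC]
      · intro i; fin_cases i <;> simp [chartMap, hψX, ht]
    let φ' : A →ₐ[R] R' := ⟨φ, fun r ↦ rfl⟩
    let ψ' : S →ₐ[R] R' := ⟨ψ, fun r ↦ congr($h1 r)⟩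
    refine ⟨(Algebra.TensorProduct.lift ψ' φ' fun _ _ ↦ Commute.all _ _).toRingHom, ?_, ?_⟩
    · ext a; simp [ρ, φ']
    · simp [κ, ψ', hψX]
  · intro R' _ χ χ' h1 h2
    refine RingHom.ext fun z ↦ ?_
    have h3 : χ.comp κ = χ'.comp κ := by
      apply MvPolynomial.ringHom_ext
      · intro c
        simp only [RingHom.comp_apply, ← hC]
        exact congr($h1 (g (C c)))
      · intro i; cases i
        · simp only [RingHom.comp_apply, ← hu]
          exact congr($h1 (g (X 0)))
        · exact h2
    refine hind (p := fun z ↦ χ z = χ' z) (fun x y hx hy ↦ by rw [map_add, map_add, hx, hy])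
      (fun a s ↦ ?_) z
    rw [map_mul, map_mul]
    exact congr($(congr($h1 a)) * $(congr($h3 s)))
  · intro z
    refine hind (p := fun z ↦ ∃ q : Polynomial ℂ, z - q.eval₂ (ρ.comp (g.comp C)) (κ (X true)) ∈
      Ideal.span {ρ (g (X 0))}) ?_ ?_ z
    · rintro x y ⟨a, ha⟩ ⟨b, hb⟩
      refine ⟨a + b, ?_⟩
      rw [Polynomial.eval₂_add, add_sub_add_comm]
      exact add_mem ha hb
    · intro a s
      obtain ⟨c, hc⟩ := hres a
      obtain ⟨q, hq⟩ := hmod s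
      refine ⟨Polynomial.C c * q, ?_⟩
      have h1 := hspan (Ideal.mem_map_of_mem ρ hc)
      rw [map_sub] at h1
      have h2 : ρ a * κ s - Polynomial.eval₂ (ρ.comp (g.comp C)) (κ (X true)) (Polynomial.C c * q) =
        (ρ a - ρ (g (C c))) * κ s +
        ρ (g (C c)) * (κ s - Polynomial.eval₂ (ρ.comp (g.comp C)) (κ (X true)) q) := by
        rw [Polynomial.eval₂_mul, Polynomial.eval₂_C]
        simp only [RingHom.comp_apply]
        ring
      rw [h2]
      exact add_mem (Ideal.mul_mem_right _ _ h1) (Ideal.mul_mem_left _ _ hq)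
  · intro q hq
    let m := Ideal.span {g (X 0), g (X 1)}
    let θ : ℂ →+* A ⧸ m := (Ideal.Quotient.mk m).comp (g.comp C)
    have : Nontrivial (A ⧸ m) := Ideal.Quotient.nontrivial_iff.mpr hne
    have hθ : Function.Bijective θ := by
      refine ⟨θ.injective, fun z ↦ ?_⟩
      obtain ⟨a, rfl⟩ := Ideal.Quotient.mk_surjective z
      obtain ⟨c, hc⟩ := hres a
      exact ⟨c, ((Ideal.Quotient.mk_eq_mk_iff_sub_mem _ _).mpr hc).symm⟩
    let θ' := (RingEquiv.ofBijective θ hθ).symm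
    let φ : A →+* Polynomial ℂ := Polynomial.C.comp (θ'.toRingHom.comp (Ideal.Quotient.mk m))
    have hφC : ∀ c, φ (g (C c)) = Polynomial.C c := by
      intro c
      simp only [φ, RingHom.comp_apply]
      congr 1
      exact (RingEquiv.ofBijective θ hθ).symm_apply_apply c
    have hφm : ∀ a ∈ m, φ a = 0 := by
      intro a ha
      simp only [φ, RingHom.comp_apply, Ideal.Quotient.eq_zero_iff_mem.mpr ha, map_zero]
    have hφ0 := hφm _ (Ideal.subset_span (Set.mem_insert _ _) : g (X 0) ∈ m)
    have hφ1 := hφm _ (Ideal.subset_span (Set.mem_insert_of_mem _ rfl) : g (X 1) ∈ m)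
    let ψ : S →+* Polynomial ℂ := eval₂Hom Polynomial.C fun b ↦ cond b Polynomial.X 0
    let : Algebra R (Polynomial ℂ) := (φ.comp g).toAlgebra
    have hψC : ∀ r, ψ (C r) = Polynomial.C r := fun r ↦ eval₂_C _ _ _
    have hψX : ∀ b, ψ (X b) = cond b Polynomial.X 0 := fun b ↦ eval₂_X _ _ _
    have h1 : ψ.comp chartMap.toRingHom = φ.comp g := by
      apply MvPolynomial.ringHom_ext
      · intro r; simp [chartMap, hφC, hψC]
      · intro i; fin_cases i <;> simp [chartMap, hφ0, hφ1, hψX]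
    let φ' : A →ₐ[R] Polynomial ℂ := ⟨φ, fun r ↦ rfl⟩
    let ψ' : S →ₐ[R] Polynomial ℂ := ⟨ψ, fun r ↦ congr($h1 r)⟩
    let Θ := (Algebra.TensorProduct.lift ψ' φ' fun _ _ ↦ Commute.all _ _).toRingHom
    have hΘρ : ∀ a, Θ (ρ a) = φ a := fun a ↦ by simp [Θ, ρ, φ']
    have hΘT : Θ (κ (X true)) = Polynomial.X := by simp [Θ, κ, ψ', hψX]
    obtain ⟨z, hz⟩ := Ideal.mem_span_singleton'.mp hq
    have h2 := congrArg Θ hz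
    rw [map_mul, hΘρ, hφ0, mul_zero, Polynomial.hom_eval₂, hΘT] at h2
    have h3 : Θ.comp (ρ.comp (g.comp C)) = Polynomial.C := by
      ext1 c; simp only [RingHom.comp_apply, hΘρ, hφC]
    rw [h3] at h2
    simpa using h2.symm

end ChartAlgebra


/-! ### Blowups -/

lemma isOpenImmersion_of_exists {X Y : Scheme.{0}} (f : X ⟶ Y) (hinj : Function.Injective f)
    (h : ∀ x : X, ∃ (X' : Scheme.{0}) (i : X' ⟶ X), IsOpenImmersion i ∧ x ∈ Set.range i ∧
      IsOpenImmersion (i ≫ f)) : IsOpenImmersion f := by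
  rw [IsOpenImmersion.iff_isIso_stalkMap]
  constructor
  · refine .of_continuous_injective_isOpenMap f.continuous hinj ?_
    rw [isOpenMap_iff_nhds_le]
    intro x
    obtain ⟨X', i, hi, ⟨x', rfl⟩, hif⟩ := h x
    rw [← i.isOpenEmbedding.map_nhds_eq, Filter.map_map]
    have := (i ≫ f).isOpenEmbedding.map_nhds_eq x'
    exact this.ge
  · intro x
    obtain ⟨X', i, hi, ⟨x', rfl⟩, hif⟩ := h x
    have h1 := Scheme.Hom.stalkMap_comp i f x'
    have h2 : IsIso ((i ≫ f).stalkMap x') := inferInstance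
    rw [h1] at h2
    exact @IsIso.of_isIso_comp_right _ _ _ _ _ _ _ _ h2

lemma map_mem_nonZeroDivisors_of_flat {R S : Type*} [CommRing R] [CommRing S] {φ : R →+* S}
    (hφ : φ.Flat) {r : R} (hr : r ∈ nonZeroDivisors R) : φ r ∈ nonZeroDivisors S := by
  algebraize [φ]
  rw [mem_nonZeroDivisors_iff_left] at hr ⊢
  intro z hz
  have := regular_mod_flat (R := R) (E := S) (x := r) (K := ⊥)
    (fun a ha ↦ Ideal.mem_bot.mpr (hr a (Ideal.mem_bot.mp ha))) z (by rw [Ideal.map_bot]; exact hz)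
  simpa using this

lemma appLE_mem_nonZeroDivisors {X Y : Scheme.{0}} (f : X ⟶ Y) [Flat f] {U : Y.Opens}
    (hU : IsAffineOpen U) {V : X.Opens} (hV : IsAffineOpen V) (e : V ≤ f ⁻¹ᵁ U) {s : Γ(Y, U)}
    (hs : s ∈ nonZeroDivisors Γ(Y, U)) : (f.appLE U V e).hom s ∈ nonZeroDivisors Γ(X, V) :=
  map_mem_nonZeroDivisors_of_flat
    (HasRingHomProperty.appLE @Flat f inferInstance ⟨U, hU⟩ ⟨V, hV⟩ e) hs

lemma res_mem_nonZeroDivisors {X : Scheme.{0}} {U V : X.Opens} (hU : IsAffineOpen U)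
    (hV : IsAffineOpen V) (e : V ≤ U) {s : Γ(X, U)} (hs : s ∈ nonZeroDivisors Γ(X, U)) :
    res e s ∈ nonZeroDivisors Γ(X, V) := by
  have := appLE_mem_nonZeroDivisors (𝟙 X) hU hV e hs
  have h1 : (𝟙 X : X ⟶ X).appLE U V e = X.presheaf.map (homOfLE e).op := by
    simp [Scheme.Hom.appLE]
    exact Category.id_comp _
  rwa [h1] at this

/-- The ideal sheaf of the reduced closed subscheme supported on the closure of `Z`. -/
noncomputable abbrev centreIdeal {P : Scheme.{0}} (Z : Set P) : P.IdealSheafData :=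
  IdealSheafData.vanishingIdeal (Closeds.closure Z)

lemma IsBlowup.hom_ext {B P : Scheme.{0}} {f : B ⟶ P} {Z : Set P} (hf : IsBlowup f Z)
    {W : Scheme.{0}} {a b : W ⟶ B} (h : a ≫ f = b ≫ f)
    (hW : IsEffectiveCartier ((centreIdeal Z).comap (a ≫ f))) : a = b :=
  (hf.2 W (a ≫ f) hW).unique rfl h.symm

lemma isEffectiveCartier_Spec {R : CommRingCat.{0}} (I : (Spec R).IdealSheafData)
    (r : R) (hr : r ∈ nonZeroDivisors R)
    (hI : I.ideal ⟨⊤, isAffineOpen_top _⟩ = Ideal.span {(Scheme.ΓSpecIso R).inv.hom r}) :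
    IsEffectiveCartier I := fun x ↦ by
  refine ⟨⟨⊤, isAffineOpen_top _⟩, trivial, _, ?_, hI⟩
  exact map_mem_nonZeroDivisors_of_flat
    (RingHom.Flat.of_bijective (ConcreteCategory.bijective_of_isIso (Scheme.ΓSpecIso R).inv)) hr

/-- The open subset `W` is affine, and on it the regular function `w` generates the ideal sheaf `E`,
which in the applications is the ideal of the exceptional divisor of a blowup. -/
def GeneratesOn {B : Scheme.{0}} (E : B.IdealSheafData) {W : B.Opens} (w : Γ(B, W)) : Prop :=
  ∃ hW : IsAffineOpen W, E.ideal ⟨W, hW⟩ = Ideal.span {w} ∧ w ∈ nonZeroDivisors Γ(B, W)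

lemma GeneratesOn.restrict {B : Scheme.{0}} {E : B.IdealSheafData} {W : B.Opens} {w : Γ(B, W)}
    (h : GeneratesOn E w) {W' : B.Opens} (hW' : IsAffineOpen W') (e : W' ≤ W) :
    GeneratesOn E (res e w) := by
  obtain ⟨hW, h1, h2⟩ := h
  refine ⟨hW', ?_, res_mem_nonZeroDivisors hW hW' e h2⟩
  rw [← E.map_ideal (U := ⟨W', hW'⟩) (V := ⟨W, hW⟩) e, h1, Ideal.map_span, Set.image_singleton]
  rfl

lemma GeneratesOn.of_unit {B : Scheme.{0}} {E : B.IdealSheafData} {W : B.Opens} {w w' c : Γ(B, W)}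
    (h : GeneratesOn E w) (hc : IsUnit c) (hw : w' = c * w) : GeneratesOn E w' := by
  obtain ⟨hW, h1, h2⟩ := h
  refine ⟨hW, ?_, ?_⟩
  · rw [h1, hw, Ideal.span_singleton_mul_left_unit hc]
  · rw [hw]; exact mul_mem hc.mem_nonZeroDivisors h2

lemma IsEffectiveCartier.exists_generatesOn {B : Scheme.{0}} {E : B.IdealSheafData}
    (hE : IsEffectiveCartier E) {O : B.Opens} {b : B} (hb : b ∈ O) :
    ∃ (W : B.Opens) (w : Γ(B, W)), b ∈ W ∧ W ≤ O ∧ GeneratesOn E w := by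
  obtain ⟨⟨U, hU⟩, hbU, g, hg, hI⟩ := hE b
  obtain ⟨r, hr, hbr⟩ := hU.exists_basicOpen_le ⟨b, hb⟩ hbU
  exact ⟨B.basicOpen r, res (B.basicOpen_le r) g, hbr, hr,
    GeneratesOn.restrict ⟨hU, hI, hg⟩ (hU.basicOpen r) _⟩


end TreeSurfaces

namespace TreeSurfaces

open Scheme MvPolynomial

/-! ### Charts of a blowup at a point -/

/-- The affine chart of a blowup on which the first of two étale coordinates generates the
exceptional divisor. -/
lemma exists_blowup_chart {B P : Scheme.{0}} {f : B ⟶ P} {Z : Set P} (hf : IsBlowup f Z)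
    {V : P.Opens} (hV : IsAffineOpen V) (g : MvPolynomial (Fin 2) ℂ →+* Γ(P, V))
    (hg : g.Etale) (hres : ∀ a, ∃ c : ℂ, a - g (C c) ∈ Ideal.span {g (X 0), g (X 1)})
    (hne : Ideal.span {g (X 0), g (X 1)} ≠ ⊤)
    (hI : (centreIdeal Z).ideal ⟨V, hV⟩ = Ideal.span {g (X 0), g (X 1)}) :
    ∃ (U : B.Opens) (hUV : U ≤ f ⁻¹ᵁ V) (T : Γ(B, U)),
      GeneratesOn ((centreIdeal Z).comap f) ((f.appLE V U hUV).hom (g (X 0))) ∧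
      (f.appLE V U hUV).hom (g (X 1)) = (f.appLE V U hUV).hom (g (X 0)) * T ∧
      (∀ z, ∃ q : Polynomial ℂ, z - q.eval₂ ((f.appLE V U hUV).hom.comp (g.comp C)) T ∈
        Ideal.span {(f.appLE V U hUV).hom (g (X 0))}) ∧
      (∀ q : Polynomial ℂ, q.eval₂ ((f.appLE V U hUV).hom.comp (g.comp C)) T ∈
        Ideal.span {(f.appLE V U hUV).hom (g (X 0))} → q = 0) ∧
      (∀ (W : B.Opens) (hW : W ≤ f ⁻¹ᵁ V), GeneratesOn ((centreIdeal Z).comap f)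
        ((f.appLE V W hW).hom (g (X 0))) → W ≤ U) := by
  obtain ⟨A', _, ρ, T', hT', hu, hUP, hUP', hm1, hm2⟩ := exists_chart_algebra g hg hres hne
  set u := g (X 0)
  set v := g (X 1)
  let E := (centreIdeal Z).comap f
  let Q := Spec (CommRingCat.of A')
  let q : Q ⟶ P := Spec.map (CommRingCat.ofHom ρ) ≫ hV.fromSpec
  -- morphisms to the chart are determined by their composites with `q`
  have hext : ∀ (R : CommRingCat.{0}) (a b : Spec R ⟶ Q), a ≫ q = b ≫ q →
      (∀ χ : CommRingCat.of A' ⟶ R, a = Spec.map χ → χ.hom (ρ u) ∈ nonZeroDivisors R) → a = b := by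
    intro R a b hab hnz
    obtain ⟨α, rfl⟩ := Spec.map_surjective a
    obtain ⟨β, rfl⟩ := Spec.map_surjective b
    have h1 : Spec.map α ≫ Spec.map (CommRingCat.ofHom ρ) =
        Spec.map β ≫ Spec.map (CommRingCat.ofHom ρ) := by
      rw [← cancel_mono hV.fromSpec, Category.assoc, Category.assoc]
      exact hab
    rw [← Spec.map_comp, ← Spec.map_comp] at h1
    have h2 := congrArg CommRingCat.Hom.hom (Spec.map_injective h1)
    have h3 : ∀ a, α.hom (ρ a) = β.hom (ρ a) := fun a ↦ congr($h2 a)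
    have h4 : α.hom = β.hom := by
      apply hUP' _ _ _ h2
      have h5 : α.hom (ρ u) * (α.hom T' - β.hom T') = 0 := by
        rw [mul_sub, ← map_mul, ← hT', h3 u, ← map_mul, ← hT', h3 v, sub_self]
      rw [← sub_eq_zero]
      exact (mem_nonZeroDivisors_iff_left.mp (hnz α rfl)) _ h5
    rw [CommRingCat.hom_ext h4]
  have hqV : ⊤ ≤ q ⁻¹ᵁ V := by
    intro x _
    have : q x ∈ hV.fromSpec.opensRange := ⟨Spec.map (CommRingCat.ofHom ρ) x, rfl⟩
    rwa [hV.opensRange_fromSpec] at this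
  have hrange : ∀ {M : Scheme.{0}} {W : M.Opens} (hW : IsAffineOpen W) (p : Spec Γ(M, W)),
      hW.fromSpec p ∈ W := by
    intro M W hW p
    have : hW.fromSpec p ∈ hW.fromSpec.opensRange := ⟨p, rfl⟩
    rwa [hW.opensRange_fromSpec] at this
  have hVtop : ⊤ ≤ hV.fromSpec ⁻¹ᵁ V := fun x _ ↦ hrange hV x
  have hqapp : q.appLE V ⊤ hqV = CommRingCat.ofHom ρ ≫
      (Scheme.ΓSpecIso (CommRingCat.of A')).inv := by
    have h1 := Scheme.Hom.appLE_comp_appLE (Spec.map (CommRingCat.ofHom ρ)) hV.fromSpec V ⊤ ⊤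
      hVtop le_top
    have h2 := appLE_fromSpec_top hV hVtop
    rw [← h1, h2, Scheme.ΓSpecIso_inv_naturality]
    congr 1
  have hspan : (Ideal.span {u, v}).map ρ = Ideal.span {ρ u} := by
    rw [Ideal.map_span, Set.image_pair]
    apply le_antisymm
    · rw [Ideal.span_le]
      rintro z (rfl | rfl)
      · exact Ideal.mem_span_singleton_self _
      · rw [hT']; exact Ideal.mul_mem_right _ _ (Ideal.mem_span_singleton_self _)
    · exact Ideal.span_mono (by simp)
  have hqC : IsEffectiveCartier ((centreIdeal Z).comap q) := by
    refine isEffectiveCartier_Spec _ (ρ u) hu ?_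
    rw [ideal_comap_eq_map (centreIdeal Z) q hV (isAffineOpen_top _) hqV, hI, hqapp,
      CommRingCat.hom_comp, ← Ideal.map_map]
    refine (congrArg _ hspan).trans ?_
    rw [Ideal.map_span, Set.image_singleton]
  obtain ⟨j, hj, -⟩ := hf.2 Q q hqC
  -- open subsets on which `u` generates `E` map to the chart
  have hlift : ∀ (W : B.Opens) (hW : W ≤ f ⁻¹ᵁ V) (hG : GeneratesOn E ((f.appLE V W hW).hom u)),
      ∃ h : Spec Γ(B, W) ⟶ Q, h ≫ j = hG.1.fromSpec := by
    intro W hW hG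
    obtain ⟨hWa, h1, h2⟩ := hG
    have h3 := ideal_comap_eq_map (centreIdeal Z) f hV hWa hW
    rw [hI, Ideal.map_span, Set.image_pair] at h3
    have h4 : (f.appLE V W hW).hom v ∈ Ideal.span {(f.appLE V W hW).hom u} := by
      rw [← h1, h3]
      exact Ideal.subset_span (by simp)
    obtain ⟨t, ht⟩ := Ideal.mem_span_singleton'.mp h4
    obtain ⟨χ, hχ, -⟩ := hUP Γ(B, W) (f.appLE V W hW).hom t (by rw [mul_comm]; exact ht.symm)
    refine ⟨Spec.map (CommRingCat.ofHom χ), ?_⟩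
    have h5 : Spec.map (CommRingCat.ofHom χ) ≫ q = hWa.fromSpec ≫ f := by
      rw [← IsAffineOpen.SpecMap_appLE_fromSpec f hV hWa hW, ← Category.assoc, ← Spec.map_comp]
      congr 2
      ext1
      exact hχ
    apply hf.hom_ext
    · rw [Category.assoc, hj, h5]
    · rw [Category.assoc, hj, h5, IdealSheafData.comap_comp]
      refine isEffectiveCartier_Spec _ _ h2 ?_
      rw [ideal_comap_fromSpec _ hWa, h1, Ideal.map_span, Set.image_singleton]
  let ι (r : A') : Spec (CommRingCat.of (Localization.Away r)) ⟶ Q :=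
    Spec.map (CommRingCat.ofHom (algebraMap A' (Localization.Away r)))
  have hι : ∀ r, IsOpenImmersion (ι r) := fun r ↦ IsOpenImmersion.of_isLocalization r
  -- small affine open subsets of the chart map to affine open subsets of the blowup
  have hk : ∀ (y : Q) (W : B.Opens) (hWa : IsAffineOpen W), j y ∈ W →
      ∃ (r : A') (k : Spec (CommRingCat.of (Localization.Away r)) ⟶ Spec Γ(B, W)),
        y ∈ Set.range (ι r) ∧ k ≫ hWa.fromSpec = ι r ≫ j := by
    intro y W hWa hyW
    obtain ⟨_, ⟨r, rfl⟩, hyr, hrW⟩ := (PrimeSpectrum.isTopologicalBasis_basic_opens (R := A')).exists_subset_of_mem_open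
      (show y ∈ ((j ⁻¹ᵁ W : Q.Opens) : Set Q) from hyW) (j ⁻¹ᵁ W).isOpen
    have hrr : Set.range (ι r) = (PrimeSpectrum.basicOpen r : Set (PrimeSpectrum A')) :=
      PrimeSpectrum.localization_away_comap_range (Localization.Away r) r
    refine ⟨r, IsOpenImmersion.lift hWa.fromSpec (ι r ≫ j) ?_, hrr ▸ hyr,
      IsOpenImmersion.lift_fac _ _ _⟩
    rintro _ ⟨z, rfl⟩
    rw [hWa.range_fromSpec]
    have : ι r z ∈ (PrimeSpectrum.basicOpen r : Set (PrimeSpectrum A')) := hrr ▸ ⟨z, rfl⟩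
    exact hrW this
  have hnzr : ∀ r : A', algebraMap A' (Localization.Away r) (ρ u) ∈
      nonZeroDivisors (Localization.Away r) := fun r ↦
    map_mem_nonZeroDivisors_of_flat (RingHom.flat_algebraMap_iff.mpr
      (IsLocalization.flat _ (Submonoid.powers r))) hu
  -- near every point of the image of the chart `u` generates `E`
  have hloc : ∀ y : Q, ∃ (W : B.Opens) (hW : W ≤ f ⁻¹ᵁ V), j y ∈ W ∧
      GeneratesOn E ((f.appLE V W hW).hom u) := by
    intro y
    have hjV : j y ∈ f ⁻¹ᵁ V := by
      have : q y ∈ V := hqV trivial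
      rwa [← hj] at this
    obtain ⟨W, e, hyW, hWV, hWa, hWe, hWn⟩ := hf.1.exists_generatesOn hjV
    have h3 := ideal_comap_eq_map (centreIdeal Z) f hV hWa hWV
    rw [hI, Ideal.map_span, Set.image_pair] at h3
    obtain ⟨c, hc⟩ := Ideal.mem_span_singleton'.mp (show (f.appLE V W hWV).hom u ∈ Ideal.span {e} by
      rw [← hWe, h3]; exact Ideal.subset_span (by simp))
    obtain ⟨α, β, hαβ⟩ := Ideal.mem_span_pair.mp (show e ∈ Ideal.span
      {(f.appLE V W hWV).hom u, (f.appLE V W hWV).hom v} by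
        rw [← h3, hWe]; exact Ideal.mem_span_singleton_self _)
    obtain ⟨r, k, ⟨y', hy'⟩, hkj⟩ := hk y W hWa hyW
    obtain ⟨κ, rfl⟩ := Spec.map_surjective k
    have h4 : f.appLE V W hWV ≫ κ = CommRingCat.ofHom ρ ≫
        CommRingCat.ofHom (algebraMap A' (Localization.Away r)) := by
      apply Spec.map_injective
      rw [Spec.map_comp, Spec.map_comp, ← cancel_mono hV.fromSpec, Category.assoc,
        IsAffineOpen.SpecMap_appLE_fromSpec f hV hWa hWV, reassoc_of% hkj, hj, Category.assoc]
    have h5 : ∀ a, κ.hom ((f.appLE V W hWV).hom a) = algebraMap A' (Localization.Away r) (ρ a) :=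
      fun a ↦ congr(($h4).hom a)
    have h6 : IsUnit (κ.hom c) := by
      have e1 := congrArg κ.hom hc
      have e2 := congrArg κ.hom hαβ
      rw [map_mul, h5] at e1
      rw [map_add, map_mul, map_mul, h5, h5, hT', map_mul] at e2
      have e3 : algebraMap A' (Localization.Away r) (ρ u) * (1 - κ.hom c * (κ.hom α + κ.hom β *
          algebraMap A' (Localization.Away r) T')) = 0 := by
        rw [mul_sub, mul_one]
        linear_combination -e1 - κ.hom c * e2
      have e4 := mem_nonZeroDivisors_iff_left.mp (hnzr r) _ e3
      exact IsUnit.of_mul_eq_one _ (sub_eq_zero.mp e4).symm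
    have h7 : j y ∈ B.basicOpen c := by
      have : j y = hWa.fromSpec (Spec.map κ y') := by
        rw [← Scheme.Hom.comp_apply, hkj, Scheme.Hom.comp_apply, hy']
      rw [this]
      refine (fromSpec_mem_basicOpen_iff hWa c (Spec.map κ y')).mpr ?_
      intro hmem
      exact y'.2.ne_top (Ideal.eq_top_of_isUnit_mem _ hmem h6)
    refine ⟨B.basicOpen c, (B.basicOpen_le c).trans hWV, h7, ?_⟩
    have h8 := GeneratesOn.restrict (E := E) ⟨hWa, hWe, hWn⟩ (hWa.basicOpen c) (B.basicOpen_le c)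
    have h9 : (f.appLE V _ ((B.basicOpen_le c).trans hWV)).hom u =
        res (B.basicOpen_le c) ((f.appLE V W hWV).hom u) :=
      congr(($(Scheme.Hom.appLE_map f hWV (homOfLE (B.basicOpen_le c)).op)).hom u).symm
    refine h8.of_unit (c := res (B.basicOpen_le c) c) ?_ ?_
    · exact RingedSpace.isUnit_res_basicOpen _ c
    · rw [h9, ← hc, map_mul]
  have hfac : ∀ (y : Q) (W : B.Opens) (hW : W ≤ f ⁻¹ᵁ V)
      (hG : GeneratesOn E ((f.appLE V W hW).hom u)), j y ∈ W →
      ∀ h : Spec Γ(B, W) ⟶ Q, h ≫ j = hG.1.fromSpec →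
      ∃ (r : A') (k : Spec (CommRingCat.of (Localization.Away r)) ⟶ Spec Γ(B, W)),
        y ∈ Set.range (ι r) ∧ k ≫ hG.1.fromSpec = ι r ≫ j ∧ ι r = k ≫ h := by
    intro y W hW hG hyW h hh
    obtain ⟨r, k, hy, hkj⟩ := hk y W hG.1 hyW
    refine ⟨r, k, hy, hkj, hext _ _ _ ?_ ?_⟩
    · rw [← hj, Category.assoc, reassoc_of% hh, reassoc_of% hkj]
    · intro χ hχ
      rw [← Spec.map_injective hχ]
      exact hnzr r
  have hopen : IsOpenImmersion j := by
    apply isOpenImmersion_of_exists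
    · intro y₁ y₂ hy
      obtain ⟨W, hW, hyW, hG⟩ := hloc y₁
      obtain ⟨h, hh⟩ := hlift W hW hG
      obtain ⟨r₁, k₁, ⟨z₁, hz₁⟩, hk₁, hi₁⟩ := hfac y₁ W hW hG hyW h hh
      obtain ⟨r₂, k₂, ⟨z₂, hz₂⟩, hk₂, hi₂⟩ := hfac y₂ W hW hG (hy ▸ hyW) h hh
      have e : k₁ z₁ = k₂ z₂ := by
        apply hG.1.fromSpec.isOpenEmbedding.injective
        rw [← Scheme.Hom.comp_apply, ← Scheme.Hom.comp_apply, hk₁, hk₂, Scheme.Hom.comp_apply,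
          Scheme.Hom.comp_apply, hz₁, hz₂, hy]
      rw [← hz₁, ← hz₂, hi₁, hi₂, Scheme.Hom.comp_apply, Scheme.Hom.comp_apply, e]
    · intro y
      obtain ⟨W, hW, hyW, hG⟩ := hloc y
      obtain ⟨h, hh⟩ := hlift W hW hG
      obtain ⟨r, k, hy, hkj, hi⟩ := hfac y W hW hG hyW h hh
      refine ⟨_, ι r, hι r, hy, ?_⟩
      have sq : IsPullback k (𝟙 _) h (ι r) := by
        refine ⟨⟨by rw [Category.id_comp, hi]⟩, ⟨PullbackCone.IsLimit.mk _ (fun s ↦ s.snd) ?_ ?_ ?_⟩⟩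
        · intro s
          rw [← cancel_mono hG.1.fromSpec, Category.assoc, hkj, ← hh, ← Category.assoc,
            ← Category.assoc, s.condition]
        · intro s; exact Category.comp_id _
        · intro s m _ hm
          rw [← hm, Category.comp_id]
      have hkopen : IsOpenImmersion k :=
        MorphismProperty.of_isPullback (P := @IsOpenImmersion) sq.flip (hι r)
      rw [← hkj]
      infer_instance
  have hUa : IsAffineOpen (j ''ᵁ ⊤) := (isAffineOpen_top Q).image_of_isOpenImmersion j
  have hUV : j ''ᵁ ⊤ ≤ f ⁻¹ᵁ V := by
    rintro _ ⟨y, -, rfl⟩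
    have : q y ∈ V := hqV trivial
    rwa [← hj] at this
  let θ : Γ(B, j ''ᵁ ⊤) ≅ CommRingCat.of A' := j.appIso ⊤ ≪≫ Scheme.ΓSpecIso _
  have hθ1 : f.appLE V (j ''ᵁ ⊤) hUV ≫ θ.hom = CommRingCat.ofHom ρ := by
    simp only [θ, Iso.trans_hom]
    rw [Scheme.Hom.appIso_hom', ← Category.assoc, ← Iso.eq_comp_inv, Scheme.Hom.appLE_comp_appLE,
      ← hqapp]
    simp only [hj]
  have hθ2 : f.appLE V (j ''ᵁ ⊤) hUV = CommRingCat.ofHom ρ ≫ θ.inv := by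
    rw [Iso.eq_comp_inv, hθ1]
  have hθ : ∀ a, (f.appLE V (j ''ᵁ ⊤) hUV).hom a = θ.inv.hom (ρ a) := fun a ↦ congr(($hθ2).hom a)
  have hθi : ∀ z, θ.inv.hom (θ.hom.hom z) = z := fun z ↦ congr(($(θ.hom_inv_id)).hom z)
  have hθh : ∀ z, θ.hom.hom (θ.inv.hom z) = z := fun z ↦ congr(($(θ.inv_hom_id)).hom z)
  have hcoef : (f.appLE V (j ''ᵁ ⊤) hUV).hom.comp (g.comp C) =
      θ.inv.hom.comp (ρ.comp (g.comp C)) := by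
    ext c; exact hθ _
  have hTU : (f.appLE V (j ''ᵁ ⊤) hUV).hom v =
      (f.appLE V (j ''ᵁ ⊤) hUV).hom u * θ.inv.hom T' := by
    rw [hθ, hθ, hT', map_mul]
  refine ⟨j ''ᵁ ⊤, hUV, θ.inv.hom T', ⟨hUa, ?_, ?_⟩, hTU, ?_, ?_, ?_⟩
  · rw [ideal_comap_eq_map (centreIdeal Z) f hV hUa hUV, hI, Ideal.map_span, Set.image_pair, hTU]
    apply le_antisymm
    · rw [Ideal.span_le]
      rintro z (rfl | rfl)
      · exact Ideal.mem_span_singleton_self _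
      · exact Ideal.mul_mem_right _ _ (Ideal.mem_span_singleton_self _)
    · exact Ideal.span_mono (by simp)
  · rw [hθ]
    exact map_mem_nonZeroDivisors_of_flat
      (RingHom.Flat.of_bijective (ConcreteCategory.bijective_of_isIso θ.inv)) hu
  · intro z
    obtain ⟨p, hp⟩ := hm1 (θ.hom.hom z)
    refine ⟨p, ?_⟩
    have := Ideal.mem_map_of_mem θ.inv.hom hp
    rwa [map_sub, hθi, Polynomial.hom_eval₂, ← hcoef, Ideal.map_span, Set.image_singleton,
      ← hθ] at this
  · intro p hp
    apply hm2
    have := Ideal.mem_map_of_mem θ.hom.hom hp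
    rw [Polynomial.hom_eval₂, hcoef, Ideal.map_span, Set.image_singleton, hθ, hθh, hθh] at this
    convert this using 2
    ext c; exact (hθh _).symm
  · intro W hW hG b hb
    obtain ⟨h, hh⟩ := hlift W hW hG
    have : b ∈ Set.range hG.1.fromSpec := by rwa [hG.1.range_fromSpec]
    obtain ⟨p, rfl⟩ := this
    refine ⟨h p, trivial, ?_⟩
    exact (Scheme.Hom.comp_apply h j p).symm.trans congr($hh p)

end TreeSurfaces

namespace TreeSurfaces

open Scheme MvPolynomial

/-! ### Charts of a surface along a line -/

/-- On the affine open set `U` of the surface `M`, the line embedded by `lam` has the equation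
`e = 0`, and `s` restricts to an affine coordinate of the line. -/
structure LineChart {L M : Scheme.{0}} (sM : M ⟶ SpecC) (lam : L ⟶ M) (U : M.Opens)
    (e s : Γ(M, U)) : Prop where
  affine : IsAffineOpen U
  ker : lam.ker.ideal ⟨U, affine⟩ = Ideal.span {e}
  nzd : e ∈ nonZeroDivisors Γ(M, U)
  exists_eval : ∀ z, ∃ q : Polynomial ℂ, z - q.eval₂ (const sM U) s ∈ Ideal.span {e}
  eq_zero : ∀ q : Polynomial ℂ, q.eval₂ (const sM U) s ∈ Ideal.span {e} → q = 0

lemma isRadical_of_exists_eval {A : Type*} [CommRing A] {κ : ℂ →+* A} {e s : A}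
    (h1 : ∀ z, ∃ q : Polynomial ℂ, z - q.eval₂ κ s ∈ Ideal.span {e})
    (h2 : ∀ q : Polynomial ℂ, q.eval₂ κ s ∈ Ideal.span {e} → q = 0) :
    (Ideal.span {e}).IsRadical := by
  rintro z ⟨n, hn⟩
  obtain ⟨q, hq⟩ := h1 z
  have h3 : z ^ n - q.eval₂ κ s ^ n ∈ Ideal.span {e} := by
    obtain ⟨d, hd⟩ := sub_dvd_pow_sub_pow z (q.eval₂ κ s) n
    rw [hd]
    exact Ideal.mul_mem_right _ _ hq
  have h4 : (q ^ n).eval₂ κ s ∈ Ideal.span {e} := by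
    rw [Polynomial.eval₂_pow]
    simpa using sub_mem hn h3
  have h5 : q = 0 := eq_zero_of_pow_eq_zero (h2 _ h4)
  simpa [h5] using hq

/-- `z` is an affine coordinate on the open subset `O` of a curve. -/
def IsLineCoord {L : Scheme.{0}} (sL : L ⟶ SpecC) (O : L.Opens) (z : Γ(L, O)) : Prop :=
  Function.Bijective (Polynomial.eval₂RingHom (const sL O) z)

lemma LineChart.isLineCoord {L M : Scheme.{0}} {sM : M ⟶ SpecC} {lam : L ⟶ M}
    [IsClosedImmersion lam] {U : M.Opens} {e s : Γ(M, U)} (h : LineChart sM lam U e s) :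
    IsLineCoord (lam ≫ sM) (lam ⁻¹ᵁ U) ((lam.app U).hom s) := by
  have hker : RingHom.ker (lam.app U).hom = Ideal.span {e} := by
    rw [← h.ker]; exact (lam.ker_apply ⟨U, h.affine⟩).symm
  have hc : const (lam ≫ sM) (lam ⁻¹ᵁ U) = (lam.app U).hom.comp (const sM U) := by
    ext c
    have := appLE_const lam rfl (sY := sM) (U := U) (V := lam ⁻¹ᵁ U) le_rfl c
    rw [Scheme.Hom.appLE_eq_app] at this
    exact this.symm
  have hev : ∀ q : Polynomial ℂ, Polynomial.eval₂RingHom (const (lam ≫ sM) (lam ⁻¹ᵁ U))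
      ((lam.app U).hom s) q = (lam.app U).hom (q.eval₂ (const sM U) s) := by
    intro q
    rw [Polynomial.hom_eval₂, ← hc]
    rfl
  constructor
  · rw [injective_iff_map_eq_zero]
    intro q hq
    rw [hev, ← RingHom.mem_ker, hker] at hq
    exact h.eq_zero q hq
  · intro z
    obtain ⟨z, rfl⟩ := lam.app_surjective U h.affine z
    obtain ⟨q, hq⟩ := h.exists_eval z
    refine ⟨q, ?_⟩
    rw [hev, ← sub_eq_zero, ← map_sub, ← RingHom.mem_ker, hker, ← neg_sub, neg_mem_iff]
    exact hq

lemma IsLineCoord.isMaximal {L : Scheme.{0}} {sL : L ⟶ SpecC} {O : L.Opens} {z : Γ(L, O)}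
    (h : IsLineCoord sL O z) : (Ideal.span {z}).IsMaximal := by
  have h1 : (Ideal.span {(Polynomial.X : Polynomial ℂ)}).IsMaximal :=
    PrincipalIdealRing.isMaximal_of_irreducible Polynomial.irreducible_X
  have h2 := Ideal.map_isMaximal_of_equiv (RingEquiv.ofBijective _ h) (hp := h1)
  rwa [Ideal.map_span, Set.image_singleton, show (RingEquiv.ofBijective _ h) Polynomial.X = z from
    Polynomial.eval₂_X _ _] at h2

lemma primeIdealOf_injective {X : Scheme.{0}} {U : X.Opens} (hU : IsAffineOpen U) {x y : X}
    (hx : x ∈ U) (hy : y ∈ U)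
    (h : (hU.primeIdealOf ⟨x, hx⟩).asIdeal = (hU.primeIdealOf ⟨y, hy⟩).asIdeal) : x = y := by
  have := congrArg hU.fromSpec (PrimeSpectrum.ext h)
  rwa [hU.fromSpec_primeIdealOf, hU.fromSpec_primeIdealOf] at this

/-- On the projective line with its two standard charts, the complement of a chart is a point. -/
lemma exists_compl_singleton {L : Scheme.{0}} {sL : L ⟶ SpecC} {O₀ O₁ : L.Opens}
    (hO : IsAffineOpen O₁) {z : Γ(L, O₁)} (hz : IsLineCoord sL O₁ z)
    (hcov : ∀ x : L, x ∈ O₀ ∨ x ∈ O₁) (hb : ∀ x ∈ O₁, x ∈ L.basicOpen z ↔ x ∈ O₀) :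
    ∃ p : L, IsClosed {p} ∧ ∀ x, x ∈ O₀ ↔ x ≠ p := by
  let P : PrimeSpectrum Γ(L, O₁) := ⟨Ideal.span {z}, hz.isMaximal.isPrime⟩
  let p := hO.fromSpec P
  have hp : p ∈ O₁ := by
    have : p ∈ Set.range hO.fromSpec := ⟨P, rfl⟩
    rwa [hO.range_fromSpec] at this
  have hp0 : p ∉ O₀ := by
    rw [← hb p hp, fromSpec_mem_basicOpen_iff, not_not]
    exact Ideal.mem_span_singleton_self z
  have hP : (hO.primeIdealOf ⟨p, hp⟩).asIdeal = Ideal.span {z} := by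
    symm
    apply hz.isMaximal.eq_of_le (hO.primeIdealOf ⟨p, hp⟩).2.ne_top
    rw [Ideal.span_singleton_le_iff_mem]
    by_contra h
    exact hp0 ((hb p hp).mp ((mem_basicOpen_iff_notMem_primeIdealOf hO z hp).mpr h))
  have key : ∀ x, x ∈ O₀ ↔ x ≠ p := by
    intro x
    refine ⟨fun h e ↦ hp0 (e ▸ h), fun hne ↦ ?_⟩
    by_contra hx
    have hx1 := (hcov x).resolve_left hx
    apply hne
    apply primeIdealOf_injective hO hx1 hp
    rw [hP]
    symm
    apply hz.isMaximal.eq_of_le (hO.primeIdealOf ⟨x, hx1⟩).2.ne_top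
    rw [Ideal.span_singleton_le_iff_mem]
    by_contra h
    exact hx ((hb x hx1).mp ((mem_basicOpen_iff_notMem_primeIdealOf hO z hx1).mpr h))
  refine ⟨p, ?_, key⟩
  have : ({p} : Set L) = (O₀ : Set L)ᶜ := by
    ext x
    simp [key]
  rw [this]
  exact O₀.isOpen.isClosed_compl

/-! ### Charts of a blowup along an exceptional line -/

/-- Étale coordinates, given by `g` on `V`, of the surface `P` at the point `x` of the centre `Z`
of the blowup `f`. -/
structure IsBlowupCoord {B P : Scheme.{0}} (f : B ⟶ P) (Z : Set P) (sP : P ⟶ SpecC) (x : P)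
    (V : P.Opens) (g : MvPolynomial (Fin 2) ℂ →+* Γ(P, V)) : Prop where
  blow : IsBlowup f Z
  isClosed : IsClosed {x}
  affine : IsAffineOpen V
  mem : x ∈ V
  etale : g.Etale
  const_eq : g.comp C = const sP V
  max : ∀ s, x ∉ P.basicOpen s ↔ s ∈ Ideal.span {g (X 0), g (X 1)}
  ideal : (centreIdeal Z).ideal ⟨V, affine⟩ = Ideal.span {g (X 0), g (X 1)}

section

variable {B P : Scheme.{0}} {f : B ⟶ P} {Z : Set P} {sP : P ⟶ SpecC} {x : P}
    {V : P.Opens} {g : MvPolynomial (Fin 2) ℂ →+* Γ(P, V)}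

lemma IsBlowupCoord.span_eq (h : IsBlowupCoord f Z sP x V g) :
    Ideal.span {g (X 0), g (X 1)} = (h.affine.primeIdealOf ⟨x, h.mem⟩).asIdeal := by
  ext s
  rw [← h.max, mem_basicOpen_iff_notMem_primeIdealOf h.affine s h.mem, not_not]

lemma IsBlowupCoord.isMaximal (h : IsBlowupCoord f Z sP x V g) :
    (Ideal.span {g (X 0), g (X 1)}).IsMaximal := by
  rw [h.span_eq]
  exact h.affine.primeIdealOf_isMaximal_of_isClosed ⟨x, h.mem⟩ h.isClosed

/-- Zariski's lemma for a finitely generated complex algebra. -/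
lemma exists_sub_mem_of_isMaximal {A : Type} [CommRing A] (κ : ℂ →+* A) (hκ : κ.FiniteType)
    (m : Ideal A) [hm : m.IsMaximal] (a : A) : ∃ c : ℂ, a - κ c ∈ m := by
  let _ : Field (A ⧸ m) := Ideal.Quotient.field m
  algebraize [κ]
  have hbij : Function.Bijective (algebraMap ℂ (A ⧸ m)) := by
    have : Module.Finite ℂ (A ⧸ m) := finite_of_finite_type_of_isJacobsonRing ℂ (A ⧸ m)
    exact IsAlgClosed.algebraMap_bijective_of_isIntegral
  obtain ⟨c, hc⟩ := hbij.2 (Ideal.Quotient.mk m a)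
  exact ⟨c, (Ideal.Quotient.mk_eq_mk_iff_sub_mem _ _).mp hc.symm⟩

lemma IsBlowupCoord.exists_sub_mem (h : IsBlowupCoord f Z sP x V g) (a : Γ(P, V)) :
    ∃ c : ℂ, a - g (C c) ∈ Ideal.span {g (X 0), g (X 1)} := by
  have h1 : (g.comp C).FiniteType := by
    have h2 : (C : ℂ →+* MvPolynomial (Fin 2) ℂ).FiniteType :=
      RingHom.finiteType_algebraMap.mpr (inferInstance : Algebra.FiniteType ℂ (MvPolynomial (Fin 2) ℂ))
    have h3 : g.FiniteType := by
      have := h.etale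
      algebraize [g]
      exact RingHom.finiteType_algebraMap.mpr
        (inferInstance : Algebra.FiniteType (MvPolynomial (Fin 2) ℂ) Γ(P, V))
    exact h3.comp h2
  have := h.isMaximal
  exact exists_sub_mem_of_isMaximal (g.comp C) h1 _ a

/-- An invertible linear substitution of étale coordinates. -/
lemma IsBlowupCoord.linear (h : IsBlowupCoord f Z sP x V g) {a b c d : ℂ} (hdet : a * d - b * c ≠ 0) :
    ∃ g', IsBlowupCoord f Z sP x V g' ∧ g' (X 0) = g (C a * X 0 + C b * X 1) ∧
      g' (X 1) = g (C c * X 0 + C d * X 1) := by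
  let D := (a * d - b * c)⁻¹
  have hD : (a * d - b * c) * D = 1 := mul_inv_cancel₀ hdet
  have hDC : (C a * C d - C b * C c) * C D = (1 : MvPolynomial (Fin 2) ℂ) := by
    rw [← C_mul, ← C_mul, ← C_sub, ← C_mul, hD, C_1]
  let τ : MvPolynomial (Fin 2) ℂ ≃ₐ[ℂ] MvPolynomial (Fin 2) ℂ :=
    AlgEquiv.ofAlgHom (aeval ![C a * X 0 + C b * X 1, C c * X 0 + C d * X 1])
      (aeval ![C D * (C d * X 0 - C b * X 1), C D * (C a * X 1 - C c * X 0)])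
      (by
        ext i : 1
        fin_cases i
        · simp [algHom_C, algebraMap_eq]
          linear_combination X 0 * hDC
        · simp [algHom_C, algebraMap_eq]
          linear_combination X 1 * hDC)
      (by
        ext i : 1
        fin_cases i
        · simp [algHom_C, algebraMap_eq]
          linear_combination X 0 * hDC
        · simp [algHom_C, algebraMap_eq]
          linear_combination X 1 * hDC)
  have hτ0 : τ (X 0) = C a * X 0 + C b * X 1 := by simp [τ]
  have hτ1 : τ (X 1) = C c * X 0 + C d * X 1 := by simp [τ]
  let g' := g.comp (τ : MvPolynomial (Fin 2) ℂ →+* MvPolynomial (Fin 2) ℂ)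
  have e0 : g' (X 0) = g (C a * X 0 + C b * X 1) := congrArg g hτ0
  have e1 : g' (X 1) = g (C c * X 0 + C d * X 1) := congrArg g hτ1
  have hspan : Ideal.span {g' (X 0), g' (X 1)} = Ideal.span {g (X 0), g (X 1)} := by
    apply le_antisymm
    · rw [Ideal.span_le]
      rintro z (rfl | rfl)
      · exact Ideal.mem_span_pair.mpr ⟨g (C a), g (C b), by rw [e0]; simp only [map_add, map_mul]⟩
      · exact Ideal.mem_span_pair.mpr ⟨g (C c), g (C d), by rw [e1]; simp only [map_add, map_mul]⟩
    · have hg := congrArg g hDC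
      simp only [map_sub, map_mul, map_one] at hg
      rw [Ideal.span_le]
      rintro z (rfl | rfl)
      · refine Ideal.mem_span_pair.mpr ⟨g (C D) * g (C d), -(g (C D) * g (C b)), ?_⟩
        rw [e0, e1]; simp only [map_add, map_mul]
        linear_combination g (X 0) * hg
      · refine Ideal.mem_span_pair.mpr ⟨-(g (C D) * g (C c)), g (C D) * g (C a), ?_⟩
        rw [e0, e1]; simp only [map_add, map_mul]
        linear_combination g (X 1) * hg
  refine ⟨g', ⟨h.blow, h.isClosed, h.affine, h.mem, ?_, ?_, ?_, ?_⟩, e0, e1⟩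
  · exact RingHom.Etale.stableUnderComposition _ _ (.of_bijective τ.bijective) h.etale
  · rw [← h.const_eq]
    ext1 r
    exact congrArg g (τ.commutes r)
  · intro s; rw [hspan]; exact h.max s
  · rw [hspan]; exact h.ideal

/-- The open subset of the blowup on which `w` generates the exceptional divisor. -/
def goodLocus (f : B ⟶ P) (Z : Set P) (w : Γ(P, V)) : B.Opens :=
  sSup {W | ∃ hW : W ≤ f ⁻¹ᵁ V, GeneratesOn ((centreIdeal Z).comap f) ((f.appLE V W hW).hom w)}

lemma goodLocus_le (w : Γ(P, V)) : goodLocus f Z w ≤ f ⁻¹ᵁ V :=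
  sSup_le fun _ ⟨hW, _⟩ ↦ hW

lemma mem_goodLocus {w : Γ(P, V)} {b : B} : b ∈ goodLocus f Z w ↔ ∃ (W : B.Opens)
    (hW : W ≤ f ⁻¹ᵁ V), b ∈ W ∧
      GeneratesOn ((centreIdeal Z).comap f) ((f.appLE V W hW).hom w) := by
  rw [goodLocus, Opens.mem_sSup]
  exact ⟨fun ⟨W, ⟨hW, h⟩, hb⟩ ↦ ⟨W, hW, hb, h⟩, fun ⟨W, hW, hb, h⟩ ↦ ⟨W, ⟨hW, h⟩, hb⟩⟩

lemma res_appLE {U W : B.Opens} (hU : U ≤ f ⁻¹ᵁ V) (hW : W ≤ U) (w : Γ(P, V)) :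
    res hW ((f.appLE V U hU).hom w) = (f.appLE V W (hW.trans hU)).hom w :=
  congr(($(Scheme.Hom.appLE_map f hU (homOfLE hW).op)).hom w)

lemma mem_basicOpen_appLE {U : B.Opens} (hU : U ≤ f ⁻¹ᵁ V) (w : Γ(P, V)) {b : B} (hb : b ∈ U) :
    b ∈ B.basicOpen ((f.appLE V U hU).hom w) ↔ f b ∈ P.basicOpen w := by
  rw [Scheme.basicOpen_appLE]
  exact ⟨fun h ↦ h.2, fun h ↦ ⟨hb, h⟩⟩

lemma goodLocus_smul {w w' : Γ(P, V)} {c : ℂ} (hc : c ≠ 0) (hw : w' = const sP V c * w) :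
    goodLocus f Z w ≤ goodLocus f Z w' := by
  intro b hb
  obtain ⟨W, hW, hbW, h⟩ := mem_goodLocus.mp hb
  refine mem_goodLocus.mpr ⟨W, hW, hbW, h.of_unit (c := (f.appLE V W hW).hom (const sP V c)) ?_ ?_⟩
  · exact ((IsUnit.mk0 c hc).map (const sP V)).map _
  · rw [hw, map_mul]

/-- On the locus where the first coordinate generates the exceptional divisor there is a chart of
the exceptional line. -/
lemma IsBlowupCoord.exists_chart (h : IsBlowupCoord f Z sP x V g) {L : Scheme.{0}} (lam : L ⟶ B)
    [IsClosedImmersion lam] [IsReduced L] (hlam : Set.range lam = f ⁻¹' {x}) :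
    ∃ T : Γ(B, goodLocus f Z (g (X 0))),
      LineChart (f ≫ sP) lam (goodLocus f Z (g (X 0)))
        ((f.appLE V _ (goodLocus_le (g (X 0)))).hom (g (X 0))) T ∧
      (f.appLE V _ (goodLocus_le (g (X 0)))).hom (g (X 1)) =
        (f.appLE V _ (goodLocus_le (g (X 0)))).hom (g (X 0)) * T := by
  obtain ⟨U, hUV, T, hG, hT, h1, h2, hmax⟩ := exists_blowup_chart h.blow h.affine g h.etale
    h.exists_sub_mem h.isMaximal.ne_top h.ideal
  have hU : goodLocus f Z (g (X 0)) = U := by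
    apply le_antisymm
    · exact sSup_le fun W ⟨hW, hWG⟩ ↦ hmax W hW hWG
    · exact le_sSup ⟨hUV, hG⟩
  have hgen : ∀ (U' : B.Opens) (hU' : U' ≤ f ⁻¹ᵁ V), U' = U → ∃ T : Γ(B, U'),
      LineChart (f ≫ sP) lam U' ((f.appLE V U' hU').hom (g (X 0))) T ∧
      (f.appLE V U' hU').hom (g (X 1)) = (f.appLE V U' hU').hom (g (X 0)) * T := by
    rintro U' hU' rfl
    have hc : (f.appLE V U' hUV).hom.comp (g.comp C) = const (f ≫ sP) U' := by
      rw [h.const_eq]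
      ext c
      exact appLE_const f rfl hUV c
    rw [hc] at h1 h2
    refine ⟨T, ⟨hG.1, ?_, hG.2.2, h1, h2⟩, hT⟩
    refine ker_ideal_eq_of_isRadical lam hG.1 (isRadical_of_exists_eval h1 h2) fun b hb ↦ ?_
    rw [forall_mem_span_singleton_notMem_basicOpen, hlam, mem_basicOpen_appLE hUV _ hb]
    constructor
    · intro hbx
      rw [show f b = x from hbx, h.max]
      exact Ideal.subset_span (by simp)
    · intro hb0
      have hb1 : f b ∉ P.basicOpen (g (X 1)) := by
        rw [← mem_basicOpen_appLE hUV _ hb, hT, Scheme.basicOpen_mul]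
        exact fun h' ↦ hb0 ((mem_basicOpen_appLE hUV _ hb).mp h'.1)
      apply primeIdealOf_injective h.affine (hUV hb) h.mem
      symm
      rw [← h.span_eq]
      apply h.isMaximal.eq_of_le (h.affine.primeIdealOf ⟨f b, hUV hb⟩).2.ne_top
      rw [Ideal.span_le]
      rintro s (rfl | rfl)
      · by_contra hs
        exact hb0 ((mem_basicOpen_iff_notMem_primeIdealOf h.affine _ (hUV hb)).mpr hs)
      · by_contra hs
        exact hb1 ((mem_basicOpen_iff_notMem_primeIdealOf h.affine _ (hUV hb)).mpr hs)
  exact hgen _ _ hU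

/-- The two standard charts cover the inverse image of the coordinate neighbourhood. -/
lemma IsBlowupCoord.mem_goodLocus_or (h : IsBlowupCoord f Z sP x V g) {b : B} (hb : f b ∈ V) :
    b ∈ goodLocus f Z (g (X 0)) ∨ b ∈ goodLocus f Z (g (X 1)) := by
  obtain ⟨W, e, hbW, hWV, hG⟩ := h.blow.1.exists_generatesOn (show b ∈ f ⁻¹ᵁ V from hb)
  obtain ⟨hWa, hWe, hWn⟩ := id hG
  have h3 := ideal_comap_eq_map (centreIdeal Z) f h.affine hWa hWV
  rw [h.ideal, Ideal.map_span, Set.image_pair] at h3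
  obtain ⟨c, hc⟩ := Ideal.mem_span_singleton'.mp
    (show (f.appLE V W hWV).hom (g (X 0)) ∈ Ideal.span {e} by
      rw [← hWe, h3]; exact Ideal.subset_span (by simp))
  obtain ⟨d, hd⟩ := Ideal.mem_span_singleton'.mp
    (show (f.appLE V W hWV).hom (g (X 1)) ∈ Ideal.span {e} by
      rw [← hWe, h3]; exact Ideal.subset_span (by simp))
  obtain ⟨α, β, hαβ⟩ := Ideal.mem_span_pair.mp (show e ∈ Ideal.span
    {(f.appLE V W hWV).hom (g (X 0)), (f.appLE V W hWV).hom (g (X 1))} by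
      rw [← h3, hWe]; exact Ideal.mem_span_singleton_self _)
  have h1 : α * c + β * d = 1 := by
    have : e * (α * c + β * d - 1) = 0 := by
      rw [← hc, ← hd] at hαβ
      linear_combination hαβ
    exact sub_eq_zero.mp (mem_nonZeroDivisors_iff_left.mp hWn _ this)
  have key : ∀ (w : Γ(P, V)) (c : Γ(B, W)), c * e = (f.appLE V W hWV).hom w → b ∈ B.basicOpen c →
      b ∈ goodLocus f Z w := by
    intro w c hc hbc
    refine mem_goodLocus.mpr ⟨B.basicOpen c, (B.basicOpen_le c).trans hWV, hbc, ?_⟩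
    refine (hG.restrict (hWa.basicOpen c) (B.basicOpen_le c)).of_unit
      (RingedSpace.isUnit_res_basicOpen _ c) ?_
    rw [← res_appLE hWV (B.basicOpen_le c), ← hc, map_mul]
    rfl
  by_cases hbc : b ∈ B.basicOpen c
  · exact Or.inl (key _ _ hc hbc)
  · right
    apply key _ _ hd
    rw [mem_basicOpen_iff_notMem_primeIdealOf hWa _ hbW] at hbc ⊢
    intro hd'
    apply (hWa.primeIdealOf ⟨b, hbW⟩).2.ne_top
    rw [Ideal.eq_top_iff_one, ← h1]
    exact add_mem (Ideal.mul_mem_left _ _ (not_not.mp hbc)) (Ideal.mul_mem_left _ _ hd')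

/-- The overlap of two standard charts. -/
lemma mem_basicOpen_iff_mem_goodLocus {w₀ w₁ : Γ(P, V)} {T : Γ(B, goodLocus f Z w₀)}
    (hT : (f.appLE V _ (goodLocus_le w₀)).hom w₁ = (f.appLE V _ (goodLocus_le w₀)).hom w₀ * T)
    {b : B} (hb : b ∈ goodLocus f Z w₀) : b ∈ B.basicOpen T ↔ b ∈ goodLocus f Z w₁ := by
  obtain ⟨W, hW, hbW, hG⟩ := mem_goodLocus.mp hb
  have hWU : W ≤ goodLocus f Z w₀ := le_sSup ⟨hW, hG⟩
  have hTW := congrArg (res hWU) hT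
  rw [map_mul, res_appLE, res_appLE] at hTW
  constructor
  · intro hbT
    rw [← mem_basicOpen_res hWU T hbW] at hbT
    refine mem_goodLocus.mpr ⟨_, (B.basicOpen_le (res hWU T)).trans hW, hbT, ?_⟩
    refine (hG.restrict (hG.1.basicOpen _) (B.basicOpen_le _)).of_unit
      (RingedSpace.isUnit_res_basicOpen _ (res hWU T)) ?_
    rw [← res_appLE hW (B.basicOpen_le (res hWU T)), hTW, map_mul, mul_comm]
    rfl
  · intro hb1
    obtain ⟨W₁, hW₁, hbW₁, hG₁⟩ := mem_goodLocus.mp hb1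
    obtain ⟨r, hr, hbr⟩ := hG.1.exists_basicOpen_le ⟨b, hbW₁⟩ hbW
    have h0 := hG.restrict (hG.1.basicOpen r) (B.basicOpen_le r)
    have h1 := hG₁.restrict (hG.1.basicOpen r) hr
    rw [res_appLE] at h0 h1
    obtain ⟨c, hc⟩ := Ideal.mem_span_singleton'.mp (show
      (f.appLE V (B.basicOpen r) ((B.basicOpen_le r).trans hW)).hom w₀ ∈
      Ideal.span {(f.appLE V (B.basicOpen r) ((B.basicOpen_le r).trans hW)).hom w₁} by
        rw [← h1.2.1, h0.2.1]; exact Ideal.mem_span_singleton_self _)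
    have hT2 := congrArg (res (B.basicOpen_le r)) hTW
    rw [map_mul, res_appLE, res_appLE, res_res] at hT2
    have h2 : c * res ((B.basicOpen_le r).trans hWU) T = 1 := by
      rw [← sub_eq_zero]
      apply mem_nonZeroDivisors_iff_left.mp h0.2.2
      rw [hT2] at hc
      linear_combination hc
    have h3 : IsUnit (res ((B.basicOpen_le r).trans hWU) T) := IsUnit.of_mul_eq_one_right _ h2
    have h4 : b ∈ B.basicOpen (res ((B.basicOpen_le r).trans hWU) T) := by
      rw [Scheme.basicOpen_of_isUnit _ h3]; exact hbr
    exact (mem_basicOpen_res _ T hbr).mp h4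

lemma isMaximal_of_forall_notMem_basicOpen (hV : IsAffineOpen V) (hx : IsClosed {x}) (hxV : x ∈ V)
    {J : Ideal Γ(P, V)} (hJ : ∀ s, x ∉ P.basicOpen s ↔ s ∈ J) :
    J.IsMaximal ∧ ∀ y ∈ V, (∀ s ∈ J, y ∉ P.basicOpen s) → y = x := by
  have h1 : J = (hV.primeIdealOf ⟨x, hxV⟩).asIdeal := by
    ext s
    rw [← hJ, mem_basicOpen_iff_notMem_primeIdealOf hV s hxV, not_not]
  have h2 : J.IsMaximal := h1 ▸ hV.primeIdealOf_isMaximal_of_isClosed ⟨x, hxV⟩ hx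
  refine ⟨h2, fun y hy hs ↦ primeIdealOf_injective hV hy hxV ?_⟩
  rw [← h1]
  symm
  apply h2.eq_of_le (hV.primeIdealOf ⟨y, hy⟩).2.ne_top
  intro s hsJ
  by_contra h
  exact hs s hsJ ((mem_basicOpen_iff_notMem_primeIdealOf hV s hy).mpr h)

lemma exists_isBlowupCoord (hf : IsBlowup f Z) (hZ : Z.Finite) (hZc : ∀ z ∈ Z, IsClosed {z})
    (sP : P ⟶ SpecC) [SmoothOfRelativeDimension 2 sP] (hx : x ∈ Z) :
    ∃ V g, IsBlowupCoord f Z sP x V g := by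
  have hcl : ∀ Y ⊆ Z, IsClosed Y := by
    intro Y hY
    rw [← Set.biUnion_of_singleton Y]
    exact (hZ.subset hY).isClosed_biUnion fun z hz ↦ hZc z (hY hz)
  let O : P.Opens := ⟨(Z \ {x})ᶜ, (hcl _ Set.sdiff_subset).isOpen_compl⟩
  obtain ⟨V, hV, hxV, hVO, g, hg, hgC, hmax⟩ := exists_etale_coordinates sP 2 (hZc x hx)
    (show x ∈ O from fun h ↦ h.2 rfl)
  have hr : Set.range (fun i : Fin 2 ↦ g (X i)) = {g (X 0), g (X 1)} := by
    ext s
    simp [Fin.exists_fin_two, eq_comm]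
  rw [hr] at hmax
  obtain ⟨hM, huniq⟩ := isMaximal_of_forall_notMem_basicOpen hV (hZc x hx) hxV hmax
  refine ⟨V, g, hf, hZc x hx, hV, hxV, hg, hgC, hmax, ?_⟩
  refine vanishingIdeal_ideal_eq_of_isRadical _ hV hM.isPrime.isRadical fun y hy ↦ ?_
  have hyZ : y ∈ Closeds.closure Z ↔ y ∈ Z := by
    rw [← SetLike.mem_coe, Closeds.coe_closure, (hcl Z subset_rfl).closure_eq]
  rw [hyZ]
  constructor
  · intro h s hs
    have hyx : y = x := by
      by_contra hne
      exact hVO hy ⟨h, hne⟩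
    rw [hyx]
    exact (hmax s).mpr hs
  · intro h
    rw [huniq y hy h]
    exact hx

lemma IsBlowupCoord.exists_chart' (h : IsBlowupCoord f Z sP x V g) {L : Scheme.{0}} (lam : L ⟶ B)
    [IsClosedImmersion lam] [IsReduced L] (hlam : Set.range lam = f ⁻¹' {x}) {w₀ w₁ : Γ(P, V)}
    (h₀ : g (X 0) = w₀) (h₁ : g (X 1) = w₁) :
    ∃ T : Γ(B, goodLocus f Z w₀), LineChart (f ≫ sP) lam (goodLocus f Z w₀)
        ((f.appLE V _ (goodLocus_le w₀)).hom w₀) T ∧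
      (f.appLE V _ (goodLocus_le w₀)).hom w₁ = (f.appLE V _ (goodLocus_le w₀)).hom w₀ * T := by
  subst h₀ h₁
  exact h.exists_chart lam hlam

lemma mem_basicOpen_app {L M : Scheme.{0}} (lam : L ⟶ M) {U : M.Opens} (s : Γ(M, U)) (y : L) :
    y ∈ L.basicOpen ((lam.app U).hom s) ↔ lam y ∈ M.basicOpen s := by
  rw [← Scheme.preimage_basicOpen]
  rfl

/-- The locus where a coordinate generates the exceptional divisor is the complement of a point on
the exceptional line. -/
lemma IsBlowupCoord.exists_point (h : IsBlowupCoord f Z sP x V g) {L : Scheme.{0}} (lam : L ⟶ B)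
    [IsClosedImmersion lam] [IsReduced L] (hlam : Set.range lam = f ⁻¹' {x}) :
    ∃ p : L, IsClosed {p} ∧ ∀ y, lam y ∈ goodLocus f Z (g (X 1)) ↔ y ≠ p := by
  obtain ⟨T, hT, hT'⟩ := h.exists_chart lam hlam
  have hfl : ∀ y : L, f (lam y) = x := fun y ↦ by
    have : lam y ∈ f ⁻¹' {x} := hlam ▸ ⟨y, rfl⟩
    exact this
  exact exists_compl_singleton (O₀ := lam ⁻¹ᵁ goodLocus f Z (g (X 1)))
    (hT.affine.preimage lam) hT.isLineCoord
    (fun y ↦ (h.mem_goodLocus_or (b := lam y) (by rw [hfl]; exact h.mem)).symm)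
    (fun y hy ↦ (mem_basicOpen_app lam T y).trans (mem_basicOpen_iff_mem_goodLocus hT' hy))

lemma IsLineCoord.finiteType {L : Scheme.{0}} {sL : L ⟶ SpecC} {O : L.Opens} {z : Γ(L, O)}
    (h : IsLineCoord sL O z) : (const sL O).FiniteType := by
  have h1 : const sL O = (Polynomial.eval₂RingHom (const sL O) z).comp Polynomial.C := by
    ext c; simp
  rw [h1]
  exact (RingHom.FiniteType.of_surjective _ h.2).comp
    (RingHom.finiteType_algebraMap.mpr (inferInstance : Algebra.FiniteType ℂ (Polynomial ℂ)))

/-- Every closed point of the exceptional line is the zero of a linear form in the coordinates. -/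
lemma IsBlowupCoord.exists_form (h : IsBlowupCoord f Z sP x V g) {L : Scheme.{0}} (lam : L ⟶ B)
    [IsClosedImmersion lam] [IsReduced L] (hlam : Set.range lam = f ⁻¹' {x}) (p : L)
    (hp : IsClosed {p}) :
    ∃ a b : ℂ, (a ≠ 0 ∨ b ≠ 0) ∧
      ∀ y, lam y ∈ goodLocus f Z (g (C a * X 0 + C b * X 1)) ↔ y ≠ p := by
  by_cases hpu : lam p ∈ goodLocus f Z (g (X 0))
  · obtain ⟨T, hT, hT'⟩ := h.exists_chart lam hlam
    let O := lam ⁻¹ᵁ goodLocus f Z (g (X 0))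
    have hO : IsAffineOpen O := hT.affine.preimage lam
    have hpO : p ∈ O := hpu
    have := hO.primeIdealOf_isMaximal_of_isClosed ⟨p, hpO⟩ hp
    obtain ⟨c, hc⟩ := exists_sub_mem_of_isMaximal _ hT.isLineCoord.finiteType
      (hO.primeIdealOf ⟨p, hpO⟩).asIdeal ((lam.app _).hom T)
    refine ⟨-c, 1, Or.inr one_ne_zero, ?_⟩
    obtain ⟨g', hg', h0, h1⟩ := h.linear (a := 1) (b := 0) (c := -c) (d := 1) (by simp)
    obtain ⟨p', hp', hy⟩ := hg'.exists_point lam hlam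
    rw [h1] at hy
    have hnot : lam p ∉ goodLocus f Z (g (C (-c) * X 0 + C 1 * X 1)) := by
      have h3 : (f.appLE V _ (goodLocus_le (g (X 0)))).hom (g (C (-c) * X 0 + C 1 * X 1)) =
          (f.appLE V _ (goodLocus_le (g (X 0)))).hom (g (X 0)) * (T - const (f ≫ sP) _ c) := by
        have h4 : (f.appLE V _ (goodLocus_le (g (X 0)))).hom (g (C c)) =
            const (f ≫ sP) (goodLocus f Z (g (X 0))) c := by
          rw [← appLE_const f rfl (goodLocus_le (g (X 0))) c, ← h.const_eq]
          rfl
        simp only [map_add, map_mul, map_neg, hT', h4, map_one]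
        ring
      rw [← mem_basicOpen_iff_mem_goodLocus h3 hpu, ← mem_basicOpen_app,
        mem_basicOpen_iff_notMem_primeIdealOf hO _ hpO, not_not, map_sub]
      have h5 := appLE_const lam rfl (sY := f ≫ sP) (U := goodLocus f Z (g (X 0))) (V := O) le_rfl c
      rw [Scheme.Hom.appLE_eq_app] at h5
      rw [h5]
      exact hc
    have hpp : p = p' := by
      by_contra hne
      exact hnot ((hy p).mpr hne)
    rw [hpp]
    exact hy
  · refine ⟨1, 0, Or.inl one_ne_zero, ?_⟩
    obtain ⟨g', hg', h0, h1⟩ := h.linear (a := 0) (b := 1) (c := 1) (d := 0) (by simp)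
    obtain ⟨p', hp', hy⟩ := hg'.exists_point lam hlam
    rw [h1] at hy
    have hpp : p = p' := by
      by_contra hne
      apply hpu
      have := (hy p).mpr hne
      simpa using this
    rw [hpp]
    exact hy

/-- Two charts of the exceptional line with given closed points at infinity. The transition
functions of the equations are those of `𝒪(-1)`. -/
lemma IsBlowupCoord.exists_charts (h : IsBlowupCoord f Z sP x V g) {L : Scheme.{0}} (lam : L ⟶ B)
    [IsClosedImmersion lam] [IsReduced L] (hlam : Set.range lam = f ⁻¹' {x}) (p : Fin 2 → L)
    (hp : ∀ i, IsClosed {p i}) (hne : ∀ i j, i ≠ j → p i ≠ p j) :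
    ∃ (U : Fin 2 → B.Opens) (e s : ∀ i, Γ(B, U i)), (∀ i, LineChart (f ≫ sP) lam (U i) (e i) (s i)) ∧
      (∀ i y, lam y ∈ U i ↔ y ≠ p i) ∧
      ∀ i j, i ≠ j → ∀ (W : B.Opens) (_ : IsAffineOpen W) (hi : W ≤ U i) (hj : W ≤ U j),
        res hi (s i) * res hj (s j) = 1 ∧ res hj (e j) = res hi (s i) * res hi (e i) := by
  choose a b hab hpt using fun i ↦ h.exists_form lam hlam (p i) (hp i)
  have hgC : ∀ c, g (C c) = const sP V c := fun c ↦ congr($(h.const_eq) c)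
  have hdet : ∀ i j, i ≠ j → a i * b j - b i * a j ≠ 0 := by
    intro i j hij h0
    obtain ⟨r, hr, ha, hb⟩ : ∃ r : ℂ, r ≠ 0 ∧ a j = r * a i ∧ b j = r * b i := by
      by_cases hai : a i = 0
      · have hbi : b i ≠ 0 := (hab i).resolve_left (by simpa using hai)
        have haj : a j = 0 := by
          rw [hai, zero_mul, zero_sub, neg_eq_zero] at h0
          exact (mul_eq_zero.mp h0).resolve_left hbi
        refine ⟨b j / b i, ?_, by rw [hai, haj, mul_zero], by field_simp⟩
        have hbj : b j ≠ 0 := (hab j).resolve_left (by simpa using haj)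
        exact div_ne_zero hbj hbi
      · refine ⟨a j / a i, ?_, by field_simp, ?_⟩
        · intro h1
          have haj : a j = 0 := by simpa [hai] using h1
          rw [haj, mul_zero, sub_zero] at h0
          have hbj : b j = 0 := (mul_eq_zero.mp h0).resolve_left hai
          exact (hab j).elim (fun h ↦ h haj) (fun h ↦ h hbj)
        · field_simp
          linear_combination h0
    have h1 := goodLocus_smul (f := f) (Z := Z) (sP := sP) (w := g (C (a i) * X 0 + C (b i) * X 1))
      (w' := g (C (a j) * X 0 + C (b j) * X 1)) hr (by
        rw [← hgC, ha, hb]; simp only [map_add, map_mul]; ring)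
    exact (hpt j (p j)).mp (h1 ((hpt i (p j)).mpr (hne i j hij).symm)) rfl
  let w : Fin 2 → Γ(P, V) := fun i ↦ g (C (a i) * X 0 + C (b i) * X 1)
  have hT : ∀ i, ∃ T : Γ(B, goodLocus f Z (w i)), LineChart (f ≫ sP) lam (goodLocus f Z (w i))
        ((f.appLE V _ (goodLocus_le (w i))).hom (w i)) T ∧ ∀ j, i ≠ j →
      (f.appLE V _ (goodLocus_le (w i))).hom (w j) =
        (f.appLE V _ (goodLocus_le (w i))).hom (w i) * T := by
    intro i
    obtain ⟨j, hij, hj⟩ : ∃ j : Fin 2, i ≠ j ∧ ∀ j', i ≠ j' → j' = j := by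
      fin_cases i
      · exact ⟨1, by decide, by decide⟩
      · exact ⟨0, by decide, by decide⟩
    obtain ⟨g', hg', h0, h1⟩ := h.linear (hdet i j hij)
    obtain ⟨T, hT, hT'⟩ := hg'.exists_chart' lam hlam h0 h1
    exact ⟨T, hT, fun j' hj' ↦ hj j' hj' ▸ hT'⟩
  choose T hT hT' using hT
  refine ⟨_, _, T, hT, hpt, fun i j hij W hW hi hj ↦ ?_⟩
  have h1 := congrArg (res hi) (hT' i j hij)
  have h2 := congrArg (res hj) (hT' j i hij.symm)
  rw [map_mul, res_appLE, res_appLE] at h1 h2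
  have h3 := res_mem_nonZeroDivisors (hT i).affine hW hi (hT i).nzd
  rw [res_appLE] at h3
  refine ⟨?_, ?_⟩
  · rw [← sub_eq_zero]
    apply mem_nonZeroDivisors_iff_left.mp h3
    rw [h1] at h2
    linear_combination -h2
  · rw [res_appLE, res_appLE, h1, mul_comm]

end

end TreeSurfaces

namespace TreeSurfaces

open Scheme MvPolynomial

/-! ### Blowups away from the centre -/

section AwayFromCentre

variable {B P : Scheme.{0}} {f : B ⟶ P} {Z : Set P}

lemma mem_support_comap_centreIdeal {W : Scheme.{0}} (g : W ⟶ P) (w : W) :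
    w ∈ ((centreIdeal Z).comap g).support ↔ g w ∈ closure Z := by
  rw [IdealSheafData.support_comap]
  have h1 : g w ∈ ((centreIdeal Z).support : Set P) ↔ g w ∈ closure Z := by
    rw [IdealSheafData.coe_support_vanishingIdeal, Closeds.coe_closure]
  exact h1

lemma isEffectiveCartier_comap_of_disjoint {W : Scheme.{0}} (g : W ⟶ P)
    (h : ∀ w, g w ∉ closure Z) : IsEffectiveCartier ((centreIdeal Z).comap g) := by
  have h1 : (centreIdeal Z).comap g = ⊤ := by
    rw [← IdealSheafData.support_eq_bot_iff]
    ext w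
    exact ⟨fun hw ↦ (h w ((mem_support_comap_centreIdeal g w).mp hw)).elim, fun hw ↦ hw.elim⟩
  intro w
  obtain ⟨U, hU, hw, -⟩ := exists_isAffineOpen_mem_and_subset (x := w) (U := ⊤) trivial
  exact ⟨⟨U, hU⟩, hw, 1, one_mem _, by rw [h1]; simp⟩

/-- A blowup is an isomorphism away from its centre. -/
lemma IsBlowup.isIso_morphismRestrict (hf : IsBlowup f Z) (U : P.Opens) (hU : ∀ z ∈ Z, z ∉ U) :
    IsIso (f ∣_ U) := by
  have hU' : ∀ x ∈ U, x ∉ closure Z := fun x hx hxZ ↦ by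
    obtain ⟨z, hz, hzZ⟩ := mem_closure_iff.mp hxZ U U.isOpen hx
    exact hU z hzZ hz
  obtain ⟨h, hh, -⟩ := hf.2 U U.ι (isEffectiveCartier_comap_of_disjoint _ fun w ↦ hU' _ w.2)
  have hr : Set.range h ⊆ Set.range (f ⁻¹ᵁ U).ι := by
    rintro _ ⟨w, rfl⟩
    rw [Scheme.Opens.range_ι]
    change f (h w) ∈ U
    rw [← Scheme.Hom.comp_apply, hh]
    exact w.2
  let h' : (U : Scheme) ⟶ (f ⁻¹ᵁ U : B.Opens) := IsOpenImmersion.lift (f ⁻¹ᵁ U).ι h hr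
  have hh' : h' ≫ (f ⁻¹ᵁ U).ι = h := IsOpenImmersion.lift_fac _ _ _
  refine ⟨h', ?_, ?_⟩
  · rw [← cancel_mono (f ⁻¹ᵁ U).ι, Category.assoc, hh', Category.id_comp]
    refine hf.hom_ext ?_ (isEffectiveCartier_comap_of_disjoint _ fun w ↦ ?_)
    · rw [Category.assoc, hh, morphismRestrict_ι]
    · rw [Category.assoc, hh, morphismRestrict_ι]
      exact hU' _ w.2
  · rw [← cancel_mono U.ι, Category.assoc, morphismRestrict_ι, reassoc_of% hh', hh,
      Category.id_comp]

lemma nonempty_basicOpen_of_mem_nonZeroDivisors {X : Scheme.{0}} {U : X.Opens} (hU : IsAffineOpen U)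
    {x : X} (hx : x ∈ U) {s : Γ(X, U)} (hs : s ∈ nonZeroDivisors Γ(X, U)) :
    ∃ y, y ∈ X.basicOpen s := by
  by_contra! h
  have : Nontrivial Γ(X, U) := (hU.primeIdealOf ⟨x, hx⟩).nontrivial
  have h1 : IsNilpotent s := by
    rw [← mem_nilradical, nilradical_eq_sInf, Ideal.mem_sInf]
    intro p hp
    by_contra hsp
    exact h _ ((fromSpec_mem_basicOpen_iff hU s ⟨p, hp⟩).mpr hsp)
  obtain ⟨n, hn⟩ := h1
  exact zero_ne_one (mem_nonZeroDivisors_iff_left.mp (pow_mem hs n) 1 (by rw [hn, zero_mul])).symm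

/-- The complement of the exceptional divisor is dense. -/
lemma IsBlowup.exists_mem_notMem_closure (hf : IsBlowup f Z) {O : B.Opens} {b : B} (hb : b ∈ O) :
    ∃ b' ∈ O, f b' ∉ closure Z := by
  obtain ⟨W, w, hbW, hWO, hW, hI, hw⟩ := hf.1.exists_generatesOn hb
  obtain ⟨b', hb'⟩ := nonempty_basicOpen_of_mem_nonZeroDivisors hW hbW hw
  have hb'W := B.basicOpen_le w hb'
  refine ⟨b', hWO hb'W, fun h ↦ ?_⟩
  have h1 := (mem_support_comap_centreIdeal f b').mpr h
  have h2 := (IdealSheafData.mem_support_iff_of_mem (U := ⟨W, hW⟩) hb'W).mp h1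
  rw [hI, Scheme.zeroLocus_span, Scheme.zeroLocus_singleton] at h2
  exact h2 hb'

lemma IsBlowup.irreducibleSpace (hf : IsBlowup f Z) [IrreducibleSpace P] (hZ : IsClosed Z)
    (hne : ∃ x, x ∉ Z) : IrreducibleSpace B := by
  let U : P.Opens := ⟨Zᶜ, hZ.isOpen_compl⟩
  have hiso := hf.isIso_morphismRestrict U fun z hz h ↦ h hz
  have : Nonempty U := let ⟨x, hx⟩ := hne; ⟨⟨x, hx⟩⟩
  have h1 : IrreducibleSpace U := (U.ι.isOpenEmbedding).irreducibleSpace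
  let j : (U : Scheme) ⟶ B := inv (f ∣_ U) ≫ (f ⁻¹ᵁ U).ι
  have hj : IsIrreducible (Set.range j) := by
    rw [← Set.image_univ]
    exact (IrreducibleSpace.isIrreducible_univ _).image _ j.continuous.continuousOn
  have hj' : Set.range j = f ⁻¹ᵁ U := by
    rw [← Scheme.Opens.range_ι, Scheme.Hom.comp_base, TopCat.coe_comp, Set.range_comp,
      Set.range_eq_univ.mpr (inv (f ∣_ U)).surjective, Set.image_univ]
  have hd : closure (Set.range j) = Set.univ := by
    refine Set.eq_univ_of_forall fun b ↦ mem_closure_iff.mpr fun O hO hb ↦ ?_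
    obtain ⟨b', hb', h⟩ := hf.exists_mem_notMem_closure (O := ⟨O, hO⟩) hb
    refine ⟨b', hb', ?_⟩
    rw [hj']
    rwa [hZ.closure_eq] at h
  have h2 := hj.closure
  rw [hd] at h2
  have : Nonempty B := let ⟨x, _⟩ := h2.1; ⟨x⟩
  have h3 : PreirreducibleSpace B := ⟨h2.2⟩
  exact ⟨this⟩

/-- An irreducible surface has a point that is not closed. -/
lemma exists_notMem_of_forall_isClosed (sP : P ⟶ SpecC) [SmoothOfRelativeDimension 2 sP]
    [IrreducibleSpace P] (hZc : ∀ z ∈ Z, IsClosed {z}) : ∃ x, x ∉ Z := by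
  by_contra! h
  have hη : ∃ η : P, closure {η} = Set.univ := ⟨genericPoint P, genericPoint_closure _⟩
  obtain ⟨η, hη⟩ := hη
  have hηc := hZc η (h η)
  rw [hηc.closure_eq] at hη
  obtain ⟨V, hV, hxV, -, g, hg, -, hmax⟩ := exists_etale_coordinates sP 2 hηc (O := ⊤) trivial
  have h1 : g (X 0) ∈ nonZeroDivisors Γ(P, V) :=
    map_mem_nonZeroDivisors_of_flat (by algebraize [g]; exact RingHom.flat_algebraMap_iff.mpr inferInstance) (mem_nonZeroDivisors_of_ne_zero (X_ne_zero 0))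
  obtain ⟨y, hy⟩ := nonempty_basicOpen_of_mem_nonZeroDivisors hV hxV h1
  have hyη : y = η := by
    have : y ∈ ({η} : Set P) := hη ▸ trivial
    exact this
  exact (hmax (g (X 0))).mpr (Ideal.subset_span ⟨0, rfl⟩) (hyη ▸ hy)

lemma bijective_app_of_isIso (q : B ⟶ P) (U : P.Opens) [IsIso (q ∣_ U)] :
    Function.Bijective (q.app U).hom := by
  have h1 := morphismRestrict_app q U ⊤
  have h2 : IsIso (q.app (U.ι ''ᵁ ⊤)) := by
    have h3 : IsIso ((q ∣_ U).app ⊤) := inferInstance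
    rw [h1] at h3
    have h4 : IsIso (B.presheaf.map (eqToHom (image_morphismRestrict_preimage q U ⊤)).op) :=
      inferInstance
    exact @IsIso.of_isIso_comp_right _ _ _ _ _ _ _ h4 h3
  rw [Scheme.Opens.ι_image_top] at h2
  exact ConcreteCategory.bijective_of_isIso _

end AwayFromCentre

/-! ### Charts of a blown up plane along a line -/

/-- A chart of the plane along a line can be shrunk, away from a closed set that does not meet the
line, without losing points of the line. -/
lemma exists_lineChart_basicOpen {M : Scheme.{0}} (sM : M ⟶ SpecC) {U : M.Opens} (hU : IsAffineOpen U)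
    {e s : Γ(M, U)} (hes : Function.Bijective (eval₂Hom (const sM U) ![e, s])) {Z : Set M}
    (hZ : IsClosed Z) (hZe : ∀ z ∈ Z, z ∈ U → z ∈ M.basicOpen e) :
    ∃ h : Γ(M, U), (∀ z ∈ Z, z ∉ M.basicOpen h) ∧
      (∀ x ∈ U, x ∉ M.basicOpen e → x ∈ M.basicOpen h) ∧
      res (M.basicOpen_le h) e ∈ nonZeroDivisors _ ∧
      (∀ z, ∃ q : Polynomial ℂ, z - q.eval₂ (const sM _) (res (M.basicOpen_le h) s) ∈
        Ideal.span {res (M.basicOpen_le h) e}) ∧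
      (∀ q : Polynomial ℂ, q.eval₂ (const sM _) (res (M.basicOpen_le h) s) ∈
        Ideal.span {res (M.basicOpen_le h) e} → q = 0) := by
  let I := (IdealSheafData.vanishingIdeal ⟨Z, hZ⟩).ideal ⟨U, hU⟩
  have hIz : ∀ x ∈ U, (∀ a ∈ I, x ∉ M.basicOpen a) ↔ x ∈ Z := by
    intro x hx
    have h1 := IdealSheafData.mem_support_iff_of_mem (U := ⟨U, hU⟩)
      (I := IdealSheafData.vanishingIdeal ⟨Z, hZ⟩) hx
    rw [Scheme.mem_zeroLocus_iff] at h1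
    refine h1.symm.trans ?_
    rw [← SetLike.mem_coe, IdealSheafData.coe_support_vanishingIdeal]
    rfl
  have htop : I ⊔ Ideal.span {e} = ⊤ := by
    by_contra hne
    obtain ⟨m, hm, hle⟩ := Ideal.exists_le_maximal _ hne
    let p : PrimeSpectrum Γ(M, U) := ⟨m, hm.isPrime⟩
    have hpU : hU.fromSpec p ∈ U := by
      have : hU.fromSpec p ∈ Set.range hU.fromSpec := ⟨p, rfl⟩
      rwa [hU.range_fromSpec] at this
    have hpZ : hU.fromSpec p ∈ Z := (hIz _ hpU).mp fun a ha h ↦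
      (fromSpec_mem_basicOpen_iff hU a p).mp h (hle (Ideal.mem_sup_left ha))
    exact (fromSpec_mem_basicOpen_iff hU e p).mp (hZe _ hpZ hpU)
      (hle (Ideal.mem_sup_right (Ideal.mem_span_singleton_self e)))
  obtain ⟨h, hh, b, hb, hhb⟩ := Submodule.mem_sup.mp ((Ideal.eq_top_iff_one _).mp htop)
  have hh1 : ∀ k, 1 - h ^ k ∈ Ideal.span {e} := by
    intro k
    obtain ⟨d, hd⟩ := sub_dvd_pow_sub_pow 1 h k
    rw [one_pow] at hd
    rw [hd, ← hhb, add_sub_cancel_left]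
    exact Ideal.mul_mem_right _ _ hb
  let R := MvPolynomial (Fin 2) ℂ
  let ev : R →+* Γ(M, U) := eval₂Hom (const sM U) ![e, s]
  have hev0 : ev (X 0) = e := eval₂_X _ _ _
  have hmem : ∀ p : R, ev p ∈ Ideal.span {e} ↔ p ∈ Ideal.span {(X 0 : R)} := by
    intro p
    rw [Ideal.mem_span_singleton', Ideal.mem_span_singleton']
    constructor
    · rintro ⟨a, ha⟩
      obtain ⟨a', rfl⟩ := hes.2 a
      exact ⟨a', hes.1 (by rw [map_mul]; exact (congrArg _ hev0).trans ha)⟩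
    · rintro ⟨a, ha⟩
      exact ⟨ev a, by rw [← ha, map_mul, hev0]⟩
  -- reduction modulo the equation of the line
  let r₀ : R →+* Polynomial ℂ := eval₂Hom Polynomial.C ![0, Polynomial.X]
  have hev : ∀ q : Polynomial ℂ, q.eval₂ (const sM U) s = ev (q.eval₂ C (X 1)) := by
    intro q
    rw [Polynomial.hom_eval₂]
    congr 1
    · ext1 c; exact (eval₂_C (const sM U) ![e, s] c).symm
    · exact (eval₂_X (const sM U) ![e, s] 1).symm
  have hr₀ : ∀ q : Polynomial ℂ, r₀ (q.eval₂ C (X 1)) = q := by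
    intro q
    rw [Polynomial.hom_eval₂]
    have h1 : r₀.comp C = Polynomial.C := by ext1 c; exact eval₂_C _ _ c
    have h2 : r₀ (X 1) = Polynomial.X := eval₂_X _ _ _
    rw [h1, h2, Polynomial.eval₂_C_X]
  have hlift : ∀ p : R, ∃ q : Polynomial ℂ, p - q.eval₂ C (X 1) ∈ Ideal.span {(X 0 : R)} := by
    intro p
    induction p using MvPolynomial.induction_on with
    | C c => exact ⟨Polynomial.C c, by simp⟩
    | add p p' hp hp' =>
      obtain ⟨q, hq⟩ := hp
      obtain ⟨q', hq'⟩ := hp'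
      refine ⟨q + q', ?_⟩
      rw [Polynomial.eval₂_add, add_sub_add_comm]
      exact add_mem hq hq'
    | mul_X p i hp =>
      obtain ⟨q, hq⟩ := hp
      fin_cases i
      · refine ⟨0, ?_⟩
        rw [Polynomial.eval₂_zero, sub_zero]
        exact Ideal.mul_mem_left _ _ (Ideal.mem_span_singleton_self _)
      · refine ⟨q * Polynomial.X, ?_⟩
        rw [Polynomial.eval₂_mul, Polynomial.eval₂_X]
        change p * X 1 - _ ∈ _
        rw [← sub_mul]
        exact Ideal.mul_mem_right _ _ hq
  let D := M.basicOpen h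
  let ρ : Γ(M, U) →+* Γ(M, D) := res (M.basicOpen_le h)
  have hloc : IsLocalization.Away h Γ(M, D) := hU.isLocalization_basicOpen h
  have hρ : ∀ q : Polynomial ℂ, q.eval₂ (const sM D) (ρ s) = ρ (q.eval₂ (const sM U) s) := by
    intro q
    rw [Polynomial.hom_eval₂]
    congr 1
    ext c
    exact (map_const (M.basicOpen_le h) c).symm
  have hunit : ∀ k, IsUnit (ρ h ^ k) := fun k ↦
    (IsLocalization.Away.algebraMap_isUnit (S := Γ(M, D)) h).pow k
  have hρe : ∀ a ∈ Ideal.span {e}, ρ a ∈ Ideal.span {ρ e} := fun a ha ↦ by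
    have := Ideal.mem_map_of_mem ρ ha
    rwa [Ideal.map_span, Set.image_singleton] at this
  refine ⟨h, fun z hz hzh ↦ ?_, fun x hx hxe ↦ ?_, ?_, fun z ↦ ?_, fun q hq ↦ ?_⟩
  · exact (hIz z (M.basicOpen_le h hzh)).mpr hz h hh hzh
  · rw [mem_basicOpen_iff_notMem_primeIdealOf hU _ hx, not_not] at hxe
    rw [mem_basicOpen_iff_notMem_primeIdealOf hU _ hx]
    intro hxh
    refine (hU.primeIdealOf ⟨x, hx⟩).2.ne_top ((Ideal.eq_top_iff_one _).mpr ?_)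
    rw [← hhb]
    exact add_mem hxh ((Ideal.span_singleton_le_iff_mem _).mpr hxe hb)
  · refine res_mem_nonZeroDivisors hU (hU.basicOpen h) _ ?_
    rw [mem_nonZeroDivisors_iff_left]
    intro a ha
    obtain ⟨a', rfl⟩ := hes.2 a
    have h1 : ev (X 0 * a') = 0 := by rw [map_mul, hev0]; exact ha
    have h2 := (map_eq_zero_iff ev hes.1).mp h1
    rw [(mul_eq_zero.mp h2).resolve_left (X_ne_zero 0), map_zero]
  · obtain ⟨a, k, hak⟩ := exists_pow_mul_eq_map hU h z
    obtain ⟨a', rfl⟩ := hes.2 a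
    obtain ⟨q, hq⟩ := hlift a'
    refine ⟨q, ?_⟩
    have h1 : z - ρ (q.eval₂ (const sM U) s) =
        z * ρ (1 - h ^ k) + ρ (ev (a' - q.eval₂ C (X 1))) := by
      rw [hev, map_sub, map_sub, map_sub, map_one, map_pow]
      linear_combination hak
    rw [hρ, h1]
    exact add_mem (Ideal.mul_mem_left _ _ (hρe _ (hh1 k))) (hρe _ ((hmem _).mpr hq))
  · rw [hρ] at hq
    obtain ⟨b', hb'⟩ := Ideal.mem_span_singleton'.mp hq
    obtain ⟨a, k, hak⟩ := exists_pow_mul_eq_map hU h b'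
    have h1 : ρ (h ^ k * q.eval₂ (const sM U) s) = ρ (a * e) := by
      rw [map_mul, map_mul, map_pow, ← hb', ← hak]
      ring
    obtain ⟨⟨_, l, rfl⟩, hl⟩ := (IsLocalization.eq_iff_exists (.powers h) Γ(M, D)).mp h1
    have h2 : q.eval₂ (const sM U) s ∈ Ideal.span {e} := by
      have h3 : q.eval₂ (const sM U) s = (1 - h ^ (l + k)) * q.eval₂ (const sM U) s +
          h ^ l * a * e := by
        rw [pow_add]
        linear_combination hl
      rw [h3]
      exact add_mem (Ideal.mul_mem_right _ _ (hh1 _))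
        (Ideal.mul_mem_left _ _ (Ideal.mem_span_singleton_self e))
    rw [hev, hmem] at h2
    have h4 : r₀ (q.eval₂ C (X 1)) = 0 := by
      obtain ⟨d, hd⟩ := Ideal.mem_span_singleton'.mp h2
      have h5 : r₀ (X 0) = 0 := eval₂_X _ _ _
      rw [← hd, map_mul, h5, mul_zero]
    rwa [hr₀] at h4

end TreeSurfaces

namespace TreeSurfaces

open Scheme MvPolynomial

lemma isAffineOpen_preimage_of_isIso {B P : Scheme.{0}} (q : B ⟶ P) {U : P.Opens}
    (hU : IsAffineOpen U) [IsIso (q ∣_ U)] : IsAffineOpen (q ⁻¹ᵁ U) := by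
  have : IsAffine U := hU
  exact IsAffine.of_isIso (q ∣_ U)

/-! ### The two charts of a projective line -/

/-- `O 0` and `O 1`, with the coordinates `z 0` and `z 1`, are the standard charts of a projective
line, and `p i` is the point outside `O i`. -/
structure IsProjLine {L : Scheme.{0}} (sL : L ⟶ SpecC) (O : Fin 2 → L.Opens)
    (z : ∀ i, Γ(L, O i)) (p : Fin 2 → L) : Prop where
  affine : ∀ i, IsAffineOpen (O i)
  coord : ∀ i, IsLineCoord sL (O i) (z i)
  mem_iff : ∀ i y, y ∈ O i ↔ y ≠ p i
  ne : ∀ i j, i ≠ j → p i ≠ p j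
  mul : ∀ i j, i ≠ j → ∀ (W : L.Opens) (hi : W ≤ O i) (hj : W ≤ O j),
    res hi (z i) * res hj (z j) = 1

lemma IsLineCoord.isDomain {L : Scheme.{0}} {sL : L ⟶ SpecC} {O : L.Opens} {z : Γ(L, O)}
    (h : IsLineCoord sL O z) : IsDomain Γ(L, O) :=
  (RingEquiv.ofBijective _ h).symm.toMulEquiv.isDomain (Polynomial ℂ)

lemma IsLineCoord.exists_const_of_isUnit {L : Scheme.{0}} {sL : L ⟶ SpecC} {O : L.Opens}
    {z : Γ(L, O)} (h : IsLineCoord sL O z) {u : Γ(L, O)} (hu : IsUnit u) :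
    ∃ a : ℂ, a ≠ 0 ∧ u = const sL O a := by
  obtain ⟨q, rfl⟩ := h.2 u
  have h1 : IsUnit q := (MulEquiv.isUnit_map (RingEquiv.ofBijective _ h)).mp hu
  obtain ⟨a, ha, rfl⟩ := Polynomial.isUnit_iff.mp h1
  exact ⟨a, ha.ne_zero, Polynomial.eval₂_C _ _⟩

section ProjLine

variable {L : Scheme.{0}} {sL : L ⟶ SpecC} {O : Fin 2 → L.Opens} {z : ∀ i, Γ(L, O i)}
  {p : Fin 2 → L}

lemma IsProjLine.basicOpen_le (h : IsProjLine sL O z p) {i j : Fin 2} (hij : i ≠ j) :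
    L.basicOpen (z i) ≤ O j ∧ p j ∉ L.basicOpen (z i) ∧ p j ∈ O i := by
  let P : PrimeSpectrum Γ(L, O i) := ⟨Ideal.span {z i}, (h.coord i).isMaximal.isPrime⟩
  let y := (h.affine i).fromSpec P
  have hy : y ∈ O i := by
    have : y ∈ Set.range (h.affine i).fromSpec := ⟨P, rfl⟩
    rwa [(h.affine i).range_fromSpec] at this
  have hy' : y ∉ L.basicOpen (z i) := by
    rw [fromSpec_mem_basicOpen_iff, not_not]
    exact Ideal.mem_span_singleton_self _
  have hyj : y = p j := by
    by_contra hne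
    have hyj : y ∈ O j := (h.mem_iff j y).mpr hne
    have h1 := h.mul i j hij (O i ⊓ O j) inf_le_left inf_le_right
    have h2 : y ∈ L.basicOpen (res inf_le_left (z i) : Γ(L, O i ⊓ O j)) := by
      rw [Scheme.basicOpen_of_isUnit _ (IsUnit.of_mul_eq_one _ h1)]
      exact show y ∈ O i ⊓ O j from ⟨hy, hyj⟩
    exact hy' ((mem_basicOpen_res inf_le_left (z i) (show y ∈ O i ⊓ O j from ⟨hy, hyj⟩)).mp h2)
  refine ⟨fun x hx ↦ (h.mem_iff j x).mpr ?_, hyj ▸ hy', hyj ▸ hy⟩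
  rintro rfl
  exact hy' (hyj ▸ hx)

lemma IsProjLine.res_injective (h : IsProjLine sL O z p) (i : Fin 2) :
    Function.Injective (res (L.basicOpen_le (z i))) := by
  have := (h.coord i).isDomain
  have h0 : z i ≠ 0 := by
    intro h0
    have h1 : Polynomial.eval₂RingHom (const sL (O i)) (z i) Polynomial.X = 0 :=
      (Polynomial.eval₂_X _ _).trans h0
    exact Polynomial.X_ne_zero ((map_eq_zero_iff _ (h.coord i).1).mp h1)
  have := (h.affine i).isLocalization_basicOpen (z i)
  exact IsLocalization.injective (M := .powers (z i)) Γ(L, L.basicOpen (z i))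
    (powers_le_nonZeroDivisors_of_noZeroDivisors h0)

/-- A global function on the projective line is constant. -/
lemma IsProjLine.exists_const (h : IsProjLine sL O z p) (c : ∀ i, Γ(L, O i))
    (hc : ∀ i j, ∀ (W : L.Opens) (hi : W ≤ O i) (hj : W ≤ O j), res hi (c i) = res hj (c j)) :
    ∃ a : ℂ, ∀ i, c i = const sL (O i) a := by
  have key : ∀ i j, i ≠ j → ∃ a, c i = const sL (O i) a := by
    intro i j hij
    obtain ⟨P, hP⟩ := (h.coord i).2 (c i)
    obtain ⟨Q, hQ⟩ := (h.coord j).2 (c j)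
    let D := L.basicOpen (z i)
    have hi : D ≤ O i := L.basicOpen_le _
    have hj : D ≤ O j := (h.basicOpen_le hij).1
    let κ := const sL D
    have hres : ∀ k (hk : D ≤ O k) (q : Polynomial ℂ),
        res hk (Polynomial.eval₂RingHom (const sL (O k)) (z k) q) = q.eval₂ κ (res hk (z k)) := by
      intro k hk q
      change res hk (q.eval₂ _ _) = _
      rw [Polynomial.hom_eval₂]
      congr 1
      ext a
      exact map_const hk a
    have h1 := hc i j D hi hj
    rw [← hP, ← hQ, hres, hres] at h1
    have h2 := h.mul i j hij D hi hj
    let u : Γ(L, D)ˣ := ⟨res hj (z j), res hi (z i), by rw [mul_comm]; exact h2, h2⟩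
    have h3 : (Polynomial.X ^ Q.natDegree * P).eval₂ κ (res hi (z i)) =
        Q.reverse.eval₂ κ (res hi (z i)) := by
      let := u.invertible
      have h4 := Polynomial.eval₂_reverse_mul_pow (i := κ) (x := (u : Γ(L, D))) (f := Q)
      have h5 : ⅟(u : Γ(L, D)) = res hi (z i) := invOf_eq_left_inv h2
      have h6 : res hi (z i) ^ Q.natDegree * (u : Γ(L, D)) ^ Q.natDegree = 1 := by
        rw [← mul_pow]
        exact (congrArg (· ^ _) h2).trans (one_pow _)
      rw [h5] at h4
      rw [Polynomial.eval₂_mul, Polynomial.eval₂_X_pow, h1]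
      change _ * Polynomial.eval₂ κ (u : Γ(L, D)) Q = _
      rw [← h4]
      linear_combination (Polynomial.eval₂ κ (res hi (z i)) Q.reverse) * h6
    rw [← hres i hi, ← hres i hi] at h3
    have h4 := (h.coord i).1 (h.res_injective i h3)
    have h5 : P.natDegree = 0 := by
      by_contra hne
      have hP0 : P ≠ 0 := by rintro rfl; simp at hne
      have h6 := congrArg Polynomial.natDegree h4
      rw [Polynomial.natDegree_X_pow_mul _ hP0] at h6
      have := Polynomial.reverse_natDegree_le Q
      omega
    refine ⟨P.coeff 0, ?_⟩
    rw [← hP, Polynomial.eq_C_of_natDegree_eq_zero h5, Polynomial.coeff_C_zero]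
    exact Polynomial.eval₂_C _ _
  obtain ⟨a, ha⟩ := key 0 1 (by decide)
  refine ⟨a, fun i ↦ ?_⟩
  fin_cases i
  · exact ha
  · apply h.res_injective 1
    have hj : L.basicOpen (z 1) ≤ O 0 := (h.basicOpen_le (by decide)).1
    have h1 := hc 1 0 _ (L.basicOpen_le (z 1)) hj
    rw [ha] at h1
    exact (h1.trans (map_const hj a)).trans (map_const (L.basicOpen_le (z 1)) a).symm

/-- Two systems of standard coordinates with the same points at infinity differ by constants. -/
lemma IsProjLine.exists_smul (h : IsProjLine sL O z p) {z' : ∀ i, Γ(L, O i)}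
    (h' : IsProjLine sL O z' p) :
    ∃ a : Fin 2 → ℂ, a 0 * a 1 = 1 ∧ ∀ i, z i = const sL (O i) (a i) * z' i := by
  have := (h.coord 1).isDomain
  have hp := (h.basicOpen_le (i := 1) (j := 0) (by decide)).2.2
  have hspan : ∀ {w : ∀ i, Γ(L, O i)}, IsProjLine sL O w p →
      Ideal.span {w 1} = ((h.affine 1).primeIdealOf ⟨p 0, hp⟩).asIdeal := by
    intro w hw
    apply (hw.coord 1).isMaximal.eq_of_le ((h.affine 1).primeIdealOf ⟨p 0, hp⟩).2.ne_top
    rw [Ideal.span_singleton_le_iff_mem]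
    by_contra hn
    exact (hw.basicOpen_le (i := 1) (j := 0) (by decide)).2.1
      ((mem_basicOpen_iff_notMem_primeIdealOf (h.affine 1) _ hp).mpr hn)
  obtain ⟨u, hu⟩ := Ideal.span_singleton_eq_span_singleton.mp ((hspan h').trans (hspan h).symm)
  obtain ⟨a, ha, hua⟩ := (h.coord 1).exists_const_of_isUnit u.isUnit
  refine ⟨![a⁻¹, a], by simp [ha], fun i ↦ ?_⟩
  have h1 : z 1 = const sL (O 1) a * z' 1 := by rw [← hu, hua, mul_comm]
  fin_cases i
  · apply h.res_injective 0
    have hj := (h.basicOpen_le (i := 0) (j := 1) (by decide)).1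
    have hi := L.basicOpen_le (z 0)
    have h2 := h.mul 0 1 (by decide) _ hi hj
    have h3 := h'.mul 0 1 (by decide) _ hi hj
    rw [h1, map_mul, map_const hj] at h2
    have h4 : const sL (L.basicOpen (z 0)) a⁻¹ * const sL (L.basicOpen (z 0)) a = 1 := by
      rw [← map_mul, inv_mul_cancel₀ ha, map_one]
    change res hi (z 0) = res hi (const sL (O 0) a⁻¹ * z' 0)
    rw [map_mul, map_const hi]
    linear_combination const sL (L.basicOpen (z 0)) a⁻¹ * res hi (z' 0) * h2 - res hi (z 0) * h3
      - res hi (z 0) * res hj (z' 1) * res hi (z' 0) * h4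
  · exact h1

end ProjLine

lemma eq_of_forall_mem_nhds {X : Scheme.{0}} {U : X.Opens} (s t : Γ(X, U))
    (h : ∀ x ∈ U, ∃ (V : X.Opens) (hV : V ≤ U), x ∈ V ∧ res hV s = res hV t) : s = t := by
  choose V hV hx hst using fun x : U ↦ h x.1 x.2
  exact TopCat.Sheaf.eq_of_locally_eq' X.sheaf V U (fun x ↦ homOfLE (hV x))
    (fun x hxU ↦ Opens.mem_iSup.mpr ⟨⟨x, hxU⟩, hx _⟩) s t hst

lemma isProjLine_of_lineCharts {L M : Scheme.{0}} {sM : M ⟶ SpecC} {lam : L ⟶ M}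
    [IsClosedImmersion lam] {U : Fin 2 → M.Opens} {e s : ∀ i, Γ(M, U i)}
    (h : ∀ i, LineChart sM lam (U i) (e i) (s i)) {p : Fin 2 → L}
    (hp : ∀ i y, lam y ∈ U i ↔ y ≠ p i) (hne : ∀ i j, i ≠ j → p i ≠ p j)
    (hmul : ∀ i j, i ≠ j → ∀ (W : M.Opens) (_ : IsAffineOpen W) (hi : W ≤ U i) (hj : W ≤ U j),
      res hi (s i) * res hj (s j) = 1) :
    IsProjLine (lam ≫ sM) (fun i ↦ lam ⁻¹ᵁ U i) (fun i ↦ (lam.app (U i)).hom (s i)) p where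
  affine i := (h i).affine.preimage lam
  coord i := (h i).isLineCoord
  mem_iff := hp
  ne := hne
  mul i j hij W hi hj := by
    apply eq_of_forall_mem_nhds
    intro y hy
    obtain ⟨V, hV, hyV, hVU⟩ := exists_isAffineOpen_mem_and_subset (x := lam y)
      (U := U i ⊓ U j) ⟨hi hy, hj hy⟩
    have hVi : V ≤ U i := fun x hx ↦ (hVU hx).1
    have hVj : V ≤ U j := fun x hx ↦ (hVU hx).2
    have h1 := congrArg (lam.appLE V (W ⊓ lam ⁻¹ᵁ V) inf_le_right).hom (hmul i j hij V hV hVi hVj)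
    refine ⟨W ⊓ lam ⁻¹ᵁ V, inf_le_left, ⟨hy, hyV⟩, ?_⟩
    have key : ∀ k (hk : W ≤ lam ⁻¹ᵁ U k) (hVk : V ≤ U k),
        res (inf_le_left : W ⊓ lam ⁻¹ᵁ V ≤ W) (res hk ((lam.app (U k)).hom (s k))) =
        (lam.appLE V (W ⊓ lam ⁻¹ᵁ V) inf_le_right).hom (res hVk (s k)) := by
      intro k hk hVk
      rw [res_res, ← Scheme.Hom.appLE_eq_app]
      have h2 := Scheme.Hom.appLE_map lam (le_refl (lam ⁻¹ᵁ U k)) (homOfLE (inf_le_left.trans hk :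
        W ⊓ lam ⁻¹ᵁ V ≤ lam ⁻¹ᵁ U k)).op
      have h3 := Scheme.Hom.map_appLE lam (inf_le_right : W ⊓ lam ⁻¹ᵁ V ≤ lam ⁻¹ᵁ V) (homOfLE hVk).op
      exact (congr(($h2).hom (s k))).trans (congr(($h3).hom (s k))).symm
    rw [map_mul, map_one] at h1
    rw [map_mul, map_one]
    exact (congrArg₂ (· * ·) (key i hi hVi) (key j hj hVj)).trans h1

/-! ### Transition functions along a line in a blown up plane -/

/-- The analogue of `IsBlowupCoord.exists_charts` for a line in the plane. The transition functions
of the equations are those of `𝒪(1)`. -/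
lemma exists_line_charts {B L : Scheme.{0}} (q : B ⟶ PSpace 2) {Z : Set (PSpace 2)}
    (hZ : IsClosed Z)
    (hq : ∀ V : (PSpace 2).Opens, (∀ z ∈ Z, z ∉ V) → IsIso (q ∣_ V)) {l : Set (PSpace 2)}
    (hl : IsLine l) (hZl : ∀ z ∈ Z, z ∉ l) (lam : L ⟶ B) [IsClosedImmersion lam] [IsReduced L]
    (hlam : Set.range lam = q ⁻¹' l) :
    ∃ (U : Fin 2 → B.Opens) (f t : ∀ i, Γ(B, U i)) (p : Fin 2 → L),
      (∀ i, LineChart (q ≫ PSpace.toC 2) lam (U i) (f i) (t i)) ∧ (∀ i, IsClosed {p i}) ∧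
      (∀ i j, i ≠ j → p i ≠ p j) ∧ (∀ i y, lam y ∈ U i ↔ y ≠ p i) ∧
      ∀ i j, i ≠ j → ∀ (W : B.Opens) (_ : IsAffineOpen W) (hi : W ≤ U i) (hj : W ≤ U j),
        res hi (t i) * res hj (t j) = 1 ∧ res hj (f j) = res hj (t j) * res hi (f i) := by
  obtain ⟨U, e, s, hU, hes, hel, hcov, hs, htr⟩ := exists_plane_charts l hl
  choose h hZh hle hnzd hex hz using fun i ↦ exists_lineChart_basicOpen (PSpace.toC 2) (hU i)
    (hes i) hZ fun z hzZ hzU ↦ by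
      by_contra hn
      exact hZl z hzZ ((hel i z hzU).mpr hn)
  let D : Fin 2 → (PSpace 2).Opens := fun i ↦ (PSpace 2).basicOpen (h i)
  have hD : ∀ i, D i ≤ U i := fun i ↦ (PSpace 2).basicOpen_le _
  have hiso : ∀ i, IsIso (q ∣_ D i) := fun i ↦ hq _ (hZh i)
  have hDa : ∀ i, IsAffineOpen (D i) := fun i ↦ (hU i).basicOpen _
  let ρ : ∀ i, Γ(PSpace 2, D i) →+* Γ(B, q ⁻¹ᵁ D i) := fun i ↦ (q.app (D i)).hom
  have hρ : ∀ i, Function.Bijective (ρ i) := fun i ↦ bijective_app_of_isIso q (D i)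
  have hev : ∀ i (w : Γ(PSpace 2, D i)) (r : Polynomial ℂ),
      r.eval₂ (const (q ≫ PSpace.toC 2) _) (ρ i w) = ρ i (r.eval₂ (const (PSpace.toC 2) _) w) := by
    intro i w r
    rw [Polynomial.hom_eval₂]
    congr 1
    ext c
    have := appLE_const q rfl (sY := PSpace.toC 2) (U := D i) (V := q ⁻¹ᵁ D i) le_rfl c
    rw [Scheme.Hom.appLE_eq_app] at this
    exact this.symm
  let f : ∀ i, Γ(B, q ⁻¹ᵁ D i) := fun i ↦ ρ i (res (hD i) (e i))
  let t : ∀ i, Γ(B, q ⁻¹ᵁ D i) := fun i ↦ ρ i (res (hD i) (s i))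
  have hmem : ∀ i (a : Γ(PSpace 2, D i)), ρ i a ∈ Ideal.span {f i} ↔
      a ∈ Ideal.span {res (hD i) (e i)} := by
    intro i a
    rw [Ideal.mem_span_singleton', Ideal.mem_span_singleton']
    constructor
    · rintro ⟨b, hb⟩
      obtain ⟨b', rfl⟩ := (hρ i).2 b
      exact ⟨b', (hρ i).1 (by rw [map_mul]; exact hb)⟩
    · rintro ⟨b, rfl⟩
      exact ⟨ρ i b, by rw [map_mul]⟩
  have h1 : ∀ i (w : Γ(B, q ⁻¹ᵁ D i)), ∃ r : Polynomial ℂ,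
      w - r.eval₂ (const (q ≫ PSpace.toC 2) _) (t i) ∈ Ideal.span {f i} := by
    intro i w
    obtain ⟨w, rfl⟩ := (hρ i).2 w
    obtain ⟨r, hr⟩ := hex i w
    refine ⟨r, ?_⟩
    rw [hev, ← map_sub, hmem]
    exact hr
  have h2 : ∀ i (r : Polynomial ℂ),
      r.eval₂ (const (q ≫ PSpace.toC 2) _) (t i) ∈ Ideal.span {f i} → r = 0 := by
    intro i r hr
    rw [hev, hmem] at hr
    exact hz i r hr
  have hchart : ∀ i, LineChart (q ≫ PSpace.toC 2) lam (q ⁻¹ᵁ D i) (f i) (t i) := by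
    intro i
    have hA : IsAffineOpen (q ⁻¹ᵁ D i) := isAffineOpen_preimage_of_isIso q (hDa i)
    refine ⟨hA, ?_, map_mem_nonZeroDivisors_of_flat (RingHom.Flat.of_bijective (hρ i)) (hnzd i),
      h1 i, h2 i⟩
    refine ker_ideal_eq_of_isRadical lam hA (isRadical_of_exists_eval (h1 i) (h2 i)) fun y hy ↦ ?_
    rw [forall_mem_span_singleton_notMem_basicOpen, hlam, mem_basicOpen_app]
    exact (hel i (q y) (hD i hy)).trans (mem_basicOpen_res (hD i) (e i) hy).not.symm
  have hql : ∀ y : L, q (lam y) ∈ l := fun y ↦ by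
    have : lam y ∈ q ⁻¹' l := hlam ▸ ⟨y, rfl⟩
    exact this
  have hDU : ∀ i (y : L), lam y ∈ q ⁻¹ᵁ D i ↔ q (lam y) ∈ U i := fun i y ↦
    ⟨fun hy ↦ hD i hy, fun hy ↦ hle i _ hy ((hel i _ hy).mp (hql y))⟩
  have hcov' : ∀ i j, i ≠ j → ∀ y : L, lam y ∈ q ⁻¹ᵁ D i ∨ lam y ∈ q ⁻¹ᵁ D j := by
    intro i j hij y
    obtain ⟨k, hk⟩ := hcov _ (hql y)
    have : k = i ∨ k = j := by omega
    rcases this with rfl | rfl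
    · exact .inl ((hDU _ y).mpr hk)
    · exact .inr ((hDU _ y).mpr hk)
  have hpt : ∀ i, ∃ p : L, IsClosed {p} ∧ ∀ y, y ∈ lam ⁻¹ᵁ (q ⁻¹ᵁ D i) ↔ y ≠ p := by
    intro i
    obtain ⟨j, hij⟩ : ∃ j : Fin 2, i ≠ j := ⟨1 - i, by fin_cases i <;> decide⟩
    refine exists_compl_singleton ((hchart j).affine.preimage lam) (hchart j).isLineCoord
      (hcov' i j hij) fun y hy ↦ ?_
    rw [mem_basicOpen_app, mem_basicOpen_app]
    refine (mem_basicOpen_res (hD j) (s j) hy).trans ?_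
    rw [hs j i hij.symm]
    exact ⟨fun h ↦ (hDU i y).mpr h.2, fun h ↦ ⟨(hDU j y).mp hy, (hDU i y).mp h⟩⟩
  choose p hpc hp using hpt
  refine ⟨_, f, t, p, hchart, hpc, fun i j hij hpp ↦ ?_, hp, fun i j hij W _ hi hj ↦ ?_⟩
  · rcases hcov' i j hij (p i) with h | h
    · exact (hp i _).mp h rfl
    · exact (hp j _).mp h hpp
  · have hW : W ≤ q ⁻¹ᵁ (U i ⊓ U j) := fun x hx ↦ ⟨hD i (hi hx), hD j (hj hx)⟩
    have key : ∀ k (hk : W ≤ q ⁻¹ᵁ D k) (hk' : U i ⊓ U j ≤ U k) (a : Γ(PSpace 2, U k)),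
        res hk (ρ k (res (hD k) a)) = (q.appLE (U i ⊓ U j) W hW).hom (res hk' a) := by
      intro k hk hk' a
      have h2 := Scheme.Hom.appLE_map q (le_refl (q ⁻¹ᵁ D k)) (homOfLE hk).op
      rw [Scheme.Hom.appLE_eq_app] at h2
      have h3 := Scheme.Hom.map_appLE q hk (homOfLE (hD k)).op
      have h4 := Scheme.Hom.map_appLE q hW (homOfLE hk').op
      exact ((congr(($h2).hom (res (hD k) a))).trans (congr(($h3).hom a))).trans
        (congr(($h4).hom a)).symm
    obtain ⟨h1, h2⟩ := htr i j hij (U i ⊓ U j) inf_le_left inf_le_right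
    obtain ⟨-, h3⟩ := htr i j hij (U i ⊓ U j) inf_le_left inf_le_right
    rw [key i hi inf_le_left, key j hj inf_le_right, key j hj inf_le_right, key i hi inf_le_left,
      ← map_mul, ← map_mul, h1, map_one, h2]
    exact ⟨rfl, rfl⟩

end TreeSurfaces

namespace TreeSurfaces

open Scheme MvPolynomial

/-! ### Matching charts on the two sides of an intersection line -/

/-- Two surfaces `A` and `B` containing the same projective line `L`. The charts of the two surfaces
along the line induce the same standard charts of the line, with the same coordinates, and the
product of the transition functions of the two equations of the line is `1` on the line. -/
structure GluedCharts {A B L : Scheme.{0}} (sA : A ⟶ SpecC) (sB : B ⟶ SpecC) (lamA : L ⟶ A)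
    (lamB : L ⟶ B) (U : Fin 2 → A.Opens) (V : Fin 2 → B.Opens) (e s : ∀ i, Γ(A, U i))
    (f t : ∀ i, Γ(B, V i)) (p : Fin 2 → L) : Prop where
  chartA : ∀ i, LineChart sA lamA (U i) (e i) (s i)
  chartB : ∀ i, LineChart sB lamB (V i) (f i) (t i)
  mem_iff : ∀ i y, lamA y ∈ U i ↔ lamB y ∈ V i
  coord : ∀ i (W : L.Opens) (hW : W ≤ lamA ⁻¹ᵁ U i) (hW' : W ≤ lamB ⁻¹ᵁ V i),
    (lamA.appLE _ W hW).hom (s i) = (lamB.appLE _ W hW').hom (t i)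
  transA : ∀ i j, i ≠ j → ∀ (W : A.Opens) (_ : IsAffineOpen W) (hi : W ≤ U i) (hj : W ≤ U j),
    res hj (e j) = res hi (s i) * res hi (e i)
  transB : ∀ i j, i ≠ j → ∀ (W : B.Opens) (_ : IsAffineOpen W) (hi : W ≤ V i) (hj : W ≤ V j),
    res hj (f j) = res hj (t j) * res hi (f i)
  proj : IsProjLine (lamA ≫ sA) (fun i ↦ lamA ⁻¹ᵁ U i) (fun i ↦ (lamA.app (U i)).hom (s i)) p

lemma LineChart.smul {L M : Scheme.{0}} {sM : M ⟶ SpecC} {lam : L ⟶ M} {U : M.Opens}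
    {e s : Γ(M, U)} (h : LineChart sM lam U e s) {a b : ℂ} (ha : a ≠ 0) (hb : b ≠ 0) :
    LineChart sM lam U (const sM U b * e) (const sM U a * s) := by
  have hbu : IsUnit (const sM U b) := (IsUnit.mk0 b hb).map _
  have hspan : Ideal.span {const sM U b * e} = Ideal.span {e} :=
    Ideal.span_singleton_mul_left_unit hbu e
  have hev : ∀ (c : ℂ) (w : Γ(M, U)) (q : Polynomial ℂ),
      (q.comp (Polynomial.C c * Polynomial.X)).eval₂ (const sM U) w =
        q.eval₂ (const sM U) (const sM U c * w) := by
    intro c w q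
    rw [Polynomial.eval₂_comp]
    simp
  refine ⟨h.affine, by rw [hspan, h.ker], mul_mem hbu.mem_nonZeroDivisors h.nzd, fun z ↦ ?_,
    fun q hq ↦ ?_⟩
  · obtain ⟨q, hq⟩ := h.exists_eval z
    refine ⟨q.comp (Polynomial.C a⁻¹ * Polynomial.X), ?_⟩
    rw [hev, hspan, ← mul_assoc, ← map_mul, inv_mul_cancel₀ ha, map_one, one_mul]
    exact hq
  · rw [hspan, ← hev] at hq
    have h1 := h.eq_zero _ hq
    have h2 := congrArg (fun r ↦ r.comp (Polynomial.C a⁻¹ * Polynomial.X)) h1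
    simpa [Polynomial.comp_assoc, ← mul_assoc, ← Polynomial.C_mul, ha] using h2

lemma IsProjLine.congr {L : Scheme.{0}} {sL : L ⟶ SpecC} {O : Fin 2 → L.Opens}
    {z : ∀ i, Γ(L, O i)} {p : Fin 2 → L} (h : IsProjLine sL O z p) {O' : Fin 2 → L.Opens}
    (hO : ∀ i, O' i = O i) : IsProjLine sL O' (fun i ↦ res (hO i).le (z i)) p := by
  obtain rfl : O' = O := funext hO
  have : (fun i ↦ res (hO i).le (z i)) = z := by
    funext i
    exact congr($(L.presheaf.map_id _) (z i))
  rw [this]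
  exact h

namespace TreeSurface

variable {T : Type} [PartialOrder T] [OrderBot T] {S X : Scheme.{0}} {sS : S ⟶ SpecC}
  {sX : X ⟶ SpecC} {σ : X ⟶ S} (ts : TreeSurface T sS sX σ)

/-- The centre of the blowup of the vertex `a`. -/
def centre (a : T) : Set (ts.P a) := {x | ∃ (b : T) (h : a ⋖ b), x = ts.pt h}

lemma isClosed_singleton_of_mem_centre {a : T} {z : ts.P a} (hz : z ∈ ts.centre a) :
    IsClosed {z} := by
  obtain ⟨b, h, rfl⟩ := hz
  exact ts.isClosed_pt h

lemma finite_centre (hT : IsTree T) (a : T) : (ts.centre a).Finite := by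
  have := hT.finite
  let φ : {b : T // a ⋖ b} → ts.P a := fun b ↦ ts.pt b.2
  refine (Set.finite_range φ).subset ?_
  rintro _ ⟨b, h, rfl⟩
  exact ⟨⟨b, h⟩, rfl⟩

lemma isClosed_centre (hT : IsTree T) (a : T) : IsClosed (ts.centre a) := by
  rw [← Set.biUnion_of_singleton (ts.centre a)]
  exact (ts.finite_centre hT a).isClosed_biUnion fun z hz ↦ ts.isClosed_singleton_of_mem_centre hz

lemma smoothOfRelativeDimension_toC (hS : IsSmoothProjectiveSurface sS) (a : T) :
    SmoothOfRelativeDimension 2 (ts.toC a) := by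
  by_cases ha : a = ⊥
  · subst ha
    rw [← ts.rootIso_over]
    have := hS.smooth
    exact (inferInstance : SmoothOfRelativeDimension (0 + 2) (ts.rootIso.hom ≫ sS))
  · rw [← ts.planeIso_over a ha]
    have := smoothOfRelativeDimension_plane
    exact (inferInstance : SmoothOfRelativeDimension (0 + 2) ((ts.planeIso a ha).hom ≫ PSpace.toC 2))

lemma irreducibleSpace_P (hS : IsSmoothProjectiveSurface sS) (a : T) :
    IrreducibleSpace (ts.P a) := by
  by_cases ha : a = ⊥
  · subst ha
    have := hS.integral
    have h1 : IrreducibleSpace S := inferInstance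
    have : Nonempty (ts.P ⊥) := ⟨ts.rootIso.inv (Nonempty.some h1.toNonempty)⟩
    exact ts.rootIso.hom.isOpenEmbedding.irreducibleSpace
  · have h1 : IrreducibleSpace (PSpace 2) := inferInstance
    have : Nonempty (ts.P a) := ⟨(ts.planeIso a ha).inv (Nonempty.some h1.toNonempty)⟩
    exact (ts.planeIso a ha).hom.isOpenEmbedding.irreducibleSpace

lemma irreducibleSpace_comp (hS : IsSmoothProjectiveSurface sS) (hT : IsTree T) (a : T) :
    IrreducibleSpace (ts.comp a) := by
  have := ts.irreducibleSpace_P hS a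
  have := ts.smoothOfRelativeDimension_toC hS a
  exact (ts.isBlowup a).irreducibleSpace (ts.isClosed_centre hT a)
    (exists_notMem_of_forall_isClosed (ts.toC a) fun z ↦ ts.isClosed_singleton_of_mem_centre)

/-- Charts of two adjacent components along the line in which they meet. -/
lemma exists_gluedCharts (hS : IsSmoothProjectiveSurface sS) (hT : IsTree T) {a b : T} (h : a ⋖ b) :
    ∃ U V e s f t p, GluedCharts (ts.incl a ≫ sX) (ts.incl b ≫ sX)
      (pullback.fst (ts.incl a) (ts.incl b)) (pullback.snd (ts.incl a) (ts.incl b))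
      U V e s f t p := by
  have hb : b ≠ ⊥ := ne_bot_of_gt h.lt
  have := ts.isClosedImmersion_incl a
  have := ts.isClosedImmersion_incl b
  have := ts.isReduced_inter h
  have := ts.smoothOfRelativeDimension_toC hS a
  let lamA := pullback.fst (ts.incl a) (ts.incl b)
  let lamB := pullback.snd (ts.incl a) (ts.incl b)
  have hcond : lamA ≫ ts.incl a = lamB ≫ ts.incl b := pullback.condition
  let φ := ts.planeIso b hb
  obtain ⟨l, hl, hline⟩ := ts.isLine b hb
  have hinv : ∀ z, φ.hom (φ.inv z) = z := fun z ↦ by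
    rw [← Scheme.Hom.comp_apply, φ.inv_hom_id]; rfl
  have hZ : IsClosed (φ.inv ⁻¹' ts.centre b) := (ts.isClosed_centre hT b).preimage φ.inv.continuous
  obtain ⟨V, f, t, p, hchB, hpc, hne, hpB, htB⟩ := exists_line_charts (ts.blow b ≫ φ.hom) hZ
    (fun V hV ↦ by
      rw [morphismRestrict_comp]
      have := (ts.isBlowup b).isIso_morphismRestrict (φ.hom ⁻¹ᵁ V) fun z hz hzV ↦
        hV (φ.hom z) (by
          change φ.inv (φ.hom z) ∈ ts.centre b
          rw [← Scheme.Hom.comp_apply, φ.hom_inv_id]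
          exact hz) hzV
      have h2 : IsIso (φ.hom ∣_ V) := inferInstance
      exact @IsIso.comp_isIso _ _ _ _ _ _ _ this h2) hl
    (fun z hz hzl ↦ by
      obtain ⟨c, hc, hzc⟩ : φ.inv z ∈ ts.centre b := hz
      refine ts.pt_notMem_line hc hb ?_
      rw [hline, ← hzc]
      change φ.hom (φ.inv z) ∈ l
      rwa [hinv]) lamB (by
      rw [ts.range_snd h, hline]
      rfl)
  rw [Category.assoc, ts.planeIso_over, ← ts.incl_over] at hchB
  obtain ⟨W, g, hg⟩ := exists_isBlowupCoord (ts.isBlowup a) (ts.finite_centre hT a)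
    (fun z ↦ ts.isClosed_singleton_of_mem_centre) (ts.toC a) (x := ts.pt h) ⟨b, h, rfl⟩
  obtain ⟨U, e, s, hchA, hpA, htA⟩ := hg.exists_charts lamA (ts.range_fst h) p hpc hne
  rw [← ts.incl_over] at hchA
  have hprojA := isProjLine_of_lineCharts hchA hpA hne fun i j hij W hW hi hj ↦
    (htA i j hij W hW hi hj).1
  have hprojB := isProjLine_of_lineCharts hchB hpB hne fun i j hij W hW hi hj ↦
    (htB i j hij W hW hi hj).1
  have hs : lamB ≫ ts.incl b ≫ sX = lamA ≫ ts.incl a ≫ sX := by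
    rw [← Category.assoc, ← hcond, Category.assoc]
  rw [hs] at hprojB
  have hO : ∀ i, lamA ⁻¹ᵁ U i = lamB ⁻¹ᵁ V i := by
    intro i
    ext y
    exact (hpA i y).trans (hpB i y).symm
  obtain ⟨r, hr, hz⟩ := hprojA.exists_smul (hprojB.congr hO)
  have hr0 : ∀ i, r i ≠ 0 := by
    intro i
    fin_cases i
    · exact left_ne_zero_of_mul_eq_one hr
    · exact right_ne_zero_of_mul_eq_one hr
  let r' : Fin 2 → ℂ := ![1, r 1]
  have hr' : ∀ i j, i ≠ j → r' j = r j * r' i := by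
    intro i j hij
    fin_cases i <;> fin_cases j <;> simp_all [r']
  have hr'0 : ∀ i, r' i ≠ 0 := by
    intro i
    fin_cases i
    · exact one_ne_zero
    · exact hr0 1
  refine ⟨U, V, e, s, fun i ↦ const (ts.incl b ≫ sX) (V i) (r' i) * f i,
    fun i ↦ const (ts.incl b ≫ sX) (V i) (r i) * t i, p, hchA, fun i ↦ (hchB i).smul (hr0 i) (hr'0 i),
    fun i y ↦ (hpA i y).trans (hpB i y).symm, fun i W hW hW' ↦ ?_,
    fun i j hij W hW hi hj ↦ (htA i j hij W hW hi hj).2, fun i j hij W hW hi hj ↦ ?_, hprojA⟩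
  · have h1 := congrArg (res hW) (hz i)
    rw [map_mul, map_const hW] at h1
    have h2 := Scheme.Hom.appLE_map lamA (le_refl (lamA ⁻¹ᵁ U i)) (homOfLE hW).op
    rw [Scheme.Hom.appLE_eq_app] at h2
    have h3 := Scheme.Hom.appLE_map lamB (le_refl (lamB ⁻¹ᵁ V i)) (homOfLE hW').op
    rw [Scheme.Hom.appLE_eq_app] at h3
    refine (congr(($h2).hom (s i))).symm.trans (h1.trans ?_)
    rw [map_mul]
    refine congrArg₂ (· * ·) ?_ ?_
    · exact (appLE_const lamB hs hW' (r i)).symm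
    · rw [res_res]
      exact congr(($h3).hom (t i))
  · have h1 := (htB i j hij W hW hi hj).2
    rw [map_mul, map_mul, map_mul, map_const hi, map_const hj, map_const hj, h1, hr' i j hij, map_mul]
    ring

/-! ### The components of a tree of surfaces -/

include ts in
lemma nonempty_comp (hS : IsSmoothProjectiveSurface sS) (hT : IsTree T) (a : T) :
    Nonempty (ts.comp a) :=
  (ts.irreducibleSpace_comp hS hT a).toNonempty

end TreeSurface

lemma LineChart.not_surjective {L M : Scheme.{0}} {sM : M ⟶ SpecC} {lam : L ⟶ M}
    [IsClosedImmersion lam] {U : M.Opens} {e s : Γ(M, U)} (h : LineChart sM lam U e s) {y : L}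
    (hy : lam y ∈ U) : ∃ x, x ∉ Set.range lam := by
  obtain ⟨x, hx⟩ := nonempty_basicOpen_of_mem_nonZeroDivisors h.affine hy h.nzd
  refine ⟨x, ?_⟩
  rintro ⟨w, rfl⟩
  have h1 : (lam.app U).hom e = 0 := by
    rw [← RingHom.mem_ker]
    have h2 := h.ker
    rw [lam.ker_apply ⟨U, h.affine⟩] at h2
    exact h2 ▸ Ideal.mem_span_singleton_self e
  have h2 := (mem_basicOpen_app lam e w).mpr hx
  rw [h1, Scheme.basicOpen_zero] at h2
  exact h2

lemma IsTree.eq_of_covBy {T : Type} [PartialOrder T] [OrderBot T] (hT : IsTree T) {a a' b : T}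
    (h : a ⋖ b) (h' : a' ⋖ b) : a = a' :=
  (hT.pred b (ne_bot_of_gt h.lt)).unique h h'

namespace TreeSurface

variable {T : Type} [PartialOrder T] [OrderBot T] {S X : Scheme.{0}} {sS : S ⟶ SpecC}
  {sX : X ⟶ SpecC} {σ : X ⟶ S} (ts : TreeSurface T sS sX σ)

include ts in
lemma covBy_or_covBy {a b : T} (hab : a ≠ b) {x : X} (hxa : x ∈ Set.range (ts.incl a))
    (hxb : x ∈ Set.range (ts.incl b)) : a ⋖ b ∨ b ⋖ a := by
  by_contra! h
  exact (ts.disjoint a b hab h.1 h.2).le_bot ⟨hxa, hxb⟩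

/-- No point lies on three components. -/
lemma eq_or_eq_of_mem_range (hT : IsTree T) {a b c : T} (h : a ⋖ b) {x : X}
    (hxa : x ∈ Set.range (ts.incl a)) (hxb : x ∈ Set.range (ts.incl b))
    (hxc : x ∈ Set.range (ts.incl c)) : c = a ∨ c = b := by
  by_contra! hne
  rcases ts.covBy_or_covBy hne.2 hxc hxb with h1 | h1
  · exact hne.1 (hT.eq_of_covBy h1 h)
  · rcases ts.covBy_or_covBy hne.1 hxc hxa with h2 | h2
    · exact (h2.lt.trans (h.lt.trans h1.lt)).false
    · exact h.lt.ne (hT.eq_of_covBy h2 h1)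

lemma mem_range_inter_iff (a b : T) (z : ts.comp a) :
    z ∈ Set.range (pullback.fst (ts.incl a) (ts.incl b)) ↔ ts.incl a z ∈ Set.range (ts.incl b) := by
  rw [Scheme.Pullback.range_fst]
  rfl

lemma mem_range_inter_iff' (a b : T) (z : ts.comp b) :
    z ∈ Set.range (pullback.snd (ts.incl a) (ts.incl b)) ↔ ts.incl b z ∈ Set.range (ts.incl a) := by
  rw [Scheme.Pullback.range_snd]
  rfl

lemma eq_of_range_subset (hS : IsSmoothProjectiveSurface sS) (hT : IsTree T) {a b : T}
    (h : Set.range (ts.incl a) ⊆ Set.range (ts.incl b)) : a = b := by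
  by_contra hab
  obtain ⟨z⟩ := ts.nonempty_comp hS hT a
  have := ts.isClosedImmersion_incl a
  have := ts.isClosedImmersion_incl b
  rcases ts.covBy_or_covBy hab ⟨z, rfl⟩ (h ⟨z, rfl⟩) with h1 | h1
  · obtain ⟨U, V, e, s, f, t, p, hg⟩ := ts.exists_gluedCharts hS hT h1
    obtain ⟨x, hx⟩ := (hg.chartA 0).not_surjective (y := p 1)
      ((hg.proj.mem_iff 0 (p 1)).mpr (hg.proj.ne 1 0 (by decide)))
    exact hx ((ts.mem_range_inter_iff a b x).mpr (h ⟨x, rfl⟩))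
  · obtain ⟨U, V, e, s, f, t, p, hg⟩ := ts.exists_gluedCharts hS hT h1
    obtain ⟨x, hx⟩ := (hg.chartB 0).not_surjective (y := p 1) ((hg.mem_iff 0 _).mp
      ((hg.proj.mem_iff 0 (p 1)).mpr (hg.proj.ne 1 0 (by decide))))
    exact hx ((ts.mem_range_inter_iff' b a x).mpr (h ⟨x, rfl⟩))

lemma irreducibleComponents_eq (hS : IsSmoothProjectiveSurface sS) (hT : IsTree T) :
    irreducibleComponents X = Set.range fun a ↦ Set.range (ts.incl a) := by
  have := hT.finite
  have hirr : ∀ a, IsIrreducible (Set.range (ts.incl a)) := by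
    intro a
    have := ts.irreducibleSpace_comp hS hT a
    rw [← Set.image_univ]
    exact (IrreducibleSpace.isIrreducible_univ _).image _ (ts.incl a).continuous.continuousOn
  have hle : ∀ s : Set X, IsIrreducible s → ∃ a, s ⊆ Set.range (ts.incl a) := by
    intro s hs
    have hfin : (Set.range fun a ↦ Set.range (ts.incl a)).Finite := Set.finite_range _
    obtain ⟨z, hz, hsz⟩ := isIrreducible_iff_sUnion_isClosed.mp hs hfin.toFinset (by
      intro z hz
      obtain ⟨a, rfl⟩ := hfin.mem_toFinset.mp hz
      have := ts.isClosedImmersion_incl a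
      exact (ts.incl a).isClosedEmbedding.isClosed_range) (by
      intro x _
      obtain ⟨a, ha⟩ := ts.cover x
      exact ⟨_, by rw [hfin.coe_toFinset]; exact ⟨a, rfl⟩, ha⟩)
    obtain ⟨a, rfl⟩ := hfin.mem_toFinset.mp hz
    exact ⟨a, hsz⟩
  ext s
  constructor
  · intro hs
    obtain ⟨a, ha⟩ := hle s hs.1
    exact ⟨a, (hs.2 (hirr a) ha).antisymm ha⟩
  · rintro ⟨a, rfl⟩
    refine ⟨hirr a, fun s hs has ↦ ?_⟩
    obtain ⟨b, hb⟩ := hle s hs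
    obtain rfl := ts.eq_of_range_subset hS hT (has.trans hb)
    exact hb

/-- A component is smooth at the points that lie on no other component. -/
lemma isSmoothAt_comp (hS : IsSmoothProjectiveSurface sS) (hT : IsTree T) (a : T) (z : ts.comp a)
    (hz : ∀ b, b ≠ a → ts.incl a z ∉ Set.range (ts.incl b)) : IsSmoothAt (ts.incl a ≫ sX) z := by
  have := ts.smoothOfRelativeDimension_toC hS a
  let O : (ts.P a).Opens := ⟨(ts.centre a)ᶜ, (ts.isClosed_centre hT a).isOpen_compl⟩
  have := (ts.isBlowup a).isIso_morphismRestrict O fun z hz h ↦ h hz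
  refine ⟨ts.blow a ⁻¹ᵁ O, ?_, ?_⟩
  · rintro ⟨b, h, hb⟩
    refine hz b h.lt.ne' ((ts.mem_range_inter_iff a b z).mp ?_)
    rw [ts.range_fst h]
    exact hb
  · rw [ts.incl_over, ← Category.assoc, ← morphismRestrict_ι, Category.assoc]
    have : Smooth (ts.toC a) := SmoothOfRelativeDimension.smooth 2 (ts.toC a)
    infer_instance

end TreeSurface

end TreeSurfaces

namespace TreeSurfaces

open Scheme

/-! ### Two branches of a special fibre -/

lemma app_res {X Y : Scheme.{0}} (f : X ⟶ Y) {U V : Y.Opens} (h : V ≤ U) (s : Γ(Y, U)) :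
    (f.app V).hom (res h s) =
      res (show f ⁻¹ᵁ V ≤ f ⁻¹ᵁ U from fun _ hx ↦ h hx) ((f.app U).hom s) :=
  congr(($(Scheme.Hom.naturality f (homOfLE h).op)).hom s)

lemma mem_ker_ideal_iff {X Y : Scheme.{0}} (f : X ⟶ Y) [IsClosedImmersion f] {U : Y.Opens}
    (hU : IsAffineOpen U) (s : Γ(Y, U)) : s ∈ f.ker.ideal ⟨U, hU⟩ ↔ (f.app U).hom s = 0 := by
  rw [f.ker_apply ⟨U, hU⟩]
  rfl

lemma LineChart.ker_restrict {L M : Scheme.{0}} {sM : M ⟶ SpecC} {lam : L ⟶ M} {U : M.Opens}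
    {e s : Γ(M, U)} (h : LineChart sM lam U e s) {W : M.Opens} (hW : IsAffineOpen W) (hle : W ≤ U) :
    lam.ker.ideal ⟨W, hW⟩ = Ideal.span {res hle e} := by
  rw [← lam.ker.map_ideal (U := ⟨W, hW⟩) (V := ⟨U, h.affine⟩) hle, h.ker, Ideal.map_span,
    Set.image_singleton]
  rfl

/-- The threefold `X` has a function `t` on the open set `O`, regular on every affine open subset,
whose zero scheme is the union of the two surfaces `A` and `B`, and these meet in the projective
line `L`. The intersection is scheme-theoretic, which makes it transversal: the local equation of
`L` on `A` is the restriction of an equation of `B`. The charts of `A` and `B` along `L` are part of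
the data. -/
structure IsTwoBranch {A B L X : Scheme.{0}} (sX : X ⟶ SpecC) (iA : A ⟶ X) (iB : B ⟶ X)
    (lamA : L ⟶ A) (lamB : L ⟶ B) (O : X.Opens) (t : Γ(X, O)) (U : Fin 2 → A.Opens)
    (V : Fin 2 → B.Opens) (e s : ∀ i, Γ(A, U i)) (f u : ∀ i, Γ(B, V i)) (p : Fin 2 → L) :
    Prop where
  closedA : IsClosedImmersion iA
  closedB : IsClosedImmersion iB
  isPullback : IsPullback lamA lamB iA iB
  charts : GluedCharts (iA ≫ sX) (iB ≫ sX) lamA lamB U V e s f u p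
  nzd : ∀ (W : X.Opens) (_ : IsAffineOpen W) (h : W ≤ O), res h t ∈ nonZeroDivisors Γ(X, W)
  inf : ∀ (W : X.Opens) (hW : IsAffineOpen W) (h : W ≤ O),
    iA.ker.ideal ⟨W, hW⟩ ⊓ iB.ker.ideal ⟨W, hW⟩ = Ideal.span {res h t}
  mem : ∀ y : L, iA (lamA y) ∈ O

section

variable {A B L X : Scheme.{0}} {sX : X ⟶ SpecC} {iA : A ⟶ X} {iB : B ⟶ X}
    {lamA : L ⟶ A} {lamB : L ⟶ B} {O : X.Opens} {t : Γ(X, O)} {U : Fin 2 → A.Opens}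
    {V : Fin 2 → B.Opens} {e s : ∀ i, Γ(A, U i)} {f u : ∀ i, Γ(B, V i)} {p : Fin 2 → L}

lemma IsTwoBranch.closed_lamA (h : IsTwoBranch sX iA iB lamA lamB O t U V e s f u p) :
    IsClosedImmersion lamA :=
  MorphismProperty.of_isPullback (P := @IsClosedImmersion) h.isPullback.flip h.closedB

lemma IsTwoBranch.closed_lamB (h : IsTwoBranch sX iA iB lamA lamB O t U V e s f u p) :
    IsClosedImmersion lamB :=
  MorphismProperty.of_isPullback (P := @IsClosedImmersion) h.isPullback h.closedA

lemma exists_lift_of_isPullback (h : IsPullback lamA lamB iA iB) [IsClosedImmersion iA]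
    [IsClosedImmersion iB] [IsClosedImmersion lamA] {W : X.Opens} (hW : IsAffineOpen W)
    {r : Γ(A, iA ⁻¹ᵁ W)} (hr : (lamA.app (iA ⁻¹ᵁ W)).hom r = 0) :
    ∃ x : Γ(X, W), (iB.app W).hom x = 0 ∧ (iA.app W).hom x = r := by
  have hWA := hW.preimage iA
  have h1 : lamA.ker = iB.ker.comap iA := by
    rw [← IdealSheafData.ker_fst_of_isClosedImmersion]
    apply le_antisymm
    · rw [← h.isoPullback_inv_fst]
      exact Scheme.Hom.le_ker_comp _ _
    · rw [← h.isoPullback_hom_fst]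
      exact Scheme.Hom.le_ker_comp _ _
  rw [← mem_ker_ideal_iff lamA hWA, h1, ideal_comap_eq_map iB.ker iA hW hWA le_rfl,
    Scheme.Hom.appLE_eq_app,
    Ideal.mem_map_iff_of_surjective _ (iA.app_surjective W hW)] at hr
  obtain ⟨x, hx, rfl⟩ := hr
  exact ⟨x, (mem_ker_ideal_iff iB hW x).mp hx, rfl⟩

/-- On the affine open set `W`, the function `x` vanishes on `B` and restricts to the equation `e i`
of the line on `A`, the function `y` vanishes on `A` and restricts to the equation `f i` of the line
on `B`, and `x * y = t ^ m * g`. Fixing the restrictions pins down `g` along the line. -/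
structure IsLevel (iA : A ⟶ X) (iB : B ⟶ X) (O : X.Opens) (t : Γ(X, O)) (U : Fin 2 → A.Opens)
    (V : Fin 2 → B.Opens) (e : ∀ i, Γ(A, U i)) (f : ∀ i, Γ(B, V i)) (m : ℕ) (i : Fin 2)
    (W : X.Opens) (x y g : Γ(X, W)) : Prop where
  affine : IsAffineOpen W
  le : W ≤ O
  leA : iA ⁻¹ᵁ W ≤ U i
  leB : iB ⁻¹ᵁ W ≤ V i
  x_mem : (iB.app W).hom x = 0
  y_mem : (iA.app W).hom y = 0
  x_eq : (iA.app W).hom x = res leA (e i)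
  y_eq : (iB.app W).hom y = res leB (f i)
  mul : x * y = res le t ^ m * g

variable {m : ℕ} {i j : Fin 2} {W : X.Opens} {x y g x' y' g' : Γ(X, W)}

lemma IsLevel.restrict (h : IsLevel iA iB O t U V e f m i W x y g) {W' : X.Opens}
    (hW' : IsAffineOpen W') (hle : W' ≤ W) :
    IsLevel iA iB O t U V e f m i W' (res hle x) (res hle y) (res hle g) where
  affine := hW'
  le := hle.trans h.le
  leA _ hx := h.leA (hle hx)
  leB _ hx := h.leB (hle hx)
  x_mem := by rw [app_res, h.x_mem, map_zero]
  y_mem := by rw [app_res, h.y_mem, map_zero]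
  x_eq := by rw [app_res, h.x_eq, res_res]
  y_eq := by rw [app_res, h.y_eq, res_res]
  mul := by
    rw [← res_res h.le hle, ← map_mul, h.mul, map_mul, map_pow]

lemma IsTwoBranch.app_t (h : IsTwoBranch sX iA iB lamA lamB O t U V e s f u p) (hW : IsAffineOpen W)
    (hle : W ≤ O) : (iA.app W).hom (res hle t) = 0 ∧ (iB.app W).hom (res hle t) = 0 := by
  have := h.closedA
  have := h.closedB
  rw [← mem_ker_ideal_iff iA hW, ← mem_ker_ideal_iff iB hW, ← Ideal.mem_inf, h.inf W hW hle]
  exact Ideal.mem_span_singleton_self _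

lemma IsTwoBranch.mem_span_t (h : IsTwoBranch sX iA iB lamA lamB O t U V e s f u p)
    (hW : IsAffineOpen W) (hle : W ≤ O) (hA : (iA.app W).hom x = 0) (hB : (iB.app W).hom x = 0) :
    ∃ c, x = res hle t * c := by
  have := h.closedA
  have := h.closedB
  rw [← mem_ker_ideal_iff iA hW] at hA
  rw [← mem_ker_ideal_iff iB hW] at hB
  have h1 : x ∈ iA.ker.ideal ⟨W, hW⟩ ⊓ iB.ker.ideal ⟨W, hW⟩ := ⟨hA, hB⟩
  rw [h.inf W hW hle] at h1
  exact Ideal.mem_span_singleton.mp h1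

/-- A function vanishing on the line is, on the branch `A`, a multiple of the equation `x`. -/
lemma IsTwoBranch.exists_mul_x (h : IsTwoBranch sX iA iB lamA lamB O t U V e s f u p)
    (hl : IsLevel iA iB O t U V e f m i W x y g) {a : Γ(X, W)}
    (ha : (lamA.app _).hom ((iA.app W).hom a) = 0) :
    ∃ c, (iA.app W).hom (a - c * x) = 0 := by
  have := h.closedA
  have := h.closed_lamA
  rw [← mem_ker_ideal_iff lamA (hl.affine.preimage iA),
    (h.charts.chartA i).ker_restrict (hl.affine.preimage iA) hl.leA] at ha
  obtain ⟨r, hr⟩ := Ideal.mem_span_singleton'.mp ha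
  obtain ⟨c, rfl⟩ := iA.app_surjective W hl.affine r
  refine ⟨c, ?_⟩
  rw [map_sub, map_mul, hl.x_eq, hr, sub_self]

lemma IsTwoBranch.exists_mul_y (h : IsTwoBranch sX iA iB lamA lamB O t U V e s f u p)
    (hl : IsLevel iA iB O t U V e f m i W x y g) {a : Γ(X, W)}
    (ha : (lamB.app _).hom ((iB.app W).hom a) = 0) :
    ∃ c, (iB.app W).hom (a - c * y) = 0 := by
  have := h.closedB
  have := h.closed_lamB
  rw [← mem_ker_ideal_iff lamB (hl.affine.preimage iB),
    (h.charts.chartB i).ker_restrict (hl.affine.preimage iB) hl.leB] at ha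
  obtain ⟨r, hr⟩ := Ideal.mem_span_singleton'.mp ha
  obtain ⟨c, rfl⟩ := iB.app_surjective W hl.affine r
  refine ⟨c, ?_⟩
  rw [map_sub, map_mul, hl.y_eq, hr, sub_self]

lemma IsTwoBranch.app_app (h : IsTwoBranch sX iA iB lamA lamB O t U V e s f u p) (W : X.Opens)
    (a : Γ(X, W)) : (lamA.app _).hom ((iA.app W).hom a) = 0 ↔
      (lamB.app _).hom ((iB.app W).hom a) = 0 := by
  have h1 : ∀ (j j' : L ⟶ X), j = j' → ((j.app W).hom a = 0 ↔ (j'.app W).hom a = 0) := by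
    rintro j _ rfl; rfl
  have h2 := h1 _ _ h.isPullback.w
  rw [Scheme.Hom.comp_app, Scheme.Hom.comp_app] at h2
  exact h2

lemma IsTwoBranch.mem_span_x_t (h : IsTwoBranch sX iA iB lamA lamB O t U V e s f u p)
    (hl : IsLevel iA iB O t U V e f m i W x y g) (a : Γ(X, W)) :
    a ∈ Ideal.span {x, res hl.le t} ↔ (iB.app W).hom a = 0 := by
  rw [Ideal.mem_span_pair]
  constructor
  · rintro ⟨b, c, rfl⟩
    rw [map_add, map_mul, map_mul, hl.x_mem, (h.app_t hl.affine hl.le).2, mul_zero, mul_zero,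
      add_zero]
  · intro ha
    obtain ⟨c, hc⟩ := h.exists_mul_x hl ((h.app_app W a).mpr (by rw [ha, map_zero]))
    obtain ⟨d, hd⟩ := h.mem_span_t hl.affine hl.le hc (by
      rw [map_sub, map_mul, ha, hl.x_mem, mul_zero, sub_zero])
    exact ⟨c, d, by linear_combination -hd⟩

lemma IsTwoBranch.mem_span_y_t (h : IsTwoBranch sX iA iB lamA lamB O t U V e s f u p)
    (hl : IsLevel iA iB O t U V e f m i W x y g) (a : Γ(X, W)) :
    a ∈ Ideal.span {y, res hl.le t} ↔ (iA.app W).hom a = 0 := by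
  rw [Ideal.mem_span_pair]
  constructor
  · rintro ⟨b, c, rfl⟩
    rw [map_add, map_mul, map_mul, hl.y_mem, (h.app_t hl.affine hl.le).1, mul_zero, mul_zero,
      add_zero]
  · intro ha
    obtain ⟨c, hc⟩ := h.exists_mul_y hl ((h.app_app W a).mp (by rw [ha, map_zero]))
    obtain ⟨d, hd⟩ := h.mem_span_t hl.affine hl.le (by
      rw [map_sub, map_mul, ha, hl.y_mem, mul_zero, sub_zero]) hc
    exact ⟨c, d, by linear_combination -hd⟩

lemma IsTwoBranch.mem_span_x_y_t (h : IsTwoBranch sX iA iB lamA lamB O t U V e s f u p)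
    (hl : IsLevel iA iB O t U V e f m i W x y g) (a : Γ(X, W)) :
    a ∈ Ideal.span {x, y, res hl.le t} ↔ (lamA.app _).hom ((iA.app W).hom a) = 0 := by
  constructor
  · intro ha
    rw [Ideal.mem_span_insert] at ha
    obtain ⟨b, z, hz, rfl⟩ := ha
    rw [h.mem_span_y_t hl] at hz
    rw [map_add, hz, add_zero, h.app_app, map_mul, hl.x_mem, mul_zero, map_zero]
  · intro ha
    obtain ⟨c, hc⟩ := h.exists_mul_x hl ha
    rw [← h.mem_span_y_t hl] at hc
    rw [Ideal.mem_span_insert]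
    exact ⟨c, _, hc, by ring⟩

lemma IsTwoBranch.y_regular (h : IsTwoBranch sX iA iB lamA lamB O t U V e s f u p)
    (hl : IsLevel iA iB O t U V e f m i W x y g) (a : Γ(X, W))
    (ha : y * a ∈ Ideal.span {x, res hl.le t}) : a ∈ Ideal.span {x, res hl.le t} := by
  have := h.closedB
  rw [h.mem_span_x_t hl, map_mul, hl.y_eq] at ha
  rw [h.mem_span_x_t hl]
  exact mem_nonZeroDivisors_iff_left.mp (res_mem_nonZeroDivisors (h.charts.chartB i).affine
    (hl.affine.preimage iB) hl.leB (h.charts.chartB i).nzd) _ ha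

lemma IsTwoBranch.x_regular (h : IsTwoBranch sX iA iB lamA lamB O t U V e s f u p)
    (hl : IsLevel iA iB O t U V e f m i W x y g) (a : Γ(X, W))
    (ha : x * a ∈ Ideal.span {y, res hl.le t}) : a ∈ Ideal.span {y, res hl.le t} := by
  have := h.closedA
  rw [h.mem_span_y_t hl, map_mul, hl.x_eq] at ha
  rw [h.mem_span_y_t hl]
  exact mem_nonZeroDivisors_iff_left.mp (res_mem_nonZeroDivisors (h.charts.chartA i).affine
    (hl.affine.preimage iA) hl.leA (h.charts.chartA i).nzd) _ ha

/-- The restriction to the line of the coefficient `g` does not depend on the choice of `x` and `y`,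
nor on the chart: changing the chart multiplies the equations on the two branches by factors that
are inverse to each other along the line. -/
lemma IsTwoBranch.coeff_eq (h : IsTwoBranch sX iA iB lamA lamB O t U V e s f u p) (hm : m ≠ 0)
    (hl : IsLevel iA iB O t U V e f m i W x y g)
    (hl' : IsLevel iA iB O t U V e f m j W x' y' g') :
    (lamA.app _).hom ((iA.app W).hom g) = (lamA.app _).hom ((iA.app W).hom g') := by
  have := h.closedA
  have := h.closedB
  have hWA := hl.affine.preimage iA
  have hWB := hl.affine.preimage iB
  have hnA := res_mem_nonZeroDivisors (h.charts.chartA j).affine hWA hl'.leA (h.charts.chartA j).nzd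
  have hnB := res_mem_nonZeroDivisors (h.charts.chartB j).affine hWB hl'.leB (h.charts.chartB j).nzd
  obtain ⟨τ, τ', hτ, hτ', hττ⟩ : ∃ τ τ' : Γ(X, W),
      res hl'.leA (e j) = (iA.app W).hom τ * res hl.leA (e i) ∧
      res hl'.leB (f j) = (iB.app W).hom τ' * res hl.leB (f i) ∧
      (lamA.app _).hom ((iA.app W).hom (τ * τ')) = 1 := by
    by_cases hij : i = j
    · subst hij
      exact ⟨1, 1, by rw [map_one, one_mul], by rw [map_one, one_mul], by simp⟩
    · obtain ⟨τ, hτ⟩ := iA.app_surjective W hl.affine (res hl.leA (s i))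
      obtain ⟨τ', hτ'⟩ := iB.app_surjective W hl.affine (res hl'.leB (u j))
      refine ⟨τ, τ', ?_, ?_, ?_⟩
      · rw [hτ]; exact h.charts.transA i j hij _ hWA hl.leA hl'.leA
      · rw [hτ']; exact h.charts.transB i j hij _ hWB hl.leB hl'.leB
      · obtain ⟨ν, hν⟩ := iA.app_surjective W hl.affine (res hl'.leA (s j))
        have h1 : (lamA.app _).hom ((iA.app W).hom τ') = (lamA.app _).hom ((iA.app W).hom ν) := by
          have hle : lamA ⁻¹ᵁ (iA ⁻¹ᵁ W) ≤ lamA ⁻¹ᵁ U j := fun z hz ↦ hl'.leA hz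
          have hw : ∀ z, iA (lamA z) = iB (lamB z) := fun z ↦ by
            rw [← Scheme.Hom.comp_apply, ← Scheme.Hom.comp_apply, h.isPullback.w]
          have hle' : lamA ⁻¹ᵁ (iA ⁻¹ᵁ W) ≤ lamB ⁻¹ᵁ V j := fun z hz ↦ hl'.leB (by
            change iB (lamB z) ∈ W
            rw [← hw]; exact hz)
          have hle2 : lamA ⁻¹ᵁ (iA ⁻¹ᵁ W) ≤ lamB ⁻¹ᵁ (iB ⁻¹ᵁ W) := fun z hz ↦ by
            change iB (lamB z) ∈ W
            rw [← hw]; exact hz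
          have h2 := h.charts.coord j _ hle hle'
          have h3 : (lamA.app _).hom ((iA.app W).hom τ') =
              (lamB.appLE (iB ⁻¹ᵁ W) _ hle2).hom ((iB.app W).hom τ') := by
            have h4 : ∀ (k k' : L ⟶ X) (hk : k = k') (hkk : k ⁻¹ᵁ W ≤ k' ⁻¹ᵁ W),
                (k.app W).hom τ' = (k'.appLE W (k ⁻¹ᵁ W) hkk).hom τ' := by
              rintro k _ rfl hkk
              rw [Scheme.Hom.appLE_eq_app]
            have h5 := h4 _ _ h.isPullback.w hle2
            have h6 := Scheme.Hom.appLE_comp_appLE lamB iB W (iB ⁻¹ᵁ W) _ le_rfl hle2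
            rw [Scheme.Hom.appLE_eq_app] at h6
            exact (congr(($(Scheme.Hom.comp_app lamA iA W)).hom τ')).symm.trans
              (h5.trans congr(($h6).hom τ').symm)
          rw [h3, hν, hτ']
          refine Eq.trans ?_ (h2.symm.trans ?_)
          · exact congr(($(Scheme.Hom.map_appLE lamB hle2 (homOfLE hl'.leB).op)).hom (u j))
          · have h6 := Scheme.Hom.map_appLE lamA (le_refl (lamA ⁻¹ᵁ (iA ⁻¹ᵁ W))) (homOfLE hl'.leA).op
            rw [Scheme.Hom.appLE_eq_app] at h6
            exact congr(($h6).hom (s j)).symm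
        rw [map_mul, map_mul, h1, hτ, hν]
        refine (congrArg₂ (· * ·) (app_res lamA hl.leA (s i)) (app_res lamA hl'.leA (s j))).trans ?_
        exact h.charts.proj.mul i j hij _ _ _
  have hx : ∃ c, x' = τ * x + res hl.le t * c := by
    obtain ⟨c, hc⟩ := h.mem_span_t (x := x' - τ * x) hl.affine hl.le
      (by rw [map_sub, map_mul, hl.x_eq, hl'.x_eq, hτ, sub_self])
      (by rw [map_sub, map_mul, hl.x_mem, hl'.x_mem, mul_zero, sub_zero])
    exact ⟨c, by linear_combination hc⟩
  have hy : ∃ d, y' = τ' * y + res hl.le t * d := by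
    obtain ⟨c, hc⟩ := h.mem_span_t (x := y' - τ' * y) hl.affine hl.le
      (by rw [map_sub, map_mul, hl.y_mem, hl'.y_mem, mul_zero, sub_zero])
      (by rw [map_sub, map_mul, hl.y_eq, hl'.y_eq, hτ', sub_self])
    exact ⟨c, by linear_combination hc⟩
  have key := level_coeff_unique (h.nzd W hl.affine hl.le) (h.y_regular hl) (h.x_regular hl)
    (fun a ha ↦ by
      rw [h.mem_span_y_t hl, map_mul] at ha
      rw [h.mem_span_y_t hl]
      refine mem_nonZeroDivisors_iff_left.mp hnA _ ?_
      rw [hτ, mul_right_comm, ha, zero_mul])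
    (fun a ha ↦ by
      rw [h.mem_span_x_t hl, map_mul] at ha
      rw [h.mem_span_x_t hl]
      refine mem_nonZeroDivisors_iff_left.mp hnB _ ?_
      rw [hτ', mul_right_comm, ha, zero_mul])
    hm hl.mul hl'.mul hx hy
  rw [h.mem_span_x_y_t hl, map_sub, map_sub, map_mul _ (τ * τ'), map_mul _ ((iA.app W).hom (τ * τ')),
    hττ, one_mul, sub_eq_zero] at key
  exact key.symm

/-- Every point of the line has a neighbourhood with equations whose product is divisible by
`t ^ m`. The number `m` is called a level of the degeneration. -/
def HasLevel (iA : A ⟶ X) (iB : B ⟶ X) (lamA : L ⟶ A) (O : X.Opens) (t : Γ(X, O))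
    (U : Fin 2 → A.Opens) (V : Fin 2 → B.Opens) (e : ∀ i, Γ(A, U i)) (f : ∀ i, Γ(B, V i))
    (m : ℕ) : Prop :=
  ∀ q : L, ∃ (i : Fin 2) (W : X.Opens) (x y g : Γ(X, W)), iA (lamA q) ∈ W ∧
    IsLevel iA iB O t U V e f m i W x y g

lemma IsTwoBranch.hasLevel_one (h : IsTwoBranch sX iA iB lamA lamB O t U V e s f u p) :
    HasLevel iA iB lamA O t U V e f 1 := by
  have := h.closedA
  have := h.closedB
  have := h.closed_lamA
  have := h.closed_lamB
  intro q
  obtain ⟨i, hi⟩ : ∃ i, lamA q ∈ U i := by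
    by_contra! hn
    have h0 := not_imp_comm.mp (h.charts.proj.mem_iff 0 q).mpr (hn 0)
    have h1 := not_imp_comm.mp (h.charts.proj.mem_iff 1 q).mpr (hn 1)
    exact h.charts.proj.ne 0 1 (by decide) (h0.symm.trans h1)
  obtain ⟨N, hN, hNU⟩ := iA.isClosedEmbedding.isInducing.isOpen_iff.mp (U i).isOpen
  obtain ⟨N', hN', hNV⟩ := iB.isClosedEmbedding.isInducing.isOpen_iff.mp (V i).isOpen
  have hqN : iA (lamA q) ∈ N := by
    have : lamA q ∈ iA ⁻¹' N := hNU ▸ hi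
    exact this
  have hqN' : iA (lamA q) ∈ N' := by
    have : lamB q ∈ iB ⁻¹' N' := hNV ▸ (h.charts.mem_iff i q).mp hi
    rw [← Scheme.Hom.comp_apply, h.isPullback.w]
    exact this
  obtain ⟨W, hW, hqW, hle⟩ := exists_isAffineOpen_mem_and_subset (x := iA (lamA q))
    (U := O ⊓ ⟨N, hN⟩ ⊓ ⟨N', hN'⟩) ⟨⟨h.mem q, hqN⟩, hqN'⟩
  have hWO : W ≤ O := fun z hz ↦ (hle hz).1.1
  have hWA : iA ⁻¹ᵁ W ≤ U i := fun z hz ↦ by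
    change z ∈ (U i : Set A)
    rw [← hNU]
    exact (hle hz).1.2
  have hWB : iB ⁻¹ᵁ W ≤ V i := fun z hz ↦ by
    change z ∈ (V i : Set B)
    rw [← hNV]
    exact (hle hz).2
  obtain ⟨x, hx, hx'⟩ := exists_lift_of_isPullback h.isPullback hW (r := res hWA (e i)) (by
    rw [← mem_ker_ideal_iff lamA (hW.preimage iA),
      (h.charts.chartA i).ker_restrict (hW.preimage iA) hWA]
    exact Ideal.mem_span_singleton_self _)
  obtain ⟨y, hy, hy'⟩ := exists_lift_of_isPullback h.isPullback.flip hW (r := res hWB (f i)) (by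
    rw [← mem_ker_ideal_iff lamB (hW.preimage iB),
      (h.charts.chartB i).ker_restrict (hW.preimage iB) hWB]
    exact Ideal.mem_span_singleton_self _)
  obtain ⟨g, hg⟩ := h.mem_span_t (x := x * y) hW hWO (by rw [map_mul, hy, mul_zero])
    (by rw [map_mul, hx, zero_mul])
  exact ⟨i, W, x, y, g, hqW, hW, hWO, hWA, hWB, hx, hy, hx', hy', by rw [pow_one, hg]⟩

/-- The coefficients of the level `m` equations glue to a global function on the line, which is
constant. -/
lemma IsTwoBranch.exists_const (h : IsTwoBranch sX iA iB lamA lamB O t U V e s f u p)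
    (hm : m ≠ 0) (hl : HasLevel iA iB lamA O t U V e f m) :
    ∃ a : ℂ, ∀ q : L, ∃ (i : Fin 2) (W : X.Opens) (x y g : Γ(X, W)), iA (lamA q) ∈ W ∧
      ∃ hl : IsLevel iA iB O t U V e f m i W x y g,
        g - const sX W a ∈ Ideal.span {x, y, res hl.le t} := by
  choose i W x y g hq hl using hl
  let j : L ⟶ X := lamA ≫ iA
  have hj : ∀ (W : X.Opens) (a : Γ(X, W)),
      (j.app W).hom a = (lamA.app _).hom ((iA.app W).hom a) := fun W a ↦
    congr(($(Scheme.Hom.comp_app lamA iA W)).hom a)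
  let c : ∀ q, Γ(L, j ⁻¹ᵁ W q) := fun q ↦ (j.app (W q)).hom (g q)
  have hcomp : TopCat.Presheaf.IsCompatible L.sheaf.obj (fun q ↦ j ⁻¹ᵁ W q) c := by
    intro q q'
    apply eq_of_forall_mem_nhds (X := L) (U := j ⁻¹ᵁ W q ⊓ j ⁻¹ᵁ W q')
    intro r hr
    obtain ⟨W', hW', hrW', hle⟩ := exists_isAffineOpen_mem_and_subset (x := j r)
      (U := W q ⊓ W q') hr
    have h1 : W' ≤ W q := fun z hz ↦ (hle hz).1
    have h2 : W' ≤ W q' := fun z hz ↦ (hle hz).2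
    refine ⟨j ⁻¹ᵁ W', fun z hz ↦ hle hz, hrW', ?_⟩
    have h3 := h.coeff_eq hm ((hl q).restrict hW' h1) ((hl q').restrict hW' h2)
    rw [← hj, ← hj, app_res, app_res] at h3
    have h4 : ∀ k (hk : j ⁻¹ᵁ W q ⊓ j ⁻¹ᵁ W q' ≤ j ⁻¹ᵁ W k)
        (hk' : j ⁻¹ᵁ W' ≤ j ⁻¹ᵁ W q ⊓ j ⁻¹ᵁ W q'),
        res hk' (res hk (c k)) = res (hk'.trans hk) ((j.app (W k)).hom (g k)) :=
      fun k hk hk' ↦ res_res hk hk' _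
    exact (h4 q inf_le_left (fun z hz ↦ hle hz)).trans
      (h3.trans (h4 q' inf_le_right (fun z hz ↦ hle hz)).symm)
  obtain ⟨c', hc', -⟩ := TopCat.Sheaf.existsUnique_gluing' L.sheaf (fun q ↦ j ⁻¹ᵁ W q) ⊤
    (fun _ ↦ homOfLE le_top) (fun q _ ↦ Opens.mem_iSup.mpr ⟨q, hq q⟩) c hcomp
  obtain ⟨a, ha⟩ := h.charts.proj.exists_const (fun i ↦ res le_top c') fun _ _ _ _ _ ↦
    (res_res _ _ c').trans (res_res _ _ c').symm
  refine ⟨a, fun q ↦ ⟨i q, W q, x q, y q, g q, hq q, hl q, ?_⟩⟩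
  rw [h.mem_span_x_y_t (hl q), map_sub, map_sub, sub_eq_zero]
  refine (hj _ _).symm.trans (Eq.trans ?_ (hj _ _))
  have hle : j ⁻¹ᵁ W q ≤ lamA ⁻¹ᵁ U (i q) := fun z hz ↦ (hl q).leA hz
  have h1 : res (le_top : j ⁻¹ᵁ W q ≤ ⊤) c' = const (lamA ≫ iA ≫ sX) (j ⁻¹ᵁ W q) a :=
    (res_res le_top hle c').symm.trans ((congrArg (res hle) (ha (i q))).trans (map_const hle a))
  have h2 : (j.app (W q)).hom (const sX (W q) a) = const (lamA ≫ iA ≫ sX) (j ⁻¹ᵁ W q) a := by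
    have := appLE_const (sX := lamA ≫ iA ≫ sX) j (Category.assoc _ _ _) (sY := sX) (U := W q)
      (V := j ⁻¹ᵁ W q) le_rfl a
    rwa [Scheme.Hom.appLE_eq_app] at this
  rw [h2, ← h1]
  exact (hc' q).symm

/-- If the levels are bounded, there is a level `k + 1` at which the coefficient restricts to the
same nonzero constant `a` all along the line. Indeed, at every level the restriction of the
coefficient is constant, and if this constant is zero then the level can be raised by one. -/
lemma IsTwoBranch.exists_level (h : IsTwoBranch sX iA iB lamA lamB O t U V e s f u p)
    (hbound : ∃ m, ¬ HasLevel iA iB lamA O t U V e f (m + 1)) :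
    ∃ (k : ℕ) (a : ℂ), a ≠ 0 ∧ ∀ q : L, ∃ (i : Fin 2) (W : X.Opens) (x y g : Γ(X, W)),
      iA (lamA q) ∈ W ∧ ∃ hl : IsLevel iA iB O t U V e f (k + 1) i W x y g,
        g - const sX W a ∈ Ideal.span {x, y, res hl.le t} := by
  by_contra! hcon
  obtain ⟨m, hm⟩ := hbound
  apply hm
  clear hm
  induction m with
  | zero => exact h.hasLevel_one
  | succ m ih =>
    obtain ⟨a, ha⟩ := h.exists_const (Nat.succ_ne_zero m) ih
    obtain rfl : a = 0 := by
      by_contra ha0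
      obtain ⟨q, hq⟩ := hcon m a ha0
      obtain ⟨i, W, x, y, g, hqW, hl, hg⟩ := ha q
      exact hq i W x y g hqW hl hg
    intro q
    obtain ⟨i, W, x, y, g, hqW, hl, hg⟩ := ha q
    rw [map_zero, sub_zero] at hg
    obtain ⟨b, c, g', hg'⟩ := exists_lift_level (Nat.succ_ne_zero m) hl.mul hg
    obtain ⟨hA, hB⟩ := h.app_t hl.affine hl.le
    have hA' : ∀ d, (iA.app W).hom (res hl.le t ^ (m + 1) * d) = 0 := fun d ↦ by
      rw [map_mul, map_pow, hA, zero_pow (Nat.succ_ne_zero m), zero_mul]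
    have hB' : ∀ d, (iB.app W).hom (res hl.le t ^ (m + 1) * d) = 0 := fun d ↦ by
      rw [map_mul, map_pow, hB, zero_pow (Nat.succ_ne_zero m), zero_mul]
    refine ⟨i, W, _, _, g', hqW, hl.affine, hl.le, hl.leA, hl.leB, ?_, ?_, ?_, ?_, hg'⟩
    · rw [map_sub, hB', hl.x_mem, sub_zero]
    · rw [map_sub, hA', hl.y_mem, sub_zero]
    · rw [map_sub, hA', hl.x_eq, sub_zero]
    · rw [map_sub, hB', hl.y_eq, sub_zero]

end

end TreeSurfaces

namespace TreeSurfaces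

open Scheme

/-! ### The local structure along the double curve -/

section LocalStructure

open MvPolynomial

/-- A family of surfaces with coordinates `x, y, t, w` in which `t` has the two smooth branches
`x = t = 0` and `y = t = 0` is locally the hypersurface `x y = t ^ m g` in an étale algebra over the
polynomial ring in four variables. -/
lemma exists_etale_hypersurface_mvPolynomial {B Λ : Type} [CommRing B] [CommRing Λ] {κ : ℂ →+* B}
    (hκ : κ.FiniteType) {ε : B →+* Λ} (hε : Function.Surjective ε) {θ : Polynomial ℂ →+* Λ}
    (hθ : θ.Etale) (hθC : θ.comp Polynomial.C = ε.comp κ) {x y t w : B} (hw : θ Polynomial.X = ε w)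
    (hker : RingHom.ker ε = Ideal.span {x, y, t}) (hT : t ∈ nonZeroDivisors B)
    (hX : ∀ a, x * a ∈ Ideal.span {y, t} → a ∈ Ideal.span {y, t})
    (hY : ∀ a, y * a ∈ Ideal.span {x, t} → a ∈ Ideal.span {x, t}) (p : Ideal B) [p.IsPrime]
    (hp : Ideal.span {x, y, t} ≤ p) {m : ℕ} (hm : m ≠ 0) {g : B} (hg : x * y = t ^ m * g) :
    ∃ h ∉ p, ∃ (E Bh : Type) (_ : CommRing E) (_ : CommRing Bh)
      (_ : Algebra (MvPolynomial (Fin 4) ℂ) E) (_ : Algebra B Bh) (_ : IsLocalization.Away h Bh)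
      (_ : Algebra.Etale (MvPolynomial (Fin 4) ℂ) E) (φ : E →+* Bh) (g' : E),
      Function.Surjective φ ∧
      RingHom.ker φ = Ideal.span {algebraMap (MvPolynomial (Fin 4) ℂ) E (X 0) *
        algebraMap (MvPolynomial (Fin 4) ℂ) E (X 1) -
        algebraMap (MvPolynomial (Fin 4) ℂ) E (X 2) ^ m * g'} ∧
      (g = 1 → g' = 1) ∧ φ.comp (algebraMap (MvPolynomial (Fin 4) ℂ) E) =
        (algebraMap B Bh).comp (eval₂Hom κ ![x, y, t, w]) := by
  let R := MvPolynomial (Fin 4) ℂ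
  let ρ : R →+* B := eval₂Hom κ ![x, y, t, w]
  let r' : R →+* Polynomial ℂ := eval₂Hom Polynomial.C ![0, 0, 0, Polynomial.X]
  have hρC : ∀ c, ρ (C c) = κ c := fun c ↦ eval₂_C _ _ _
  have hρX : ∀ i, ρ (X i) = ![x, y, t, w] i := fun i ↦ eval₂_X _ _ _
  have hr'C : ∀ c, r' (C c) = Polynomial.C c := fun c ↦ eval₂_C _ _ _
  have hr'X : ∀ i, r' (X i) = ![0, 0, 0, Polynomial.X] i := fun i ↦ eval₂_X _ _ _
  have hz : ∀ a ∈ Ideal.span {x, y, t}, ε a = 0 := fun a ha ↦ by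
    rwa [← hker] at ha
  have h1 : θ.comp r' = ε.comp ρ := by
    apply MvPolynomial.ringHom_ext
    · intro c
      rw [RingHom.comp_apply, RingHom.comp_apply, hr'C, hρC]
      exact congr($hθC c)
    · intro i
      rw [RingHom.comp_apply, RingHom.comp_apply, hr'X, hρX]
      fin_cases i
      · exact (map_zero θ).trans (hz x (Ideal.subset_span (by simp))).symm
      · exact (map_zero θ).trans (hz y (Ideal.subset_span (by simp))).symm
      · exact (map_zero θ).trans (hz t (Ideal.subset_span (by simp))).symm
      · exact hw
  let : Algebra R B := ρ.toAlgebra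
  let : Algebra R (Polynomial ℂ) := r'.toAlgebra
  let : Algebra B Λ := ε.toAlgebra
  let : Algebra (Polynomial ℂ) Λ := θ.toAlgebra
  let : Algebra R Λ := (ε.comp ρ).toAlgebra
  have : IsScalarTower R B Λ := .of_algebraMap_eq' rfl
  have : IsScalarTower R (Polynomial ℂ) Λ := .of_algebraMap_eq' h1.symm
  have : Algebra.Etale (Polynomial ℂ) Λ := hθ
  have : Algebra.FiniteType R B := by
    refine RingHom.finiteType_algebraMap.mp (RingHom.FiniteType.of_comp_finiteType (f := C) ?_)
    have : ρ.comp C = κ := by ext1 c; exact hρC c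
    exact this ▸ hκ
  have hR : Function.Surjective r' := by
    intro q
    refine ⟨q.eval₂ C (X 3), ?_⟩
    have h2 : r'.comp C = Polynomial.C := by ext1 c; exact hr'C c
    rw [Polynomial.hom_eval₂, h2, hr'X]
    exact Polynomial.eval₂_C_X
  have hRker : RingHom.ker r' = Ideal.span {X 0, X 1, X 2} := by
    have h2 : ∀ q : R, q - (r' q).eval₂ C (X 3) ∈ Ideal.span {(X 0 : R), X 1, X 2} := by
      intro q
      induction q using MvPolynomial.induction_on with
      | C c => rw [hr'C, Polynomial.eval₂_C, sub_self]; exact zero_mem _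
      | add q q' hq hq' =>
        rw [map_add, Polynomial.eval₂_add, add_sub_add_comm]
        exact add_mem hq hq'
      | mul_X q i hq =>
        rw [map_mul, Polynomial.eval₂_mul, hr'X]
        have h3 : ∀ i : Fin 4, (X i : R) - (![0, 0, 0, Polynomial.X] i : Polynomial ℂ).eval₂ C (X 3) ∈
            Ideal.span {(X 0 : R), X 1, X 2} := by
          intro i
          fin_cases i
          · simp only [Fin.zero_eta, Matrix.cons_val_zero, Polynomial.eval₂_zero, sub_zero]
            exact Ideal.subset_span (by simp)
          · change (X 1 : R) - (0 : Polynomial ℂ).eval₂ C (X 3) ∈ _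
            rw [Polynomial.eval₂_zero, sub_zero]
            exact Ideal.subset_span (by simp)
          · change (X 2 : R) - (0 : Polynomial ℂ).eval₂ C (X 3) ∈ _
            rw [Polynomial.eval₂_zero, sub_zero]
            exact Ideal.subset_span (by simp)
          · change (X 3 : R) - (Polynomial.X : Polynomial ℂ).eval₂ C (X 3) ∈ _
            rw [Polynomial.eval₂_X, sub_self]
            exact zero_mem _
        have h4 := add_mem (Ideal.mul_mem_right (X i) _ hq)
          (Ideal.mul_mem_left _ ((r' q).eval₂ C (X 3)) (h3 i))
        convert h4 using 1
        ring
    apply le_antisymm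
    · intro q hq
      have := h2 q
      rwa [(RingHom.mem_ker).mp hq, Polynomial.eval₂_zero, sub_zero] at this
    · rw [Ideal.span_le]
      rintro _ (rfl | rfl | rfl) <;> exact hr'X _
  have hmap : ∀ i j : Fin 4, (Ideal.span {(X i : R), X j}).map (algebraMap R B) =
      Ideal.span {![x, y, t, w] i, ![x, y, t, w] j} := by
    intro i j
    rw [Ideal.map_span, Set.image_pair]
    exact congrArg₂ (fun a b ↦ Ideal.span {a, b}) (hρX i) (hρX j)
  have hmap3 : (Ideal.span {(X 0 : R), X 1, X 2}).map (algebraMap R B) = Ideal.span {x, y, t} := by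
    rw [Ideal.map_span, Set.image_insert_eq, Set.image_pair]
    have h0 : algebraMap R B (X 0) = x := hρX 0
    have h1 : algebraMap R B (X 1) = y := hρX 1
    have h2 : algebraMap R B (X 2) = t := hρX 2
    rw [h0, h1, h2]
  obtain ⟨h, hhp, E, Bh, _, _, _, _, _, _, _, _, φ, g', hφ, hφker, -, hg'⟩ :=
    exists_etale_hypersurface (R := R) (R' := Polynomial ℂ) (B := B) (Λ := Λ) (X := X 0) (Y := X 1)
      (T := X 2) hR hRker hε (hker.trans hmap3.symm)
      (fun a ha ↦ mem_span_X_pair_of_X_mul_mem (by decide) (by decide) a ha)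
      (fun a ha ↦ mem_nonZeroDivisors_iff_left.mp hT a (by
        rw [← ha]; exact congrArg (· * a) (hρX 2).symm))
      (by
        rw [hmap]
        intro a ha
        exact hX a (by rwa [show algebraMap R B (X 0) = x from hρX 0] at ha))
      (by
        rw [hmap]
        intro a ha
        exact hY a (by rwa [show algebraMap R B (X 1) = y from hρX 1] at ha))
      p (hmap3.le.trans hp) hm g (by
        rw [show algebraMap R B (X 0) = x from hρX 0, show algebraMap R B (X 1) = y from hρX 1,
          show algebraMap R B (X 2) = t from hρX 2, hg])
  refine ⟨h, hhp, E, Bh, inferInstance, inferInstance, inferInstance, inferInstance, inferInstance,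
    inferInstance, φ.toRingHom, g', hφ, hφker, hg', ?_⟩
  exact φ.comp_algebraMap.trans (IsScalarTower.algebraMap_eq R B Bh)

/-- If moreover `x y = t ^ (k + 1)`, then the family is étale over the model of an
`A_k`-singularity. -/
lemma exists_etale_model {B Λ : Type} [CommRing B] [CommRing Λ] {κ : ℂ →+* B}
    (hκ : κ.FiniteType) {ε : B →+* Λ} (hε : Function.Surjective ε) {θ : Polynomial ℂ →+* Λ}
    (hθ : θ.Etale) (hθC : θ.comp Polynomial.C = ε.comp κ) {x y t w : B} (hw : θ Polynomial.X = ε w)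
    (hker : RingHom.ker ε = Ideal.span {x, y, t}) (hT : t ∈ nonZeroDivisors B)
    (hX : ∀ a, x * a ∈ Ideal.span {y, t} → a ∈ Ideal.span {y, t})
    (hY : ∀ a, y * a ∈ Ideal.span {x, t} → a ∈ Ideal.span {x, t}) (p : Ideal B) [p.IsPrime]
    (hp : Ideal.span {x, y, t} ≤ p) {k : ℕ} (hg : x * y = t ^ (k + 1)) :
    ∃ h ∉ p, ∃ (Bh : Type) (_ : CommRing Bh) (_ : Algebra B Bh) (_ : IsLocalization.Away h Bh)
      (ψ : AkRing k →+* Bh), ψ.Etale ∧ ψ.comp (Ideal.Quotient.mk _) =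
        (algebraMap B Bh).comp (eval₂Hom κ ![x, y, t, w]) := by
  obtain ⟨h, hp, E, Bh, _, _, _, _, _, _, φ, g', hφ, hker, hg1, hcomp⟩ :=
    exists_etale_hypersurface_mvPolynomial hκ hε hθ hθC hw hker hT hX hY p hp (Nat.succ_ne_zero k)
      (g := 1) (by rw [hg, mul_one])
  rw [hg1 rfl, mul_one] at hker
  let : Algebra (MvPolynomial (Fin 4) ℂ) Bh :=
    (φ.comp (algebraMap (MvPolynomial (Fin 4) ℂ) E)).toAlgebra
  let φ' : E →ₐ[MvPolynomial (Fin 4) ℂ] Bh := ⟨φ, fun _ ↦ rfl⟩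
  let ψ : AkRing k →+* Bh := Ideal.Quotient.lift _ (algebraMap (MvPolynomial (Fin 4) ℂ) Bh) (by
    suffices h : Ideal.span {X 0 * X 1 - X 2 ^ (k + 1)} ≤
      RingHom.ker (algebraMap (MvPolynomial (Fin 4) ℂ) Bh) from fun a ha ↦ h ha
    rw [Ideal.span_singleton_le_iff_mem]
    rw [RingHom.mem_ker, ← φ'.commutes]
    change φ _ = 0
    rw [← RingHom.mem_ker, hker, map_sub, map_mul, map_pow]
    exact Ideal.mem_span_singleton_self _)
  have hψ : ψ.comp (Ideal.Quotient.mk _) = algebraMap (MvPolynomial (Fin 4) ℂ) Bh :=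
    RingHom.ext fun _ ↦ rfl
  refine ⟨h, hp, Bh, inferInstance, inferInstance, inferInstance, ψ, ?_, hψ.trans hcomp⟩
  algebraize [ψ]
  have : IsScalarTower (MvPolynomial (Fin 4) ℂ) (AkRing k) Bh :=
    ⟨fun r a b ↦ by
      obtain ⟨a, rfl⟩ := Ideal.Quotient.mk_surjective a
      rw [Algebra.smul_def r]
      change ψ (Ideal.Quotient.mk _ (r * a)) * b = _ * (ψ (Ideal.Quotient.mk _ a) * b)
      rw [map_mul, map_mul, mul_assoc]; rfl⟩
  rw [RingHom.Etale]
  refine etale_of_ker_eq_map (R := MvPolynomial (Fin 4) ℂ) Ideal.Quotient.mk_surjective φ' hφ ?_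
  change RingHom.ker φ = _
  rw [hker, Ideal.Quotient.algebraMap_eq, Ideal.mk_ker, Ideal.map_span, Set.image_singleton,
    map_sub, map_mul, map_pow]

/-- The model of the `A_0`-singularity is smooth. -/
lemma smooth_akModel_zero : Smooth (AkModel.toC 0) := by
  let R := MvPolynomial (Fin 4) ℂ
  let f : AkRing 0 →ₐ[ℂ] MvPolynomial (Fin 3) ℂ :=
    Ideal.Quotient.liftₐ _ (aeval ![X 0, X 1, X 0 * X 1, X 2]) (by
      suffices h : Ideal.span {(X 0 * X 1 - X 2 ^ (0 + 1) : R)} ≤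
        RingHom.ker (aeval ![X 0, X 1, X 0 * X 1, X 2] : R →ₐ[ℂ] MvPolynomial (Fin 3) ℂ) from
        fun a ha ↦ h ha
      rw [Ideal.span_singleton_le_iff_mem, RingHom.mem_ker, zero_add, pow_one, map_sub, map_mul,
        aeval_X, aeval_X, aeval_X]
      exact sub_self _)
  let g : MvPolynomial (Fin 3) ℂ →ₐ[ℂ] AkRing 0 :=
    aeval ![AkModel.coord 0 0, AkModel.coord 0 1, AkModel.coord 0 3]
  have hf : ∀ i, f (AkModel.coord 0 i) = ![X 0, X 1, X 0 * X 1, X 2] i := fun i ↦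
    aeval_X _ _
  have hg : ∀ i, g (X i) = ![AkModel.coord 0 0, AkModel.coord 0 1, AkModel.coord 0 3] i := fun i ↦
    aeval_X _ _
  have h0 : AkModel.coord 0 0 * AkModel.coord 0 1 = AkModel.coord 0 2 := by
    rw [AkModel.coord, AkModel.coord, AkModel.coord, ← map_mul, Ideal.Quotient.mk_eq_mk_iff_sub_mem]
    have := Ideal.mem_span_singleton_self (X 0 * X 1 - X 2 ^ (0 + 1) : R)
    rwa [zero_add, pow_one] at this ⊢
  let ι : MvPolynomial (Fin 3) ℂ ≃ₐ[ℂ] AkRing 0 := AlgEquiv.ofAlgHom g f (by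
      apply Ideal.Quotient.algHom_ext
      apply MvPolynomial.algHom_ext
      intro i
      change g (f (AkModel.coord 0 i)) = AkModel.coord 0 i
      rw [hf]
      fin_cases i
      · exact hg 0
      · exact hg 1
      · exact (map_mul g _ _).trans ((congrArg₂ (· * ·) (hg 0) (hg 1)).trans h0)
      · exact hg 2) (by
      apply MvPolynomial.algHom_ext
      intro i
      change f (g (X i)) = X i
      rw [hg]
      fin_cases i
      · exact hf 0
      · exact hf 1
      · exact hf 3)
  have : Algebra.Smooth ℂ (MvPolynomial (Fin 3) ℂ) := ⟨inferInstance, inferInstance⟩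
  have h1 : Algebra.Smooth ℂ (AkRing 0) := Algebra.Smooth.of_equiv ι
  refine (HasRingHomProperty.Spec_iff (P := @Smooth)).mpr ?_
  exact RingHom.smooth_algebraMap.mpr h1

end LocalStructure

lemma fromSpec_comp {X : Scheme.{0}} (sX : X ⟶ SpecC) {W : X.Opens} (hW : IsAffineOpen W) :
    hW.fromSpec ≫ sX = Spec.map (CommRingCat.ofHom (const sX W)) := by
  obtain ⟨χ, hχ⟩ := Spec.map_surjective (hW.fromSpec ≫ sX)
  rw [← hχ]
  congr 1
  have hle : ⊤ ≤ hW.fromSpec ⁻¹ᵁ W := fun x _ ↦ by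
    have : hW.fromSpec x ∈ Set.range hW.fromSpec := ⟨x, rfl⟩
    rwa [hW.range_fromSpec] at this
  have h1 := Scheme.Hom.appLE_comp_appLE hW.fromSpec sX ⊤ W ⊤ le_top hle
  rw [appLE_fromSpec_top hW hle] at h1
  have h2 : (hW.fromSpec ≫ sX).appLE ⊤ ⊤ le_top = (Spec.map χ).appTop := by
    rw [← hχ]
    exact Scheme.Hom.appLE_eq_app _
  have h3 := Scheme.ΓSpecIso_inv_naturality χ
  rw [← h2, ← h1, ← Category.assoc, Iso.eq_comp_inv, Category.assoc, Iso.inv_hom_id,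
    Category.comp_id] at h3
  rw [h3]
  rfl

lemma mem_range_iff_forall_ker {A X : Scheme.{0}} (f : A ⟶ X) [IsClosedImmersion f] {W : X.Opens}
    (hW : IsAffineOpen W) {x : X} (hx : x ∈ W) :
    x ∈ Set.range f ↔ ∀ a : Γ(X, W), (f.app W).hom a = 0 → x ∉ X.basicOpen a := by
  have h1 : x ∈ f.ker.support ↔ x ∈ Set.range f := by
    rw [← SetLike.mem_coe, Scheme.Hom.support_ker, f.isClosedEmbedding.isClosed_range.closure_eq]
  rw [← h1, IdealSheafData.mem_support_iff_of_mem (U := ⟨W, hW⟩) hx, Scheme.mem_zeroLocus_iff]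
  simp only [SetLike.mem_coe, mem_ker_ideal_iff f hW]

lemma IsLineCoord.exists_const {L : Scheme.{0}} {sL : L ⟶ SpecC} {O : L.Opens} {z : Γ(L, O)}
    (h : IsLineCoord sL O z) (hO : IsAffineOpen O) {q : L} (hq : IsClosed {q}) (hqO : q ∈ O) :
    ∃ c : ℂ, q ∉ L.basicOpen (z - const sL O c) := by
  obtain ⟨hmax, -⟩ := isMaximal_of_forall_notMem_basicOpen hO hq hqO
    (J := (hO.primeIdealOf ⟨q, hqO⟩).asIdeal) fun s ↦ by
      rw [mem_basicOpen_iff_notMem_primeIdealOf hO s hqO, not_not]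
  obtain ⟨c, hc⟩ := exists_sub_mem_of_isMaximal _ h.finiteType (hO.primeIdealOf ⟨q, hqO⟩).asIdeal z
  exact ⟨c, by rwa [mem_basicOpen_iff_notMem_primeIdealOf hO _ hqO, not_not]⟩

lemma res_etale {X : Scheme.{0}} {U V : X.Opens} (hU : IsAffineOpen U) (hV : IsAffineOpen V)
    (h : V ≤ U) : (res h).Etale := by
  have h1 : (𝟙 X : X ⟶ X).appLE U V h = X.presheaf.map (homOfLE h).op := by
    simp [Scheme.Hom.appLE]
    exact Category.id_comp _
  have h2 := HasRingHomProperty.appLE @Etale (𝟙 X) inferInstance ⟨U, hU⟩ ⟨V, hV⟩ h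
  rwa [h1] at h2

/-- A coordinate of the line, shifted so that it vanishes at a given closed point, is an étale
coordinate on smaller open sets. -/
lemma IsLineCoord.exists_etale {L : Scheme.{0}} {sL : L ⟶ SpecC} {O : L.Opens} {z : Γ(L, O)}
    (h : IsLineCoord sL O z) (hO : IsAffineOpen O) {W : L.Opens} (hW : IsAffineOpen W) (hle : W ≤ O)
    (c : ℂ) : ∃ θ : Polynomial ℂ →+* Γ(L, W), θ.Etale ∧ θ.comp Polynomial.C = const sL W ∧
      θ Polynomial.X = res hle (z - const sL O c) := by
  let τ := Polynomial.algEquivAevalXAddC (-c)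
  let θ : Polynomial ℂ →+* Γ(L, W) :=
    (res hle).comp ((Polynomial.eval₂RingHom (const sL O) z).comp τ.toRingEquiv.toRingHom)
  refine ⟨θ, ?_, ?_, ?_⟩
  · refine RingHom.Etale.stableUnderComposition _ _ ?_ (res_etale hO hW hle)
    exact RingHom.Etale.stableUnderComposition _ _
      (RingHom.Etale.of_bijective (f := τ.toRingEquiv.toRingHom) τ.bijective)
      (RingHom.Etale.of_bijective h)
  · ext1 a
    have h1 : τ (Polynomial.C a) = Polynomial.C a := τ.commutes a
    change res hle (Polynomial.eval₂RingHom (const sL O) z (τ (Polynomial.C a))) = _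
    rw [h1]
    exact (congrArg _ (Polynomial.eval₂_C _ _)).trans (map_const hle a)
  · have h1 : τ Polynomial.X = Polynomial.X + Polynomial.C (-c) := by
      simp [τ]
    change res hle (Polynomial.eval₂RingHom (const sL O) z (τ Polynomial.X)) = _
    rw [h1, map_add]
    congr 1
    rw [sub_eq_add_neg, ← map_neg]
    exact congrArg₂ (· + ·) (Polynomial.eval₂_X _ _) (Polynomial.eval₂_C _ _)

section

variable {A B L X : Scheme.{0}} {sX : X ⟶ SpecC} {iA : A ⟶ X} {iB : B ⟶ X}
    {lamA : L ⟶ A} {lamB : L ⟶ B} {O : X.Opens} {t : Γ(X, O)} {U : Fin 2 → A.Opens}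
    {V : Fin 2 → B.Opens} {e s : ∀ i, Γ(A, U i)} {f u : ∀ i, Γ(B, V i)} {p : Fin 2 → L}
    {m : ℕ} {i : Fin 2} {W : X.Opens} {x y g : Γ(X, W)}

lemma const_finiteType {X : Scheme.{0}} (sX : X ⟶ SpecC) [LocallyOfFiniteType sX] {W : X.Opens}
    (hW : IsAffineOpen W) : (const sX W).FiniteType := by
  have h1 := HasRingHomProperty.appLE @LocallyOfFiniteType sX inferInstance
    ⟨⊤, isAffineOpen_top _⟩ ⟨W, hW⟩ le_top
  refine RingHom.FiniteType.comp h1 (RingHom.FiniteType.of_surjective _ ?_)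
  exact (ConcreteCategory.bijective_of_isIso (Scheme.ΓSpecIso (CommRingCat.of ℂ)).inv).2

/-- The line together with an étale coordinate, near one of its closed points. -/
lemma IsTwoBranch.exists_coord (h : IsTwoBranch sX iA iB lamA lamB O t U V e s f u p)
    (hl : IsLevel iA iB O t U V e f m i W x y g) {q : L} (hq : IsClosed {q})
    (hqW : iA (lamA q) ∈ W) :
    ∃ (θ : Polynomial ℂ →+* Γ(L, lamA ⁻¹ᵁ (iA ⁻¹ᵁ W))) (w : Γ(X, W)), θ.Etale ∧
      θ.comp Polynomial.C = ((lamA.app _).hom.comp (iA.app W).hom).comp (const sX W) ∧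
      θ Polynomial.X = ((lamA.app _).hom.comp (iA.app W).hom) w ∧ iA (lamA q) ∉ X.basicOpen w := by
  have := h.closedA
  have := h.closed_lamA
  have hLW := (hl.affine.preimage iA).preimage lamA
  have hle : lamA ⁻¹ᵁ (iA ⁻¹ᵁ W) ≤ lamA ⁻¹ᵁ U i := fun z hz ↦ hl.leA hz
  obtain ⟨c, hc⟩ := (h.charts.proj.coord i).exists_const (h.charts.proj.affine i) hq (hle hqW)
  obtain ⟨θ, hθ, hθC, hθX⟩ := (h.charts.proj.coord i).exists_etale (h.charts.proj.affine i) hLW hle c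
  obtain ⟨w, hw⟩ := iA.app_surjective W hl.affine (res hl.leA (s i - const (iA ≫ sX) (U i) c))
  have hκ : ∀ c, (lamA.app (U i)).hom (const (iA ≫ sX) (U i) c) =
      const (lamA ≫ iA ≫ sX) (lamA ⁻¹ᵁ U i) c := fun c ↦ by
    have := appLE_const lamA rfl (sY := iA ≫ sX) (U := U i) (V := lamA ⁻¹ᵁ U i) le_rfl c
    rwa [Scheme.Hom.appLE_eq_app] at this
  have hww : (lamA.app _).hom ((iA.app W).hom w) =
      res hle ((lamA.app (U i)).hom (s i) - const (lamA ≫ iA ≫ sX) (lamA ⁻¹ᵁ U i) c) := by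
    rw [hw, ← hκ, ← map_sub]
    exact app_res lamA hl.leA _
  refine ⟨θ, w, hθ, ?_, ?_, ?_⟩
  · rw [hθC]
    ext c
    have h1 := appLE_const iA rfl (sY := sX) (U := W) (V := iA ⁻¹ᵁ W) le_rfl c
    have h2 := appLE_const lamA rfl (sY := iA ≫ sX) (U := iA ⁻¹ᵁ W) (V := lamA ⁻¹ᵁ (iA ⁻¹ᵁ W)) le_rfl c
    rw [Scheme.Hom.appLE_eq_app] at h1 h2
    change _ = (lamA.app _).hom ((iA.app W).hom _)
    rw [h1, h2]
  · exact hθX.trans hww.symm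
  · intro hqw
    have h1 := (mem_basicOpen_app lamA _ q).mpr ((mem_basicOpen_app iA w (lamA q)).mpr hqw)
    rw [hww] at h1
    exact hc ((mem_basicOpen_res hle _ (show q ∈ lamA ⁻¹ᵁ (iA ⁻¹ᵁ W) from hqW)).mp h1)

/-- Near a closed point of the line with equations `x y = t ^ (k + 1) g`, where `g` is invertible,
the threefold and the line are étale over the `A_k`-model and its singular line. -/
lemma IsTwoBranch.exists_model (h : IsTwoBranch sX iA iB lamA lamB O t U V e s f u p)
    [LocallyOfFiniteType sX] {k : ℕ} (hl : IsLevel iA iB O t U V e f (k + 1) i W x y g) {a : ℂ}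
    (ha : a ≠ 0) (hg : g - const sX W a ∈ Ideal.span {x, y, res hl.le t}) {q : L}
    (hq : IsClosed {q}) (hqW : iA (lamA q) ∈ W) :
    ∃ (M : Scheme.{0}) (w : M) (j : M ⟶ X) (v : M ⟶ AkModel k), IsOpenImmersion j ∧ Etale v ∧
      j ≫ sX = v ≫ AkModel.toC k ∧ j w = iA (lamA q) ∧ v w ∈ AkModel.origin k ∧
      j ⁻¹' (Set.range (lamA ≫ iA)) = v ⁻¹' AkModel.line k := by
  have := h.closedA
  have := h.closed_lamA
  have hzero : ∀ {W : X.Opens} {i m} {x y g : Γ(X, W)} (hl : IsLevel iA iB O t U V e f m i W x y g)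
      (_ : iA (lamA q) ∈ W), ∀ b ∈ Ideal.span {x, y, res hl.le t}, iA (lamA q) ∉ X.basicOpen b := by
    intro W i m x y g hl hqW b hb hqb
    rw [h.mem_span_x_y_t hl] at hb
    have h1 := (mem_basicOpen_app lamA _ q).mpr ((mem_basicOpen_app iA b (lamA q)).mpr hqb)
    rw [hb, Scheme.basicOpen_zero] at h1
    exact h1
  -- shrink, so that the coefficient becomes invertible
  obtain ⟨W', hW', hqW', hle, hgu⟩ : ∃ (W' : X.Opens) (_ : IsAffineOpen W') (_ : iA (lamA q) ∈ W')
      (hle : W' ≤ W), IsUnit (res hle g) := by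
    refine ⟨X.basicOpen g, hl.affine.basicOpen g, ?_, X.basicOpen_le g,
      RingedSpace.isUnit_res_basicOpen _ g⟩
    have h1 := hzero hl hqW _ hg
    rw [mem_basicOpen_iff_notMem_primeIdealOf hl.affine _ hqW] at h1 ⊢
    rw [not_not] at h1
    intro h2
    have h3 := sub_mem h2 h1
    rw [sub_sub_cancel] at h3
    exact (hl.affine.primeIdealOf ⟨_, hqW⟩).2.ne_top
      (Ideal.eq_top_of_isUnit_mem _ h3 ((IsUnit.mk0 a ha).map _))
  have hl' := hl.restrict hW' hle
  obtain ⟨γ, hγ⟩ := hgu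
  set x₁ := res hle x
  set y₁ := res hle y
  set t₁ := res hl'.le t
  rw [← hγ] at hl'
  let x₂ : Γ(X, W') := ↑γ⁻¹ * x₁
  have hx₁ : x₁ = γ * x₂ := by rw [← mul_assoc, Units.mul_inv, one_mul]
  have hs1 : Ideal.span {x₂, t₁} = Ideal.span {x₁, t₁} := by
    rw [Ideal.span_insert, Ideal.span_insert, Ideal.span_singleton_mul_left_unit γ⁻¹.isUnit]
  have hs2 : Ideal.span {x₂, y₁, t₁} = Ideal.span {x₁, y₁, t₁} := by
    rw [Ideal.span_insert, Ideal.span_insert x₁, Ideal.span_singleton_mul_left_unit γ⁻¹.isUnit]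
  let ε := (lamA.app _).hom.comp (iA.app W').hom
  have hε : Function.Surjective ε :=
    (lamA.app_surjective _ (hW'.preimage iA)).comp (iA.app_surjective W' hW')
  have hker : RingHom.ker ε = Ideal.span {x₂, y₁, t₁} := by
    ext b
    rw [hs2, h.mem_span_x_y_t hl', RingHom.mem_ker]
    rfl
  obtain ⟨θ, w, hθ, hθC, hθX, hqw⟩ := h.exists_coord hl' hq hqW'
  let P := hW'.primeIdealOf ⟨_, hqW'⟩
  have hP : Ideal.span {x₂, y₁, t₁} ≤ P.asIdeal := by
    intro b hb
    rw [hs2] at hb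
    have h1 := hzero hl' hqW' b hb
    rwa [mem_basicOpen_iff_notMem_primeIdealOf hW' _ hqW', not_not] at h1
  have hwP : w ∈ P.asIdeal := by
    rwa [mem_basicOpen_iff_notMem_primeIdealOf hW' _ hqW', not_not] at hqw
  obtain ⟨r, hrP, Bh, _, _, _, ψ, hψ, hψc⟩ := exists_etale_model (const_finiteType sX hW') hε hθ hθC
    hθX hker (h.nzd W' hW' hl'.le)
    (fun b hb ↦ h.x_regular hl' b (by
      have h1 := Ideal.mul_mem_left _ (γ : Γ(X, W')) hb
      rwa [← mul_assoc, ← hx₁] at h1))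
    (fun b hb ↦ by rw [hs1] at hb ⊢; exact h.y_regular hl' b hb) P.asIdeal hP (k := k) (by
      rw [mul_assoc, hl'.mul, mul_comm, mul_assoc, Units.mul_inv, mul_one])
  have hψC : ∀ c, ψ (algebraMap ℂ (AkRing k) c) = algebraMap _ Bh (const sX W' c) := fun c ↦
    (congr($hψc (MvPolynomial.C c))).trans (congrArg (algebraMap _ Bh) (MvPolynomial.eval₂_C _ _ _))
  have hψX : ∀ i, ψ (AkModel.coord k i) = algebraMap _ Bh (![x₂, y₁, t₁, w] i) := fun i ↦
    (congr($hψc (MvPolynomial.X i))).trans (congrArg (algebraMap _ Bh) (MvPolynomial.eval₂_X _ _ _))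
  let M := Spec (CommRingCat.of Bh)
  let b : M ⟶ Spec Γ(X, W') := Spec.map (CommRingCat.ofHom (algebraMap Γ(X, W') Bh))
  have hb : IsOpenImmersion b := IsOpenImmersion.of_isLocalization r
  let j : M ⟶ X := b ≫ hW'.fromSpec
  let v : M ⟶ AkModel k := Spec.map (CommRingCat.ofHom ψ)
  have hPr : Disjoint ((Submonoid.powers r : Submonoid _) : Set Γ(X, W')) (P.asIdeal : Set _) := by
    rw [Set.disjoint_left]
    rintro _ ⟨n, rfl⟩ hn
    exact hrP (P.2.mem_of_pow_mem n hn)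
  let w₀ : M := (⟨P.asIdeal.map (algebraMap Γ(X, W') Bh),
    IsLocalization.isPrime_of_isPrime_disjoint (.powers r) Bh _ P.2 hPr⟩ : PrimeSpectrum Bh)
  have hbw : b w₀ = P := by
    apply PrimeSpectrum.ext
    exact IsLocalization.under_map_of_isPrime_disjoint (.powers r) Bh P.2 hPr
  refine ⟨M, w₀, j, v, inferInstance, ?_, ?_, ?_, ?_, ?_⟩
  · exact (HasRingHomProperty.Spec_iff (P := @Etale)).mpr hψ
  · rw [Category.assoc, fromSpec_comp sX hW', AkModel.toC]
    change Spec.map _ ≫ Spec.map _ = Spec.map _ ≫ Spec.map _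
    rw [← Spec.map_comp, ← Spec.map_comp]
    congr 1
    ext c
    exact (hψC c).symm
  · change hW'.fromSpec (b w₀) = _
    rw [hbw, hW'.fromSpec_primeIdealOf]
  · rintro _ ⟨i, rfl⟩
    change ψ (AkModel.coord k i) ∈ P.asIdeal.map (algebraMap Γ(X, W') Bh)
    rw [hψX]
    apply Ideal.mem_map_of_mem
    fin_cases i
    · exact hP (Ideal.subset_span (by simp))
    · exact hP (Ideal.subset_span (by simp))
    · exact hP (Ideal.subset_span (by simp))
    · exact hwP
  · ext z
    have hzW : j z ∈ W' := by
      have : j z ∈ Set.range hW'.fromSpec := ⟨b z, rfl⟩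
      rwa [hW'.range_fromSpec] at this
    have h1 : ∀ c : Γ(X, W'), j z ∉ X.basicOpen c ↔ algebraMap _ Bh c ∈ z.asIdeal := fun c ↦ by
      refine ((fromSpec_mem_basicOpen_iff hW' c (b z)).not).trans ?_
      rw [not_not]
      rfl
    have h2 : j z ∈ Set.range (lamA ≫ iA) ↔ ∀ c ∈ Ideal.span {x₂, y₁, t₁},
        algebraMap _ Bh c ∈ z.asIdeal := by
      rw [mem_range_iff_forall_ker (lamA ≫ iA) hW' hzW, ← hker]
      have hcomp : ∀ c, ((lamA ≫ iA).app W').hom c = ε c := fun c ↦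
        congr(($(Scheme.Hom.comp_app lamA iA W')).hom c)
      refine forall_congr' fun c ↦ ?_
      rw [h1, RingHom.mem_ker]
      exact ⟨fun hc h ↦ hc ((hcomp c).trans h), fun hc h ↦ hc ((hcomp c).symm.trans h)⟩
    refine h2.trans ?_
    have h3 : (∀ c ∈ Ideal.span {x₂, y₁, t₁}, algebraMap _ Bh c ∈ z.asIdeal) ↔
        Ideal.span {x₂, y₁, t₁} ≤ z.asIdeal.comap (algebraMap _ Bh) := Iff.rfl
    rw [h3, Ideal.span_le]
    have h4 : v z ∈ AkModel.line k ↔ ({AkModel.coord k 0, AkModel.coord k 1, AkModel.coord k 2} :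
      Set (AkRing k)) ⊆ z.asIdeal.comap ψ := Iff.rfl
    change _ ↔ v z ∈ AkModel.line k
    rw [h4]
    simp only [Set.insert_subset_iff, Set.singleton_subset_iff, SetLike.mem_coe, Ideal.mem_comap,
      hψX]
    rfl

end

end TreeSurfaces

namespace TreeSurfaces

open Scheme

/-! ### Fibres over a curve -/

section

variable {X C : Scheme.{0}}

lemma isClosedImmersion_fiberι (π : X ⟶ C) {y : C} (hy : IsClosed {y}) :
    IsClosedImmersion (π.fiberι y) := by
  have := isClosed_singleton_iff_isClosedImmersion.mp hy
  exact inferInstanceAs (IsClosedImmersion (pullback.fst π (C.fromSpecResidueField y)))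

lemma ker_fiberι_ideal (π : X ⟶ C) {y : C} (hy : IsClosed {y}) {V : C.Opens} (hV : IsAffineOpen V)
    (hyV : y ∈ V) {J : Ideal Γ(C, V)} (hJ : ∀ s, y ∉ C.basicOpen s ↔ s ∈ J) {W : X.Opens}
    (hW : IsAffineOpen W) (e : W ≤ π ⁻¹ᵁ V) :
    (π.fiberι y).ker.ideal ⟨W, hW⟩ = J.map (π.appLE V W e).hom := by
  have := isClosed_singleton_iff_isClosedImmersion.mp hy
  obtain ⟨hM, huniq⟩ := isMaximal_of_forall_notMem_basicOpen hV hy hyV hJ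
  have h1 : (C.fromSpecResidueField y).ker.ideal ⟨V, hV⟩ = J := by
    refine ker_ideal_eq_of_isRadical _ hV hM.isPrime.isRadical fun x hx ↦ ?_
    rw [Scheme.range_fromSpecResidueField]
    constructor
    · rintro rfl s hs
      exact (hJ s).mpr hs
    · exact huniq x hx
  rw [← h1, ← ideal_comap_eq_map _ π hV hW e, ← IdealSheafData.ker_fst_of_isClosedImmersion]
  rfl

end

/-- Over an open set that meets only the components `a` and `b`, a function on an ambient scheme
vanishes on the tree of surfaces if it vanishes on these two components. -/
lemma TreeSurface.ker_inf_ker {T : Type} [PartialOrder T] [OrderBot T] {S F X : Scheme.{0}}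
    {sS : S ⟶ SpecC} {sF : F ⟶ SpecC} {σ : F ⟶ S} (ts : TreeSurface T sS sF σ) (ι : F ⟶ X)
    [IsClosedImmersion ι] {a b : T} {W : X.Opens} (hW : IsAffineOpen W)
    (h : ∀ c, c ≠ a → c ≠ b → ∀ z, ι (ts.incl c z) ∉ W) :
    (ts.incl a ≫ ι).ker.ideal ⟨W, hW⟩ ⊓ (ts.incl b ≫ ι).ker.ideal ⟨W, hW⟩ =
      ι.ker.ideal ⟨W, hW⟩ := by
  have := ts.isReduced
  have := ts.isClosedImmersion_incl
  have happ (c : T) (s : Γ(X, W)) : s ∈ (ts.incl c ≫ ι).ker.ideal ⟨W, hW⟩ ↔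
      ((ts.incl c).app (ι ⁻¹ᵁ W)).hom ((ι.app W).hom s) = 0 := by
    rw [mem_ker_ideal_iff _ hW, Scheme.Hom.comp_app]
    rfl
  ext s
  rw [Ideal.mem_inf, happ, happ, mem_ker_ideal_iff _ hW]
  refine ⟨fun ⟨ha, hb⟩ ↦ ?_, fun hs ↦ by simp [hs]⟩
  rw [← basicOpen_eq_bot_iff, eq_bot_iff]
  intro x hx
  have hxW : ι x ∈ W := (F.basicOpen_le _ hx : _)
  obtain ⟨c, z, rfl⟩ := ts.cover x
  have h0 : ((ts.incl c).app (ι ⁻¹ᵁ W)).hom ((ι.app W).hom s) = 0 := by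
    by_cases hca : c = a
    · exact hca ▸ ha
    · by_cases hcb : c = b
      · exact hcb ▸ hb
      · exact absurd hxW (h c hca hcb z)
  have h1 := (mem_basicOpen_app (ts.incl c) ((ι.app W).hom s) z).mpr hx
  rw [h0, Scheme.basicOpen_zero] at h1
  exact h1

open TensorProduct in
/-- A flat algebra is smooth at the points of a fibre that is smooth over the complex numbers. -/
lemma isSmoothAt_of_formallySmooth_fiber {R S A : Type} [CommRing R] [CommRing S] [CommRing A]
    [Algebra ℂ R] [Algebra R S] [Algebra ℂ S] [IsScalarTower ℂ R S] [Algebra.FiniteType ℂ R]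
    [Algebra.FinitePresentation R S] [Module.Flat R S] [Algebra S A] [Algebra ℂ A]
    [IsScalarTower ℂ S A] (hs : Function.Surjective (algebraMap S A)) (J : Ideal R) [hJ : J.IsMaximal]
    (hker : RingHom.ker (algebraMap S A) = J.map (algebraMap R S)) [Algebra.FormallySmooth ℂ A]
    (q : Ideal S) [hq : q.IsPrime] (hJq : J.map (algebraMap R S) ≤ q) : Algebra.IsSmoothAt R q := by
  have hJR := J.algebraMap_residueField_surjective
  have : q.LiesOver J :=
    ⟨hJ.eq_of_le (hq.comap (algebraMap R S)).ne_top (Ideal.map_le_iff_le_comap.mp hJq)⟩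
  let : Algebra R A := ((algebraMap S A).comp (algebraMap R S)).toAlgebra
  have : IsScalarTower R S A := .of_algebraMap_eq fun _ ↦ rfl
  let inr : S →ₐ[R] J.Fiber S := Algebra.TensorProduct.includeRight
  have hinr : Function.Surjective inr := by
    intro z
    induction z using TensorProduct.induction_on with
    | zero => exact ⟨0, map_zero _⟩
    | tmul r s =>
      obtain ⟨r, rfl⟩ := hJR r
      refine ⟨r • s, ?_⟩
      rw [Algebra.algebraMap_eq_smul_one, TensorProduct.smul_tmul]
      rfl
    | add a b ha hb =>
      obtain ⟨a, rfl⟩ := ha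
      obtain ⟨b, rfl⟩ := hb
      exact ⟨a + b, map_add _ _ _⟩
  have hJA : RingHom.ker (Algebra.ofId R J.ResidueField) ≤ RingHom.ker (Algebra.ofId R A) := by
    intro r hr
    have h1 : r ∈ J := by
      rwa [RingHom.mem_ker, Algebra.ofId_apply, Ideal.algebraMap_residueField_eq_zero] at hr
    change algebraMap S A (algebraMap R S r) = 0
    rw [← RingHom.mem_ker, hker]
    exact Ideal.mem_map_of_mem _ h1
  let f : J.ResidueField →ₐ[R] A :=
    AlgHom.liftOfSurjective (Algebra.ofId R J.ResidueField) hJR (Algebra.ofId R A) hJA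
  let l : J.Fiber S →ₐ[R] A :=
    Algebra.TensorProduct.productMap f (IsScalarTower.toAlgHom R S A)
  have hl (s : S) : l (inr s) = algebraMap S A s := by
    simp [l, inr]
  have hkinr : RingHom.ker (inr.restrictScalars ℂ) = RingHom.ker (IsScalarTower.toAlgHom ℂ S A) := by
    apply le_antisymm
    · intro s hs
      have : inr s = 0 := hs
      change algebraMap S A s = 0
      rw [← hl, this, map_zero]
    · change RingHom.ker (algebraMap S A) ≤ _
      rw [hker, Ideal.map_le_iff_le_comap]
      intro r hr
      change inr (algebraMap R S r) = 0
      rw [inr.commutes]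
      change (algebraMap R J.ResidueField r) ⊗ₜ[R] (1 : S) = 0
      rw [Ideal.algebraMap_residueField_eq_zero.mpr hr, TensorProduct.zero_tmul]
  let e : A ≃ₐ[ℂ] J.Fiber S :=
    ((Ideal.quotientKerAlgEquivOfSurjective (f := IsScalarTower.toAlgHom ℂ S A) hs).symm.trans
      (Ideal.quotientEquivAlgOfEq ℂ hkinr.symm)).trans
      (Ideal.quotientKerAlgEquivOfSurjective (f := inr.restrictScalars ℂ) hinr)
  have h1 : Algebra.FormallySmooth ℂ (J.Fiber S) := .of_equiv e
  have h2 : Algebra.FormallyUnramified ℂ J.ResidueField := by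
    refine .of_surjective (Algebra.ofId ℂ J.ResidueField) fun z ↦ ?_
    obtain ⟨r, rfl⟩ := hJR z
    obtain ⟨c, hc⟩ := exists_sub_mem_of_isMaximal (algebraMap ℂ R)
      (RingHom.finiteType_algebraMap.mpr inferInstance) J r
    refine ⟨c, ?_⟩
    rw [Algebra.ofId_apply, IsScalarTower.algebraMap_apply ℂ R J.ResidueField, eq_comm,
      ← sub_eq_zero, ← map_sub]
    exact Ideal.algebraMap_residueField_eq_zero.mpr hc
  have h3 : Algebra.FormallySmooth J.ResidueField (J.Fiber S) := .of_restrictScalars ℂ _ _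
  exact .of_formallySmooth_fiber J q

lemma smooth_const {X : Scheme.{0}} {sX : X ⟶ SpecC} {U W : X.Opens} [Smooth (U.ι ≫ sX)]
    (hW : IsAffineOpen W) (h : W ≤ U) : (const sX W).Smooth := by
  have h1 : Set.range hW.fromSpec ⊆ Set.range U.ι := by
    rw [hW.range_fromSpec, Scheme.Opens.range_ι]
    exact h
  have h2 : IsOpenImmersion.lift U.ι hW.fromSpec h1 ≫ U.ι ≫ sX = Spec.map (CommRingCat.ofHom
      (const sX W)) := by
    rw [← Category.assoc, IsOpenImmersion.lift_fac, fromSpec_comp]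
  have h3 : IsOpenImmersion (IsOpenImmersion.lift U.ι hW.fromSpec h1) := inferInstance
  have h4 : Smooth (Spec.map (CommRingCat.ofHom (const sX W))) := by
    rw [← h2]
    infer_instance
  exact (HasRingHomProperty.Spec_iff (P := @Smooth)).mp h4

section

variable {S X C : Scheme.{0}} {sS : S ⟶ SpecC} (hS : IsSmoothProjectiveSurface sS)
  {sC : C ⟶ SpecC} {π : X ⟶ C} {y : C} {T : Type} [PartialOrder T] [OrderBot T]
  {τ : π.fiber y ⟶ S} (ts : TreeSurface T sS (π.fiberι y ≫ π ≫ sC) τ)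

lemma TreeSurface.finite_isClosed (hT : IsTree T) (hy : IsClosed {y}) (p : T → Prop) :
    IsClosed {x | ∃ c, p c ∧ x ∈ Set.range (ts.incl c ≫ π.fiberι y)} := by
  have := hT.finite
  have := isClosedImmersion_fiberι π hy
  have := ts.isClosedImmersion_incl
  have h1 : {x | ∃ c, p c ∧ x ∈ Set.range (ts.incl c ≫ π.fiberι y)} =
      ⋃ c ∈ {c | p c}, Set.range (ts.incl c ≫ π.fiberι y) := by
    ext x
    simp
  rw [h1]
  exact (Set.toFinite _).isClosed_biUnion fun c _ ↦
    (ts.incl c ≫ π.fiberι y).isClosedEmbedding.isClosed_range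

include hS in
/-- The two components that meet in an intersection line form a degeneration with two branches. -/
lemma TreeSurface.exists_isTwoBranch [Flat π] (hT : IsTree T) (hy : IsClosed {y}) {V : C.Opens}
    (hV : IsAffineOpen V) (hyV : y ∈ V) {t : Γ(C, V)} (ht : t ∈ nonZeroDivisors Γ(C, V))
    (hJ : ∀ s, y ∉ C.basicOpen s ↔ s ∈ Ideal.span {t}) {a b : T} (hab : a ⋖ b) :
    ∃ (O : X.Opens) (hO : O ≤ π ⁻¹ᵁ V), ∃ U V' e s f u p,
      IsTwoBranch (π ≫ sC) (ts.incl a ≫ π.fiberι y) (ts.incl b ≫ π.fiberι y)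
        (pullback.fst (ts.incl a) (ts.incl b)) (pullback.snd (ts.incl a) (ts.incl b)) O
        ((π.appLE V O hO).hom t) U V' e s f u p := by
  have := isClosedImmersion_fiberι π hy
  have := ts.isClosedImmersion_incl
  have hfib (x : π.fiber y) : π (π.fiberι y x) = y := by
    have : π.fiberι y x ∈ Set.range (π.fiberι y) := ⟨x, rfl⟩
    rwa [π.range_fiberι] at this
  -- the complement of all other components of the fibre; three components never meet in one point
  let O : X.Opens := π ⁻¹ᵁ V ⊓
    ⟨_, (ts.finite_isClosed hT hy fun c ↦ c ≠ a ∧ c ≠ b).isOpen_compl⟩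
  have hO : O ≤ π ⁻¹ᵁ V := inf_le_left
  have hOc (c : T) (hca : c ≠ a) (hcb : c ≠ b) (z) : π.fiberι y (ts.incl c z) ∉ O :=
    fun h ↦ h.2 ⟨c, ⟨hca, hcb⟩, z, rfl⟩
  obtain ⟨U, V', e, s, f, u, p, hg⟩ := ts.exists_gluedCharts hS hT hab
  refine ⟨O, hO, U, V', e, s, f, u, p, inferInstance, inferInstance, ?_, ?_, ?_, ?_, ?_⟩
  · refine ⟨⟨by rw [pullback.condition_assoc]⟩,
      ⟨?_⟩⟩
    exact pullbackIsPullbackOfCompMono (ts.incl a) (ts.incl b) (π.fiberι y)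
  · simpa only [Category.assoc] using hg
  · intro W hW h
    have h1 : res h ((π.appLE V O hO).hom t) = (π.appLE V W (h.trans hO)).hom t :=
      congr(($(Scheme.Hom.appLE_map π hO (homOfLE h).op)).hom t)
    rw [h1]
    exact appLE_mem_nonZeroDivisors π hV hW _ ht
  · intro W hW h
    rw [ts.ker_inf_ker (π.fiberι y) hW fun c hca hcb z hz ↦ hOc c hca hcb z (h hz),
      ker_fiberι_ideal π hy hV hyV hJ hW (h.trans hO), Ideal.map_span, Set.image_singleton]
    congr 2
    exact congr(($(Scheme.Hom.appLE_map π hO (homOfLE h).op)).hom t).symm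
  · intro q
    refine ⟨?_, ?_⟩
    · change π _ ∈ V
      rw [Scheme.Hom.comp_apply, hfib]
      exact hyV
    · rintro ⟨c, ⟨hca, hcb⟩, z, hz⟩
      rw [Scheme.Hom.comp_apply, Scheme.Hom.comp_apply] at hz
      have hz' := (π.fiberι y).isEmbedding.injective hz
      rcases ts.eq_or_eq_of_mem_range hT hab (x := ts.incl a (pullback.fst (ts.incl a) (ts.incl b) q))
        ⟨_, rfl⟩ ((ts.mem_range_inter_iff a b _).mp ⟨q, rfl⟩) ⟨z, hz'⟩ with h | h
      · exact hca h
      · exact hcb h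

include hS in
/-- Every point on only one component of a fibre has an affine neighbourhood in which the fibre
is smooth. -/
lemma TreeSurface.exists_affine_smooth_fibre (hT : IsTree T) (hy : IsClosed {y})
    {V : C.Opens} (hV : IsAffineOpen V) (hyV : y ∈ V) {J : Ideal Γ(C, V)}
    (hJ : ∀ s, y ∉ C.basicOpen s ↔ s ∈ J) (a : T) (z : ts.comp a)
    (hz : ∀ b, b ≠ a → ts.incl a z ∉ Set.range (ts.incl b)) {O : X.Opens}
    (hzO : π.fiberι y (ts.incl a z) ∈ O) :
    ∃ (W : X.Opens) (hW : IsAffineOpen W) (hWV : W ≤ π ⁻¹ᵁ V), W ≤ O ∧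
      π.fiberι y (ts.incl a z) ∈ W ∧ (const ((ts.incl a ≫ π.fiberι y) ≫ π ≫ sC)
        ((ts.incl a ≫ π.fiberι y) ⁻¹ᵁ W)).Smooth ∧
      (ts.incl a ≫ π.fiberι y).ker.ideal ⟨W, hW⟩ = J.map (π.appLE V W hWV).hom := by
  have := isClosedImmersion_fiberι π hy
  have := ts.isClosedImmersion_incl
  have hfib (x : π.fiber y) : π (π.fiberι y x) = y := by
    have : π.fiberι y x ∈ Set.range (π.fiberι y) := ⟨x, rfl⟩
    rwa [π.range_fiberι] at this
  obtain ⟨U, hzU, hU⟩ := ts.isSmoothAt_comp hS hT a z hz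
  obtain ⟨U', hU'o, hU'⟩ := (ts.incl a ≫ π.fiberι y).isClosedEmbedding.isInducing.isOpen_iff.mp U.isOpen
  let O' : X.Opens := (π ⁻¹ᵁ V ⊓ O) ⊓ (⟨U', hU'o⟩ ⊓
    ⟨_, (ts.finite_isClosed hT hy fun c ↦ c ≠ a).isOpen_compl⟩)
  have hzO' : π.fiberι y (ts.incl a z) ∈ O' := by
    refine ⟨⟨?_, hzO⟩, ?_, ?_⟩
    · change π _ ∈ V
      rwa [hfib]
    · change z ∈ (ts.incl a ≫ π.fiberι y) ⁻¹' U'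
      rwa [hU']
    · rintro ⟨c, hca, w, hw⟩
      rw [Scheme.Hom.comp_apply] at hw
      exact hz c hca ⟨w, (π.fiberι y).isEmbedding.injective hw⟩
  obtain ⟨W, hW, hzW, hle⟩ := exists_isAffineOpen_mem_and_subset hzO'
  have hWV : W ≤ π ⁻¹ᵁ V := fun x hx ↦ (hle hx).1.1
  refine ⟨W, hW, hWV, fun x hx ↦ (hle hx).1.2, hzW, ?_, ?_⟩
  · have h1 : (ts.incl a ≫ π.fiberι y) ⁻¹ᵁ W ≤ U := by
      intro x hx
      have : x ∈ (ts.incl a ≫ π.fiberι y) ⁻¹' U' := (hle hx).2.1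
      rwa [hU'] at this
    rw [Category.assoc]
    exact smooth_const (hW.preimage (ts.incl a ≫ π.fiberι y)) h1
  · have h1 := ts.ker_inf_ker (π.fiberι y) (a := a) (b := a) hW
      fun c hc _ z hz ↦ (hle hz).2.2 ⟨c, hc, z, rfl⟩
    rw [inf_idem] at h1
    rw [h1, ker_fiberι_ideal π hy hV hyV hJ hW]

include hS in
/-- The total space is smooth at the points that lie on only one component of a fibre. -/
lemma TreeSurface.isSmoothAt_of_forall_notMem [Flat π] [LocallyOfFiniteType π]
    [LocallyOfFiniteType sC] [Smooth sC] (hT : IsTree T) (hy : IsClosed {y}) (a : T) (z : ts.comp a)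
    (hz : ∀ b, b ≠ a → ts.incl a z ∉ Set.range (ts.incl b)) :
    IsSmoothAt (π ≫ sC) (π.fiberι y (ts.incl a z)) := by
  have := isClosedImmersion_fiberι π hy
  have := ts.isClosedImmersion_incl
  have : IsLocallyNoetherian C := LocallyOfFiniteType.isLocallyNoetherian sC
  have : LocallyOfFinitePresentation π := inferInstance
  obtain ⟨V, hV, hyV, -⟩ := exists_isAffineOpen_mem_and_subset (x := y) (U := ⊤) trivial
  have hJ (s : Γ(C, V)) : y ∉ C.basicOpen s ↔ s ∈ (hV.primeIdealOf ⟨y, hyV⟩).asIdeal := by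
    rw [mem_basicOpen_iff_notMem_primeIdealOf hV s hyV, not_not]
  have hM := (isMaximal_of_forall_notMem_basicOpen hV hy hyV hJ).1
  obtain ⟨W, hW, hWV, -, hzW, hsm, hker⟩ := ts.exists_affine_smooth_fibre hS hT hy hV hyV hJ a z hz
    (O := ⊤) trivial
  set i := ts.incl a ≫ π.fiberι y
  have hzl : π.fiberι y (ts.incl a z) ∈ π.smoothLocus := by
    rw [Scheme.Hom.mem_smoothLocus, formallySmooth_stalkMap_iff V hV W hW hWV hzW]
    let := (const sC V).toAlgebra
    let := (const (π ≫ sC) W).toAlgebra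
    let := (const (i ≫ π ≫ sC) (i ⁻¹ᵁ W)).toAlgebra
    let := (π.appLE V W hWV).hom.toAlgebra
    let := (i.app W).hom.toAlgebra
    have : IsScalarTower ℂ Γ(C, V) Γ(X, W) :=
      .of_algebraMap_eq fun c ↦ (appLE_const π rfl hWV c).symm
    have : IsScalarTower ℂ Γ(X, W) Γ(ts.comp a, i ⁻¹ᵁ W) :=
      .of_algebraMap_eq fun c ↦ by
        have := appLE_const i rfl le_rfl c (sY := π ≫ sC) (U := W) (V := i ⁻¹ᵁ W)
        rw [Scheme.Hom.appLE_eq_app] at this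
        exact this.symm
    have : Algebra.FiniteType ℂ Γ(C, V) := const_finiteType sC hV
    have : Algebra.FinitePresentation Γ(C, V) Γ(X, W) := π.finitePresentation_appLE hV hW hWV
    have : Module.Flat Γ(C, V) Γ(X, W) := HasRingHomProperty.appLE @Flat π inferInstance ⟨V, hV⟩ ⟨W, hW⟩ hWV
    have : Algebra.Smooth ℂ Γ(ts.comp a, i ⁻¹ᵁ W) := hsm
    refine isSmoothAt_of_formallySmooth_fiber (i.app_surjective W hW) (hV.primeIdealOf ⟨y, hyV⟩).asIdeal
      ((i.ker_apply ⟨W, hW⟩).symm.trans hker) _ ?_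
    refine le_of_eq_of_le ((i.ker_apply ⟨W, hW⟩).symm.trans hker).symm fun s hs ↦ ?_
    by_contra hs'
    rw [← mem_basicOpen_iff_notMem_primeIdealOf hW s hzW] at hs'
    have h1 := (mem_basicOpen_app i s z).mpr hs'
    have h2 : (i.app W).hom s = 0 := hs
    rw [h2, Scheme.basicOpen_zero] at h1
    exact h1
  refine ⟨π.smoothLocus, hzl, ?_⟩
  have : Smooth (π.smoothLocus.ι ≫ π) := by
    rw [← Scheme.Hom.smoothLocus_eq_top_iff, ← Scheme.Hom.preimage_smoothLocus_eq]
    exact Scheme.Opens.ι_preimage_self _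
  rw [← Category.assoc]
  infer_instance

end

end TreeSurfaces

namespace TreeSurfaces

open Scheme

/-! ### Contracted components and differentials of the family -/

/-- A prime ideal that is locally generated by one element is minimal over every ideal below it
whose zero locus is nowhere dense. -/
lemma mem_minimalPrimes_of_forall_exists {B : Type*} [CommRing B] [IsNoetherianRing B]
    {I Q : Ideal B} [hQp : Q.IsPrime] (hIQ : I ≤ Q) {τ : B} (hτ : τ ∈ Q)
    (hQ : ∀ s ∈ Q, ∃ g ∉ Q, g * s ∈ Ideal.span {τ})
    (hI : ∀ h, (∀ s ∈ I, h * s = 0) → h ∈ Q) : Q ∈ I.minimalPrimes := by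
  classical
  refine ⟨⟨hQp, hIQ⟩, fun P ⟨hP, hIP⟩ hPQ ↦ ?_⟩
  choose! g hg hgs using hQ
  choose! r hr using fun s hs ↦ Ideal.mem_span_singleton.mp (hgs s hs)
  by_cases hτP : τ ∈ P
  · intro s hs
    exact (hP.mem_or_mem (hr s hs ▸ P.mul_mem_right _ hτP)).resolve_left fun h ↦ hg s hs (hPQ h)
  · -- Here `P` is `τ` times itself at `Q`, so that it vanishes there by the determinant trick.
    exfalso
    obtain ⟨S, hS⟩ := IsNoetherian.noetherian P
    have hSP (s : S) : (s : B) ∈ P := hS ▸ Submodule.subset_span s.2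
    have hrP (s : S) : ∃ a : S → B, ∑ j, a j • (j : B) = r s := by
      have h1 : r s ∈ P := (hP.mem_or_mem (hr s (hPQ (hSP s)) ▸ P.mul_mem_left _ (hSP s) :
        τ * r s ∈ P)).resolve_left hτP
      rw [← hS] at h1
      exact Submodule.mem_span_finset'.mp h1
    choose a ha using hrP
    let M : Matrix S S B := Matrix.diagonal (fun s : S ↦ g s) - τ • Matrix.of a
    have hM : M.mulVec (fun s ↦ (s : B)) = 0 := by
      funext s
      have h1 := hr s (hPQ (hSP s))
      rw [← ha s] at h1
      simp only [M, Matrix.sub_mulVec, Matrix.smul_mulVec, Pi.sub_apply, Pi.smul_apply,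
        Matrix.mulVec_diagonal, Pi.zero_apply, smul_eq_mul, h1]
      exact sub_self _
    have hdet (s : S) : M.det * s = 0 := by
      have h1 : M.adjugate.mulVec (M.mulVec fun s ↦ (s : B)) = M.det • fun s : S ↦ (s : B) := by
        rw [Matrix.mulVec_mulVec, Matrix.adjugate_mul, Matrix.smul_mulVec, Matrix.one_mulVec]
      rw [hM, Matrix.mulVec_zero] at h1
      exact (congrFun h1 s).symm
    have hdetQ : M.det ∈ Q := by
      refine hI _ fun s hs ↦ ?_
      have h1 : s ∈ Submodule.span B (S : Set B) := hS ▸ hIP hs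
      clear hs
      induction h1 using Submodule.span_induction with
      | mem x hx => exact hdet ⟨x, hx⟩
      | zero => exact mul_zero _
      | add x y _ _ hx hy => rw [mul_add, hx, hy, add_zero]
      | smul c x _ hx => rw [smul_eq_mul, mul_left_comm, hx, mul_zero]
    have h2 : (Ideal.Quotient.mk Q).mapMatrix M =
        Matrix.diagonal fun s : S ↦ Ideal.Quotient.mk Q (g s) := by
      ext i j
      have : Ideal.Quotient.mk Q τ = 0 := Ideal.Quotient.eq_zero_iff_mem.mpr hτ
      simp [M, Matrix.diagonal_apply, this, apply_ite (Ideal.Quotient.mk Q)]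
    have h3 : ∏ s : S, Ideal.Quotient.mk Q (g s) = 0 := by
      rw [← Matrix.det_diagonal, ← h2, ← RingHom.map_det, Ideal.Quotient.eq_zero_iff_mem]
      exact hdetQ
    obtain ⟨s, -, hs⟩ := Finset.prod_eq_zero_iff.mp h3
    exact hg s (hPQ (hSP s)) (Ideal.Quotient.eq_zero_iff_mem.mp hs)

/-- If the maximal ideal `P` is locally generated by the maximal ideal `J` of the base and by two
elements, then the relative differentials are generated by two elements near `P`. -/
lemma exists_forall_smul_mem_span_pair {D B : Type} [CommRing D] [CommRing B] [Algebra D B]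
    [Algebra ℂ D] [Algebra ℂ B] [IsScalarTower ℂ D B] [Algebra.FiniteType D B]
    [Algebra.FiniteType ℂ B] (J : Ideal D) (P : Ideal B) [hP : P.IsMaximal]
    (hJP : J.map (algebraMap D B) ≤ P) {x₁ x₂ : B} (h₁ : x₁ ∈ P) (h₂ : x₂ ∈ P)
    (h : ∀ b ∈ P, ∃ g ∉ P, g * b ∈ J.map (algebraMap D B) ⊔ Ideal.span {x₁, x₂}) :
    ∃ c ∉ P, ∃ ω₁ ω₂ : Ω[B⁄D], ∀ η : Ω[B⁄D], c • η ∈ Submodule.span B {ω₁, ω₂} := by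
  set d := KaehlerDifferential.D D B
  set N : Submodule B (Ω[B⁄D]) := Submodule.span B {d x₁, d x₂} with hN
  set N' : Submodule B (Ω[B⁄D]) := N ⊔ P • ⊤ with hN'
  have hPN {p : B} (hp : p ∈ P) (η : Ω[B⁄D]) : p • η ∈ N' :=
    Submodule.mem_sup_right (Submodule.smul_mem_smul hp trivial)
  have key (e : B) (he : e ∈ J.map (algebraMap D B) ⊔ Ideal.span {x₁, x₂}) : e ∈ P ∧ d e ∈ N' := by
    rw [Ideal.map, ← Ideal.span_union] at he
    induction he using Submodule.span_induction with
    | mem x hx =>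
      rcases hx with ⟨j, hj, rfl⟩ | rfl | rfl
      · exact ⟨hJP (Ideal.mem_map_of_mem _ hj), by rw [d.map_algebraMap]; exact zero_mem _⟩
      · exact ⟨h₁, Submodule.mem_sup_left (Submodule.subset_span (by simp))⟩
      · exact ⟨h₂, Submodule.mem_sup_left (Submodule.subset_span (by simp))⟩
    | zero => exact ⟨zero_mem _, by rw [map_zero]; exact zero_mem _⟩
    | add x y _ _ hx hy => exact ⟨add_mem hx.1 hy.1, by rw [map_add]; exact add_mem hx.2 hy.2⟩
    | smul a x _ hx =>
      refine ⟨P.mul_mem_left a hx.1, ?_⟩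
      rw [smul_eq_mul, d.leibniz]
      exact add_mem (N'.smul_mem a hx.2) (hPN hx.1 _)
  have hd (b : B) : d b ∈ N' := by
    obtain ⟨c, hc⟩ := exists_sub_mem_of_isMaximal (algebraMap ℂ B)
      (RingHom.finiteType_algebraMap.mpr inferInstance) P b
    have h1 : d b = d (b - algebraMap ℂ B c) := by
      rw [map_sub, IsScalarTower.algebraMap_apply ℂ D B, d.map_algebraMap, sub_zero]
    rw [h1]
    generalize b - algebraMap ℂ B c = b at hc
    obtain ⟨g, hg, hgb⟩ := h b hc
    have h2 := (key _ hgb).2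
    rw [d.leibniz] at h2
    have h3 : g • d b ∈ N' := (add_mem_cancel_right (hPN hc _)).mp h2
    obtain ⟨a, ha⟩ := hP.exists_inv hg
    obtain ⟨p, hp, hap⟩ := ha
    have h4 : d b = a • g • d b + p • d b := by
      rw [smul_smul, ← add_smul, hap, one_smul]
    rw [h4]
    exact add_mem (N'.smul_mem a h3) (hPN hp _)
  obtain ⟨r, hr, hrN⟩ := Submodule.exists_sub_one_mem_and_smul_le_of_fg_of_le_sup (I := P) (N := N)
    (N' := ⊤) (P := ⊤) Module.Finite.fg_top le_rfl (by
      rw [← KaehlerDifferential.span_range_derivation D B, Submodule.span_le]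
      rintro _ ⟨b, rfl⟩
      rw [KaehlerDifferential.span_range_derivation D B]
      exact hd b)
  refine ⟨r, fun hrP ↦ ?_, d x₁, d x₂, fun η ↦ hrN (Submodule.smul_mem_pointwise_smul η r ⊤ trivial)⟩
  exact hP.ne_top ((Ideal.eq_top_iff_one _).mpr (by simpa using sub_mem hrP hr))

namespace TreeSurface

section

variable {T : Type} [PartialOrder T] [OrderBot T] {S X : Scheme.{0}} {sS : S ⟶ SpecC}
  {sX : X ⟶ SpecC} {σ : X ⟶ S} (ts : TreeSurface T sS sX σ)

/-- Local coordinates of a component at a closed point that lies on no other component. -/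
lemma exists_coordinates (hS : IsSmoothProjectiveSurface sS) (hT : IsTree T)
    [LocallyOfFiniteType sX] {a : T} {z : ts.comp a} (hzc : IsClosed {z})
    (hz : ∀ b, b ≠ a → ts.incl a z ∉ Set.range (ts.incl b)) {O : (ts.comp a).Opens} (hzO : z ∈ O) :
    ∃ (V : (ts.comp a).Opens) (_ : IsAffineOpen V), z ∈ V ∧ V ≤ O ∧ ∃ u₁ u₂ : Γ(ts.comp a, V),
      ∀ s, z ∉ (ts.comp a).basicOpen s ↔ s ∈ Ideal.span {u₁, u₂} := by
  have := ts.smoothOfRelativeDimension_toC hS a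
  have := ts.isClosedImmersion_incl a
  have hsm : Smooth (ts.toC a) := SmoothOfRelativeDimension.smooth 2 (ts.toC a)
  have : LocallyOfFiniteType (ts.blow a ≫ ts.toC a) := by
    rw [← ts.incl_over]
    infer_instance
  have : LocallyOfFiniteType (ts.blow a) := locallyOfFiniteType_of_comp (ts.blow a) (ts.toC a)
  have : JacobsonSpace (ts.P a) := LocallyOfFiniteType.jacobsonSpace (ts.toC a)
  have hbz : IsClosed {ts.blow a z} :=
    (ts.blow a).closePoints_subset_preimage_closedPoints hzc
  let O₁ : (ts.P a).Opens := ⟨(ts.centre a)ᶜ, (ts.isClosed_centre hT a).isOpen_compl⟩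
  have hiso := (ts.isBlowup a).isIso_morphismRestrict O₁ fun z hz h ↦ h hz
  have hzO₁ : ts.blow a z ∈ O₁ := by
    rintro ⟨b, h, hb⟩
    refine hz b h.lt.ne' ((ts.mem_range_inter_iff a b z).mp ?_)
    rw [ts.range_fst h]
    exact hb
  -- the blowup is an open embedding over the complement of its centre
  let f := (ts.blow a ⁻¹ᵁ O₁).ι ≫ ts.blow a
  have hf : IsOpenImmersion f := by
    change IsOpenImmersion ((ts.blow a ⁻¹ᵁ O₁).ι ≫ ts.blow a)
    rw [← morphismRestrict_ι]
    infer_instance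
  let O₂ : (ts.P a).Opens := f ''ᵁ ((ts.blow a ⁻¹ᵁ O₁).ι ⁻¹ᵁ O)
  have hO₂ (w : ts.comp a) (hw : ts.blow a w ∈ O₂) : w ∈ O := by
    obtain ⟨v, hv, hvw⟩ := hw
    have hwO₁ : ts.blow a w ∈ O₁ := by
      rw [← hvw]
      exact v.2
    have h1 : f ⟨w, hwO₁⟩ = f v := hvw.symm
    have h2 := f.isOpenEmbedding.injective h1
    rw [← h2] at hv
    exact hv
  have hzO₂ : ts.blow a z ∈ O₂ := ⟨⟨z, hzO₁⟩, hzO, rfl⟩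
  obtain ⟨V, hV, hzV, hVO, g, -, -, hg⟩ := exists_etale_coordinates (ts.toC a) 2 hbz
    (O := O₁ ⊓ O₂) ⟨hzO₁, hzO₂⟩
  have hisoV := (ts.isBlowup a).isIso_morphismRestrict V fun z hz h ↦ (hVO h).1 hz
  have hVaff : IsAffineOpen (ts.blow a ⁻¹ᵁ V) := by
    have : IsAffine V := hV
    exact IsAffine.of_isIso (ts.blow a ∣_ V)
  obtain ⟨hinj, hsurj⟩ := bijective_app_of_isIso (ts.blow a) V
  refine ⟨ts.blow a ⁻¹ᵁ V, hVaff, hzV, fun w hw ↦ hO₂ w (hVO hw).2,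
    ((ts.blow a).app V).hom (g (MvPolynomial.X 0)), ((ts.blow a).app V).hom (g (MvPolynomial.X 1)),
    fun s ↦ ?_⟩
  obtain ⟨s, rfl⟩ := hsurj s
  have hrange : (Set.range fun i ↦ g (MvPolynomial.X i)) =
      {g (MvPolynomial.X 0), g (MvPolynomial.X 1)} := by
    ext
    simp [Fin.exists_fin_two, eq_comm]
  have hmap : Ideal.span {((ts.blow a).app V).hom (g (MvPolynomial.X 0)),
      ((ts.blow a).app V).hom (g (MvPolynomial.X 1))} =
      (Ideal.span {g (MvPolynomial.X 0), g (MvPolynomial.X 1)}).map ((ts.blow a).app V).hom := by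
    rw [Ideal.map_span, Set.image_pair]
  rw [mem_basicOpen_app, hg, hrange, hmap, Ideal.mem_map_iff_of_surjective _ hsurj]
  exact ⟨fun h ↦ ⟨s, h, rfl⟩, fun ⟨r, hr, hrs⟩ ↦ hinj hrs ▸ hr⟩

lemma exists_ne (hS : IsSmoothProjectiveSurface sS) (hT : IsTree T) {c : T} (hc : c ≠ ⊥) :
    ∃ w₀ w₁ : ts.comp c, w₀ ≠ w₁ := by
  obtain ⟨a, ha, -⟩ := hT.pred c hc
  obtain ⟨U, V, e, s, f, t, p, hg⟩ := ts.exists_gluedCharts hS hT ha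
  have := ts.isClosedImmersion_incl a
  exact ⟨_, _, fun h ↦ hg.proj.ne 0 1 (by decide)
    ((pullback.snd (ts.incl a) (ts.incl c)).isClosedEmbedding.injective h)⟩

end

variable {S X C : Scheme.{0}} {sS : S ⟶ SpecC} (hS : IsSmoothProjectiveSurface sS)
  {sC : C ⟶ SpecC} {π : X ⟶ C} {σ : X ⟶ pullback sS sC} {y : C} {T : Type} [PartialOrder T]
  [OrderBot T] (ts : TreeSurface T sS (π.fiberι y ≫ π ≫ sC)
    (π.fiberι y ≫ σ ≫ pullback.fst sS sC))

include hS in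
/-- The components that are contracted lie in the exceptional locus of `σ`. -/
lemma notMem_of_isOpenImmersion [LocallyOfFiniteType π] [LocallyOfFiniteType sC]
    (hσ : σ ≫ pullback.snd sS sC = π) (hT : IsTree T) (hy : IsClosed {y})
    {U : X.Opens} [hU : IsOpenImmersion (U.ι ≫ σ)] {c : T} (hc : c ≠ ⊥) (z : ts.comp c) :
    π.fiberι y (ts.incl c z) ∉ U := by
  intro hzU
  have := hT.finite
  have := isClosedImmersion_fiberι π hy
  have := ts.isClosedImmersion_incl c
  have := ts.irreducibleSpace_comp hS hT c
  have hsS : Smooth sS := by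
    have := hS.smooth
    exact SmoothOfRelativeDimension.smooth 2 sS
  set i := ts.incl c ≫ π.fiberι y with hi
  set sM := i ≫ π ≫ sC with hsM
  have : LocallyOfFiniteType sM := inferInstance
  have : JacobsonSpace (ts.comp c) := LocallyOfFiniteType.jacobsonSpace sM
  have hfib (x : π.fiber y) : π (π.fiberι y x) = y := by
    have : π.fiberι y x ∈ Set.range (π.fiberι y) := ⟨x, rfl⟩
    rwa [π.range_fiberι] at this
  obtain ⟨a, ha, hac⟩ := exists_covBy_le_of_lt (bot_lt_iff_ne_bot.mpr hc)
  -- `σ` takes the same value at all closed points of the component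
  have heq (z₁ z₂ : ts.comp c) (h₁ : IsClosed {z₁}) (h₂ : IsClosed {z₂}) :
      σ (i z₁) = σ (i z₂) := by
    let g (z : ts.comp c) (hz : IsClosed {z}) : SpecC ⟶ pullback sS sC :=
      pointOfClosedPoint sM z hz ≫ i ≫ σ
    have hσC : σ ≫ pullback.fst sS sC ≫ sS = π ≫ sC := by
      rw [pullback.condition, ← Category.assoc, hσ]
    have hg : g z₁ h₁ = g z₂ h₂ := by
      have hg1 (z : ts.comp c) (hz : IsClosed {z}) :
          (g z hz ≫ pullback.fst sS sC) ≫ sS = 𝟙 _ := by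
        simp only [g, Category.assoc, hσC]
        exact pointOfClosedPoint_comp sM z hz
      have hg2 (z : ts.comp c) (hz : IsClosed {z}) :
          (g z hz ≫ pullback.snd sS sC) ≫ sC = 𝟙 _ := by
        simp only [g, Category.assoc, reassoc_of% hσ]
        exact pointOfClosedPoint_comp sM z hz
      apply pullback.hom_ext
      · refine ext_of_apply_closedPoint_eq sS (hg1 _ _) (hg1 _ _) ?_
        have h3 (z : ts.comp c) (hz : IsClosed {z}) :
            (g z hz ≫ pullback.fst sS sC) (IsLocalRing.closedPoint ℂ) = ts.rootIso.hom (ts.pt ha) := by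
          refine Eq.trans ?_ (ts.σ_contract ha c hac z)
          exact congrArg (fun w ↦ (pullback.fst sS sC) (σ (i w))) (pointOfClosedPoint_apply sM z hz _)
        rw [h3, h3]
      · refine ext_of_apply_closedPoint_eq sC (hg2 _ _) (hg2 _ _) ?_
        have h3 (z : ts.comp c) (hz : IsClosed {z}) :
            (g z hz ≫ pullback.snd sS sC) (IsLocalRing.closedPoint ℂ) = y := by
          simp only [g, i, Category.assoc, hσ]
          exact hfib _
        rw [h3, h3]
    have h4 (z : ts.comp c) (hz : IsClosed {z}) : g z hz (IsLocalRing.closedPoint ℂ) = σ (i z) := by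
      exact congrArg (fun w ↦ σ (i w)) (pointOfClosedPoint_apply sM z hz _)
    rw [← h4 z₁ h₁, ← h4 z₂ h₂, hg]
  -- an open subset of the component has more than one closed point, but `σ` is injective on `U`
  have hUo : IsOpen (i ⁻¹' (U : Set X)) := U.isOpen.preimage i.continuous
  obtain ⟨z₁, hz₁U, hz₁⟩ := nonempty_inter_closedPoints (Z := i ⁻¹' (U : Set X)) ⟨z, hzU⟩
    hUo.isLocallyClosed
  have hne : ((i ⁻¹' (U : Set X)) \ {z₁}).Nonempty := by
    rw [Set.sdiff_nonempty]
    intro hsub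
    have h1 : i ⁻¹' (U : Set X) = {z₁} := hsub.antisymm (Set.singleton_subset_iff.mpr hz₁U)
    have h2 : IsClopen {z₁} := ⟨hz₁, h1 ▸ hUo⟩
    have h3 := h2.eq_univ (Set.singleton_nonempty _)
    obtain ⟨w₀, w₁, hw⟩ := ts.exists_ne hS hT hc
    have h4 (w : ts.comp c) : w = z₁ := (h3.symm ▸ Set.mem_univ w : w ∈ ({z₁} : Set _))
    exact hw ((h4 w₀).trans (h4 w₁).symm)
  obtain ⟨z₂, ⟨hz₂U, hz₂ne⟩, hz₂⟩ := nonempty_inter_closedPoints hne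
    (hUo.sdiff hz₁).isLocallyClosed
  have h1 : (U.ι ≫ σ) ⟨i z₁, hz₁U⟩ = (U.ι ≫ σ) ⟨i z₂, hz₂U⟩ := heq z₁ z₂ hz₁ hz₂
  have h2 := (U.ι ≫ σ).isOpenEmbedding.injective h1
  exact hz₂ne (i.isClosedEmbedding.injective (congrArg Subtype.val h2)).symm

end TreeSurface

end TreeSurfaces

namespace TreeSurfaces

open Scheme

/-! ### Other fibres near an intersection line -/

lemma exists_pow_mul_mem_of_res_mem_map {X : Scheme.{0}} {W : X.Opens} (hW : IsAffineOpen W)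
    (g s : Γ(X, W)) {K : Ideal Γ(X, W)}
    (h : res (X.basicOpen_le g) s ∈ K.map (res (X.basicOpen_le g))) : ∃ n, g ^ n * s ∈ K := by
  have := hW.isLocalization_basicOpen g
  obtain ⟨_, ⟨n, rfl⟩, hn⟩ := (IsLocalization.algebraMap_mem_map_algebraMap_iff (.powers g)
    Γ(X, X.basicOpen g) K s).mp h
  exact ⟨n, hn⟩

lemma map_fiberι {X C : Scheme.{0}} (π : X ⟶ C) {y : C} (x : π.fiber y) : π (π.fiberι y x) = y := by
  have : π.fiberι y x ∈ Set.range (π.fiberι y) := ⟨x, rfl⟩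
  rwa [π.range_fiberι] at this

namespace TreeSurface

variable {S X C : Scheme.{0}} {sS : S ⟶ SpecC} (hS : IsSmoothProjectiveSurface sS)
  {sC : C ⟶ SpecC} {π : X ⟶ C} {y : C} {T : Type} [PartialOrder T]
  [OrderBot T] {τ : π.fiber y ⟶ S} (ts : TreeSurface T sS (π.fiberι y ≫ π ≫ sC) τ)

include hS in
/-- At the generic point of a component, the ideal of the component is generated by the ideal of
the fibre. -/
lemma exists_mul_mem_map_of_genericPoint (hT : IsTree T) (hy : IsClosed {y}) {V : C.Opens}
    (hV : IsAffineOpen V) (hyV : y ∈ V) {J : Ideal Γ(C, V)}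
    (hJ : ∀ s, y ∉ C.basicOpen s ↔ s ∈ J) (c : T) {η : ts.comp c} (hη : IsGenericPoint η Set.univ)
    {W : X.Opens} (hW : IsAffineOpen W) (hWV : W ≤ π ⁻¹ᵁ V) (hηW : π.fiberι y (ts.incl c η) ∈ W)
    {s : Γ(X, W)} (hs : π.fiberι y (ts.incl c η) ∉ X.basicOpen s) :
    ∃ g, π.fiberι y (ts.incl c η) ∈ X.basicOpen g ∧ g * s ∈ J.map (π.appLE V W hWV).hom := by
  have := isClosedImmersion_fiberι π hy
  have := ts.isClosedImmersion_incl
  have := ts.isReduced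
  let O : X.Opens := ⟨_, (ts.finite_isClosed hT hy fun b ↦ b ≠ c).isOpen_compl⟩
  have hηO : π.fiberι y (ts.incl c η) ∈ O := by
    rintro ⟨b, hb, w, hw⟩
    have h1 : ts.incl b w = ts.incl c η := (π.fiberι y).isEmbedding.injective hw
    refine hb (ts.eq_of_range_subset hS hT ?_).symm
    rintro _ ⟨z, rfl⟩
    have h2 : IsClosed (ts.incl c ⁻¹' Set.range (ts.incl b)) :=
      (ts.incl b).isClosedEmbedding.isClosed_range.preimage (ts.incl c).continuous
    exact (hη.mem_closed_set_iff h2).mp ⟨w, h1⟩ trivial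
  obtain ⟨g, hgO, hηg⟩ := hW.exists_basicOpen_le ⟨_, hηO⟩ hηW
  have hWg := hW.basicOpen g
  set r := res (X.basicOpen_le g) s with hr
  have h0 : ((π.fiberι y).app (X.basicOpen g)).hom r = 0 := by
    rw [← basicOpen_eq_bot_iff, eq_bot_iff]
    intro x hx
    have hxg : π.fiberι y x ∈ X.basicOpen g := (π.fiber y).basicOpen_le _ hx
    obtain ⟨b, w, rfl⟩ := ts.cover x
    obtain rfl : b = c := by
      by_contra hb
      exact hgO hxg ⟨b, hb, w, rfl⟩
    have h2 : π.fiberι y (ts.incl b w) ∈ X.basicOpen s :=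
      (mem_basicOpen_res _ s hxg).mp ((mem_basicOpen_app (π.fiberι y) r _).mp hx)
    exact absurd ((hη.mem_open_set_iff ((X.basicOpen s).isOpen.preimage
      (ts.incl b ≫ π.fiberι y).continuous)).mpr ⟨w, trivial, h2⟩) hs
  rw [← mem_ker_ideal_iff _ hWg, ker_fiberι_ideal π hy hV hyV hJ hWg ((X.basicOpen_le g).trans hWV)]
    at h0
  have h1 : J.map (π.appLE V (X.basicOpen g) ((X.basicOpen_le g).trans hWV)).hom =
      (J.map (π.appLE V W hWV).hom).map (res (X.basicOpen_le g)) := by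
    rw [Ideal.map_map]
    congr 1
    ext a
    exact (res_appLE hWV (X.basicOpen_le g) a).symm
  rw [h1] at h0
  obtain ⟨n, hn⟩ := exists_pow_mul_mem_of_res_mem_map hW g s h0
  refine ⟨g ^ n, ?_, hn⟩
  rcases n.eq_zero_or_pos with rfl | hn0
  · rw [pow_zero, X.basicOpen_of_isUnit isUnit_one]
    exact hηW
  · rwa [X.basicOpen_pow _ hn0]

include hS in
/-- The ideal of a closed point on only one component is locally generated by the ideal of the
fibre and by two more functions. -/
lemma exists_mul_mem_sup_span_pair [LocallyOfFiniteType π] [LocallyOfFiniteType sC] (hT : IsTree T)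
    (hy : IsClosed {y}) {V : C.Opens} (hV : IsAffineOpen V) (hyV : y ∈ V) {J : Ideal Γ(C, V)}
    (hJ : ∀ s, y ∉ C.basicOpen s ↔ s ∈ J) (a : T) {z : ts.comp a} (hzc : IsClosed {z})
    (hz : ∀ b, b ≠ a → ts.incl a z ∉ Set.range (ts.incl b)) {W : X.Opens} (hW : IsAffineOpen W)
    (hWV : W ≤ π ⁻¹ᵁ V) (hzW : π.fiberι y (ts.incl a z) ∈ W) :
    ∃ x₁ x₂ : Γ(X, W), π.fiberι y (ts.incl a z) ∉ X.basicOpen x₁ ∧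
      π.fiberι y (ts.incl a z) ∉ X.basicOpen x₂ ∧
      ∀ b, π.fiberι y (ts.incl a z) ∉ X.basicOpen b → ∃ g, π.fiberι y (ts.incl a z) ∈ X.basicOpen g ∧
        g * b ∈ J.map (π.appLE V W hWV).hom ⊔ Ideal.span {x₁, x₂} := by
  have := isClosedImmersion_fiberι π hy
  have := ts.isClosedImmersion_incl
  set i := ts.incl a ≫ π.fiberι y with hi
  let O : X.Opens := ⟨_, (ts.finite_isClosed hT hy fun b ↦ b ≠ a).isOpen_compl⟩
  have hzO : i z ∈ O := by
    rintro ⟨b, hb, w, hw⟩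
    exact hz b hb ⟨w, (π.fiberι y).isEmbedding.injective hw⟩
  obtain ⟨V₁, hV₁, hzV₁, hVO, u₁, u₂, hu⟩ := ts.exists_coordinates hS hT hzc hz
    (O := i ⁻¹ᵁ (W ⊓ O)) ⟨hzW, hzO⟩
  obtain ⟨U', hU'o, hU'⟩ := i.isClosedEmbedding.isInducing.isOpen_iff.mp V₁.isOpen
  obtain ⟨h, hhO, hzh⟩ := hW.exists_basicOpen_le (V := O ⊓ ⟨U', hU'o⟩) ⟨i z, hzO, by
    change z ∈ i ⁻¹' U'
    rwa [hU']⟩ hzW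
  have hWh := hW.basicOpen h
  set ρ := res (X.basicOpen_le h)
  have hleV : i ⁻¹ᵁ X.basicOpen h ≤ V₁ := by
    intro w hw
    have : w ∈ i ⁻¹' U' := (hhO hw).2
    rwa [hU'] at this
  have hker : i.ker.ideal ⟨X.basicOpen h, hWh⟩ = (J.map (π.appLE V W hWV).hom).map ρ := by
    have h1 := ts.ker_inf_ker (π.fiberι y) (a := a) (b := a) hWh
      fun b hb _ w hw ↦ (hhO hw).1 ⟨b, hb, w, rfl⟩
    rw [inf_idem] at h1
    rw [h1, ker_fiberι_ideal π hy hV hyV hJ hWh ((X.basicOpen_le h).trans hWV), Ideal.map_map]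
    congr 1
    ext a
    exact (res_appLE hWV (X.basicOpen_le h) a).symm
  have hlift (u : Γ(ts.comp a, V₁)) (hu : z ∉ (ts.comp a).basicOpen u) : ∃ (v : Γ(X, X.basicOpen h))
      (x : Γ(X, W)), (i.app _).hom v = res hleV u ∧ i z ∉ X.basicOpen x ∧ v ∈ Ideal.span {ρ x} := by
    obtain ⟨v, hv⟩ := i.app_surjective _ hWh (res hleV u)
    obtain ⟨x, k, hx⟩ := exists_pow_mul_eq_map hW h v
    refine ⟨v, x, hv, fun hzx ↦ hu ?_, ?_⟩
    · have h1 : i z ∈ X.basicOpen (ρ x) := (mem_basicOpen_res _ x hzh).mpr hzx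
      have h2 : ρ x = v * ρ h ^ k := hx.symm
      rw [h2, X.basicOpen_mul] at h1
      have h3 := (mem_basicOpen_app i v z).mpr h1.1
      rw [hv] at h3
      exact (mem_basicOpen_res hleV u hzh).mp h3
    · have hunit : IsUnit (ρ h) := RingedSpace.isUnit_res_basicOpen _ _
      rw [← Ideal.mul_unit_mem_iff_mem _ (hunit.pow k)]
      exact Ideal.mem_span_singleton.mpr (dvd_of_eq hx.symm)
  obtain ⟨v₁, x₁, hv₁, hx₁, hvx₁⟩ := hlift u₁ ((hu _).mpr (Ideal.subset_span (by simp)))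
  obtain ⟨v₂, x₂, hv₂, hx₂, hvx₂⟩ := hlift u₂ ((hu _).mpr (Ideal.subset_span (by simp)))
  refine ⟨x₁, x₂, hx₁, hx₂, fun b hb ↦ ?_⟩
  have hV₁W : V₁ ≤ i ⁻¹ᵁ W := fun w hw ↦ (hVO hw).1
  have hb1 : z ∉ (ts.comp a).basicOpen ((i.appLE W V₁ hV₁W).hom b) :=
    fun h ↦ hb ((mem_basicOpen_appLE hV₁W b hzV₁).mp h)
  obtain ⟨c₁, c₂, hc⟩ := Ideal.mem_span_pair.mp ((hu _).mp hb1)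
  obtain ⟨d₁, hd₁⟩ := i.app_surjective _ hWh (res hleV c₁)
  obtain ⟨d₂, hd₂⟩ := i.app_surjective _ hWh (res hleV c₂)
  have hbr : (i.app _).hom (ρ b) = (i.app _).hom (d₁ * v₁ + d₂ * v₂) := by
    rw [map_add, map_mul, map_mul, hd₁, hd₂, hv₁, hv₂, ← map_mul, ← map_mul, ← map_add, hc,
      app_res, res_appLE]
    rw [Scheme.Hom.app_eq_appLE]
    exact congr(($(Scheme.Hom.appLE_map i le_rfl (homOfLE (show i ⁻¹ᵁ X.basicOpen h ≤ i ⁻¹ᵁ W from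
      fun _ hx ↦ X.basicOpen_le h hx)).op)).hom b)
  have hmem : ρ b ∈ (J.map (π.appLE V W hWV).hom ⊔ Ideal.span {x₁, x₂}).map ρ := by
    have h1 : ρ b - (d₁ * v₁ + d₂ * v₂) ∈ (J.map (π.appLE V W hWV).hom).map ρ := by
      rw [← hker, mem_ker_ideal_iff i hWh, map_sub, hbr, sub_self]
    have h2 (v : Γ(X, X.basicOpen h)) (x : Γ(X, W)) (hx : x ∈ ({x₁, x₂} : Set Γ(X, W)))
        (hv : v ∈ Ideal.span {ρ x}) : v ∈ (Ideal.span {x₁, x₂}).map ρ := by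
      refine (Ideal.span_singleton_le_iff_mem _).mpr ?_ hv
      exact Ideal.mem_map_of_mem _ (Ideal.subset_span hx)
    rw [Ideal.map_sup]
    have h3 := Submodule.add_mem_sup h1 (add_mem (Ideal.mul_mem_left _ d₁ (h2 v₁ x₁ (by simp) hvx₁))
      (Ideal.mul_mem_left _ d₂ (h2 v₂ x₂ (by simp) hvx₂)))
    rwa [sub_add_cancel] at h3
  obtain ⟨n, hn⟩ := exists_pow_mul_mem_of_res_mem_map hW h b hmem
  refine ⟨h ^ n, ?_, hn⟩
  rcases n.eq_zero_or_pos with rfl | hn0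
  · rw [pow_zero, X.basicOpen_of_isUnit isUnit_one]
    exact hzW
  · rwa [X.basicOpen_pow _ hn0]

end TreeSurface

/-- Near a given point, every other fibre meets only its root component: a contracted component is
an irreducible component of the exceptional locus of `σ`, and there are only finitely many of
these. -/
lemma exists_affine_forall_notMem {S X C : Scheme.{0}} {sS : S ⟶ SpecC}
    (hS : IsSmoothProjectiveSurface sS) {sC : C ⟶ SpecC} {π : X ⟶ C} {σ : X ⟶ pullback sS sC}
    [LocallyOfFiniteType π] [LocallyOfFiniteType sC] (hσ : σ ≫ pullback.snd sS sC = π)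
    {U : X.Opens} [IsOpenImmersion (U.ι ≫ σ)] (hU : Dense (U : Set X)) {V : C.Opens}
    (hV : IsAffineOpen V) {g : MvPolynomial (Fin 1) ℂ →+* Γ(C, V)} (hg : g.Etale)
    (hgC : g.comp MvPolynomial.C = const sC V) {p : X} {O : X.Opens} (hO : O ≤ π ⁻¹ᵁ V) (hp : p ∈ O) :
    ∃ (W : X.Opens) (_ : IsAffineOpen W), p ∈ W ∧ W ≤ O ∧ ∀ (y : C) (_ : IsClosed {y}) (_ : y ≠ π p)
      (T : Type) (_ : PartialOrder T) (_ : OrderBot T) (_ : IsTree T)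
      (ts : TreeSurface T sS (π.fiberι y ≫ π ≫ sC) (π.fiberι y ≫ σ ≫ pullback.fst sS sC)) (c : T)
      (_ : c ≠ ⊥) (z : ts.comp c), π.fiberι y (ts.incl c z) ∉ W := by
  obtain ⟨W, hW, hpW, hWO⟩ := exists_isAffineOpen_mem_and_subset hp
  have hWV : W ≤ π ⁻¹ᵁ V := fun x hx ↦ hO (hWO hx)
  have hft := const_finiteType (π ≫ sC) hW
  have hnoeth : IsNoetherianRing Γ(X, W) := by
    algebraize [const (π ≫ sC) W]
    exact Algebra.FiniteType.isNoetherianRing ℂ _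
  let Z : Set (PrimeSpectrum Γ(X, W)) := hW.fromSpec ⁻¹' (U : Set X)ᶜ
  have hZ : IsClosed Z := U.isOpen.isClosed_compl.preimage hW.fromSpec.continuous
  -- `I` is the ideal of the exceptional locus. The functions that annihilate it are nilpotent, as
  -- `U` is dense.
  set I := PrimeSpectrum.vanishingIdeal Z with hI
  have hIn : ∀ h, (∀ s ∈ I, h * s = 0) → ∀ q : PrimeSpectrum Γ(X, W), h ∈ q.asIdeal := by
    intro h hh q
    by_contra hhq
    obtain ⟨x, hxh, hxU⟩ := hU.inter_open_nonempty (X.basicOpen h) (X.basicOpen h).isOpen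
      ⟨_, (fromSpec_mem_basicOpen_iff hW h q).mpr hhq⟩
    have hxW := X.basicOpen_le h hxh
    rw [SetLike.mem_coe, mem_basicOpen_iff_notMem_primeIdealOf hW h hxW] at hxh
    have h1 : hW.primeIdealOf ⟨x, hxW⟩ ∉ Z := by
      intro h2
      have h3 : hW.fromSpec (hW.primeIdealOf ⟨x, hxW⟩) ∉ U := h2
      rw [hW.fromSpec_primeIdealOf] at h3
      exact h3 hxU
    rw [← hZ.closure_eq, ← PrimeSpectrum.zeroLocus_vanishingIdeal_eq_closure,
      PrimeSpectrum.mem_zeroLocus, Set.not_subset] at h1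
    obtain ⟨s, hs, hsx⟩ := h1
    have h2 : h * s ∈ (hW.primeIdealOf ⟨x, hxW⟩).asIdeal := by
      rw [hh s hs]
      exact zero_mem _
    exact ((hW.primeIdealOf ⟨x, hxW⟩).2.mem_or_mem h2).elim hxh hsx
  have hfin : I.minimalPrimes.Finite := Ideal.finite_minimalPrimes_of_isNoetherianRing _ I
  -- a function that does not vanish at `p`, but on all components of the exceptional locus that
  -- do not pass through `p`
  obtain ⟨f, hpf, hf⟩ : ∃ f, p ∈ X.basicOpen f ∧ ∀ Q ∈ I.minimalPrimes,
      ¬ Q ≤ (hW.primeIdealOf ⟨p, hpW⟩).asIdeal → f ∈ Q := by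
    classical
    let M := hfin.toFinset.filter fun Q ↦ ¬ Q ≤ (hW.primeIdealOf ⟨p, hpW⟩).asIdeal
    have h1 : ¬ M.inf id ≤ (hW.primeIdealOf ⟨p, hpW⟩).asIdeal := by
      rw [(hW.primeIdealOf ⟨p, hpW⟩).2.inf_le']
      rintro ⟨Q, hQ, hle⟩
      exact (Finset.mem_filter.mp hQ).2 hle
    obtain ⟨f, hf, hfp⟩ := SetLike.not_le_iff_exists.mp h1
    refine ⟨f, (mem_basicOpen_iff_notMem_primeIdealOf hW f hpW).mpr hfp, fun Q hQ hQp ↦ ?_⟩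
    exact (Finset.inf_le (f := id) (Finset.mem_filter.mpr ⟨hfin.mem_toFinset.mpr hQ, hQp⟩) :
      M.inf id ≤ Q) hf
  refine ⟨X.basicOpen f, hW.basicOpen f, hpf, (X.basicOpen_le f).trans hWO,
    fun y hy hyp T _ _ hT ts c hc z hz ↦ ?_⟩
  have := isClosedImmersion_fiberι π hy
  have := ts.isClosedImmersion_incl
  have := ts.irreducibleSpace_comp hS hT c
  have hyV : y ∈ V := by
    have := hWV (X.basicOpen_le f hz)
    rwa [Scheme.Hom.mem_preimage, map_fiberι] at this
  set i := ts.incl c ≫ π.fiberι y with hi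
  let η := genericPoint (ts.comp c)
  have hη : IsGenericPoint η Set.univ := genericPoint_spec (ts.comp c)
  have hηf : i η ∈ X.basicOpen f := (hη.mem_open_set_iff ((X.basicOpen f).isOpen.preimage
    i.continuous)).mpr ⟨z, trivial, hz⟩
  have hηW := X.basicOpen_le f hηf
  set Q := hW.primeIdealOf ⟨i η, hηW⟩ with hQ
  have hQmem (s : Γ(X, W)) : i η ∉ X.basicOpen s ↔ s ∈ Q.asIdeal := by
    rw [mem_basicOpen_iff_notMem_primeIdealOf hW s hηW, not_not]
  have hJ (s : Γ(C, V)) : y ∉ C.basicOpen s ↔ s ∈ (hV.primeIdealOf ⟨y, hyV⟩).asIdeal := by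
    rw [mem_basicOpen_iff_notMem_primeIdealOf hV s hyV, not_not]
  have hM := (isMaximal_of_forall_notMem_basicOpen hV hy hyV hJ).1
  have hiη (s : Γ(C, V)) : (π.appLE V W hWV).hom s ∈ Q.asIdeal ↔
      s ∈ (hV.primeIdealOf ⟨y, hyV⟩).asIdeal := by
    rw [← hQmem, ← hJ, mem_basicOpen_appLE hWV s hηW]
    change π (π.fiberι y (ts.incl c η)) ∉ _ ↔ _
    rw [map_fiberι]
  -- The prime ideal of the component contains `I` and is locally generated by a coordinate of the
  -- base curve, so that it has height at most one.
  have hQmin : Q.asIdeal ∈ I.minimalPrimes := by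
    let := (const sC V).toAlgebra
    let g₁ : MvPolynomial (Fin 1) ℂ →ₐ[ℂ] Γ(C, V) :=
      { g with commutes' := fun c ↦ congr($hgC c) }
    obtain ⟨g', -, hg'X, d, hd, hdJ⟩ := exists_etale_coordinates_algebra g₁ hg
      (hV.primeIdealOf ⟨y, hyV⟩).asIdeal
    have hrange : (Set.range fun i ↦ g' (MvPolynomial.X i)) = {g' (MvPolynomial.X 0)} := by
      ext
      simp [eq_comm]
    rw [hrange] at hdJ
    refine mem_minimalPrimes_of_forall_exists (τ := (π.appLE V W hWV).hom (g' (MvPolynomial.X 0)))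
      ?_ ((hiη _).mpr (hg'X 0)) ?_ fun h hh ↦ hIn h hh Q
    · intro s hs
      refine (PrimeSpectrum.mem_vanishingIdeal Z s).mp hs Q ?_
      change hW.fromSpec Q ∉ U
      rw [hW.fromSpec_primeIdealOf]
      exact ts.notMem_of_isOpenImmersion hS hσ hT hy hc η
    · intro s hs
      obtain ⟨h, hηh, hhs⟩ := ts.exists_mul_mem_map_of_genericPoint hS hT hy hV hyV hJ c hη hW hWV hηW
        ((hQmem s).mpr hs)
      refine ⟨(π.appLE V W hWV).hom d * h, ?_, ?_⟩
      · intro hdh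
        refine (Q.2.mem_or_mem hdh).elim (fun h1 ↦ hd ((hiη d).mp h1)) fun h1 ↦ ?_
        exact (hQmem h).mpr h1 hηh
      · have hle : ((hV.primeIdealOf ⟨y, hyV⟩).asIdeal.map (π.appLE V W hWV).hom) ≤
            Submodule.comap (LinearMap.mulLeft Γ(X, W) ((π.appLE V W hWV).hom d))
              (Ideal.span {(π.appLE V W hWV).hom (g' (MvPolynomial.X 0))}) := by
          refine Ideal.span_le.mpr ?_
          rintro _ ⟨j, hj, rfl⟩
          change (π.appLE V W hWV).hom d * (π.appLE V W hWV).hom j ∈ Ideal.span _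
          rw [← map_mul, ← Set.image_singleton, ← Ideal.map_span]
          exact Ideal.mem_map_of_mem _ (hdJ j hj)
        rw [mul_assoc]
        exact hle hhs
  -- By the choice of `f` the component passes through `p`, so that `p` lies over `y`.
  have hQp : Q.asIdeal ≤ (hW.primeIdealOf ⟨p, hpW⟩).asIdeal := by
    by_contra h
    exact (hQmem f).mpr (hf _ hQmin h) hηf
  have h1 : hW.fromSpec Q ⤳ hW.fromSpec (hW.primeIdealOf ⟨p, hpW⟩) :=
    ((PrimeSpectrum.le_iff_specializes _ _).mp hQp).map hW.fromSpec.continuous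
  rw [hW.fromSpec_primeIdealOf, hW.fromSpec_primeIdealOf] at h1
  have h2 := h1.map π.continuous
  have h3 : π (i η) = y := map_fiberι π _
  rw [h3] at h2
  exact hyp (by simpa [hy.closure_eq] using h2.mem_closure : π p = y).symm

end TreeSurfaces

namespace TreeSurfaces

open Scheme

/-! ### The levels are bounded -/

section

variable {A B L X : Scheme.{0}} {sX : X ⟶ SpecC} {iA : A ⟶ X} {iB : B ⟶ X}
    {lamA : L ⟶ A} {lamB : L ⟶ B} {O : X.Opens} {t : Γ(X, O)} {U : Fin 2 → A.Opens}
    {V : Fin 2 → B.Opens} {e s : ∀ i, Γ(A, U i)} {f u : ∀ i, Γ(B, V i)} {p : Fin 2 → L}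

open MvPolynomial in
/-- If the differentials relative to the base curve, with its étale coordinate `t`, are generated by
two elements on the nearby fibres, then the local equations have bounded level. -/
lemma IsTwoBranch.exists_not_hasLevel (h : IsTwoBranch sX iA iB lamA lamB O t U V e s f u p)
    [LocallyOfFiniteType sX] {q : L} (hq : IsClosed {q}) {W₀ : X.Opens} (hW₀ : IsAffineOpen W₀)
    (hqW₀ : iA (lamA q) ∈ W₀) (hW₀O : W₀ ≤ O) {D : Type} [CommRing D] (θ : Polynomial ℂ →+* D)
    (hθ : θ.Etale) [Algebra D Γ(X, W₀)]
    (hθC : ((algebraMap D Γ(X, W₀)).comp θ).comp Polynomial.C = const sX W₀)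
    (hθX : algebraMap D Γ(X, W₀) (θ Polynomial.X) = res hW₀O t)
    (hΩ : ∀ P : Ideal Γ(X, W₀), P.IsMaximal → res hW₀O t ∉ P →
      ∃ c ∉ P, ∃ ω₁ ω₂ : Ω[Γ(X, W₀)⁄D], ∀ η : Ω[Γ(X, W₀)⁄D],
        c • η ∈ Submodule.span Γ(X, W₀) {ω₁, ω₂}) :
    ∃ m, ¬ HasLevel iA iB lamA O t U V e f (m + 1) := by
  have := h.closedA
  have := h.closed_lamA
  have hft := const_finiteType sX hW₀
  have : IsJacobsonRing Γ(X, W₀) := by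
    algebraize [const sX W₀]
    exact isJacobsonRing_of_finiteType (A := ℂ)
  let : Algebra (Polynomial ℂ) D := θ.toAlgebra
  let : Algebra ℂ D := (θ.comp Polynomial.C).toAlgebra
  let : Algebra ℂ Γ(X, W₀) := (const sX W₀).toAlgebra
  have : IsScalarTower ℂ (Polynomial ℂ) D := .of_algebraMap_eq' rfl
  have : IsScalarTower ℂ D Γ(X, W₀) := .of_algebraMap_eq' hθC.symm
  have : Algebra.Etale (Polynomial ℂ) D := hθ
  obtain ⟨N, hN⟩ := exists_level_bound (D := D) (B := Γ(X, W₀)) fun P hP htP ↦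
    hΩ P hP fun h ↦ htP (by rw [← hθX] at h; exact h)
  refine ⟨N, fun hlev ↦ ?_⟩
  obtain ⟨i, W, x, y, g, hqW, hl⟩ := hlev q
  obtain ⟨b, hbW, hqb⟩ := hW₀.exists_basicOpen_le ⟨_, hqW⟩ hqW₀
  have hW' := hW₀.basicOpen b
  have hl' := hl.restrict hW' hbW
  set W' := X.basicOpen b
  set x₁ := res hbW x
  set y₁ := res hbW y
  set t₁ := res hl'.le t
  let ε := (lamA.app _).hom.comp (iA.app W').hom
  have hε : Function.Surjective ε :=
    (lamA.app_surjective _ (hW'.preimage iA)).comp (iA.app_surjective W' hW')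
  have hker : RingHom.ker ε = Ideal.span {x₁, y₁, t₁} := by
    ext b
    rw [h.mem_span_x_y_t hl', RingHom.mem_ker]
    rfl
  obtain ⟨θ', w, hθ', hθ'C, hθ'X, -⟩ := h.exists_coord hl' hq hqb
  let P := hW'.primeIdealOf ⟨_, hqb⟩
  have hP : Ideal.span {x₁, y₁, t₁} ≤ P.asIdeal := by
    intro b hb
    rw [h.mem_span_x_y_t hl'] at hb
    by_contra hqb'
    rw [← mem_basicOpen_iff_notMem_primeIdealOf hW' _ hqb] at hqb'
    have h1 := (mem_basicOpen_app lamA _ q).mpr ((mem_basicOpen_app iA b (lamA q)).mpr hqb')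
    rw [hb, Scheme.basicOpen_zero] at h1
    exact h1
  obtain ⟨r, hrP, E, Bh, _, _, _, _, _, _, φ, g', hφ, hφker, -, hφc⟩ :=
    exists_etale_hypersurface_mvPolynomial (const_finiteType sX hW') hε hθ' hθ'C hθ'X hker
      (h.nzd W' hW' hl'.le) (h.x_regular hl') (h.y_regular hl') P.asIdeal hP
      (Nat.succ_ne_zero N) hl'.mul
  have hφC (c : ℂ) : φ (algebraMap (MvPolynomial (Fin 4) ℂ) E (C c)) =
      algebraMap Γ(X, W') Bh (const sX W' c) :=
    (congr($hφc (C c))).trans (congrArg (algebraMap _ Bh) (eval₂_C _ _ _))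
  have hφX (i : Fin 4) : φ (algebraMap (MvPolynomial (Fin 4) ℂ) E (MvPolynomial.X i)) =
      algebraMap Γ(X, W') Bh (![x₁, y₁, t₁, w] i) :=
    (congr($hφc (MvPolynomial.X i))).trans (congrArg (algebraMap _ Bh) (eval₂_X _ _ _))
  -- `Bh` is a localization of the functions on `W₀`
  have hloc := hW₀.isLocalization_basicOpen b
  let : Algebra Γ(X, W₀) Bh :=
    ((algebraMap Γ(X, W') Bh).comp (algebraMap Γ(X, W₀) Γ(X, W'))).toAlgebra
  have : IsScalarTower Γ(X, W₀) Γ(X, W') Bh := .of_algebraMap_eq' rfl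
  obtain ⟨r₀, k, hr₀⟩ := exists_pow_mul_eq_map hW₀ b r
  have hunit : IsUnit (res (X.basicOpen_le b) b) := RingedSpace.isUnit_res_basicOpen _ _
  have hr₀' : Associated r (algebraMap Γ(X, W₀) Γ(X, W') r₀) := by
    refine ⟨(hunit.pow k).unit, ?_⟩
    exact hr₀
  have : IsLocalization.Away (algebraMap Γ(X, W₀) Γ(X, W') r₀) Bh := .of_associated hr₀'
  have : IsLocalization.Away (r₀ * b) Bh := .mul Γ(X, W') Bh b r₀
  let : Algebra ℂ E := ((algebraMap (MvPolynomial (Fin 4) ℂ) E).comp C).toAlgebra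
  let : Algebra ℂ Bh := ((algebraMap Γ(X, W₀) Bh).comp (const sX W₀)).toAlgebra
  have : IsScalarTower ℂ (MvPolynomial (Fin 4) ℂ) E := .of_algebraMap_eq' rfl
  have : IsScalarTower ℂ Γ(X, W₀) Bh := .of_algebraMap_eq' rfl
  let φ' : E →ₐ[ℂ] Bh := { φ with
    commutes' := fun c ↦ (hφC c).trans
      (congrArg (algebraMap Γ(X, W') Bh) (map_const (X.basicOpen_le b) c).symm) }
  have hPr : Disjoint ((Submonoid.powers r : Submonoid _) : Set Γ(X, W')) (P.asIdeal : Set _) := by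
    rw [Set.disjoint_left]
    rintro _ ⟨n, rfl⟩ hn
    exact hrP (P.2.mem_of_pow_mem n hn)
  have hPB (z : Γ(X, W')) (hz : z ∈ P.asIdeal) : algebraMap Γ(X, W') Bh z ∈
      P.asIdeal.map (algebraMap Γ(X, W') Bh) := Ideal.mem_map_of_mem _ hz
  have hle := hN E Bh (r₀ * b) φ' hφ (N + 1) g' hφker ((hφX 2).trans (by
      change _ = algebraMap Γ(X, W') Bh (res (X.basicOpen_le b) (algebraMap D Γ(X, W₀) (θ Polynomial.X)))
      rw [hθX, res_res]
      rfl))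
    (P.asIdeal.map (algebraMap Γ(X, W') Bh))
    (IsLocalization.isPrime_of_isPrime_disjoint (.powers r) Bh _ P.2 hPr)
    ((congrArg (· ∈ _) (hφX 0)).mpr (hPB x₁ (hP (Ideal.subset_span (by simp)))))
    ((congrArg (· ∈ _) (hφX 1)).mpr (hPB y₁ (hP (Ideal.subset_span (by simp)))))
    ((congrArg (· ∈ _) (hφX 2)).mpr (hPB t₁ (hP (Ideal.subset_span (by simp)))))
  omega

end

end TreeSurfaces

namespace TreeSurfaces

open Scheme

/-! ### Intersection lines of a good family -/

/-- An étale coordinate of a smooth curve at a closed point. -/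
lemma exists_etale_coordinate {C : Scheme.{0}} (sC : C ⟶ SpecC) [SmoothOfRelativeDimension 1 sC]
    {y : C} (hy : IsClosed {y}) :
    ∃ (V : C.Opens) (_ : IsAffineOpen V), y ∈ V ∧ ∃ (g : MvPolynomial (Fin 1) ℂ →+* Γ(C, V))
      (θ : Polynomial ℂ →+* Γ(C, V)), g.Etale ∧ g.comp MvPolynomial.C = const sC V ∧ θ.Etale ∧
        θ.comp Polynomial.C = const sC V ∧ θ Polynomial.X ∈ nonZeroDivisors Γ(C, V) ∧
        ∀ s, y ∉ C.basicOpen s ↔ s ∈ Ideal.span {θ Polynomial.X} := by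
  obtain ⟨V, hV, hyV, -, g, hg, hgC, hgX⟩ := exists_etale_coordinates sC 1 hy (O := ⊤) trivial
  let e := (MvPolynomial.uniqueAlgEquiv ℂ (Fin 1)).symm
  let θ : Polynomial ℂ →+* Γ(C, V) := g.comp (e : Polynomial ℂ →+* MvPolynomial (Fin 1) ℂ)
  have heC (c : ℂ) : e (Polynomial.C c) = MvPolynomial.C c := e.commutes c
  have heX : e Polynomial.X = MvPolynomial.X 0 := Polynomial.eval₂_X _ _
  have hθX : θ Polynomial.X = g (MvPolynomial.X 0) := congrArg g heX
  have hθ : θ.Etale := RingHom.Etale.stableUnderComposition _ _ (.of_bijective e.bijective) hg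
  have hflat : θ.Flat := by
    algebraize [θ]
    change Module.Flat _ _
    infer_instance
  refine ⟨V, hV, hyV, g, θ, hg, hgC, hθ, ?_, ?_, fun s ↦ ?_⟩
  · rw [← hgC]
    ext c
    exact congrArg g (heC c)
  · exact map_mem_nonZeroDivisors_of_flat hflat
      (mem_nonZeroDivisors_of_ne_zero Polynomial.X_ne_zero)
  · have hrange : (Set.range fun i ↦ g (MvPolynomial.X i)) = {θ Polynomial.X} := by
      rw [hθX]
      ext
      simp [eq_comm]
    rw [hgX, hrange]

namespace TreeSurface

variable {S X C : Scheme.{0}} {sS : S ⟶ SpecC} (hS : IsSmoothProjectiveSurface sS)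
  {sC : C ⟶ SpecC} {π : X ⟶ C} {σ : X ⟶ pullback sS sC} {y : C} {T : Type} [PartialOrder T]
  [OrderBot T]

include hS in
/-- Étale models of the total space along an intersection line, all of the same type `A_k`. -/
lemma exists_models [Flat π] [LocallyOfFiniteType π] [LocallyOfFiniteType sC]
    [SmoothOfRelativeDimension 1 sC] (hσ : σ ≫ pullback.snd sS sC = π)
    {U : X.Opens} [IsOpenImmersion (U.ι ≫ σ)] (hU : Dense (U : Set X))
    (hfib : ∀ y : C, IsClosed {y} → ∃ (T : Type) (_ : PartialOrder T) (_ : OrderBot T), IsTree T ∧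
      Nonempty (TreeSurface T sS (π.fiberι y ≫ π ≫ sC) (π.fiberι y ≫ σ ≫ pullback.fst sS sC)))
    (ts : TreeSurface T sS (π.fiberι y ≫ π ≫ sC) (π.fiberι y ≫ σ ≫ pullback.fst sS sC))
    (hT : IsTree T) (hy : IsClosed {y}) {a b : T} (hab : a ⋖ b) :
    ∃ k : ℕ, ∀ q : ↑(pullback (ts.incl a) (ts.incl b)), IsClosed {q} →
      ∃ (M : Scheme.{0}) (w : M) (j : M ⟶ X) (v : M ⟶ AkModel k), IsOpenImmersion j ∧ Etale v ∧
        j ≫ π ≫ sC = v ≫ AkModel.toC k ∧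
        j w = π.fiberι y (ts.incl a (pullback.fst (ts.incl a) (ts.incl b) q)) ∧
        v w ∈ AkModel.origin k ∧
        j ⁻¹' (π.fiberι y '' (Set.range (ts.incl a) ∩ Set.range (ts.incl b))) =
          v ⁻¹' AkModel.line k := by
  have := isClosedImmersion_fiberι π hy
  have := ts.isClosedImmersion_incl
  obtain ⟨V, hV, hyV, g, θ, hg, hgC, hθ, hθC, ht, hJ⟩ := exists_etale_coordinate sC hy
  obtain ⟨O, hO, U₁, V₁, e, s, f, u, p, h⟩ := ts.exists_isTwoBranch hS hT hy hV hyV ht hJ hab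
  set lamA := pullback.fst (ts.incl a) (ts.incl b)
  set iA := ts.incl a ≫ π.fiberι y with hiA
  have hlamA := h.closed_lamA
  have : LocallyOfFiniteType (lamA ≫ iA ≫ π ≫ sC) := inferInstance
  have : JacobsonSpace ↑(pullback (ts.incl a) (ts.incl b)) :=
    LocallyOfFiniteType.jacobsonSpace (lamA ≫ iA ≫ π ≫ sC)
  obtain ⟨q, -, hq⟩ := nonempty_inter_closedPoints (X := ↑(pullback (ts.incl a) (ts.incl b)))
    (Z := Set.univ) ⟨p 0, trivial⟩ isOpen_univ.isLocallyClosed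
  have hyq : π (iA (lamA q)) = y := map_fiberι π _
  obtain ⟨W₀, hW₀, hqW₀, hW₀O, hroot⟩ := exists_affine_forall_notMem hS hσ hU hV hg hgC hO (h.mem q)
  have hW₀V : W₀ ≤ π ⁻¹ᵁ V := hW₀O.trans hO
  let : Algebra Γ(C, V) Γ(X, W₀) := (π.appLE V W₀ hW₀V).hom.toAlgebra
  have hft : Algebra.FiniteType Γ(C, V) Γ(X, W₀) := π.finiteType_appLE hV hW₀ hW₀V
  have hX : JacobsonSpace X := LocallyOfFiniteType.jacobsonSpace (π ≫ sC)
  have hC : JacobsonSpace C := LocallyOfFiniteType.jacobsonSpace sC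
  -- Closed points of `W₀` outside of the special fibre lie on the root component of their fibre and
  -- on no other component, so that there the fibre is a smooth surface with two local coordinates.
  have hbound := h.exists_not_hasLevel hq hW₀ hqW₀ hW₀O θ hθ
    (by
      ext c
      exact (congrArg _ (congr($hθC c))).trans (appLE_const π rfl hW₀V c))
    (res_appLE hO hW₀O _).symm (by
      intro P hP htP
      rw [res_appLE] at htP
      let x : X := hW₀.fromSpec (⟨P, hP.isPrime⟩ : PrimeSpectrum Γ(X, W₀))
      have hxP (s : Γ(X, W₀)) : x ∉ X.basicOpen s ↔ s ∈ P := by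
        rw [← not_not (a := s ∈ P)]
        exact (fromSpec_mem_basicOpen_iff hW₀ s ⟨P, hP.isPrime⟩).not
      have hxW : x ∈ W₀ := by
        have : x ∈ Set.range hW₀.fromSpec := ⟨_, rfl⟩
        rwa [hW₀.range_fromSpec] at this
      have hx : IsClosed {x} := by
        have h1 : (⟨P, hP.isPrime⟩ : PrimeSpectrum Γ(X, W₀)) ∈
            closedPoints (PrimeSpectrum Γ(X, W₀)) :=
          (PrimeSpectrum.isClosed_singleton_iff_isMaximal _).mpr hP
        have h2 := hW₀.fromSpec.isOpenEmbedding.preimage_closedPoints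
        exact (h2.symm ▸ h1 : _ ∈ hW₀.fromSpec ⁻¹' closedPoints X)
      obtain ⟨y', hxy'⟩ : ∃ y', π x = y' := ⟨_, rfl⟩
      have hy' : IsClosed {y'} := hxy' ▸ π.closePoints_subset_preimage_closedPoints hx
      have hy'V : y' ∈ V := hxy' ▸ hW₀V hxW
      have hne : y' ≠ π (iA (lamA q)) := by
        rintro rfl
        refine htP ((hxP _).mp ?_)
        rw [mem_basicOpen_appLE hW₀V _ hxW, hxy', hyq, hJ]
        exact Ideal.mem_span_singleton_self _
      obtain ⟨T', _, _, hT', ⟨ts'⟩⟩ := hfib y' hy'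
      have hι' := isClosedImmersion_fiberι π hy'
      have := ts'.isClosedImmersion_incl
      obtain ⟨x', hx'⟩ : x ∈ Set.range (π.fiberι y') := by
        rw [π.range_fiberι]
        exact hxy'
      obtain ⟨c, z, rfl⟩ := ts'.cover x'
      obtain rfl : c = ⊥ := by
        by_contra hc
        exact hroot y' hy' hne T' _ _ hT' ts' c hc z (hx' ▸ hxW)
      have hz : ∀ b, b ≠ ⊥ → ts'.incl ⊥ z ∉ Set.range (ts'.incl b) := by
        rintro b hb ⟨w, hw⟩
        refine hroot y' hy' hne T' _ _ hT' ts' b hb w ?_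
        rw [hw, hx']
        exact hxW
      have hzc : IsClosed {z} := by
        have h1 : {z} = (ts'.incl ⊥ ≫ π.fiberι y') ⁻¹' {x} := by
          ext w
          constructor
          · rintro rfl
            exact hx'
          · intro hw
            exact (ts'.incl ⊥ ≫ π.fiberι y').isClosedEmbedding.injective (hw.trans hx'.symm)
        rw [h1]
        exact hx.preimage (ts'.incl ⊥ ≫ π.fiberι y').continuous
      have hJ' (s : Γ(C, V)) : y' ∉ C.basicOpen s ↔ s ∈ (hV.primeIdealOf ⟨y', hy'V⟩).asIdeal := by
        rw [mem_basicOpen_iff_notMem_primeIdealOf hV s hy'V, not_not]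
      obtain ⟨x₁, x₂, hx₁, hx₂, hx₁₂⟩ := ts'.exists_mul_mem_sup_span_pair hS hT' hy' hV hy'V hJ' ⊥ hzc
        hz hW₀ hW₀V (hx' ▸ hxW)
      rw [hx', hxP] at hx₁ hx₂
      let := (const sC V).toAlgebra
      let := (const (π ≫ sC) W₀).toAlgebra
      have : IsScalarTower ℂ Γ(C, V) Γ(X, W₀) :=
        .of_algebraMap_eq fun c ↦ (appLE_const π rfl hW₀V c).symm
      have : Algebra.FiniteType ℂ Γ(X, W₀) := const_finiteType (π ≫ sC) hW₀
      refine exists_forall_smul_mem_span_pair (hV.primeIdealOf ⟨y', hy'V⟩).asIdeal P ?_ hx₁ hx₂ ?_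
      · rw [Ideal.map_le_iff_le_comap]
        intro s hs
        refine (hxP _).mp ?_
        change x ∉ X.basicOpen ((π.appLE V W₀ hW₀V).hom s)
        rw [mem_basicOpen_appLE hW₀V _ hxW, hxy', hJ']
        exact hs
      · intro b hb
        rw [← hxP, ← hx'] at hb
        obtain ⟨g, hg, hgb⟩ := hx₁₂ b hb
        rw [hx'] at hg
        exact ⟨g, fun h ↦ (hxP g).mpr h hg, hgb⟩)
  obtain ⟨k, c, hc, hlev⟩ := h.exists_level hbound
  refine ⟨k, fun q hq ↦ ?_⟩
  obtain ⟨i, W, x, y', g, hqW, hl, hgc⟩ := hlev q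
  obtain ⟨M, w, j, v, h1, h2, h3, h4, h5, h6⟩ := h.exists_model hl hc hgc hq hqW
  refine ⟨M, w, j, v, h1, h2, h3, h4, h5, ?_⟩
  rw [← h6]
  congr 1
  ext x
  constructor
  · rintro ⟨_, ⟨⟨z, rfl⟩, hz⟩, rfl⟩
    obtain ⟨l, rfl⟩ := (ts.mem_range_inter_iff a b z).mpr hz
    exact ⟨l, rfl⟩
  · rintro ⟨l, rfl⟩
    exact ⟨_, ⟨⟨_, rfl⟩, (ts.mem_range_inter_iff a b _).mp ⟨l, rfl⟩⟩, rfl⟩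

end TreeSurface

lemma isSmoothAt_of_isOpenImmersion {X M : Scheme.{0}} {sX : X ⟶ SpecC} (j : M ⟶ X)
    [IsOpenImmersion j] [Smooth (j ≫ sX)] (w : M) : IsSmoothAt sX (j w) := by
  refine ⟨j.opensRange, ⟨w, rfl⟩, ?_⟩
  rw [← j.isoOpensRange_inv_comp, Category.assoc]
  infer_instance

/-- Along an intersection line of a good family, the total space has étale models of one and the
same type. -/
lemma IsGoodTnFamily.exists_isTrivialAkAlongAt {S C X : Scheme.{0}} {sS : S ⟶ SpecC}
    (hS : IsSmoothProjectiveSurface sS) {sC : C ⟶ SpecC} (hC : SmoothOfRelativeDimension 1 sC)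
    {c n : ℤ} {π : X ⟶ C} {σ : X ⟶ pullback sS sC} (hX : IsGoodTnFamily c n sS sC π σ) {L : Set X}
    (hL : IsIntersectionLine π L) : ∃ k : ℕ, ∀ p ∈ L, IsClosed {p} →
      IsTrivialAkAlongAt (π ≫ sC) k L p ∧ (k = 0 → IsSmoothAt (π ≫ sC) p) := by
  have := hX.locallyOfFiniteType_base
  have := hX.locallyOfFiniteType
  have := hX.flat
  obtain ⟨U, hU, hUσ, -⟩ := hX.birational
  have hfib : ∀ y : C, IsClosed {y} → ∃ (T : Type) (_ : PartialOrder T) (_ : OrderBot T), IsTree T ∧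
      Nonempty (TreeSurface T sS (π.fiberι y ≫ π ≫ sC) (π.fiberι y ≫ σ ≫ pullback.fst sS sC)) := by
    intro y hy
    obtain ⟨T, i₁, i₂, hT, hts⟩ := hX.fibre y hy
    exact ⟨T, i₁, i₂, hT.1, hts⟩
  obtain ⟨y, hy, Z₁, hZ₁, Z₂, hZ₂, hne, ⟨x₀, hx₁, hx₂⟩, rfl⟩ := hL
  obtain ⟨T, _, _, hT, ⟨ts⟩⟩ := hfib y hy
  rw [ts.irreducibleComponents_eq hS hT] at hZ₁ hZ₂
  obtain ⟨a, rfl⟩ := hZ₁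
  obtain ⟨b, rfl⟩ := hZ₂
  have := isClosedImmersion_fiberι π hy
  have := ts.isClosedImmersion_incl
  have key (a b : T) (hab : a ⋖ b) : ∃ k : ℕ, ∀ p ∈ π.fiberι y '' (Set.range (ts.incl a) ∩
      Set.range (ts.incl b)), IsClosed {p} → IsTrivialAkAlongAt (π ≫ sC) k (π.fiberι y ''
        (Set.range (ts.incl a) ∩ Set.range (ts.incl b))) p ∧ (k = 0 → IsSmoothAt (π ≫ sC) p) := by
    obtain ⟨k, hk⟩ := ts.exists_models hS hX.comp_snd hU hfib hT hy hab
    refine ⟨k, ?_⟩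
    rintro _ ⟨_, ⟨⟨z, rfl⟩, hz⟩, rfl⟩ hp
    obtain ⟨q, rfl⟩ := (ts.mem_range_inter_iff a b z).mpr hz
    set lam := pullback.fst (ts.incl a) (ts.incl b)
    have hlam : IsClosedImmersion lam := inferInstance
    have hq : IsClosed {q} := by
      have h1 : {q} = (lam ≫ ts.incl a ≫ π.fiberι y) ⁻¹' {π.fiberι y (ts.incl a (lam q))} := by
        ext w
        constructor
        · rintro rfl
          rfl
        · intro hw
          exact (lam ≫ ts.incl a ≫ π.fiberι y).isClosedEmbedding.injective hw
      rw [h1]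
      exact hp.preimage (lam ≫ ts.incl a ≫ π.fiberι y).continuous
    obtain ⟨M, w, j, v, hj, hv, hjv, hw, hvw, hline⟩ := hk q hq
    refine ⟨⟨M, w, j, v, inferInstance, hv, hjv, hw, hvw, hline⟩, ?_⟩
    rintro rfl
    have := smooth_akModel_zero
    have : Smooth (j ≫ π ≫ sC) := by
      rw [hjv]
      infer_instance
    rw [← hw]
    exact isSmoothAt_of_isOpenImmersion j w
  have hab : a ≠ b := fun h ↦ hne (by rw [h])
  rcases ts.covBy_or_covBy hab hx₁ hx₂ with h | h
  · exact key a b h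
  · have h1 := key b a h
    rwa [Set.inter_comm] at h1

/-- A good family is smooth outside of the intersection lines. -/
lemma IsGoodTnFamily.isSmoothAt {S C X : Scheme.{0}} {sS : S ⟶ SpecC}
    (hS : IsSmoothProjectiveSurface sS) {sC : C ⟶ SpecC} (hC : SmoothOfRelativeDimension 1 sC)
    {c n : ℤ} {π : X ⟶ C} {σ : X ⟶ pullback sS sC} (hX : IsGoodTnFamily c n sS sC π σ) {p : X}
    (hp : IsClosed {p}) (hpL : ∀ L : Set X, IsIntersectionLine π L → p ∉ L) :
    IsSmoothAt (π ≫ sC) p := by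
  have := hX.locallyOfFiniteType_base
  have := hX.locallyOfFiniteType
  have := hX.flat
  have : Smooth sC := SmoothOfRelativeDimension.smooth 1 sC
  have : JacobsonSpace C := LocallyOfFiniteType.jacobsonSpace sC
  obtain ⟨y, hpy⟩ : ∃ y, π p = y := ⟨_, rfl⟩
  have hy : IsClosed {y} := hpy ▸ π.closePoints_subset_preimage_closedPoints hp
  obtain ⟨T, _, _, ⟨hT, -⟩, ⟨ts⟩⟩ := hX.fibre y hy
  obtain ⟨x, rfl⟩ : p ∈ Set.range (π.fiberι y) := by
    rw [π.range_fiberι]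
    exact hpy
  obtain ⟨a, z, rfl⟩ := ts.cover x
  refine ts.isSmoothAt_of_forall_notMem hS hT hy a z fun b hb hz ↦ ?_
  refine hpL _ ⟨y, hy, Set.range (ts.incl a), ?_, Set.range (ts.incl b), ?_, ?_,
    ⟨ts.incl a z, ⟨z, rfl⟩, hz⟩, rfl⟩ ⟨ts.incl a z, ⟨⟨z, rfl⟩, hz⟩, rfl⟩
  · rw [ts.irreducibleComponents_eq hS hT]
    exact ⟨a, rfl⟩
  · rw [ts.irreducibleComponents_eq hS hT]
    exact ⟨b, rfl⟩
  · exact fun h ↦ hb (ts.eq_of_range_subset hS hT h.le).symm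

end TreeSurfaces

open TreeSurfaces in
theorem theorem4p3 {S C X : Scheme.{0}}
    (sS : S ⟶ SpecC) (hS : IsSmoothProjectiveSurface sS)
    (sC : C ⟶ SpecC) (hC : SmoothOfRelativeDimension 1 sC)
    (c n : ℤ)
    (π : X ⟶ C) (σ : X ⟶ pullback sS sC)
    (hX : IsGoodTnFamily c n sS sC π σ) :
    -- `X` has at most `A_k`-singularities
    (∀ p : X, IsClosed {p} →
      IsSmoothAt (π ≫ sC) p ∨ ∃ k : ℕ, 1 ≤ k ∧ IsAkAt (π ≫ sC) k p) ∧
    -- the singular points lie on the intersection lines of components of fibres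
    (∀ p : X, IsClosed {p} → (∀ L : Set X, IsIntersectionLine π L → p ∉ L) →
      IsSmoothAt (π ≫ sC) p) ∧
    -- along every such line the singularity is locally trivial, with the same `k` at all points
    (∀ L : Set X, IsIntersectionLine π L → ∃ k : ℕ, ∀ p ∈ L, IsClosed {p} →
      IsTrivialAkAlongAt (π ≫ sC) k L p) := by
  have hline := fun L hL ↦ hX.exists_isTrivialAkAlongAt hS hC (L := L) hL
  have hsm := fun p (hp : IsClosed {p}) ↦ hX.isSmoothAt hS hC (p := p) hp
  refine ⟨fun p hp ↦ ?_, hsm, fun L hL ↦ ?_⟩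
  · by_cases h : ∀ L : Set X, IsIntersectionLine π L → p ∉ L
    · exact Or.inl (hsm p hp h)
    · push Not at h
      obtain ⟨L, hL, hpL⟩ := h
      obtain ⟨k, hk⟩ := hline L hL
      obtain ⟨⟨W, w, u, v, hu, hv, huv, hw, hvw, -⟩, hk0⟩ := hk p hpL hp
      rcases Nat.eq_zero_or_pos k with h0 | hpos
      · exact Or.inl (hk0 h0)
      · exact Or.inr ⟨k, hpos, W, w, u, v, hu, hv, huv, hw, hvw⟩
  · obtain ⟨k, hk⟩ := hline L hL
    exact ⟨k, fun p hpL hp ↦ (hk p hpL hp).1⟩
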